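/- **Setting.** Let $F/\mathbb{Q}_p$ be an unramified extension of degree $f$, $q=p^f$, $\xi=q-1$, $\Gamma=\mathcal{O}_F^\times$, and let $k$ be a finite extension of the residue field $\mathbb{F}_q$ of $F$. Let $\Phi(t)=pt+t^q$. For $\gamma\in\Gamma$ let $[\gamma](t)=\gamma t+\dots\in\mathcal{O}_F[[t]]$ be the unique power series with $\Phi([\gamma](t))=[\gamma](\Phi(t))$; write $[\gamma]$ also for its image in $k[[t]]$ and $a_{\gamma,n}\in k$ for the coefficient of $t^n$ in it. Then $\Gamma$ acts $k$-linearly on $k((t))$ by $t\mapsto[\gamma]$, and $\varphi$ is the $k$-linear endomorphism of $k((t))$ with $\varphi(t)=t^q$. An étale $(\varphi,\Gamma)$-module is a finite dimensional $k((t))$-vector space with a semilinear $\Gamma$-action and a commuting semilinear endomorphism $\varphi$ whose linearization is bijective; isomorphisms are $k((t))$-linear bijections commuting with $\varphi$ and $\Gamma$. Let $k[[t]][\varphi]$ be the $k$-algebra with $\varphi t=t^q\varphi$. **Data.** Fix $0<\ell<\xi$, $0\le u<\xi$ and $\alpha,\beta\in k^\times$. Write $\ell=\sum_{j=0}^{f-1}m_jp^j$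 with $0\le m_j<p$, extend $m_j$ to $j\in\mathbb{Z}$ by $m_{j+f}=m_j$, and put $\ell_i=\sum_{j=0}^{f-1}m_{j+i}p^{j+i}$ for $0\le i<f$. Let $\mathcal{E}(\ell)$ be the set of $0\le i<f$ for which there is an integer $r<i$ with $m_r=p-1$ and $m_s=p-2$ for all $r<s<i$, and let $\mathcal{D}(\ell)=\{0,\dots,f-1\}\setminus\mathcal{E}(\ell)$. Let $\mathbf{b}_i\in k$ ($i\in\mathcal{D}(\ell)$), $\mathbf{c}_i\in k$ ($i\in\mathcal{E}(\ell)$) and $\mathbf{c}\in k$ be given, where $\mathbf{c}\neq0$ is allowed only if $\ell=\frac{(p-2)\xi}{p-1}$ and $\alpha=\beta$. For $N\in\mathbb{Z}_{\geq 0}$ and $1\le j\le f$ put $$r=q^N-1-\tfrac{p^{f-1}\xi}{p-1},\quad o_i=q^N-1-p^i\bigl(\xi+\tfrac{q\xi}{p-1}\bigr),\quad r_i=q^N-1+\ell_i-p^i\xi,$$ $$n_i=q^N-1+q^2\ell_i-2p^{2f+i}\xi,\quad g^{(j)}=\xi\Bigl(\sum_{s=0}^{j-1}p^{2f+s+1-j}-p^{f+1-j}\Bigr),\quad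 H_i=1-(m_i+2)\sum_{j=1}^ft^{p^ig^{(j)}}.$$ Choose auxiliary integers $N\ge0$, $n_x,n_y>0$ such that $r$, $o_i$ ($0\le i<f$), $r_i$ ($i\in\mathcal{D}(\ell)$), $n_i$ and $n_i+p^ig^{(j)}$ ($i\in\mathcal{E}(\ell)$, $1\le j\le f$) are non-negative and such that - $\ell_i\ge n_y$ and $qn_x+\ell_i-\xi(p^i+1)\ge n_y$ for $i\in\mathcal{D}(\ell)$; - $q^2\ell_i-p^{i+f}\xi\bigl(q-\sum_{s=0}^{f-1}p^s\bigr)\ge n_y$ and $qn_x+q^2\ell_i-\xi(2p^{2f+i}+1)\ge n_y$ for $i\in\mathcal{E}(\ell)$; - if $\mathbf{c}\ne0$: $\xi\ge n_y$, and $n_x-\frac{p^{f-1}\xi}{p-1}\ge n_y$, and $qn_x-\xi\bigl(1+p^{f-1}+\frac{p^{2f-1}}{p-1}\bigr)\ge n_y$, and, if moreover $q=p$, $p-2\ge n_y$. **Construction.** Let $M$ be the free $k[[t]][\varphi]$-module on $x,y$, let $\nabla\subset M$ be the submodule generated by $t^{n_x}x$, $t^{n_y}y$, $t^\xi\varphi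 y-\beta y$ and $$R=t^\xi\varphi x-\alpha x+\alpha\beta^{1-N}\Bigl(\sum_{i\in\mathcal{D}(\ell)}\mathbf{b}_it^{r_i}+\mathbf{c}\sum_{i=0}^{f-1}t^{o_i}+\sum_{i\in\mathcal{E}(\ell)}\mathbf{c}_it^{n_i}H_i\Bigr)\varphi^Ny,$$ and put $\Delta=M/\nabla$. Let $\Gamma$ act on $\Delta$, semilinearly over $k[[t]]$ and commuting with $\varphi$, by $$\gamma*x=a_{\gamma,1}^u\Bigl(\tfrac{a_{\gamma,1}t}{[\gamma]}x-\mathbf{c}\,\beta^{1-N}a_{\gamma,q}^{p^{f-1}}a_{\gamma,1}^{-p^{f-1}-r}[\gamma]^r\varphi^Ny\Bigr),\qquad \gamma*y=a_{\gamma,1}^{u-\ell+1}\tfrac{t}{[\gamma]}y .$$ Let $\Delta^*=\mathrm{Hom}_k(\Delta,k)$ with $(Sl)(z)=l(Sz)$ for $S\in k[[t]]$ and $(\gamma*l)(z)=l(\gamma^{-1}*z)$, and let $\Gamma$ act accordingly on $\mathbf{D}=\Delta^*\otimes_{k[[t]]}k((t))$. Let $\psi:k[[t]]\to k[[t]]$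 be the $k$-linear map with $\psi(\varphi(a)b)=a\psi(b)$, $\psi(t^{\xi})=1$, $\psi(t^j)=0$ for $0<j<\xi$, and $\psi(1)=q/p\in k$ (so $\psi(1)=0$ if $F\ne\mathbb{Q}_p$, and $\psi(1)=1$ if $F=\mathbb{Q}_p$). The semilinear endomorphism $\varphi$ of $\mathbf{D}$ is characterized by: for $l\in\Delta^*$, the element $\varphi(l\otimes1)$ maps under $$\Delta^*\otimes_{k[[t]]}k((t))\to(\Delta\otimes_{k[[t]],\varphi}k[[t]])^*\otimes_{k[[t]]}k((t)),\qquad \mu\otimes1\mapsto[z\otimes b\mapsto\mu(b\varphi(z))]\otimes1,$$ to $[z\otimes b\mapsto l(\psi(b)z)]\otimes1$. **Theorem.** For all admissible auxiliary integers this construction yields a well-defined étale $(\varphi,\Gamma)$-module $\mathbf{D}$ (there is exactly one étale $(\varphi,\Gamma)$-module structure on $\Delta^*\otimes_{k[[t]]}k((t))$ arising as described). With $\ell,u,\alpha,\beta$ fixed, let $\mathbf{D}$ and $\mathbf{D}'$ be the étale $(\varphi,\Gamma)$-modules obtained in this way from scalars $(\mathbf{b}_i),(\mathbf{c}_i),\mathbf{c}$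 and $(\mathbf{b}'_i),(\mathbf{c}'_i),\mathbf{c}'$, each with its own admissible choice of auxiliary integers. Then $\mathbf{D}$ and $\mathbf{D}'$ are isomorphic if and only if there is $\epsilon\in k^\times$ with $\mathbf{b}_i=\epsilon\mathbf{b}'_i$ for all $i\in\mathcal{D}(\ell)$, $\mathbf{c}_i=\epsilon\mathbf{c}'_i$ for all $i\in\mathcal{E}(\ell)$, and $\mathbf{c}=\epsilon\mathbf{c}'$. -/

import Mathlib

open scoped PowerSeries LaurentSeries TensorProduct

namespace LTPhiGamma

/-! ### Lubin-Tate power series -/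

section LubinTate

variable {O : Type*} [CommRing O] (p f : ℕ)

/-- `Φ(t) = p t + t ^ q` with `q = p ^ f`. -/
noncomputable def lubinTatePhi (O : Type*) [CommRing O] (p f : ℕ) : O⟦X⟧ :=
  PowerSeries.C (p : O) * PowerSeries.X + PowerSeries.X ^ (p ^ f)

/-- `g` is the power series `[γ](t)`: `g = γ t + …` and `Φ(g(t)) = g(Φ(t))`. -/
def IsLubinTateSeries (γ : O) (g : O⟦X⟧) : Prop :=
  PowerSeries.constantCoeff g = 0 ∧ PowerSeries.coeff 1 g = γ ∧
    PowerSeries.C (p : O) * g + g ^ (p ^ f) = g.subst (lubinTatePhi O p f)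

/-- The power series `[γ](t)`, the unique one satisfying `IsLubinTateSeries`. -/
noncomputable def lubinTateSeries (γ : O) : O⟦X⟧ :=
  Classical.epsilon (IsLubinTateSeries p f γ)

variable (k : Type*) [Field k] [Algebra O k]

/-- The image of `[γ](t)` in `k⟦t⟧`. -/
noncomputable def brk (γ : Oˣ) : k⟦X⟧ :=
  (lubinTateSeries p f (γ : O)).map (algebraMap O k)

/-- The coefficient `a_{γ,n}` of `[γ](t)`, read in `k`. -/
noncomputable def brkCoeff (γ : Oˣ) (n : ℕ) : k := PowerSeries.coeff n (brk p f k γ)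

/-- The power series `t / [γ](t)` in `k⟦t⟧`. -/
noncomputable def tDivBrk (γ : Oˣ) : k⟦X⟧ :=
  (PowerSeries.mk fun n => PowerSeries.coeff (n + 1) (brk p f k γ))⁻¹

end LubinTate

/-! ### Étale `(φ,Γ)`-modules over `k((t))`, with `Γ = Oˣ` -/

/-- For `g ∈ t k⟦t⟧` nonzero, the substitution `F(t) ↦ F(g(t))` on `k((t))`: writing
`F = t ^ n * F₀` with `F₀ ∈ k⟦t⟧`, the value is `g ^ n * F₀(g)`. -/
noncomputable def laurentSubst {k : Type*} [Field k] (g : k⟦X⟧) (F : k⸨X⸩) : k⸨X⸩ :=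
  (algebraMap k⟦X⟧ k⸨X⸩ g) ^ (F.order) *
    algebraMap k⟦X⟧ k⸨X⸩ (PowerSeries.subst g (LaurentSeries.powerSeriesPart F))

/-- The structure of an étale `(φ,Γ)`-module on a `k((t))`-vector space `D`. The endomorphism `φ`
is semilinear for `φ(t) = t ^ q`, an element `γ` acts semilinearly for `γ(t) = [γ](t)`. Étaleness,
i.e. bijectivity of the linearization of `φ`, is expressed by saying that `φ` takes
a basis to a basis. -/
structure EtalePhiGamma (O : Type*) [CommRing O] (k : Type*) [Field k] [Algebra O k] (p f : ℕ)
    (D : Type*) [AddCommGroup D] [Module k⸨X⸩ D] where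
  phi : D → D
  act : Oˣ → D → D
  finite : Module.Finite k⸨X⸩ D
  phi_add : ∀ d e, phi (d + e) = phi d + phi e
  phi_smul : ∀ (F : k⸨X⸩) (d : D),
    phi (F • d) = laurentSubst (PowerSeries.X ^ (p ^ f)) F • phi d
  act_add : ∀ γ d e, act γ (d + e) = act γ d + act γ e
  act_smul : ∀ (γ : Oˣ) (F : k⸨X⸩) (d : D),
    act γ (F • d) = laurentSubst (brk p f k γ) F • act γ d
  act_one : ∀ d, act 1 d = d
  act_mul : ∀ γ γ' d, act (γ * γ') d = act γ (act γ' d)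
  act_phi : ∀ γ d, act γ (phi d) = phi (act γ d)
  etale : ∃ (n : ℕ) (b b' : Module.Basis (Fin n) k⸨X⸩ D), ∀ i, phi (b i) = b' i

/-- Isomorphy of étale `(φ,Γ)`-modules. -/
def EtalePhiGamma.Isomorphic {O : Type*} [CommRing O] {k : Type*} [Field k] [Algebra O k]
    {p f : ℕ} {D D' : Type*} [AddCommGroup D] [Module k⸨X⸩ D] [AddCommGroup D'] [Module k⸨X⸩ D']
    (S : EtalePhiGamma O k p f D) (S' : EtalePhiGamma O k p f D') : Prop :=
  ∃ e : D ≃ₗ[k⸨X⸩] D', (∀ d, e (S.phi d) = S'.phi (e d)) ∧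
    ∀ γ d, e (S.act γ d) = S'.act γ (e d)

/-! ### The dual of a `k⟦t⟧`-module -/

/-- `Δ* = Hom_k(Δ, k)`. -/
def TDual (k : Type*) [Field k] (Δ : Type*) [AddCommGroup Δ] [Module k Δ] : Type _ := Δ →ₗ[k] k

section TDual

variable {k : Type*} [Field k] {Δ : Type*} [AddCommGroup Δ] [Module k Δ]

noncomputable instance : AddCommGroup (TDual k Δ) := inferInstanceAs (AddCommGroup (Δ →ₗ[k] k))

/-- The value of a linear form. -/
def TDual.eval (l : TDual k Δ) (x : Δ) : k := (show Δ →ₗ[k] k from l) x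

variable [Module k⟦X⟧ Δ] [IsScalarTower k k⟦X⟧ Δ]

/-- The `k⟦t⟧`-module structure `(S l)(x) = l (S x)` on `Δ*`. -/
noncomputable instance : Module k⟦X⟧ (TDual k Δ) where
  smul S l := (show Δ →ₗ[k] k from l).comp (Algebra.lsmul k k Δ S)
  one_smul l := by
    apply LinearMap.ext; intro x
    exact congrArg (show Δ →ₗ[k] k from l) (one_smul k⟦X⟧ x)
  mul_smul S T l := by
    apply LinearMap.ext; intro x
    refine congrArg (show Δ →ₗ[k] k from l) ?_
    change (S * T) • x = T • S • x
    rw [mul_comm, mul_smul]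
  smul_zero S := rfl
  smul_add S l l' := rfl
  add_smul S T l := by
    apply LinearMap.ext; intro x
    refine (congrArg (show Δ →ₗ[k] k from l) (add_smul S T x)).trans ?_
    exact map_add (show Δ →ₗ[k] k from l) _ _
  zero_smul l := by
    apply LinearMap.ext; intro x
    refine (congrArg (show Δ →ₗ[k] k from l) (zero_smul k⟦X⟧ x)).trans ?_
    exact map_zero (show Δ →ₗ[k] k from l)

theorem TDual.eval_smul (S : k⟦X⟧) (l : TDual k Δ) (x : Δ) :
    (S • l).eval x = l.eval (S • x) := rfl

end TDual

/-- `Δ* ⊗_{k⟦t⟧} k((t))`. -/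
abbrev DualLaurent (k : Type*) [Field k] (Δ : Type*) [AddCommGroup Δ] [Module k Δ]
    [Module k⟦X⟧ Δ] [IsScalarTower k k⟦X⟧ Δ] : Type _ :=
  k⸨X⸩ ⊗[k⟦X⟧] TDual k Δ

/-! ### The free `k⟦t⟧[φ]`-module on `x, y` and its quotients -/

section Modules

variable (k : Type*) [Field k] (p f : ℕ) [Fact p.Prime]

/-- The `k`-algebra endomorphism `φ` of `k⟦t⟧` with `φ(t) = t ^ q`. -/
noncomputable def phiR : k⟦X⟧ →+* k⟦X⟧ :=
  (PowerSeries.expand (p ^ f) (pow_ne_zero f (Fact.out : p.Prime).ne_zero) :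
    k⟦X⟧ →ₐ[k] k⟦X⟧).toRingHom

/-- The free left module over `k⟦t⟧[φ]` (with `φ t = t ^ q φ`) on the basis `x, y`:
`Finsupp.single (0, s) F` is `F φ^s x` and `Finsupp.single (1, s) F` is `F φ^s y`. -/
abbrev FreeM : Type _ := (Fin 2 × ℕ) →₀ k⟦X⟧

/-- Left multiplication by `φ` on the free module: `F φ^s z ↦ F(t ^ q) φ^(s+1) z`. -/
noncomputable def phiM : FreeM k →ₛₗ[phiR k p f] FreeM k where
  toFun m := (m.mapRange (phiR k p f) (map_zero _)).mapDomain (Prod.map id Nat.succ)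
  map_add' m m' := by
    rw [Finsupp.mapRange_add (map_add _), Finsupp.mapDomain_add]
  map_smul' F m := by
    rw [Finsupp.mapRange_smul' (c := F) (d := phiR k p f F) m
      (fun a => by simp only [smul_eq_mul, map_mul]), Finsupp.mapDomain_smul]

/-- The `k⟦t⟧[φ]`-submodule generated by a set. -/
noncomputable def phiSpan (S : Set (FreeM k)) : Submodule k⟦X⟧ (FreeM k) :=
  Submodule.span k⟦X⟧ {m | ∃ n : ℕ, ∃ g ∈ S, m = (phiM k p f)^[n] g}

theorem phiSpan_le_comap (S : Set (FreeM k)) :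
    phiSpan k p f S ≤ (phiSpan k p f S).comap (phiM k p f) := by
  refine Submodule.span_le.2 ?_
  rintro _ ⟨n, g, hg, rfl⟩
  refine Submodule.subset_span ⟨n + 1, g, hg, ?_⟩
  exact (Function.iterate_succ_apply' _ _ _).symm

/-- The action of `φ` on the quotient by a generated submodule. -/
noncomputable def phiQuot (S : Set (FreeM k)) :
    (FreeM k ⧸ phiSpan k p f S) →ₛₗ[phiR k p f] (FreeM k ⧸ phiSpan k p f S) :=
  Submodule.mapQ _ _ (phiM k p f) (phiSpan_le_comap k p f S)

/-- The `k`-linear operator `ψ` on `k⟦t⟧` for which the map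
`Δ* ⊗_{k⟦t⟧,φ} k((t)) → (Δ ⊗_{k⟦t⟧,φ} k⟦t⟧)* ⊗_{k⟦t⟧} k((t))` sends `l ⊗ 1` to
`[x ⊗ b ↦ l (ψ(b) x)] ⊗ 1`. It satisfies `ψ(φ(a) b) = a ψ(b)`, `ψ(t^(q-1)) = 1`, `ψ(t^j) = 0` for
`0 < j < q - 1`, and `ψ(1) = q / p`, which vanishes in `k` unless `q = p`: it is the reduction
of `p⁻¹ φ⁻¹ ∘ Tr`, the operator that commutes with `Γ`. -/
noncomputable def psiR (b : k⟦X⟧) : k⟦X⟧ :=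
  PowerSeries.mk fun n =>
    PowerSeries.coeff (p ^ f * n + (p ^ f - 1)) b +
      ((p ^ (f - 1) : ℕ) : k) * PowerSeries.coeff (p ^ f * n) b

end Modules

/-! ### Numerical data -/

section Numbers

variable (p f ell : ℕ)

/-- `ξ = q - 1`. -/
def xi : ℤ := (p : ℤ) ^ f - 1

/-- The digits `m_j` of `ell = ∑_{j < f} m_j p^j`, extended `f`-periodically to `j ∈ ℤ`. -/
def digit (j : ℤ) : ℕ := ell / p ^ (j % (f : ℤ)).toNat % p

/-- `ell_i = ∑_{j < f} m_{j+i} p^{j+i}`. -/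
def ellShift (i : ℕ) : ℤ :=
  ∑ j ∈ Finset.range f, (digit p f ell ((j : ℤ) + i) : ℤ) * (p : ℤ) ^ (j + i)

open Classical in
/-- The set `E(ell)`. -/
noncomputable def setE : Finset ℕ :=
  (Finset.range f).filter fun i => ∃ r : ℤ, r < i ∧ digit p f ell r = p - 1 ∧
    ∀ s : ℤ, r < s → s < i → digit p f ell s = p - 2

/-- The set `D(ell)`, the complement of `E(ell)` in `{0, …, f - 1}`. -/
noncomputable def setD : Finset ℕ := Finset.range f \ setE p f ell

variable (N : ℕ)

/-- The exponent `r` (the division by `p - 1` is exact). -/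
def expR : ℤ := (p : ℤ) ^ (f * N) - 1 - (p : ℤ) ^ (f - 1) * (xi p f / ((p : ℤ) - 1))

/-- The exponents `o_i` (the division by `p - 1` is exact). -/
def expO (i : ℕ) : ℤ :=
  (p : ℤ) ^ (f * N) - 1 - (p : ℤ) ^ i * (xi p f + (p : ℤ) ^ f * (xi p f / ((p : ℤ) - 1)))

/-- The exponents `r_i`. -/
def expRi (i : ℕ) : ℤ := (p : ℤ) ^ (f * N) - 1 + ellShift p f ell i - (p : ℤ) ^ i * xi p f

/-- The numbers `g^{(j)}`, for `1 ≤ j ≤ f`. -/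
def gNum (j : ℕ) : ℤ :=
  xi p f * ((∑ s ∈ Finset.range j, (p : ℤ) ^ (2 * f + s + 1 - j)) - (p : ℤ) ^ (f + 1 - j))

/-- The exponents `n_i^{(0)}`. -/
def expN (i : ℕ) : ℤ :=
  (p : ℤ) ^ (f * N) - 1 + (p : ℤ) ^ (2 * f) * ellShift p f ell i
    - 2 * (p : ℤ) ^ (2 * f + i) * xi p f

/-- The polynomial `H(m, i) = 1 - (m + 2) ∑_{j=1}^f t^{p^i g^{(j)}}`. -/
noncomputable def polyH (k : Type*) [Field k] (m i : ℕ) : k⟦X⟧ :=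
  1 - PowerSeries.C ((m + 2 : ℕ) : k) *
    ∑ j ∈ Finset.Icc 1 f, PowerSeries.X ^ ((p : ℤ) ^ i * gNum p f j).toNat

end Numbers

/-! ### The modules `Δ` -/

/-- The fixed parameters `ell, u, α, β`. -/
structure Params (k : Type*) [Field k] where
  ell : ℕ
  u : ℕ
  alpha : kˣ
  beta : kˣ

/-- The scalars `b_i` for `i ∈ D(ell)`, `c_i` for `i ∈ E(ell)`, and the extra scalar `c`. -/
structure Scalars (k : Type*) [Field k] (p f ell : ℕ) where
  b : setD p f ell → k
  cE : setE p f ell → k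
  c : k

/-- The extra scalar may be nonzero only if
`(ell, α/β) = ((p - 2)(q - 1)/(p - 1), 1)`. -/
def Scalars.Allowed {k : Type*} [Field k] {p f : ℕ} (P : Params k) (C : Scalars k p f P.ell) :
    Prop :=
  C.c ≠ 0 → (P.ell : ℤ) * ((p : ℤ) - 1) = ((p : ℤ) - 2) * xi p f ∧ P.alpha = P.beta

/-- The auxiliary numbers `N, n_x, n_y`. -/
structure Aux where
  N : ℕ
  nx : ℕ
  ny : ℕ

/-- The conditions on the auxiliary numbers. -/
structure Aux.Admissible {k : Type*} [Field k] {p f ell : ℕ} (A : Aux) (C : Scalars k p f ell) :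
    Prop where
  nx_pos : 0 < A.nx
  ny_pos : 0 < A.ny
  expR_nonneg : 0 ≤ expR p f A.N
  expO_nonneg : ∀ i < f, 0 ≤ expO p f A.N i
  expRi_nonneg : ∀ i ∈ setD p f ell, 0 ≤ expRi p f ell A.N i
  expN_nonneg : ∀ i ∈ setE p f ell, 0 ≤ expN p f ell A.N i
  expNj_nonneg : ∀ i ∈ setE p f ell, ∀ j ∈ Finset.Icc 1 f,
    0 ≤ expN p f ell A.N i + (p : ℤ) ^ i * gNum p f j
  d1 : ∀ i ∈ setD p f ell, (A.ny : ℤ) ≤ ellShift p f ell i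
  d2 : ∀ i ∈ setD p f ell,
    (A.ny : ℤ) ≤ (p : ℤ) ^ f * A.nx + ellShift p f ell i - xi p f * ((p : ℤ) ^ i + 1)
  e1 : ∀ i ∈ setE p f ell,
    (A.ny : ℤ) ≤ (p : ℤ) ^ (2 * f) * ellShift p f ell i
      - (p : ℤ) ^ (i + f) * xi p f * ((p : ℤ) ^ f - ∑ s ∈ Finset.range f, (p : ℤ) ^ s)
  e2 : ∀ i ∈ setE p f ell,
    (A.ny : ℤ) ≤ (p : ℤ) ^ f * A.nx + (p : ℤ) ^ (2 * f) * ellShift p f ell i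
      - xi p f * (2 * (p : ℤ) ^ (2 * f + i) + 1)
  c1 : C.c ≠ 0 → (A.ny : ℤ) ≤ xi p f
  c2 : C.c ≠ 0 → f = 1 → (A.ny : ℤ) ≤ (p : ℤ) - 2
  c3 : C.c ≠ 0 → (A.ny : ℤ) ≤ A.nx - (p : ℤ) ^ (f - 1) * (xi p f / ((p : ℤ) - 1))
  c4 : C.c ≠ 0 → (A.ny : ℤ) ≤ (p : ℤ) ^ f * A.nx
    - (xi p f * (1 + (p : ℤ) ^ (f - 1)) + (p : ℤ) ^ (2 * f - 1) * (xi p f / ((p : ℤ) - 1)))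

section Delta

variable {k : Type*} [Field k] (p f : ℕ) [Fact p.Prime]
  (P : Params k) (C : Scalars k p f P.ell) (A : Aux)

/-- The power series `∑_{i ∈ D} b_i t^{r_i} + c ∑_{i<f} t^{o_i} + ∑_{i ∈ E} c_i t^{n_i} H(m_i, i)`. -/
noncomputable def seriesB : k⟦X⟧ :=
  (∑ i : setD p f P.ell, PowerSeries.C (C.b i) *
      PowerSeries.X ^ (expRi p f P.ell A.N i).toNat) +
    PowerSeries.C C.c * (∑ i ∈ Finset.range f, PowerSeries.X ^ (expO p f A.N i).toNat) +
    ∑ i : setE p f P.ell, PowerSeries.C (C.cE i) *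
      (PowerSeries.X ^ (expN p f P.ell A.N i).toNat * polyH p f k (digit p f P.ell i) i)

/-- The element `R = t^ξ φ x - α x + α β^{1-N} (…) φ^N y`. -/
noncomputable def elemR : FreeM k :=
  Finsupp.single (0, 1) (PowerSeries.X ^ (p ^ f - 1))
    - Finsupp.single (0, 0) (PowerSeries.C (P.alpha : k))
    + Finsupp.single (1, A.N)
        (PowerSeries.C ((P.alpha : k) * (P.beta : k) ^ (1 - (A.N : ℤ))) * seriesB p f P C A)

/-- The four generators `t^{n_y} y`, `t^ξ φ y - β y`, `t^{n_x} x`, `R` of `∇`. -/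
noncomputable def nablaGens : Set (FreeM k) :=
  {Finsupp.single (1, 0) (PowerSeries.X ^ A.ny),
    Finsupp.single (1, 1) (PowerSeries.X ^ (p ^ f - 1))
      - Finsupp.single (1, 0) (PowerSeries.C (P.beta : k)),
    Finsupp.single (0, 0) (PowerSeries.X ^ A.nx),
    elemR p f P C A}

/-- `Δ = M / ∇`. -/
abbrev Delta : Type _ := FreeM k ⧸ phiSpan k p f (nablaGens p f P C A)

/-- The class in `Δ` of an element of `M`. -/
noncomputable def deltaMk (m : FreeM k) : Delta p f P C A :=
  Submodule.Quotient.mk m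

/-- The action of `φ` on `Δ`. -/
noncomputable def deltaPhi (m : Delta p f P C A) : Delta p f P C A :=
  phiQuot k p f (nablaGens p f P C A) m

variable {O : Type*} [CommRing O] [Algebra O k]

/-- `G_γ = a_{γ,q}^{p^{f-1}} a_{γ,1}^{-p^{f-1}-r} [γ]^r`. -/
noncomputable def seriesG (k : Type*) [Field k] [Algebra O k] (N : ℕ) (γ : Oˣ) : k⟦X⟧ :=
  PowerSeries.C (brkCoeff p f k γ (p ^ f) ^ (p ^ (f - 1)) *
      brkCoeff p f k γ 1 ^ (-(p : ℤ) ^ (f - 1) - expR p f N)) *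
    brk p f k γ ^ (expR p f N).toNat

/-- `T` is the action of `Γ` on `Δ`: it makes `Δ` a `k⟦t⟧[φ,Γ]`-module and is given by the
prescribed formulae on `x` and `y`. -/
structure IsGammaAction (T : Oˣ → Delta p f P C A → Delta p f P C A) : Prop where
  add : ∀ γ m m', T γ (m + m') = T γ m + T γ m'
  smul : ∀ (γ : Oˣ) (F : k⟦X⟧) m,
    T γ (F • m) = (PowerSeries.subst (brk p f k γ) F : k⟦X⟧) • T γ m
  one : ∀ m, T 1 m = m
  mul : ∀ γ γ' m, T (γ * γ') m = T γ (T γ' m)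
  phi : ∀ γ m, T γ (deltaPhi p f P C A m) = deltaPhi p f P C A (T γ m)
  on_x : ∀ γ : Oˣ, T γ (deltaMk p f P C A (Finsupp.single (0, 0) 1)) =
    deltaMk p f P C A
      (PowerSeries.C (brkCoeff p f k γ 1 ^ P.u) •
        (Finsupp.single (0, 0) (PowerSeries.C (brkCoeff p f k γ 1) * tDivBrk p f k γ)
          - Finsupp.single (1, A.N)
              (PowerSeries.C (C.c * (P.beta : k) ^ (1 - (A.N : ℤ))) * seriesG p f k A.N γ)))
  on_y : ∀ γ : Oˣ, T γ (deltaMk p f P C A (Finsupp.single (1, 0) 1)) =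
    deltaMk p f P C A
      (Finsupp.single (1, 0)
        (PowerSeries.C (brkCoeff p f k γ 1 ^ ((P.u : ℤ) - P.ell + 1)) * tDivBrk p f k γ))

/-- `S` is the `(φ,Γ)`-module structure on `Δ* ⊗ k((t))` deduced from `Δ`. The action of `Γ` comes
from `(γ * l)(x) = l (γ⁻¹ * x)`. The value `φ(l ⊗ 1)` is the element `t^{-m} μ` whose image
under `μ ⊗ 1 ↦ [x ⊗ b ↦ μ (b φ(x))] ⊗ 1` is `[x ⊗ b ↦ l (ψ(b) x)] ⊗ 1`, both images lying in
`(Δ ⊗_{k⟦t⟧,φ} k⟦t⟧)* ⊗ k((t))`. -/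
def IsAssociated (S : EtalePhiGamma O k p f (DualLaurent k (Delta p f P C A))) : Prop :=
  ∃ T : Oˣ → Delta p f P C A → Delta p f P C A, IsGammaAction p f P C A T ∧
    (∀ (γ : Oˣ) (l : TDual k (Delta p f P C A)), ∃ l' : TDual k (Delta p f P C A),
      (∀ x, l'.eval x = l.eval (T γ⁻¹ x)) ∧
        S.act γ ((1 : k⸨X⸩) ⊗ₜ[k⟦X⟧] l) = (1 : k⸨X⸩) ⊗ₜ[k⟦X⟧] l') ∧
    ∀ l : TDual k (Delta p f P C A), ∃ (m : ℕ) (μ : TDual k (Delta p f P C A)),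
      (∀ (b : k⟦X⟧) (x : Delta p f P C A),
        μ.eval (b • deltaPhi p f P C A x) = l.eval (psiR k p f (PowerSeries.X ^ m * b) • x)) ∧
      S.phi ((1 : k⸨X⸩) ⊗ₜ[k⟦X⟧] l) =
        ((algebraMap k⟦X⟧ k⸨X⸩ PowerSeries.X)⁻¹ ^ m) ⊗ₜ[k⟦X⟧] μ

end Delta

end LTPhiGamma

set_option linter.unusedSectionVars false

/-! Everything is carried over to `k((t))²`. Send `x`, `y` to `t⁻¹e_x`, `t⁻¹e_y` and let `φ` act
semilinearly by the matrix `(α, 0; -αβB, β)`, where `B` is `t^(1-q^N)` times the series in `R`. Then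
`R` and `t^ξφy - βy` go to `0`, while `t^(n_x)x` and `t^(n_y)y` go to `t^(n_x-1)e_x` and
`t^(n_y-1)e_y`. Admissibility makes the lattice spanned by these two vectors stable under `φ`, and
`Δ` is `k((t))²` modulo this lattice (`LatticeStable.mem_nabla_iff`). The residue pairing identifies
`Δ* ⊗ k((t))` with `k((t))²`. As `ψ` is adjoint to `w ↦ ωφ(w)` with `ω = 1 + (q/p)t^ξ`, the operator
`φ` on it is `w ↦ ω · (1/α, B; 0, 1/β) · φ(w)`, with the inverse transpose matrix
(`LatticeStable.phiSpec_iff`); so it exists, is unique and is étale. It commutes with `Γ` because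
`ψ` does (`IsUnramifiedBase.psiR_substHom`).

For the action of `Γ` on `Δ`, write `[γ] = a t U` with `a = a_{γ,1}`. The functional equation modulo
`p²`, divided by `p`, gives `U = 1 + υt^ξ - υ^(p^(f-1)) t^(ξ(1+p^(f-1))) + …` with `υ =
a_{γ,q}/a_{γ,1}`, which is additive in `γ` (`IsUnramifiedBase.exists_brk_expansion`). Compatibility
of the prescribed formulae with `R` becomes the congruence `GammaKey`: modulo `t^(n_y)`, the series
`a^(-ℓ)B([γ]) - B` equals `cυ^(p^(f-1))(φ(W) - W)` for an explicit `W`. The exponents in `B` are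
congruent to `ℓ` modulo `ξ`, so the powers of `a` cancel, and the congruence is checked for each
scalar separately. The term of `b_i` changes by a series of order at least `ℓ_i`. For `c`, the two
nontrivial terms of `U` make the sum over `i` telescope, and the ends of the telescope are the
coboundary of `W`. For `c_i`, up to a `p^i`-th power, the linear term `(m_i+2)υt^(q²ξ)` is cancelled
by the terms of `H_i`, again through a telescoping sum (`sum_twist_gNum_sub_mem`).

The scalars can be read off from `φ` alone. An isomorphism is an invertible matrix over `k((t))`.
Its lower left entry is an eigenvector of `φ`, hence constant. If it vanishes, the diagonal entries
are constants `a`, `d`, and `aB - dB'` is a coboundary `α⁻¹φ(h) - β⁻¹h`; otherwise `α = β`, and `B`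
and `B'` are both coboundaries. For each negative exponent `e`, a weighted sum of coefficients along
the orbit of `e` under multiplication by `q` kills coboundaries (`exists_orbit_functional`). The
exponents attached to the various scalars lie in different orbits: this is what the partition into
`𝒟(ℓ)` and `ℰ(ℓ)` is for. Hence a coboundary of the shape of `B` has all its scalars zero.

Conversely, `B` does not depend on the auxiliary integers, so proportional scalars give maps between
the modules `Δ`, diagonal in the coordinates above, as soon as the lattices are nested. Their
transposes are isomorphisms, and any two choices of auxiliary integers are linked by a chain of
nested ones (`isomorphic_of_scalars_eq`). -/

namespace LTPhiGamma

/-! ### Substitution of power series without constant term -/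

section Subst

variable {S : Type*} [CommRing S]

/-- Substitution of a power series without constant term, as a ring homomorphism. -/
noncomputable def substHom (g : S⟦X⟧) (hg : PowerSeries.constantCoeff g = 0) : S⟦X⟧ →+* S⟦X⟧ :=
  (PowerSeries.substAlgHom (R := S) (PowerSeries.HasSubst.of_constantCoeff_zero' hg) :
    S⟦X⟧ →ₐ[S] S⟦X⟧).toRingHom

theorem substHom_apply {g : S⟦X⟧} (hg : PowerSeries.constantCoeff g = 0) (h : S⟦X⟧) :
    substHom g hg h = PowerSeries.subst g h := by
  have := congrFun (PowerSeries.coe_substAlgHom (R := S)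
    (PowerSeries.HasSubst.of_constantCoeff_zero' hg)) h
  exact this

theorem substHom_X {g : S⟦X⟧} (hg : PowerSeries.constantCoeff g = 0) :
    substHom g hg PowerSeries.X = g := by
  rw [substHom_apply]
  exact PowerSeries.subst_X (PowerSeries.HasSubst.of_constantCoeff_zero' hg)

theorem substHom_C {g : S⟦X⟧} (hg : PowerSeries.constantCoeff g = 0) (c : S) :
    substHom g hg (PowerSeries.C c) = PowerSeries.C c := by
  rw [substHom_apply]
  exact PowerSeries.subst_C c

theorem constantCoeff_substHom {g : S⟦X⟧} (hg : PowerSeries.constantCoeff g = 0) (h : S⟦X⟧) :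
    PowerSeries.constantCoeff (substHom g hg h) = PowerSeries.constantCoeff h := by
  have h1 : h = PowerSeries.C (PowerSeries.constantCoeff h) +
      PowerSeries.X * PowerSeries.mk fun n => PowerSeries.coeff (n + 1) h := by
    rw [add_comm]
    exact PowerSeries.eq_X_mul_shift_add_const h
  conv_lhs => rw [h1]
  rw [map_add, map_mul, substHom_X, substHom_C, map_add, map_mul, hg, zero_mul, add_zero,
    PowerSeries.constantCoeff_C]

theorem X_pow_dvd_substHom {g : S⟦X⟧} (hg : PowerSeries.constantCoeff g = 0) {n : ℕ} {h : S⟦X⟧}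
    (hn : PowerSeries.X ^ n ∣ h) : PowerSeries.X ^ n ∣ substHom g hg h := by
  obtain ⟨h', rfl⟩ := hn
  rw [map_mul, map_pow, substHom_X]
  exact Dvd.dvd.mul_right (pow_dvd_pow_of_dvd (PowerSeries.X_dvd_iff.2 hg) n) _

theorem substHom_comp {g h : S⟦X⟧} (hg : PowerSeries.constantCoeff g = 0)
    (hh : PowerSeries.constantCoeff h = 0)
    (hgh : PowerSeries.constantCoeff (substHom h hh g) = 0) (F : S⟦X⟧) :
    substHom h hh (substHom g hg F) = substHom (substHom h hh g) hgh F := by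
  simp only [substHom_apply]
  exact PowerSeries.subst_comp_subst_apply (PowerSeries.HasSubst.of_constantCoeff_zero' hg)
    (PowerSeries.HasSubst.of_constantCoeff_zero' hh) F

theorem substHom_congr {g g' : S⟦X⟧} (e : g = g') (hg : PowerSeries.constantCoeff g = 0)
    (hg' : PowerSeries.constantCoeff g' = 0) (F : S⟦X⟧) :
    substHom g hg F = substHom g' hg' F := by
  subst e; rfl

theorem substHom_X_self (h0 : PowerSeries.constantCoeff (PowerSeries.X : S⟦X⟧) = 0) (F : S⟦X⟧) :
    substHom PowerSeries.X h0 F = F := by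
  rw [substHom_apply]; exact PowerSeries.X_subst F

theorem map_substHom {T : Type*} [CommRing T] (σ : S →+* T) {g : S⟦X⟧}
    (hg : PowerSeries.constantCoeff g = 0)
    (hg' : PowerSeries.constantCoeff (PowerSeries.map σ g) = 0) (F : S⟦X⟧) :
    PowerSeries.map σ (substHom g hg F) =
      substHom (PowerSeries.map σ g) hg' (PowerSeries.map σ F) := by
  simp only [substHom_apply]
  exact PowerSeries.map_subst (PowerSeries.HasSubst.of_constantCoeff_zero' hg) F

theorem constantCoeff_X_pow {n : ℕ} (hn : n ≠ 0) :
    PowerSeries.constantCoeff (PowerSeries.X ^ n : S⟦X⟧) = 0 := by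
  rw [map_pow, PowerSeries.constantCoeff_X, zero_pow hn]

theorem substHom_X_pow {n : ℕ} (hn : n ≠ 0) (F : S⟦X⟧) :
    substHom (PowerSeries.X ^ n) (constantCoeff_X_pow hn) F = PowerSeries.expand n hn F := by
  rw [substHom_apply, PowerSeries.expand_apply]

/-- In characteristic `p`, a series whose coefficients are fixed by `x ↦ x ^ q` satisfies
`h(t ^ q) = h ^ q`. -/
theorem expand_eq_pow (p f : ℕ) [Fact p.Prime] [CharP S p] (h : S⟦X⟧)
    (hh : ∀ n, PowerSeries.coeff n h ^ (p ^ f) = PowerSeries.coeff n h)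
    (h0 : p ^ f ≠ 0) : PowerSeries.expand (p ^ f) h0 h = h ^ (p ^ f) := by
  have hp : p ≠ 0 := (Fact.out : p.Prime).ne_zero
  have : ExpChar S p := ExpChar.prime (Fact.out : p.Prime)
  have e := MvPowerSeries.map_iterateFrobenius_expand (σ := Unit) p hp h f
  rw [← e]
  refine PowerSeries.ext fun n => ?_
  have e1 : PowerSeries.coeff n (MvPowerSeries.map (iterateFrobenius S p f)
      (MvPowerSeries.expand (p ^ f) (pow_ne_zero f hp) h)) =
      iterateFrobenius S p f (PowerSeries.coeff n (PowerSeries.expand (p ^ f) h0 h)) :=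
    MvPowerSeries.coeff_map _ _ _
  rw [e1, iterateFrobenius_def, PowerSeries.coeff_expand]
  split_ifs
  · rw [hh]
  · rw [zero_pow h0]

end Subst

/-! ### The Lubin–Tate series -/

/-- The properties of the ring of integers of an unramified extension of `ℚ_p` of degree `f` used in the
construction of the Lubin–Tate series. -/
structure IsUnramifiedBase (O : Type*) [CommRing O] (p f : ℕ) : Prop where
  f_pos : 0 < f
  p_ne : (p : O) ≠ 0
  dvd_pow_sub : ∀ x : O, (p : O) ∣ x ^ (p ^ f) - x
  isUnit_one_sub : ∀ n : ℕ, 0 < n → IsUnit (1 - (p : O) ^ n)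

section LubinTate

variable {O : Type*} [CommRing O] {p f : ℕ}

theorem constantCoeff_lubinTatePhi [hp : Fact p.Prime] :
    PowerSeries.constantCoeff (lubinTatePhi O p f) = 0 := by
  rw [lubinTatePhi, map_add, map_mul, PowerSeries.constantCoeff_X, mul_zero, zero_add]
  exact constantCoeff_X_pow (pow_ne_zero _ hp.out.ne_zero)

/-- The defect `p g + g ^ q - g(Φ)`. -/
noncomputable def ltDefect (O : Type*) [CommRing O] (p f : ℕ) [Fact p.Prime] (g : O⟦X⟧) : O⟦X⟧ :=
  PowerSeries.C (p : O) * g + g ^ (p ^ f) -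
    substHom (lubinTatePhi O p f) constantCoeff_lubinTatePhi g

variable [hp : Fact p.Prime]

theorem two_le_q (hf : 0 < f) : 2 ≤ p ^ f :=
  hp.out.two_le.trans (Nat.le_self_pow hf.ne' p)

theorem isLubinTateSeries_iff {γ : O} {g : O⟦X⟧} : IsLubinTateSeries p f γ g ↔
    PowerSeries.constantCoeff g = 0 ∧ PowerSeries.coeff 1 g = γ ∧ ltDefect O p f g = 0 := by
  rw [IsLubinTateSeries, ltDefect, substHom_apply, sub_eq_zero]

/-- In degree `n`, the term `p d` contributes `p d_n` and `d(Φ)` contributes `p^n d_n`, as `Φ = t(p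
+ …)`. The `q`-th power contributes nothing there, because `q ≥ 2` and the series have no constant
term. Every statement about `[γ]` below is obtained by solving degree by degree with this formula.
-/
theorem ltDefect_add (hf : 0 < f) {g d : O⟦X⟧} {n : ℕ} (hn : 1 ≤ n)
    (hg : PowerSeries.constantCoeff g = 0) (hd : PowerSeries.X ^ n ∣ d) :
    PowerSeries.X ^ (n + 1) ∣ ltDefect O p f (g + d) - ltDefect O p f g -
      PowerSeries.C (((p : O) - (p : O) ^ n) * PowerSeries.coeff n d) * PowerSeries.X ^ n := by
  obtain ⟨w, rfl⟩ := hd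
  have hq := two_le_q (p := p) hf
  obtain ⟨w', hw'⟩ : (PowerSeries.X : O⟦X⟧) ∣ w - PowerSeries.C (PowerSeries.constantCoeff w) := by
    rw [PowerSeries.X_dvd_iff, map_sub, PowerSeries.constantCoeff_C, sub_self]
  have hc : PowerSeries.coeff n (PowerSeries.X ^ n * w) = PowerSeries.constantCoeff w := by
    have := PowerSeries.coeff_X_pow_mul w n 0
    rwa [zero_add, PowerSeries.coeff_zero_eq_constantCoeff_apply] at this
  rw [hc]
  set c := PowerSeries.constantCoeff w
  have hw : w = PowerSeries.C c + PowerSeries.X * w' := by rw [← hw']; ring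
  have h1 : PowerSeries.X ^ (n + 1) ∣ (g + PowerSeries.X ^ n * w) ^ (p ^ f) - g ^ (p ^ f) := by
    rw [← (Commute.all _ _).geom_sum₂_mul, add_sub_cancel_left, pow_succ]
    rw [mul_left_comm]
    refine mul_dvd_mul_left _ (Dvd.dvd.mul_right ?_ _)
    rw [PowerSeries.X_dvd_iff, map_sum]
    refine Finset.sum_eq_zero fun i hi => ?_
    have hn' : n ≠ 0 := by omega
    rw [map_mul, map_pow, map_pow, map_add, hg, map_mul, constantCoeff_X_pow hn', zero_mul,
      add_zero, ← pow_add, zero_pow]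
    have := Finset.mem_range.1 hi
    omega
  have h2 : PowerSeries.X ^ (n + 1) ∣ substHom (lubinTatePhi O p f) constantCoeff_lubinTatePhi
      (PowerSeries.X ^ n * w) - PowerSeries.C ((p : O) ^ n * c) * PowerSeries.X ^ n := by
    rw [hw, map_mul, map_pow, substHom_X, map_add, substHom_C, map_mul, substHom_X]
    have e : lubinTatePhi O p f = PowerSeries.X * (PowerSeries.C (p : O) + PowerSeries.X *
        PowerSeries.X ^ (p ^ f - 2)) := by
      rw [lubinTatePhi, mul_add, ← pow_succ', ← pow_succ', mul_comm PowerSeries.X]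
      congr 2; omega
    set v : O⟦X⟧ := PowerSeries.X ^ (p ^ f - 2) with hv
    obtain ⟨z, hz⟩ : (PowerSeries.X : O⟦X⟧) ∣
        (PowerSeries.C (p : O) + PowerSeries.X * v) ^ n - PowerSeries.C (p : O) ^ n := by
      refine Dvd.dvd.trans ?_ (sub_dvd_pow_sub_pow _ _ n)
      rw [add_sub_cancel_left]; exact dvd_mul_right _ _
    rw [sub_eq_iff_eq_add] at hz
    refine ⟨(PowerSeries.C c * z + (PowerSeries.C (p : O) + PowerSeries.X * v) ^ (n + 1) *
      substHom (lubinTatePhi O p f) constantCoeff_lubinTatePhi w'), ?_⟩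
    generalize substHom (lubinTatePhi O p f) constantCoeff_lubinTatePhi w' = y
    rw [map_mul, map_pow, pow_succ (PowerSeries.C (p : O) + PowerSeries.X * v) n,
      e, mul_pow, hz]
    ring
  have h3 : PowerSeries.X ^ (n + 1) ∣ PowerSeries.C (p : O) * (PowerSeries.X ^ n * w) -
      PowerSeries.C ((p : O) * c) * PowerSeries.X ^ n := by
    rw [hw, map_mul]
    exact ⟨PowerSeries.C (p : O) * w', by ring⟩
  have e : ltDefect O p f (g + PowerSeries.X ^ n * w) - ltDefect O p f g -
      PowerSeries.C (((p : O) - (p : O) ^ n) * c) * PowerSeries.X ^ n =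
      (PowerSeries.C (p : O) * (PowerSeries.X ^ n * w) -
      PowerSeries.C ((p : O) * c) * PowerSeries.X ^ n) +
      ((g + PowerSeries.X ^ n * w) ^ (p ^ f) - g ^ (p ^ f)) -
      (substHom (lubinTatePhi O p f) constantCoeff_lubinTatePhi
      (PowerSeries.X ^ n * w) - PowerSeries.C ((p : O) ^ n * c) * PowerSeries.X ^ n) := by
    rw [ltDefect, ltDefect, map_add, sub_mul, map_sub]
    ring
  rw [e]
  exact dvd_sub (dvd_add h3 h1) h2

theorem X_pow_dvd_ltDefect_sub {g g' : O⟦X⟧} {n : ℕ}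
    (h : PowerSeries.X ^ n ∣ g - g') :
    PowerSeries.X ^ n ∣ ltDefect O p f g - ltDefect O p f g' := by
  have e : ltDefect O p f g - ltDefect O p f g' = PowerSeries.C (p : O) * (g - g') +
      (g ^ (p ^ f) - g' ^ (p ^ f)) -
      substHom (lubinTatePhi O p f) constantCoeff_lubinTatePhi (g - g') := by
    rw [ltDefect, ltDefect, map_sub]; ring
  rw [e]
  exact dvd_sub (dvd_add (Dvd.dvd.mul_left h _) (h.trans (sub_dvd_pow_sub_pow _ _ _)))
    (X_pow_dvd_substHom _ h)

end LubinTate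


section LubinTate

variable {O : Type*} [CommRing O] {p f : ℕ} [hp : Fact p.Prime]

theorem charP_quotient_span [Nontrivial (O ⧸ Ideal.span {(p : O)})] :
    CharP (O ⧸ Ideal.span {(p : O)}) p := by
  refine (CharP.charP_iff_prime_eq_zero hp.out).2 ?_
  rw [← map_natCast (Ideal.Quotient.mk (Ideal.span {(p : O)})), Ideal.Quotient.eq_zero_iff_mem]
  exact Ideal.mem_span_singleton_self _

omit hp in
theorem map_lubinTatePhi {T : Type*} [CommRing T] (σ : O →+* T) (hσ : σ p = 0) :
    PowerSeries.map σ (lubinTatePhi O p f) = PowerSeries.X ^ (p ^ f) := by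
  rw [lubinTatePhi, map_add, map_mul, map_pow, PowerSeries.map_X, PowerSeries.map_C, hσ, map_zero,
    zero_mul, zero_add]

/-- The defect vanishes after reduction to a ring of characteristic `p` in which the coefficients
are fixed by `x ↦ x ^ q`. -/
theorem map_ltDefect {T : Type*} [CommRing T] [CharP T p] (σ : O →+* T)
    (hσ : ∀ x, σ x ^ (p ^ f) = σ x) (g : O⟦X⟧) : PowerSeries.map σ (ltDefect O p f g) = 0 := by
  have hq : p ^ f ≠ 0 := pow_ne_zero _ hp.out.ne_zero
  have h0 : σ p = 0 := by rw [map_natCast, CharP.cast_eq_zero]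
  have h1 : PowerSeries.constantCoeff (PowerSeries.map σ (lubinTatePhi O p f)) = 0 := by
    rw [map_lubinTatePhi σ h0]; exact constantCoeff_X_pow hq
  rw [ltDefect, map_sub, map_substHom σ _ h1, substHom_congr (map_lubinTatePhi σ h0) h1
    (constantCoeff_X_pow hq), substHom_X_pow hq, expand_eq_pow p f _ (fun n => by rw [PowerSeries.coeff_map, hσ]), map_add,
    map_mul, map_pow,
    PowerSeries.map_C, h0, map_zero, zero_mul, zero_add, sub_self]

/-- Modulo `p` the functional equation reads `g^q = g(t^q)`, which every series satisfies because
`x^q = x` in `O/p`. -/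
theorem IsUnramifiedBase.dvd_coeff_ltDefect (hO : IsUnramifiedBase O p f) (g : O⟦X⟧) (n : ℕ) :
    (p : O) ∣ PowerSeries.coeff n (ltDefect O p f g) := by
  rw [← Ideal.mem_span_singleton, ← Ideal.Quotient.eq_zero_iff_mem]
  rcases subsingleton_or_nontrivial (O ⧸ Ideal.span {(p : O)}) with h | h
  · exact Subsingleton.elim _ _
  · have := charP_quotient_span (O := O) (p := p)
    have e := map_ltDefect (p := p) (f := f) (Ideal.Quotient.mk (Ideal.span {(p : O)}))
      (fun x => by
        rw [← map_pow, Ideal.Quotient.eq, Ideal.mem_span_singleton]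
        exact hO.dvd_pow_sub x) g
    rw [← PowerSeries.coeff_map, e, map_zero]

variable [IsDomain O]

omit hp in
theorem IsUnramifiedBase.sub_pow_ne_zero (hO : IsUnramifiedBase O p f) {n : ℕ} (hn : 2 ≤ n) :
    (p : O) - (p : O) ^ n ≠ 0 := by
  obtain ⟨m, rfl⟩ : ∃ m, n = m + 1 := ⟨n - 1, by omega⟩
  have : (p : O) - (p : O) ^ (m + 1) = p * (1 - (p : O) ^ m) := by ring
  rw [this]
  exact mul_ne_zero hO.p_ne (hO.isUnit_one_sub m (by omega)).ne_zero

/-- If two solutions agree below degree `n ≥ 2`, the difference of their `n`-th coefficients is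
killed by `p - p^n ≠ 0`. -/
theorem IsUnramifiedBase.isLubinTateSeries_unique (hO : IsUnramifiedBase O p f) {γ : O} {g g' : O⟦X⟧}
    (hg : IsLubinTateSeries p f γ g) (hg' : IsLubinTateSeries p f γ g') : g' = g := by
  rw [isLubinTateSeries_iff] at hg hg'
  have key : ∀ n, 2 ≤ n → PowerSeries.X ^ n ∣ g' - g := by
    intro n hn
    induction n, hn using Nat.le_induction with
    | base =>
      rw [PowerSeries.X_pow_dvd_iff]
      intro m hm
      rcases (by omega : m = 0 ∨ m = 1) with rfl | rfl
      · rw [PowerSeries.coeff_zero_eq_constantCoeff_apply, map_sub, hg.1, hg'.1, sub_self]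
      · rw [map_sub, hg.2.1, hg'.2.1, sub_self]
    | succ n hn ih =>
      have h := ltDefect_add (p := p) hO.f_pos (g := g) (by omega : 1 ≤ n) hg.1 ih
      rw [add_sub_cancel, hg.2.2, hg'.2.2, sub_zero, zero_sub, dvd_neg] at h
      have h2 := (PowerSeries.X_pow_dvd_iff.1 h) n (by omega)
      rw [PowerSeries.coeff_C_mul_X_pow, if_pos rfl] at h2
      have h3 := (mul_eq_zero.1 h2).resolve_left (hO.sub_pow_ne_zero hn)
      rw [PowerSeries.X_pow_dvd_iff] at ih ⊢
      intro m hm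
      rcases (by omega : m < n ∨ m = n) with h | rfl
      · exact ih m h
      · exact h3
  rw [← sub_eq_zero]
  refine PowerSeries.ext fun n => ?_
  rw [map_zero]
  exact PowerSeries.X_pow_dvd_iff.1 (key (n + 2) (by omega)) n (by omega)

omit [IsDomain O] in
-- For `n ≥ 2` the factor `p - p^n` is `p` times a unit, and the leading coefficient of the defect
-- is divisible by `p`; so the linear equation for the correction can be solved in `O`.
theorem IsUnramifiedBase.exists_correction (hO : IsUnramifiedBase O p f) {n : ℕ} (hn : 2 ≤ n) {g : O⟦X⟧}
    (hg : PowerSeries.constantCoeff g = 0) (h : PowerSeries.X ^ n ∣ ltDefect O p f g) :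
    ∃ c : O, PowerSeries.X ^ (n + 1) ∣
      ltDefect O p f (g + PowerSeries.C c * PowerSeries.X ^ n) := by
  obtain ⟨e, he⟩ := hO.dvd_coeff_ltDefect g n
  obtain ⟨v, hv⟩ := hO.isUnit_one_sub (n - 1) (by omega)
  refine ⟨-(e * ((v⁻¹ : Oˣ) : O)), ?_⟩
  set c := -(e * ((v⁻¹ : Oˣ) : O)) with hc
  have h1 := ltDefect_add (p := p) hO.f_pos (g := g) (by omega : 1 ≤ n) hg
    (Dvd.intro_left (PowerSeries.C c) (rfl : _ = PowerSeries.C c * PowerSeries.X ^ n))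
  rw [PowerSeries.coeff_C_mul_X_pow, if_pos rfl] at h1
  have e1 : ((p : O) - (p : O) ^ n) * c = -PowerSeries.coeff n (ltDefect O p f g) := by
    have : (p : O) - (p : O) ^ n = p * v := by
      rw [hv, mul_sub, mul_one, ← pow_succ', Nat.sub_add_cancel (by omega)]
    rw [this, he, hc]
    linear_combination -(p : O) * e * v.mul_inv
  rw [e1, map_neg (PowerSeries.C (R := O)) (PowerSeries.coeff n _), neg_mul, sub_neg_eq_add] at h1
  have h2 : PowerSeries.X ^ (n + 1) ∣ ltDefect O p f g -
      PowerSeries.C (PowerSeries.coeff n (ltDefect O p f g)) * PowerSeries.X ^ n := by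
    rw [PowerSeries.X_pow_dvd_iff] at h ⊢
    intro m hm
    rw [map_sub, PowerSeries.coeff_C_mul_X_pow]
    split_ifs with hmn
    · rw [hmn, sub_self]
    · rw [h m (by omega), sub_zero]
  have := dvd_add h1 h2
  convert this using 1
  ring

theorem IsUnramifiedBase.exists_isLubinTateSeries (hO : IsUnramifiedBase O p f) (γ : O) :
    ∃ g : O⟦X⟧, IsLubinTateSeries p f γ g := by
  choose! c hc using fun (n : ℕ) (hn : 2 ≤ n) (g : O⟦X⟧) => hO.exists_correction hn (g := g)
  let G : ℕ → O⟦X⟧ := fun n => Nat.rec (PowerSeries.C γ * PowerSeries.X)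
    (fun n g => g + PowerSeries.C (c (n + 2) g) * PowerSeries.X ^ (n + 2)) n
  have hG : ∀ n, G (n + 1) = G n + PowerSeries.C (c (n + 2) (G n)) * PowerSeries.X ^ (n + 2) :=
    fun n => rfl
  have hG0 : ∀ n, PowerSeries.constantCoeff (G n) = 0 := by
    intro n
    induction n with
    | zero => simp [G]
    | succ n ih => rw [hG, map_add, ih, map_mul, constantCoeff_X_pow (by omega)]; simp
  have hE : ∀ n, PowerSeries.X ^ (n + 2) ∣ ltDefect O p f (G n) := by
    intro n
    induction n with
    | zero =>
      have h := ltDefect_add (p := p) (f := f) hO.f_pos (g := (0 : O⟦X⟧)) le_rfl (map_zero _)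
        (Dvd.intro_left (PowerSeries.C γ) (by rw [pow_one] :
          _ = PowerSeries.C γ * PowerSeries.X))
      have h0 : ltDefect O p f 0 = 0 := by
        rw [ltDefect, map_zero, mul_zero, zero_pow (pow_ne_zero _ hp.out.ne_zero), add_zero,
          sub_self]
      rw [h0, pow_one, sub_self, zero_mul, map_zero, zero_mul, sub_zero, sub_zero, zero_add] at h
      exact h
    | succ n ih =>
      rw [hG]
      exact hc (n + 2) (by omega) (G n) (hG0 n) ih
  have hstab : ∀ n m, n ≤ m → PowerSeries.X ^ (n + 2) ∣ G m - G n := by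
    intro n m hnm
    induction m, hnm using Nat.le_induction with
    | base => rw [sub_self]; exact dvd_zero _
    | succ m hm ih =>
      rw [hG, add_sub_right_comm]
      exact dvd_add ih (Dvd.dvd.mul_left (pow_dvd_pow _ (by omega)) _)
  -- The `n`-th coefficient is already final at stage `n`, since later corrections start in degree
  -- `n + 2`.
  let g : O⟦X⟧ := PowerSeries.mk fun n => PowerSeries.coeff n (G n)
  have hg : ∀ n, PowerSeries.X ^ (n + 2) ∣ g - G n := by
    intro n
    rw [PowerSeries.X_pow_dvd_iff]
    intro m hm
    rw [map_sub, PowerSeries.coeff_mk, sub_eq_zero]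
    rcases le_total m n with h | h
    · have := PowerSeries.X_pow_dvd_iff.1 (hstab m n h) m (by omega)
      rw [map_sub, sub_eq_zero] at this
      exact this.symm
    · have := PowerSeries.X_pow_dvd_iff.1 (hstab n m h) m (by omega)
      rw [map_sub, sub_eq_zero] at this
      exact this
  refine ⟨g, isLubinTateSeries_iff.2 ⟨?_, ?_, ?_⟩⟩
  · rw [← PowerSeries.coeff_zero_eq_constantCoeff_apply, PowerSeries.coeff_mk,
      PowerSeries.coeff_zero_eq_constantCoeff_apply, hG0]
  · have := PowerSeries.X_pow_dvd_iff.1 (hg 0) 1 (by omega)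
    rw [map_sub, sub_eq_zero] at this
    rw [this]
    simp [G]
  · refine PowerSeries.ext fun n => ?_
    have := dvd_add (X_pow_dvd_ltDefect_sub (p := p) (f := f) (hg n)) (hE n)
    rw [sub_add_cancel] at this
    rw [map_zero]
    exact PowerSeries.X_pow_dvd_iff.1 this n (by omega)

theorem IsUnramifiedBase.isLubinTateSeries (hO : IsUnramifiedBase O p f) (γ : O) :
    IsLubinTateSeries p f γ (lubinTateSeries p f γ) :=
  Classical.epsilon_spec (hO.exists_isLubinTateSeries γ)

theorem IsUnramifiedBase.constantCoeff_lubinTateSeries (hO : IsUnramifiedBase O p f) (γ : O) :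
    PowerSeries.constantCoeff (lubinTateSeries p f γ) = 0 := (hO.isLubinTateSeries γ).1

theorem IsUnramifiedBase.lubinTateSeries_eq (hO : IsUnramifiedBase O p f) {γ : O} {g : O⟦X⟧}
    (hg : IsLubinTateSeries p f γ g) : lubinTateSeries p f γ = g :=
  hO.isLubinTateSeries_unique hg (hO.isLubinTateSeries γ)

theorem IsUnramifiedBase.lubinTateSeries_one (hO : IsUnramifiedBase O p f) :
    lubinTateSeries p f (1 : O) = PowerSeries.X := by
  refine hO.lubinTateSeries_eq (isLubinTateSeries_iff.2 ⟨?_, ?_, ?_⟩)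
  · exact PowerSeries.constantCoeff_X
  · exact PowerSeries.coeff_one_X
  · rw [ltDefect, substHom_X, lubinTatePhi, sub_self]

theorem coeff_one_substHom {S : Type*} [CommRing S] {g : S⟦X⟧}
    (hg : PowerSeries.constantCoeff g = 0) {F : S⟦X⟧} (hF : PowerSeries.constantCoeff F = 0) :
    PowerSeries.coeff 1 (substHom g hg F) = PowerSeries.coeff 1 F * PowerSeries.coeff 1 g := by
  obtain ⟨F', rfl⟩ := PowerSeries.X_dvd_iff.2 hF
  obtain ⟨g', hg'⟩ := PowerSeries.X_dvd_iff.2 hg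
  rw [map_mul, substHom_X]
  have h1 : ∀ a b : S⟦X⟧, PowerSeries.coeff 1 ((PowerSeries.X * a) * b) =
      PowerSeries.constantCoeff a * PowerSeries.constantCoeff b := by
    intro a b
    rw [mul_assoc, PowerSeries.coeff_succ_X_mul, PowerSeries.coeff_zero_eq_constantCoeff_apply,
      map_mul]
  have h2 : ∀ a : S⟦X⟧, PowerSeries.coeff 1 (PowerSeries.X * a) = PowerSeries.constantCoeff a := by
    intro a
    rw [PowerSeries.coeff_succ_X_mul, PowerSeries.coeff_zero_eq_constantCoeff_apply]
  rw [h2]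
  have h3 : PowerSeries.coeff 1 g = PowerSeries.constantCoeff g' := by rw [hg', h2]
  rw [h3]
  conv_lhs => rw [show g * substHom g hg F' = (PowerSeries.X * g') * substHom g hg F' from by
    rw [← hg']]
  rw [h1, constantCoeff_substHom, mul_comm]

/-- The composite commutes with `Φ` and has linear coefficient `γγ'`, so uniqueness applies. -/
theorem IsUnramifiedBase.lubinTateSeries_mul (hO : IsUnramifiedBase O p f) (γ γ' : O) :
    lubinTateSeries p f (γ * γ') =
      substHom (lubinTateSeries p f γ) (hO.constantCoeff_lubinTateSeries γ)
        (lubinTateSeries p f γ') := by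
  obtain ⟨h0, h1, h2⟩ := isLubinTateSeries_iff.1 (hO.isLubinTateSeries γ)
  obtain ⟨h0', h1', h2'⟩ := isLubinTateSeries_iff.1 (hO.isLubinTateSeries γ')
  set g := lubinTateSeries p f γ
  set g' := lubinTateSeries p f γ'
  refine hO.lubinTateSeries_eq (isLubinTateSeries_iff.2 ⟨?_, ?_, ?_⟩)
  · rw [constantCoeff_substHom, h0']
  · rw [coeff_one_substHom _ h0', h1, h1', mul_comm]
  · rw [ltDefect, sub_eq_zero] at h2 h2' ⊢
    have e1 : substHom g h0 (lubinTatePhi O p f) =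
        substHom (lubinTatePhi O p f) constantCoeff_lubinTatePhi g := by
      conv_lhs => rw [lubinTatePhi]
      rw [map_add, map_mul, map_pow, substHom_X, substHom_C, h2]
    have e2 := congrArg (substHom g h0) h2'
    rw [map_add, map_mul, map_pow, substHom_C] at e2
    rw [e2, substHom_comp _ _ (by rw [constantCoeff_substHom]; exact constantCoeff_lubinTatePhi),
      substHom_comp _ _ (by rw [constantCoeff_substHom]; exact h0)]
    exact substHom_congr e1 _ _ _

/-- `[γ](t) = γ t + t ^ q w`. -/
theorem IsUnramifiedBase.exists_lubinTateSeries_eq (hO : IsUnramifiedBase O p f) (γ : O) :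
    ∃ w : O⟦X⟧, lubinTateSeries p f γ = PowerSeries.C γ * PowerSeries.X +
      PowerSeries.X ^ (p ^ f) * w := by
  obtain ⟨h0, h1, h2⟩ := isLubinTateSeries_iff.1 (hO.isLubinTateSeries γ)
  set g := lubinTateSeries p f γ
  have hq := two_le_q (p := p) hO.f_pos
  have key : ∀ n, 2 ≤ n → n ≤ p ^ f → PowerSeries.X ^ n ∣ g - PowerSeries.C γ * PowerSeries.X := by
    intro n hn
    induction n, hn using Nat.le_induction with
    | base =>
      intro _
      rw [PowerSeries.X_pow_dvd_iff]
      intro m hm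
      rcases (by omega : m = 0 ∨ m = 1) with rfl | rfl
      · simp [h0]
      · simp [h1]
    | succ n hn ih =>
      intro hnq
      specialize ih (by omega)
      have h := ltDefect_add (p := p) hO.f_pos (g := PowerSeries.C γ * PowerSeries.X)
        (by omega : 1 ≤ n) (by simp) ih
      rw [add_sub_cancel, h2, zero_sub] at h
      -- The defect of `γt` is `(γ^q - γ)t^q`, which is invisible in degrees below `q`. So `(p -
      -- p^n)` times the next coefficient must vanish.
      have h4 : PowerSeries.X ^ (n + 1) ∣ ltDefect O p f (PowerSeries.C γ * PowerSeries.X) := by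
        rw [ltDefect, map_mul, substHom_X, substHom_C, lubinTatePhi]
        have e : PowerSeries.C (p : O) * (PowerSeries.C γ * PowerSeries.X) +
          (PowerSeries.C γ * PowerSeries.X) ^ p ^ f - PowerSeries.C γ * (PowerSeries.C (p : O) *
          PowerSeries.X + PowerSeries.X ^ p ^ f) =
          (PowerSeries.C γ ^ (p ^ f) - PowerSeries.C γ) * PowerSeries.X ^ p ^ f := by
          rw [mul_pow]; ring
        rw [e]
        exact Dvd.dvd.mul_left (pow_dvd_pow _ hnq) _
      have h5 := dvd_add h h4
      have h2 := (PowerSeries.X_pow_dvd_iff.1 h5) n (by omega)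
      have e2 : ∀ a b : O⟦X⟧, -a - b + a = -b := fun a b => by ring
      rw [e2, map_neg, neg_eq_zero, PowerSeries.coeff_C_mul_X_pow, if_pos rfl] at h2
      have h3 := (mul_eq_zero.1 h2).resolve_left (hO.sub_pow_ne_zero hn)
      rw [PowerSeries.X_pow_dvd_iff] at ih ⊢
      intro m hm
      rcases (by omega : m < n ∨ m = n) with h | rfl
      · exact ih m h
      · exact h3
  obtain ⟨w, hw⟩ := key (p ^ f) hq le_rfl
  exact ⟨w, by rw [← hw]; ring⟩

end LubinTate


/-! ### Reduction of `[γ]` to `k` and its expansion up to third order. -/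

section Brk

variable {O : Type*} [CommRing O] [IsDomain O] {p f : ℕ} [hp : Fact p.Prime]
  {k : Type*} [Field k] [Algebra O k] [CharP k p]

omit [IsDomain O] hp in
theorem IsUnramifiedBase.algebraMap_pow (hO : IsUnramifiedBase O p f) (x : O) :
    algebraMap O k x ^ (p ^ f) = algebraMap O k x := by
  obtain ⟨y, hy⟩ := hO.dvd_pow_sub x
  have := congrArg (algebraMap O k) hy
  rw [map_sub, map_pow, map_mul, map_natCast, CharP.cast_eq_zero, zero_mul, sub_eq_zero] at this
  exact this

omit [CharP k p] in
theorem IsUnramifiedBase.constantCoeff_brk (hO : IsUnramifiedBase O p f) (γ : Oˣ) :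
    PowerSeries.constantCoeff (brk p f k γ) = 0 := by
  rw [brk, ← PowerSeries.coeff_zero_eq_constantCoeff_apply, PowerSeries.coeff_map,
    PowerSeries.coeff_zero_eq_constantCoeff_apply, hO.constantCoeff_lubinTateSeries, map_zero]

omit [CharP k p] in
theorem IsUnramifiedBase.brkCoeff_one (hO : IsUnramifiedBase O p f) (γ : Oˣ) :
    brkCoeff p f k γ 1 = algebraMap O k γ := by
  rw [brkCoeff, brk, PowerSeries.coeff_map, (hO.isLubinTateSeries (γ : O)).2.1]

omit [CharP k p] in
theorem IsUnramifiedBase.brkCoeff_one_ne_zero (hO : IsUnramifiedBase O p f) (γ : Oˣ) :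
    brkCoeff p f k γ 1 ≠ 0 := by
  rw [hO.brkCoeff_one]; exact (γ.isUnit.map (algebraMap O k)).ne_zero

omit [IsDomain O] hp in
theorem IsUnramifiedBase.brkCoeff_pow (hO : IsUnramifiedBase O p f) (γ : Oˣ) (n : ℕ) :
    brkCoeff p f k γ n ^ (p ^ f) = brkCoeff p f k γ n := by
  rw [brkCoeff, brk, PowerSeries.coeff_map, hO.algebraMap_pow]

omit [IsDomain O] in
theorem IsUnramifiedBase.expand_brk (hO : IsUnramifiedBase O p f) (γ : Oˣ) (h0 : p ^ f ≠ 0) :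
    PowerSeries.expand (p ^ f) h0 (brk p f k γ) = brk p f k γ ^ (p ^ f) :=
  expand_eq_pow p f _ (hO.brkCoeff_pow γ) h0

omit [CharP k p] in
theorem IsUnramifiedBase.brk_one (hO : IsUnramifiedBase O p f) :
    brk p f k (1 : Oˣ) = PowerSeries.X := by
  rw [brk, Units.val_one, hO.lubinTateSeries_one, PowerSeries.map_X]

omit [CharP k p] in
theorem IsUnramifiedBase.brk_mul (hO : IsUnramifiedBase O p f) (γ γ' : Oˣ) :
    brk p f k (γ * γ') = substHom (brk p f k γ) (hO.constantCoeff_brk γ) (brk p f k γ') := by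
  rw [brk, Units.val_mul, hO.lubinTateSeries_mul, map_substHom _ _ (hO.constantCoeff_brk γ)]
  rfl

/-- The normalised coefficient `a_{γ,q} / a_{γ,1}`. -/
noncomputable def brkRatio (p f : ℕ) (k : Type*) [Field k] [Algebra O k] (γ : Oˣ) : k :=
  brkCoeff p f k γ (p ^ f) / brkCoeff p f k γ 1

omit [IsDomain O] hp in
theorem IsUnramifiedBase.brkRatio_pow (hO : IsUnramifiedBase O p f) (γ : Oˣ) :
    brkRatio p f k γ ^ (p ^ f) = brkRatio p f k γ := by
  rw [brkRatio, div_pow, hO.brkCoeff_pow, hO.brkCoeff_pow]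

omit [CharP k p] in
theorem IsUnramifiedBase.exists_brk_eq (hO : IsUnramifiedBase O p f) (γ : Oˣ) :
    ∃ w : k⟦X⟧, brk p f k γ = PowerSeries.C (brkCoeff p f k γ 1) * PowerSeries.X +
      PowerSeries.X ^ (p ^ f) * w ∧ PowerSeries.constantCoeff w = brkCoeff p f k γ (p ^ f) := by
  obtain ⟨w, hw⟩ := hO.exists_lubinTateSeries_eq (γ : O)
  have h : brk p f k γ = PowerSeries.C (brkCoeff p f k γ 1) * PowerSeries.X +
      PowerSeries.X ^ (p ^ f) * PowerSeries.map (algebraMap O k) w := by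
    rw [hO.brkCoeff_one, brk, hw, map_add, map_mul, map_mul, map_pow, PowerSeries.map_X,
      PowerSeries.map_C]
  refine ⟨_, h, ?_⟩
  conv_rhs => rw [brkCoeff, h]
  have hq := two_le_q (p := p) hO.f_pos
  rw [map_add, PowerSeries.coeff_C_mul, PowerSeries.coeff_X, if_neg (by omega), mul_zero, zero_add]
  conv_rhs => rw [← Nat.zero_add (p ^ f), Nat.zero_add (p ^ f)]
  have := PowerSeries.coeff_X_pow_mul (PowerSeries.map (algebraMap O k) w) (p ^ f) 0
  rw [zero_add, PowerSeries.coeff_zero_eq_constantCoeff_apply] at this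
  exact this.symm

/-- The coefficient of `t^q` in `[γ']([γ])` is `a'_1 a_q + a'_q a_1^q`, and `a_1^q = a_1`. This
additivity is what makes the `c`-term of `γ * x` a cocycle. -/
theorem IsUnramifiedBase.brkRatio_mul (hO : IsUnramifiedBase O p f) (γ γ' : Oˣ) :
    brkRatio p f k (γ * γ') = brkRatio p f k γ + brkRatio p f k γ' := by
  have ha := hO.brkCoeff_one_ne_zero (k := k) γ
  have ha' := hO.brkCoeff_one_ne_zero (k := k) γ'
  have hq := two_le_q (p := p) hO.f_pos
  have h1 : brkCoeff p f k (γ * γ') 1 = brkCoeff p f k γ 1 * brkCoeff p f k γ' 1 := by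
    rw [hO.brkCoeff_one, hO.brkCoeff_one, hO.brkCoeff_one, Units.val_mul, map_mul]
  have h2 : brkCoeff p f k (γ * γ') (p ^ f) = brkCoeff p f k γ' 1 * brkCoeff p f k γ (p ^ f) +
      brkCoeff p f k γ 1 * brkCoeff p f k γ' (p ^ f) := by
    obtain ⟨w, hw, hw0⟩ := hO.exists_brk_eq (k := k) γ
    obtain ⟨w', hw', hw0'⟩ := hO.exists_brk_eq (k := k) γ'
    have hc : ∀ v : k⟦X⟧, PowerSeries.coeff (p ^ f) (PowerSeries.X ^ (p ^ f) * v) =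
        PowerSeries.constantCoeff v := by
      intro v
      have := PowerSeries.coeff_X_pow_mul v (p ^ f) 0
      rwa [zero_add, PowerSeries.coeff_zero_eq_constantCoeff_apply] at this
    conv_lhs => rw [brkCoeff, hO.brk_mul, hw']
    rw [map_add, map_mul, map_mul, map_pow, substHom_X, substHom_C, map_add, PowerSeries.coeff_C_mul]
    have e : brk p f k γ ^ (p ^ f) = PowerSeries.X ^ (p ^ f) *
        (PowerSeries.C (brkCoeff p f k γ 1) + PowerSeries.X ^ (p ^ f - 1) * w) ^ (p ^ f) := by
      rw [← mul_pow, hw]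
      congr 1
      conv_lhs => rw [show p ^ f = (p ^ f - 1) + 1 by omega, pow_succ]
      ring
    rw [e, mul_assoc, hc, map_mul, map_pow, map_add, map_mul, constantCoeff_X_pow (by omega),
      zero_mul, add_zero, PowerSeries.constantCoeff_C, constantCoeff_substHom, hw0',
      hO.brkCoeff_pow]
    rfl
  rw [brkRatio, brkRatio, brkRatio, h1, h2]
  field_simp

omit [IsDomain O] in
-- With `P = p^(f-1)`, one has `(u + v)^P ≡ u^P + v^P` modulo `p`. The `p`-th power of this
-- congruence holds modulo `p²`, and `(u^P + v^P)^p` is expanded up to its second order term in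
-- `v^P`.
theorem pow_mul_add_pow_mod_sq (γ : O) (z : O⟦X⟧) (hf : 0 < f) :
    ∃ r s : O⟦X⟧, (PowerSeries.C γ * PowerSeries.X + PowerSeries.X ^ (p ^ f) * z) ^ (p ^ f) =
      PowerSeries.X ^ (p ^ f) * (PowerSeries.C (γ ^ p ^ f) +
        (p : O⟦X⟧) * (PowerSeries.C (γ ^ (p ^ (f - 1) * (p - 1))) *
          (PowerSeries.X ^ ((p ^ f - 1) * p ^ (f - 1)) * z ^ p ^ (f - 1)))) +
      PowerSeries.X ^ (p ^ f + 2 * ((p ^ f - 1) * p ^ (f - 1))) * r + (p : O⟦X⟧) ^ 2 * s := by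
  have hqP : p ^ f = p ^ (f - 1) * p := by
    rw [← pow_succ, Nat.sub_add_cancel hf]
  have hq0 : 0 < p ^ f := pow_pos hp.out.pos _
  set P := p ^ (f - 1) with hP
  clear_value P
  set D := (p ^ f - 1) * P with hD
  obtain ⟨v, hv⟩ := exists_add_pow_prime_pow_eq hp.out (PowerSeries.C γ * PowerSeries.X)
    (PowerSeries.X ^ (p ^ f) * z) (f - 1)
  rw [← hP] at hv
  have h1 : (p : O⟦X⟧) ∣ (PowerSeries.C γ * PowerSeries.X + PowerSeries.X ^ (p ^ f) * z) ^ P -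
      PowerSeries.X ^ P * (PowerSeries.C (γ ^ P) + PowerSeries.X ^ D * z ^ P) := by
    rw [hv]
    refine ⟨PowerSeries.C γ * PowerSeries.X * (PowerSeries.X ^ p ^ f * z) * v, ?_⟩
    have e : (PowerSeries.X : O⟦X⟧) ^ (p ^ f * P) = PowerSeries.X ^ P * PowerSeries.X ^ D := by
      rw [← pow_add]
      congr 1
      rw [hD, Nat.sub_one_mul]
      exact (Nat.add_sub_cancel' (Nat.le_mul_of_pos_left P hq0)).symm
    rw [mul_pow, mul_pow, ← pow_mul, e, map_pow]
    ring
  -- A congruence modulo `p` raised to the power `p` holds modulo `p²`.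
  obtain ⟨s, hs⟩ := dvd_sub_pow_of_dvd_sub h1 1
  rw [sub_eq_iff_eq_add] at hs
  obtain ⟨r, hr⟩ := Polynomial.powAddExpansion (PowerSeries.C (γ ^ P)) (PowerSeries.X ^ D * z ^ P) p
  refine ⟨r * z ^ P ^ 1 * z ^ P, s, ?_⟩
  rw [pow_one, ← pow_mul, ← hqP] at hs
  rw [hs, mul_pow, hr, ← pow_mul, ← hqP, ← map_pow, ← map_pow, ← pow_mul, ← pow_mul, ← hqP, pow_add,
    mul_comm 2 D, pow_mul]
  ring

omit [IsDomain O] hp in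
-- From `p ∣ Φ - t^q` follows `p^(f+1) ∣ Φ^q - t^(q²)`, and `f + 1 ≥ 2`.
theorem lubinTatePhi_pow_q (hf : 0 < f) :
    ∃ s : O⟦X⟧, lubinTatePhi O p f ^ (p ^ f) =
      PowerSeries.X ^ (p ^ f * p ^ f) + (p : O⟦X⟧) ^ 2 * s := by
  have h : (p : O⟦X⟧) ∣ lubinTatePhi O p f - PowerSeries.X ^ (p ^ f) := by
    rw [lubinTatePhi, add_sub_cancel_right, map_natCast]
    exact dvd_mul_right _ _
  obtain ⟨s, hs⟩ := (pow_dvd_pow (p : O⟦X⟧) (by omega : 2 ≤ f + 1)).trans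
    (dvd_sub_pow_of_dvd_sub h f)
  exact ⟨s, by rw [pow_mul, ← hs]; ring⟩

/-- This is the functional equation modulo `p²`, divided by `p t^q`. Working modulo `p` would give
no information, as the equation is then vacuous. The constant `δ` is `(γ^q - γ)/p`. -/
theorem IsUnramifiedBase.exists_lubinTateSeries_mod (hO : IsUnramifiedBase O p f) (γ : O) (z : O⟦X⟧)
    (hz : lubinTateSeries p f γ = PowerSeries.C γ * PowerSeries.X + PowerSeries.X ^ (p ^ f) * z) :
    ∃ δ : O, ∀ n < 2 * ((p ^ f - 1) * p ^ (f - 1)), (p : O) ∣ PowerSeries.coeff n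
      (z + PowerSeries.C δ + PowerSeries.C (γ ^ (p ^ (f - 1) * (p - 1))) *
        (PowerSeries.X ^ ((p ^ f - 1) * p ^ (f - 1)) * z ^ p ^ (f - 1))) := by
  have hqP : p ^ f = p ^ (f - 1) * p := by
    rw [← pow_succ, Nat.sub_add_cancel hO.f_pos]
  have hq := two_le_q (p := p) hO.f_pos
  obtain ⟨δ, hδ⟩ := hO.dvd_pow_sub γ
  refine ⟨δ, fun n hn => ?_⟩
  obtain ⟨h0, h1, h2⟩ := isLubinTateSeries_iff.1 (hO.isLubinTateSeries γ)
  rw [ltDefect, hz, map_add, map_mul, map_mul, map_pow, substHom_X, substHom_C] at h2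
  obtain ⟨r, s, hrs⟩ := pow_mul_add_pow_mod_sq (p := p) γ z hO.f_pos
  obtain ⟨t, ht⟩ := lubinTatePhi_pow_q (O := O) (p := p) hO.f_pos
  rw [hrs, ht] at h2
  generalize substHom (lubinTatePhi O p f) constantCoeff_lubinTatePhi z = y at h2
  set D := (p ^ f - 1) * p ^ (f - 1) with hD
  -- Since `2p^(f-1) ≤ q`, the term `Φ^q z(Φ)`, of order `q²` modulo `p²`, lies beyond the degrees
  -- considered.
  obtain ⟨e, he⟩ : ∃ e, p ^ f * p ^ f = p ^ f + 2 * D + e := by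
    refine Nat.exists_eq_add_of_le ?_
    have h3 : 2 * p ^ (f - 1) ≤ p ^ f := by rw [hqP, mul_comm]; gcongr; exact hp.out.two_le
    obtain ⟨m, hm⟩ : ∃ m, p ^ f = m + 1 := ⟨p ^ f - 1, by omega⟩
    rw [hD, hm, Nat.add_sub_cancel]
    rw [hm] at h3
    nlinarith
  have hδ' : PowerSeries.C (γ ^ p ^ f) = PowerSeries.C γ + (p : O⟦X⟧) * PowerSeries.C δ := by
    rw [← map_natCast (PowerSeries.C (R := O)), ← map_mul, ← map_add, ← hδ]
    congr 1; ring
  set Q := z + PowerSeries.C δ + PowerSeries.C (γ ^ (p ^ (f - 1) * (p - 1))) *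
        (PowerSeries.X ^ D * z ^ p ^ (f - 1)) with hQ
  have key : (p : O⟦X⟧) * (PowerSeries.X ^ (p ^ f) * Q) =
      PowerSeries.X ^ (p ^ f + 2 * D) * (PowerSeries.X ^ e * y - r) +
        (p : O⟦X⟧) * ((p : O⟦X⟧) * (t * y - s)) := by
    rw [he, hδ', lubinTatePhi, map_natCast, pow_add _ (p ^ f + 2 * D) e] at h2
    rw [hQ]
    linear_combination h2
  clear_value Q
  have hc : ∀ (v : O⟦X⟧) (m : ℕ), PowerSeries.coeff m ((p : O⟦X⟧) * v) =
      (p : O) * PowerSeries.coeff m v := by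
    intro v m
    rw [← map_natCast (PowerSeries.C (R := O)), PowerSeries.coeff_C_mul]
  have h4 := congrArg (PowerSeries.coeff (n + p ^ f)) key
  rw [hc, PowerSeries.coeff_X_pow_mul, map_add, hc, hc,
    PowerSeries.X_pow_dvd_iff.1 (Dvd.intro _ rfl) (n + p ^ f) (by omega), zero_add] at h4
  exact ⟨_, mul_left_cancel₀ hO.p_ne h4⟩

/-- After reduction to `k`, the tail `w` of `[γ] = at + t^q w` satisfies `w = b - a^(P(p-1)) t^D
w^P` modulo `t^(2D)`, where `b = a_{γ,q}`, `P = p^(f-1)` and `D = ξP`. Substituting `w ≡ b` on the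
right gives the third term, normalised by `a^(P(p-1)) a^P = a^q = a`. -/
theorem IsUnramifiedBase.exists_brk_expansion (hO : IsUnramifiedBase O p f) (γ : Oˣ) :
    ∃ U w : k⟦X⟧, brk p f k γ = PowerSeries.C (brkCoeff p f k γ 1) * PowerSeries.X * U ∧
      U = 1 + PowerSeries.C (brkRatio p f k γ) * PowerSeries.X ^ (p ^ f - 1) -
        PowerSeries.C (brkRatio p f k γ ^ p ^ (f - 1)) *
          PowerSeries.X ^ ((p ^ f - 1) * (1 + p ^ (f - 1))) +
        PowerSeries.X ^ ((p ^ f - 1) * (1 + 2 * p ^ (f - 1))) * w := by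
  have hqP : p ^ f = p ^ (f - 1) * p := by
    rw [← pow_succ, Nat.sub_add_cancel hO.f_pos]
  have hq := two_le_q (p := p) hO.f_pos
  have hP0 : 0 < p ^ (f - 1) := pow_pos hp.out.pos _
  have ha := hO.brkCoeff_one_ne_zero (k := k) γ
  have haq := hO.brkCoeff_pow (k := k) γ 1
  obtain ⟨z, hz⟩ := hO.exists_lubinTateSeries_eq (γ : O)
  obtain ⟨δ, hδ⟩ := hO.exists_lubinTateSeries_mod _ z hz
  have hp0 : algebraMap O k p = 0 := by rw [map_natCast, CharP.cast_eq_zero]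
  set σ := algebraMap O k
  have hg : brk p f k γ = PowerSeries.C (brkCoeff p f k γ 1) * PowerSeries.X +
      PowerSeries.X ^ (p ^ f) * PowerSeries.map σ z := by
    rw [hO.brkCoeff_one, brk, hz, map_add, map_mul, map_mul, map_pow, PowerSeries.map_X,
      PowerSeries.map_C]
  set w := PowerSeries.map σ z
  set a := brkCoeff p f k γ 1
  have hw0 : PowerSeries.constantCoeff w = brkCoeff p f k γ (p ^ f) := by
    rw [brkCoeff, hg, map_add, PowerSeries.coeff_C_mul, PowerSeries.coeff_X, if_neg (by omega),
      mul_zero, zero_add]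
    have := PowerSeries.coeff_X_pow_mul w (p ^ f) 0
    rw [zero_add, PowerSeries.coeff_zero_eq_constantCoeff_apply] at this
    exact this.symm
  set D := (p ^ f - 1) * p ^ (f - 1) with hD
  have hD0 : 0 < D := Nat.mul_pos (by omega) hP0
  obtain ⟨r, hr⟩ : (PowerSeries.X : k⟦X⟧) ^ (2 * D) ∣ w + PowerSeries.C (σ δ) +
      PowerSeries.C (a ^ (p ^ (f - 1) * (p - 1))) *
        (PowerSeries.X ^ D * w ^ p ^ (f - 1)) := by
    rw [PowerSeries.X_pow_dvd_iff]
    intro n hn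
    obtain ⟨c, hc⟩ := hδ n hn
    have := congrArg σ hc
    rw [map_mul, hp0, zero_mul, ← PowerSeries.coeff_map] at this
    rw [← this]
    simp only [map_add, map_mul, map_pow, PowerSeries.map_C, PowerSeries.map_X, w, a, σ,
      hO.brkCoeff_one]
  have hw1 : PowerSeries.constantCoeff w = - σ δ := by
    have := congrArg PowerSeries.constantCoeff hr
    rw [map_add, map_add, map_mul, map_mul, map_mul, constantCoeff_X_pow (by omega),
      constantCoeff_X_pow (by omega), zero_mul, zero_mul, mul_zero, add_zero,
      PowerSeries.constantCoeff_C] at this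
    exact eq_neg_of_add_eq_zero_left this
  have hδ' : PowerSeries.C (σ δ) = - PowerSeries.C (brkCoeff p f k γ (p ^ f)) := by
    rw [← map_neg, ← hw0, hw1, neg_neg]
  set b := brkCoeff p f k γ (p ^ f)
  rw [hδ'] at hr
  obtain ⟨r2, hr2⟩ : ∃ r2, w = PowerSeries.C b + PowerSeries.X ^ D * r2 :=
    ⟨PowerSeries.X ^ D * r - PowerSeries.C (a ^ (p ^ (f - 1) * (p - 1))) * w ^ p ^ (f - 1), by
      rw [two_mul, pow_add] at hr
      linear_combination hr⟩
  -- Only `w ≡ b` modulo `t^D` is needed: the power `P` is a Frobenius power, so the constant term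
  -- of `w^P` is `b^P` and the rest stays divisible by `t^D`.
  have hwP : ∃ r3, w ^ p ^ (f - 1) = PowerSeries.C (b ^ p ^ (f - 1)) + PowerSeries.X ^ D * r3 := by
    have : CharP k⟦X⟧ p := charP_of_injective_ringHom (f := PowerSeries.C (R := k))
      PowerSeries.C_injective p
    refine ⟨PowerSeries.X ^ (D * (p ^ (f - 1) - 1)) * r2 ^ p ^ (f - 1), ?_⟩
    rw [hr2, add_pow_char_pow, mul_pow, ← pow_mul, map_pow, ← mul_assoc, ← pow_add]
    congr 3
    rw [Nat.mul_sub_one, Nat.add_sub_cancel' (Nat.le_mul_of_pos_right _ hP0)]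
  obtain ⟨r3, hr3⟩ := hwP
  have hau : PowerSeries.C b = PowerSeries.C a * PowerSeries.C (brkRatio p f k γ) := by
    rw [← map_mul, brkRatio, mul_div_cancel₀ _ ha]
  have hau2 : PowerSeries.C (a ^ (p ^ (f - 1) * (p - 1))) * PowerSeries.C (b ^ p ^ (f - 1)) =
      PowerSeries.C a * PowerSeries.C (brkRatio p f k γ ^ p ^ (f - 1)) := by
    rw [← map_mul, ← map_mul, brkRatio, div_pow]
    congr 1
    have h3 : a ^ (p ^ (f - 1) * (p - 1)) * a ^ p ^ (f - 1) = a := by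
      rw [← pow_add, ← Nat.mul_succ, Nat.succ_eq_add_one, Nat.sub_add_cancel hp.out.one_le, ← hqP, haq]
    change _ = a * (b ^ p ^ (f - 1) / a ^ p ^ (f - 1))
    field_simp
    rw [mul_right_comm, h3, mul_comm]
  have hai : PowerSeries.C a * PowerSeries.C a⁻¹ = (1 : k⟦X⟧) := by
    rw [← map_mul, mul_inv_cancel₀ ha, map_one]
  refine ⟨1 + PowerSeries.C (brkRatio p f k γ) * PowerSeries.X ^ (p ^ f - 1) -
        PowerSeries.C (brkRatio p f k γ ^ p ^ (f - 1)) *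
          PowerSeries.X ^ ((p ^ f - 1) * (1 + p ^ (f - 1))) +
        PowerSeries.X ^ ((p ^ f - 1) * (1 + 2 * p ^ (f - 1))) * (PowerSeries.C a⁻¹ *
          (r - PowerSeries.C (a ^ (p ^ (f - 1) * (p - 1))) * r3)), _, ?_, rfl⟩
  have e1 : (p ^ f - 1) * (1 + p ^ (f - 1)) = (p ^ f - 1) + D := by rw [hD]; ring
  have e2 : (p ^ f - 1) * (1 + 2 * p ^ (f - 1)) = (p ^ f - 1) + 2 * D := by rw [hD]; ring
  clear_value D
  rw [hg, e1, e2, pow_add, pow_add, mul_comm 2 D, pow_mul _ D 2]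
  rw [hr3, mul_comm 2 D, pow_mul _ D 2] at hr
  have e3 : (PowerSeries.X : k⟦X⟧) ^ p ^ f = PowerSeries.X * PowerSeries.X ^ (p ^ f - 1) := by
    rw [← pow_succ', Nat.sub_add_cancel (by omega)]
  rw [e3]
  generalize PowerSeries.C (a ^ (p ^ (f - 1) * (p - 1))) = A at *
  linear_combination PowerSeries.X * PowerSeries.X ^ (p ^ f - 1) * hr +
    PowerSeries.X * PowerSeries.X ^ (p ^ f - 1) * hau -
    PowerSeries.X * PowerSeries.X ^ (p ^ f - 1) * PowerSeries.X ^ D * hau2 -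
    PowerSeries.X * PowerSeries.X ^ (p ^ f - 1) * (PowerSeries.X ^ D) ^ 2 *
      (r - A * r3) * hai

end Brk


open PowerSeries (derivative)

/-! ### The operators `ψ₀` and `ψ` on power series. -/

section Psi

variable {k : Type*} [Field k]

/-- The operator `ψ₀` taking `∑ b_n t ^ n` to `∑ b_{qn+q-1} t ^ n`. -/
noncomputable def psiZero (q : ℕ) (b : k⟦X⟧) : k⟦X⟧ :=
  PowerSeries.mk fun n => PowerSeries.coeff (q * n + (q - 1)) b

theorem psiZero_sum {ι : Type*} (q : ℕ) (s : Finset ι) (b : ι → k⟦X⟧) :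
    psiZero q (∑ i ∈ s, b i) = ∑ i ∈ s, psiZero q (b i) := by
  refine PowerSeries.ext fun n => ?_
  simp only [psiZero, PowerSeries.coeff_mk, map_sum]

theorem psiZero_expand_mul {q : ℕ} (hq : q ≠ 0) (a b : k⟦X⟧) :
    psiZero q (PowerSeries.expand q hq a * b) = a * psiZero q b := by
  refine PowerSeries.ext fun n => ?_
  rw [psiZero, PowerSeries.coeff_mk, PowerSeries.coeff_mul, PowerSeries.coeff_mul]
  symm
  refine Finset.sum_of_injOn (fun x => (q * x.1, q * x.2 + (q - 1))) ?_ ?_ ?_ ?_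
  · rintro ⟨a, b⟩ - ⟨c, d⟩ - h
    simp only [Prod.mk.injEq, Nat.add_right_cancel_iff] at h
    exact Prod.ext (Nat.eq_of_mul_eq_mul_left (by omega) h.1)
      (Nat.eq_of_mul_eq_mul_left (by omega) h.2)
  · rintro ⟨i, j⟩ h
    rw [Finset.mem_coe, Finset.HasAntidiagonal.mem_antidiagonal] at h ⊢
    rw [← h]; ring
  · rintro ⟨i, j⟩ h hn
    rw [Finset.HasAntidiagonal.mem_antidiagonal] at h
    rw [PowerSeries.coeff_expand_of_not_dvd, zero_mul]
    rintro ⟨i', rfl⟩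
    refine hn ⟨(i', n - i'), ?_, ?_⟩
    · rw [Finset.mem_coe, Finset.HasAntidiagonal.mem_antidiagonal]
      have : i' ≤ n := by
        by_contra hlt
        have : q * (n + 1) ≤ q * i' := Nat.mul_le_mul_left _ (by omega)
        rw [Nat.mul_succ] at this
        dsimp only at h
        omega
      omega
    · have : i' ≤ n := by
        by_contra hlt
        have : q * (n + 1) ≤ q * i' := Nat.mul_le_mul_left _ (by omega)
        rw [Nat.mul_succ] at this
        dsimp only at h
        omega
      dsimp only at h ⊢
      rw [Nat.mul_sub]
      have := Nat.mul_le_mul_left q this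
      refine Prod.ext rfl ?_
      dsimp only
      omega
  · rintro ⟨i, j⟩ h
    rw [PowerSeries.coeff_expand_mul, psiZero, PowerSeries.coeff_mk]

/-- The series `ω = 1 + (q / p) t ^ (q - 1)`. -/
noncomputable def omegaSeries (k : Type*) [Field k] (p f : ℕ) : k⟦X⟧ :=
  1 + PowerSeries.C ((p ^ (f - 1) : ℕ) : k) * PowerSeries.X ^ (p ^ f - 1)

/-- The series `ω` is the reduction of `Φ'/p`. The twist by it turns the operator `ψ₀`, which is
natural on differentials `b dt`, into one that is natural on functions. -/
theorem psiR_eq (p f : ℕ) [Fact p.Prime] (b : k⟦X⟧) :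
    psiR k p f b = psiZero (p ^ f) (omegaSeries k p f * b) := by
  refine PowerSeries.ext fun n => ?_
  rw [psiR, psiZero, PowerSeries.coeff_mk, PowerSeries.coeff_mk, omegaSeries, add_mul, one_mul,
    map_add, mul_assoc, PowerSeries.coeff_C_mul, PowerSeries.coeff_X_pow_mul]

theorem psiR_expand_mul (p f : ℕ) [Fact p.Prime] (h0 : p ^ f ≠ 0) (a b : k⟦X⟧) :
    psiR k p f (PowerSeries.expand (p ^ f) h0 a * b) = a * psiR k p f b := by
  rw [psiR_eq, psiR_eq, mul_left_comm, psiZero_expand_mul]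

theorem eq_sum_expand_mul_X_pow {q : ℕ} (hq : q ≠ 0) (h : k⟦X⟧) :
    h = ∑ j ∈ Finset.range q, PowerSeries.expand q hq
      (PowerSeries.mk fun n => PowerSeries.coeff (q * n + j) h) * PowerSeries.X ^ j := by
  refine PowerSeries.ext fun n => ?_
  rw [map_sum, Finset.sum_eq_single (n % q)]
  · rw [PowerSeries.coeff_mul_X_pow', if_pos (Nat.mod_le _ _)]
    have : n - n % q = q * (n / q) := by
      have := Nat.div_add_mod n q
      omega
    rw [this, PowerSeries.coeff_expand_mul, PowerSeries.coeff_mk, Nat.div_add_mod]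
  · intro j hj hjn
    rw [PowerSeries.coeff_mul_X_pow']
    split_ifs with h1
    · rw [PowerSeries.coeff_expand_of_not_dvd]
      rintro ⟨c, hc⟩
      refine hjn ?_
      have : n = j + q * c := by omega
      rw [this, Nat.add_mul_mod_self_left, Nat.mod_eq_of_lt (Finset.mem_range.1 hj)]
    · rfl
  · intro h
    exact absurd (Finset.mem_range.2 (Nat.mod_lt _ (Nat.pos_of_ne_zero hq))) h

end Psi

/-! ### Commutation of `ψ` with the action of `Γ`. -/

section PsiBrk

variable {O : Type*} [CommRing O] [IsDomain O] {p f : ℕ} [hp : Fact p.Prime]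
  {k : Type*} [Field k] [Algebra O k] [CharP k p]

theorem map_derivative {S T : Type*} [CommRing S] [CommRing T] (σ : S →+* T) (F : S⟦X⟧) :
    PowerSeries.map σ (derivative S F) = derivative T (PowerSeries.map σ F) := by
  refine PowerSeries.ext fun n => ?_
  rw [PowerSeries.coeff_map, PowerSeries.coeff_derivative, PowerSeries.coeff_derivative,
    PowerSeries.coeff_map, map_mul, map_add, map_natCast, map_one]

/-- Differentiate `Φ(g) = g(Φ)` over `O`: both sides acquire a factor `p`, which is cancelled before
reducing to `k`. -/
theorem IsUnramifiedBase.omega_mul_derivative (hO : IsUnramifiedBase O p f) (γ : Oˣ) (h0 : p ^ f ≠ 0) :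
    substHom (brk p f k γ) (hO.constantCoeff_brk γ) (omegaSeries k p f) *
        derivative k (brk p f k γ) =
      omegaSeries k p f * PowerSeries.expand (p ^ f) h0 (derivative k (brk p f k γ)) := by
  obtain ⟨_, _, h2⟩ := isLubinTateSeries_iff.1 (hO.isLubinTateSeries (γ : O))
  have hqP : ((p ^ f : ℕ) : O⟦X⟧) = PowerSeries.C (p : O) * PowerSeries.C ((p ^ (f - 1) : ℕ) : O) := by
    rw [← map_mul, ← Nat.cast_mul, ← pow_succ', Nat.sub_add_cancel hO.f_pos, map_natCast]
  rw [ltDefect, sub_eq_zero] at h2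
  set G := lubinTateSeries p f (γ : O) with hG
  have hd : derivative O (lubinTatePhi O p f) = PowerSeries.C (p : O) +
      PowerSeries.C (p : O) * PowerSeries.C ((p ^ (f - 1) : ℕ) : O) *
        PowerSeries.X ^ (p ^ f - 1) := by
    rw [lubinTatePhi, map_add, Derivation.leibniz, PowerSeries.derivative_C, smul_zero, add_zero,
      PowerSeries.derivative_X, Derivation.leibniz_pow, PowerSeries.derivative_X]
    simp only [smul_eq_mul, mul_one, nsmul_eq_mul, hqP]
  have h3 := congrArg (derivative O) h2
  rw [substHom_apply, PowerSeries.derivative_subst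
    (PowerSeries.HasSubst.of_constantCoeff_zero' constantCoeff_lubinTatePhi), hd,
    map_add, Derivation.leibniz,
    PowerSeries.derivative_C, smul_zero, add_zero, Derivation.leibniz_pow] at h3
  simp only [smul_eq_mul, nsmul_eq_mul, hqP] at h3
  have hp0 : PowerSeries.C (p : O) ≠ 0 := by
    rw [Ne, ← map_zero (PowerSeries.C (R := O)), PowerSeries.C_injective.eq_iff]
    exact hO.p_ne
  have h4 : derivative O G + PowerSeries.C ((p ^ (f - 1) : ℕ) : O) * G ^ (p ^ f - 1) * derivative O G =
      substHom (lubinTatePhi O p f) constantCoeff_lubinTatePhi (derivative O G) *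
        (1 + PowerSeries.C ((p ^ (f - 1) : ℕ) : O) * PowerSeries.X ^ (p ^ f - 1)) := by
    refine mul_left_cancel₀ hp0 ?_
    rw [substHom_apply]
    linear_combination h3
  have hσ : algebraMap O k p = 0 := by rw [map_natCast, CharP.cast_eq_zero]
  have h1 : PowerSeries.constantCoeff (PowerSeries.map (algebraMap O k) (lubinTatePhi O p f)) = 0 := by
    rw [map_lubinTatePhi _ hσ]; exact constantCoeff_X_pow h0
  have h5 := congrArg (PowerSeries.map (algebraMap O k)) h4
  rw [map_mul, map_substHom _ _ h1, substHom_congr (map_lubinTatePhi _ hσ) h1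
    (constantCoeff_X_pow h0), substHom_X_pow h0] at h5
  simp only [map_add, map_mul, map_pow, map_one, map_derivative,
    PowerSeries.map_X, map_natCast] at h5
  rw [omegaSeries, map_add, map_mul, map_pow, substHom_X, substHom_C, map_one]
  change _ + _ * brk p f k γ ^ _ * derivative k (brk p f k γ) =
    PowerSeries.expand _ _ (derivative k (brk p f k γ)) * _ at h5
  simp only [map_natCast]
  change derivative k (brk p f k γ) + _ = _ at h5
  linear_combination h5

/-- `ψ₀ (g ^ j g')` for the Lubin–Tate series `g`. -/
theorem IsUnramifiedBase.psiZero_pow_mul_derivative (hO : IsUnramifiedBase O p f) (γ : Oˣ) {j : ℕ}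
    (hj : j < p ^ f) : psiZero (p ^ f) (brk p f k γ ^ j * derivative k (brk p f k γ)) =
      if j = p ^ f - 1 then derivative k (brk p f k γ) else 0 := by
  have hq := two_le_q (p := p) hO.f_pos
  have h0 : p ^ f ≠ 0 := by omega
  set G := lubinTateSeries p f (γ : O) with hG
  have hg : brk p f k γ = PowerSeries.map (algebraMap O k) G := rfl
  refine PowerSeries.ext fun n => ?_
  -- The coefficient of `t^(qn+q-1)` in the derivative of `G^(j+1)`, computed in two ways. This is
  -- done over `O`, where powers of `p` can be cancelled.
  have h1 : ((j + 1 : ℕ) : O) * PowerSeries.coeff (p ^ f * n + (p ^ f - 1)) (G ^ j * derivative O G) =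
      ((p ^ f * (n + 1) : ℕ) : O) * PowerSeries.coeff (p ^ f * (n + 1)) (G ^ (j + 1)) := by
    have e := PowerSeries.derivative_pow G (j + 1)
    have e2 := congrArg (PowerSeries.coeff (p ^ f * n + (p ^ f - 1))) e
    have e3 : p ^ f * n + (p ^ f - 1) + 1 = p ^ f * (n + 1) := by rw [Nat.mul_succ]; omega
    rw [PowerSeries.coeff_derivative, e3, ← Nat.cast_succ, Nat.succ_eq_add_one, e3, Nat.add_sub_cancel, mul_assoc,
      ← map_natCast (PowerSeries.C (R := O)), PowerSeries.coeff_C_mul] at e2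
    rw [← e2, mul_comm]
  have hc : PowerSeries.coeff n (psiZero (p ^ f) (brk p f k γ ^ j * derivative k (brk p f k γ))) =
      algebraMap O k (PowerSeries.coeff (p ^ f * n + (p ^ f - 1)) (G ^ j * derivative O G)) := by
    rw [psiZero, PowerSeries.coeff_mk, ← PowerSeries.coeff_map, map_mul (PowerSeries.map _),
      map_pow, map_derivative, hg]
  rw [hc]
  split_ifs with h
  · have hj1 : j + 1 = p ^ f := by omega
    have hqO : ((p ^ f : ℕ) : O) ≠ 0 := by
      rw [Nat.cast_pow]; exact pow_ne_zero _ hO.p_ne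
    rw [hj1, Nat.cast_mul, mul_assoc] at h1
    rw [mul_left_cancel₀ hqO h1, map_mul, map_natCast, ← PowerSeries.coeff_map, map_pow, ← hg,
      ← hO.expand_brk γ h0, PowerSeries.coeff_expand_mul, PowerSeries.coeff_derivative, mul_comm,
      Nat.cast_succ]
  · obtain ⟨v, m, hm, hv⟩ := Nat.exists_eq_pow_mul_and_not_dvd (Nat.succ_ne_zero j) p
      hp.out.ne_one
    -- As `j + 1 < q`, its exact `p`-power `p^v` has `v < f`; after cancelling `p^v` the other side
    -- still has a factor `p`.
    have hvf : v < f := by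
      by_contra hlt
      have h2 : p ^ f ≤ p ^ v := Nat.pow_le_pow_right hp.out.pos (by omega)
      have h3 : 0 < m := Nat.pos_of_ne_zero (by rintro rfl; exact hm (dvd_zero p))
      have h4 : p ^ v ≤ p ^ v * m := Nat.le_mul_of_pos_right _ h3
      omega
    rw [Nat.succ_eq_add_one] at hv
    have hpv : ((p ^ v : ℕ) : O) ≠ 0 := by
      rw [Nat.cast_pow]; exact pow_ne_zero _ hO.p_ne
    have e : p ^ f * (n + 1) = p ^ v * (p * (p ^ (f - v - 1) * (n + 1))) := by
      rw [← mul_assoc p, ← mul_assoc (p ^ v), ← pow_succ', ← pow_add]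
      congr 2; omega
    rw [hv, e, Nat.cast_mul, Nat.cast_mul (p ^ v), mul_assoc, mul_assoc] at h1
    have h2 := congrArg (algebraMap O k) (mul_left_cancel₀ hpv h1)
    rw [map_mul (algebraMap O k), map_mul (algebraMap O k), map_natCast, map_natCast, Nat.cast_mul p,
      CharP.cast_eq_zero k p, zero_mul, zero_mul] at h2
    rw [map_zero]
    refine (mul_eq_zero.1 h2).resolve_left fun h3 => hm ?_
    exact (CharP.cast_eq_zero_iff k p m).1 h3

/-- The map `h dt ↦ ψ₀(h) dt` is compatible with the change of variable `[γ]`. Expand `h` in the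
basis `1, t, …, t^(q-1)` over `φ(k⟦t⟧)`: substitution commutes with `φ`, and only the part of
`t^(q-1)` survives `ψ₀`. -/
theorem IsUnramifiedBase.psiZero_substHom_mul_derivative (hO : IsUnramifiedBase O p f) (γ : Oˣ)
    (h : k⟦X⟧) :
    psiZero (p ^ f) (substHom (brk p f k γ) (hO.constantCoeff_brk γ) h *
        derivative k (brk p f k γ)) =
      derivative k (brk p f k γ) *
        substHom (brk p f k γ) (hO.constantCoeff_brk γ) (psiZero (p ^ f) h) := by
  have hq := two_le_q (p := p) hO.f_pos
  have h0 : p ^ f ≠ 0 := by omega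
  have hexp : ∀ a : k⟦X⟧, substHom (brk p f k γ) (hO.constantCoeff_brk γ)
      (PowerSeries.expand (p ^ f) h0 a) =
      PowerSeries.expand (p ^ f) h0 (substHom (brk p f k γ) (hO.constantCoeff_brk γ) a) := by
    intro a
    have hc : PowerSeries.constantCoeff (brk p f k γ ^ (p ^ f)) = 0 := by
      rw [map_pow, hO.constantCoeff_brk, zero_pow h0]
    rw [← substHom_X_pow h0, ← substHom_X_pow h0,
      substHom_comp _ _ (by rw [map_pow, substHom_X]; exact hc),
      substHom_comp _ _ (by rw [substHom_X_pow h0, hO.expand_brk]; exact hc)]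
    refine substHom_congr ?_ _ _ _
    rw [map_pow, substHom_X, substHom_X_pow h0, hO.expand_brk]
  conv_lhs => rw [eq_sum_expand_mul_X_pow h0 h]
  rw [map_sum, Finset.sum_mul, psiZero_sum, Finset.sum_eq_single (p ^ f - 1)]
  · rw [map_mul, map_pow, substHom_X, hexp, mul_assoc, psiZero_expand_mul,
      hO.psiZero_pow_mul_derivative γ (by omega), if_pos rfl, mul_comm]
    rfl
  · intro j hj hjq
    rw [map_mul, map_pow, substHom_X, hexp, mul_assoc, psiZero_expand_mul,
      hO.psiZero_pow_mul_derivative γ (Finset.mem_range.1 hj), if_neg hjq, mul_zero]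
  · intro h
    exact absurd (Finset.mem_range.2 (by omega)) h

omit [CharP k p] in
theorem IsUnramifiedBase.derivative_brk_ne_zero (hO : IsUnramifiedBase O p f) (γ : Oˣ) :
    derivative k (brk p f k γ) ≠ 0 := by
  intro h
  have := congrArg (PowerSeries.coeff 0) h
  rw [PowerSeries.coeff_derivative, map_zero, Nat.cast_zero, zero_add, zero_add, mul_one] at this
  exact hO.brkCoeff_one_ne_zero γ this

/-- The operator `ψ` commutes with the action of `Γ`. -/
theorem IsUnramifiedBase.psiR_substHom (hO : IsUnramifiedBase O p f) (γ : Oˣ) (b : k⟦X⟧) :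
    psiR k p f (substHom (brk p f k γ) (hO.constantCoeff_brk γ) b) =
      substHom (brk p f k γ) (hO.constantCoeff_brk γ) (psiR k p f b) := by
  have h0 : p ^ f ≠ 0 := pow_ne_zero _ hp.out.ne_zero
  refine mul_left_cancel₀ (hO.derivative_brk_ne_zero (k := k) γ) ?_
  rw [psiR_eq, psiR_eq, ← hO.psiZero_substHom_mul_derivative, ← psiZero_expand_mul h0, map_mul]
  congr 1
  linear_combination -substHom (brk p f k γ) (hO.constantCoeff_brk γ) b *
    hO.omega_mul_derivative (k := k) γ h0

end PsiBrk


/-! ### Laurent series -/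

section Laurent

variable {k : Type*} [Field k]

/-- The inclusion of `k⟦t⟧` in `k((t))`. -/
noncomputable abbrev toL : k⟦X⟧ →+* k⸨X⸩ := algebraMap k⟦X⟧ k⸨X⸩

/-- The monomial `t ^ n` in `k((t))`. -/
noncomputable def tpow (k : Type*) [Field k] (n : ℤ) : k⸨X⸩ := HahnSeries.single n (1 : k)

theorem tpow_add (m n : ℤ) : tpow k (m + n) = tpow k m * tpow k n := by
  rw [tpow, tpow, tpow, HahnSeries.single_mul_single, mul_one]

theorem tpow_zero : tpow k 0 = 1 := rfl

theorem tpow_mul_neg (n : ℤ) : tpow k n * tpow k (-n) = 1 := by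
  rw [← tpow_add, add_neg_cancel, tpow_zero]

theorem tpow_ne_zero (n : ℤ) : tpow k n ≠ 0 := left_ne_zero_of_mul_eq_one (tpow_mul_neg n)

theorem tpow_neg (n : ℤ) : tpow k (-n) = (tpow k n)⁻¹ :=
  eq_inv_of_mul_eq_one_right (tpow_mul_neg n)

theorem toL_apply (F : k⟦X⟧) : toL F = HahnSeries.ofPowerSeries ℤ k F := rfl

theorem toL_injective : Function.Injective (toL : k⟦X⟧ →+* k⸨X⸩) :=
  IsFractionRing.injective k⟦X⟧ k⸨X⸩

theorem toL_X : toL (PowerSeries.X : k⟦X⟧) = tpow k 1 := by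
  rw [toL_apply, HahnSeries.ofPowerSeries_X]; rfl

theorem toL_X_pow (n : ℕ) : toL (PowerSeries.X ^ n : k⟦X⟧) = tpow k n := by
  rw [toL_apply, HahnSeries.ofPowerSeries_X_pow]; rfl

theorem tpow_zpow (n : ℤ) : tpow k 1 ^ n = tpow k n := by
  exact (RatFunc.single_zpow n).symm

theorem tpow_pow (n : ℤ) (m : ℕ) : tpow k n ^ m = tpow k (m * n) := by
  rw [← tpow_zpow n, ← zpow_natCast, ← zpow_mul, mul_comm, tpow_zpow]

theorem toL_C (c : k) : toL (PowerSeries.C c) = HahnSeries.single 0 c := by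
  rw [toL_apply, HahnSeries.ofPowerSeries_C]; rfl

theorem coeff_toL (F : k⟦X⟧) (n : ℕ) : (toL F).coeff n = PowerSeries.coeff n F := by
  rw [toL_apply, LaurentSeries.coeff_coe_powerSeries]

theorem coeff_toL_neg (F : k⟦X⟧) {n : ℤ} (hn : n < 0) : (toL F).coeff n = 0 := by
  rw [toL_apply, PowerSeries.coeff_coe, if_pos hn]

theorem coeff_tpow_mul (n m : ℤ) (x : k⸨X⸩) : (tpow k n * x).coeff m = x.coeff (m - n) := by
  rw [tpow, HahnSeries.coeff_single_mul, one_mul]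

theorem coeff_toL_C_mul (c : k) (m : ℤ) (x : k⸨X⸩) :
    (toL (PowerSeries.C c) * x).coeff m = c * x.coeff m := by
  rw [toL_C, HahnSeries.coeff_single_zero_mul]

theorem coeff_tpow (n m : ℤ) : (tpow k n).coeff m = if m = n then 1 else 0 := by
  rw [tpow, HahnSeries.coeff_single]
  congr

theorem exists_eq_tpow_mul (x : k⸨X⸩) (n : ℤ) (h : ∀ m < n, x.coeff m = 0) :
    ∃ F : k⟦X⟧, x = tpow k n * toL F := by
  refine ⟨PowerSeries.mk fun i => x.coeff (n + i), ?_⟩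
  refine HahnSeries.ext (funext fun m => ?_)
  rw [coeff_tpow_mul]
  rcases lt_or_ge m n with h1 | h1
  · rw [h m h1, coeff_toL_neg _ (by omega)]
  · obtain ⟨i, hi⟩ := Int.eq_ofNat_of_zero_le (sub_nonneg.2 h1)
    rw [hi, coeff_toL, PowerSeries.coeff_mk]
    congr 1; omega

/-- Any large enough pole order is allowed, so that it can be chosen in common for several series or
of a prescribed form such as `q^s`. -/
theorem exists_eq_tpow_neg_mul (x : k⸨X⸩) : ∃ (N : ℕ), ∀ M : ℕ, N ≤ M →
    ∃ F : k⟦X⟧, x = tpow k (-M) * toL F := by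
  refine ⟨(-x.order).toNat, fun M hM => exists_eq_tpow_mul x _ fun m hm => ?_⟩
  refine HahnSeries.coeff_eq_zero_of_lt_order ?_
  omega

/-- The lattice `t ^ n k⟦t⟧` in `k((t))`. -/
noncomputable def lat (k : Type*) [Field k] (n : ℤ) : Submodule k⟦X⟧ k⸨X⸩ where
  carrier := {x | ∃ F : k⟦X⟧, x = tpow k n * toL F}
  zero_mem' := ⟨0, by rw [map_zero, mul_zero]⟩
  add_mem' := by
    rintro _ _ ⟨F, rfl⟩ ⟨G, rfl⟩
    exact ⟨F + G, by rw [map_add, mul_add]⟩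
  smul_mem' := by
    rintro c _ ⟨F, rfl⟩
    exact ⟨c * F, by rw [Algebra.smul_def, map_mul]; ring⟩

theorem mem_lat {n : ℤ} {x : k⸨X⸩} : x ∈ lat k n ↔ ∃ F : k⟦X⟧, x = tpow k n * toL F := Iff.rfl

theorem mem_lat_iff_coeff {n : ℤ} {x : k⸨X⸩} : x ∈ lat k n ↔ ∀ m < n, x.coeff m = 0 := by
  refine ⟨?_, exists_eq_tpow_mul x n⟩
  rintro ⟨F, rfl⟩ m hm
  rw [coeff_tpow_mul, coeff_toL_neg _ (by omega)]

theorem lat_anti {m n : ℤ} (h : m ≤ n) : lat k n ≤ lat k m := by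
  intro x hx
  rw [mem_lat_iff_coeff] at hx ⊢
  exact fun i hi => hx i (by omega)

theorem tpow_mem_lat {m n : ℤ} (h : n ≤ m) : tpow k m ∈ lat k n :=
  lat_anti h ⟨1, by rw [map_one, mul_one]⟩

theorem mul_mem_lat {m n : ℤ} {x y : k⸨X⸩} (hx : x ∈ lat k m) (hy : y ∈ lat k n) :
    x * y ∈ lat k (m + n) := by
  obtain ⟨F, rfl⟩ := hx
  obtain ⟨G, rfl⟩ := hy
  exact ⟨F * G, by rw [map_mul, tpow_add]; ring⟩

theorem mul_mem_lat' {m n l : ℤ} (h : l ≤ m + n) {x y : k⸨X⸩} (hx : x ∈ lat k m)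
    (hy : y ∈ lat k n) : x * y ∈ lat k l := lat_anti h (mul_mem_lat hx hy)

theorem toL_mem_lat (F : k⟦X⟧) : toL F ∈ lat k 0 := ⟨F, by rw [tpow_zero, one_mul]⟩

theorem toL_mul_mem_lat {n : ℤ} (F : k⟦X⟧) {x : k⸨X⸩} (hx : x ∈ lat k n) : toL F * x ∈ lat k n := by
  have := (lat k n).smul_mem F hx
  rwa [Algebra.smul_def] at this

theorem dvd_of_toL_mem_lat {n : ℕ} {F : k⟦X⟧} (h : toL F ∈ lat k n) : PowerSeries.X ^ n ∣ F := by
  obtain ⟨G, hG⟩ := h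
  exact ⟨G, toL_injective (by rw [map_mul, toL_X_pow, hG])⟩

/-! ### Substitutions in Laurent series -/

theorem substHom_injective {g : k⟦X⟧} (hg : PowerSeries.constantCoeff g = 0) (hg' : g ≠ 0) :
    Function.Injective (substHom g hg) := by
  rw [injective_iff_map_eq_zero]
  intro F hF
  by_contra hF0
  obtain ⟨v, hv⟩ := PowerSeries.isUnit_divided_by_X_pow_order hF0
  rw [← PowerSeries.X_pow_order_mul_divXPowOrder (f := F), map_mul, map_pow, substHom_X, ← hv] at hF
  refine (mul_ne_zero (pow_ne_zero _ hg') (v.isUnit.map (substHom g hg)).ne_zero) hF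

/-- The substitution `F(t) ↦ F(g(t))` on `k((t))` as a ring homomorphism. -/
noncomputable def laurentHom (g : k⟦X⟧) (hg : PowerSeries.constantCoeff g = 0) (hg' : g ≠ 0) :
    k⸨X⸩ →+* k⸨X⸩ :=
  IsFractionRing.lift (g := (toL : k⟦X⟧ →+* k⸨X⸩).comp (substHom g hg))
    (toL_injective.comp (substHom_injective hg hg'))

theorem laurentHom_toL {g : k⟦X⟧} (hg : PowerSeries.constantCoeff g = 0) (hg' : g ≠ 0) (F : k⟦X⟧) :
    laurentHom g hg hg' (toL F) = toL (substHom g hg F) :=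
  IsFractionRing.lift_algebraMap (toL_injective.comp (substHom_injective hg hg')) F

theorem laurentHom_tpow {g : k⟦X⟧} (hg : PowerSeries.constantCoeff g = 0) (hg' : g ≠ 0) (n : ℤ) :
    laurentHom g hg hg' (tpow k n) = toL g ^ n := by
  rw [← tpow_zpow, map_zpow₀, ← toL_X, laurentHom_toL, substHom_X]

theorem laurentSubst_eq {g : k⟦X⟧} (hg : PowerSeries.constantCoeff g = 0) (hg' : g ≠ 0) (F : k⸨X⸩) :
    laurentSubst g F = laurentHom g hg hg' F := by
  conv_rhs => rw [← LaurentSeries.single_order_mul_powerSeriesPart F]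
  rw [map_mul]
  change _ = laurentHom g hg hg' (tpow k _) * laurentHom g hg hg' (toL _)
  rw [laurentHom_tpow, laurentHom_toL, substHom_apply, laurentSubst]

theorem laurentHom_ext {τ τ' : k⸨X⸩ →+* k⸨X⸩} (h : ∀ F, τ (toL F) = τ' (toL F)) : τ = τ' :=
  IsLocalization.ringHom_ext (nonZeroDivisors k⟦X⟧) (RingHom.ext h)

/-- The endomorphism `φ` of `k((t))`. -/
noncomputable def phiL (k : Type*) [Field k] (p f : ℕ) [hp : Fact p.Prime] : k⸨X⸩ →+* k⸨X⸩ :=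
  laurentHom (PowerSeries.X ^ (p ^ f)) (constantCoeff_X_pow (pow_ne_zero f hp.out.ne_zero))
    (pow_ne_zero _ PowerSeries.X_ne_zero)

section PhiL

variable {p f : ℕ} [hp : Fact p.Prime]

theorem phiR_apply (F : k⟦X⟧) : phiR k p f F =
    PowerSeries.expand (p ^ f) (pow_ne_zero f hp.out.ne_zero) F := rfl

theorem phiR_X_pow (n : ℕ) :
    phiR k p f (PowerSeries.X ^ n) = PowerSeries.X ^ (p ^ f * n) := by
  rw [phiR_apply, map_pow, PowerSeries.expand_X, pow_mul]

theorem phiR_C (c : k) : phiR k p f (PowerSeries.C c) = PowerSeries.C c :=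
  PowerSeries.expand_C _ _ c

theorem phiL_toL (F : k⟦X⟧) : phiL k p f (toL F) = toL (phiR k p f F) := by
  rw [phiL, laurentHom_toL, substHom_X_pow]; rfl

theorem phiL_toL_C (c : k) : phiL k p f (toL (PowerSeries.C c)) = toL (PowerSeries.C c) := by
  rw [phiL_toL, phiR_C]

theorem phiL_tpow (n : ℤ) : phiL k p f (tpow k n) = tpow k ((p ^ f : ℕ) * n) := by
  rw [phiL, laurentHom_tpow, toL_X_pow, ← tpow_zpow ((p ^ f : ℕ) : ℤ), ← zpow_mul, tpow_zpow]

theorem laurentSubst_phi (F : k⸨X⸩) : laurentSubst (PowerSeries.X ^ (p ^ f)) F = phiL k p f F :=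
  laurentSubst_eq _ _ F

theorem phiL_mem_lat {n : ℤ} {x : k⸨X⸩} (hx : x ∈ lat k n) :
    phiL k p f x ∈ lat k ((p ^ f : ℕ) * n) := by
  obtain ⟨F, rfl⟩ := hx
  exact ⟨phiR k p f F, by rw [map_mul, phiL_tpow, phiL_toL]⟩

theorem coeff_phiL_mul (x : k⸨X⸩) (n : ℤ) :
    (phiL k p f x).coeff ((p ^ f : ℕ) * n) = x.coeff n := by
  have h0 : p ^ f ≠ 0 := pow_ne_zero f hp.out.ne_zero
  obtain ⟨N, hN⟩ := exists_eq_tpow_neg_mul x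
  obtain ⟨F, rfl⟩ := hN (max N n.natAbs) (le_max_left _ _)
  set M := max N n.natAbs
  have hM : n.natAbs ≤ M := le_max_right _ _
  obtain ⟨i, hi⟩ := Int.eq_ofNat_of_zero_le (by omega : 0 ≤ n + M)
  rw [map_mul, phiL_tpow, phiL_toL, coeff_tpow_mul, coeff_tpow_mul, ← mul_sub, sub_neg_eq_add, hi,
    ← Nat.cast_mul, coeff_toL, coeff_toL, phiR_apply, PowerSeries.coeff_expand_mul]

theorem coeff_phiL_of_not_dvd (x : k⸨X⸩) {n : ℤ} (hn : ¬ ((p ^ f : ℕ) : ℤ) ∣ n) :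
    (phiL k p f x).coeff n = 0 := by
  obtain ⟨N, hN⟩ := exists_eq_tpow_neg_mul x
  obtain ⟨F, rfl⟩ := hN _ le_rfl
  rw [map_mul, phiL_tpow, phiL_toL, coeff_tpow_mul, phiR_apply]
  rcases lt_or_ge (n - ((p ^ f : ℕ) : ℤ) * -N) 0 with h | h
  · rw [coeff_toL_neg _ h]
  · obtain ⟨i, hi⟩ := Int.eq_ofNat_of_zero_le h
    rw [hi, coeff_toL, PowerSeries.coeff_expand_of_not_dvd]
    intro hd
    refine hn ?_
    have : n = i + ((p ^ f : ℕ) : ℤ) * -N := by omega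
    rw [this]
    exact dvd_add (Int.natCast_dvd_natCast.2 hd) (dvd_mul_right _ _)

end PhiL

end Laurent


/-! ### The free `k⟦t⟧[φ]`-module mapped to `k((t))²`. -/

section FreeModule

variable {k : Type*} [Field k] {p f : ℕ} [hp : Fact p.Prime]

theorem phiM_single (i : Fin 2) (s : ℕ) (F : k⟦X⟧) :
    phiM k p f (Finsupp.single (i, s) F) = Finsupp.single (i, s + 1) (phiR k p f F) := by
  change Finsupp.mapDomain _ (Finsupp.mapRange _ _ _) = _
  rw [Finsupp.mapRange_single, Finsupp.mapDomain_single]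
  rfl

theorem phiM_iterate_single (n : ℕ) (i : Fin 2) (s : ℕ) (F : k⟦X⟧) :
    (phiM k p f)^[n] (Finsupp.single (i, s) F) =
      Finsupp.single (i, s + n) ((phiR k p f)^[n] F) := by
  induction n with
  | zero => rfl
  | succ n ih => rw [Function.iterate_succ_apply', ih, phiM_single, Function.iterate_succ_apply',
      add_assoc]

theorem phiR_iterate_X_pow (n m : ℕ) :
    (phiR k p f)^[n] (PowerSeries.X ^ m) = PowerSeries.X ^ ((p ^ f) ^ n * m) := by
  induction n with
  | zero => simp
  | succ n ih => rw [Function.iterate_succ_apply', ih, phiR_X_pow, pow_succ', mul_assoc]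

theorem phiR_iterate_C (n : ℕ) (c : k) :
    (phiR k p f)^[n] (PowerSeries.C c) = PowerSeries.C c := by
  induction n with
  | zero => rfl
  | succ n ih => rw [Function.iterate_succ_apply', ih, phiR_C]

/-- The semilinear endomorphism `φ` of `k((t))²` with matrix `(α, 0; -αβB, β)`. -/
noncomputable def phiV (p f : ℕ) [Fact p.Prime] (α β : k) (B : k⸨X⸩) :
    k⸨X⸩ × k⸨X⸩ →ₛₗ[phiR k p f] k⸨X⸩ × k⸨X⸩ where
  toFun v := (toL (PowerSeries.C α) * phiL k p f v.1, toL (PowerSeries.C β) * phiL k p f v.2 -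
    toL (PowerSeries.C (α * β)) * B * phiL k p f v.1)
  map_add' v w := by
    simp only [Prod.fst_add, Prod.snd_add, map_add, Prod.mk_add_mk]
    refine Prod.ext ?_ ?_ <;> dsimp only <;> ring
  map_smul' F v := by
    have h : ∀ x : k⸨X⸩, phiL k p f (F • x) = toL (phiR k p f F) * phiL k p f x := fun x => by
      rw [Algebra.smul_def, map_mul, phiL_toL]
    rw [Prod.smul_fst, Prod.smul_snd, h, h, Prod.smul_mk, Algebra.smul_def, Algebra.smul_def]
    refine Prod.ext ?_ ?_ <;> dsimp only <;> ring

theorem phiV_apply (α β : k) (B : k⸨X⸩) (v : k⸨X⸩ × k⸨X⸩) :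
    phiV p f α β B v = (toL (PowerSeries.C α) * phiL k p f v.1,
      toL (PowerSeries.C β) * phiL k p f v.2 -
      toL (PowerSeries.C (α * β)) * B * phiL k p f v.1) := rfl

theorem phiV_iterate_snd (α β : k) (B w : k⸨X⸩) (s : ℕ) :
    (phiV p f α β B)^[s] (0, w) = (0, toL (PowerSeries.C (β ^ s)) * (phiL k p f)^[s] w) := by
  induction s with
  | zero => simp
  | succ s ih =>
    rw [Function.iterate_succ_apply', ih, Function.iterate_succ_apply', phiV_apply]
    simp only [map_zero, mul_zero, sub_zero, map_mul, phiL_toL_C, pow_succ']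
    refine Prod.ext rfl ?_
    dsimp only; ring

theorem phiL_iterate_tpow (s : ℕ) (n : ℤ) :
    (phiL k p f)^[s] (tpow k n) = tpow k (((p ^ f) ^ s : ℕ) * n) := by
  induction s with
  | zero => simp
  | succ s ih =>
    rw [Function.iterate_succ_apply', ih, phiL_tpow, pow_succ', Nat.cast_mul, mul_assoc]

theorem phiV_iterate_fst (α β : k) (B w : k⸨X⸩) (s : ℕ) :
    ((phiV p f α β B)^[s] (w, 0)).1 = toL (PowerSeries.C (α ^ s)) * (phiL k p f)^[s] w := by
  induction s with
  | zero => simp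
  | succ s ih =>
    rw [Function.iterate_succ_apply', Function.iterate_succ_apply', phiV_apply]
    dsimp only
    rw [ih, map_mul, phiL_toL_C, pow_succ', map_mul, map_mul, mul_assoc]

/-- The images of `x = t⁻¹ e_x` and `y = t⁻¹ e_y`. -/
noncomputable def genV (k : Type*) [Field k] : Fin 2 → k⸨X⸩ × k⸨X⸩ :=
  ![(tpow k (-1), 0), (0, tpow k (-1))]

/-- The `k⟦t⟧[φ]`-linear map from the free module to `k((t))²`. -/
noncomputable def freeToV (p f : ℕ) [Fact p.Prime] (α β : k) (B : k⸨X⸩) :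
    FreeM k →ₗ[k⟦X⟧] k⸨X⸩ × k⸨X⸩ :=
  Finsupp.linearCombination k⟦X⟧ fun i : Fin 2 × ℕ => (phiV p f α β B)^[i.2] (genV k i.1)

theorem freeToV_single (α β : k) (B : k⸨X⸩) (i : Fin 2) (s : ℕ) (F : k⟦X⟧) :
    freeToV p f α β B (Finsupp.single (i, s) F) = F • (phiV p f α β B)^[s] (genV k i) :=
  Finsupp.linearCombination_single _ _ _

theorem freeToV_phiM (α β : k) (B : k⸨X⸩) (m : FreeM k) :
    freeToV p f α β B (phiM k p f m) = phiV p f α β B (freeToV p f α β B m) := by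
  induction m using Finsupp.induction_linear with
  | zero => rw [map_zero, map_zero, map_zero]
  | add m m' h h' => rw [map_add, map_add, map_add, map_add, h, h']
  | single i F =>
    obtain ⟨i, s⟩ := i
    rw [phiM_single, freeToV_single, freeToV_single, Function.iterate_succ_apply', map_smulₛₗ]

theorem freeToV_phiM_iterate (α β : k) (B : k⸨X⸩) (n : ℕ) (m : FreeM k) :
    freeToV p f α β B ((phiM k p f)^[n] m) = (phiV p f α β B)^[n] (freeToV p f α β B m) := by
  induction n with
  | zero => rfl
  | succ n ih => rw [Function.iterate_succ_apply', freeToV_phiM, ih, Function.iterate_succ_apply']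

theorem freeToV_single_one (α β : k) (B : k⸨X⸩) (s : ℕ) (F : k⟦X⟧) :
    freeToV p f α β B (Finsupp.single (1, s) F) =
      (0, toL F * (toL (PowerSeries.C (β ^ s)) * tpow k (-((p ^ f) ^ s : ℕ)))) := by
  rw [freeToV_single]
  change F • (phiV p f α β B)^[s] (0, tpow k (-1)) = _
  rw [phiV_iterate_snd, phiL_iterate_tpow, mul_neg_one, Prod.smul_mk, smul_zero, Algebra.smul_def]

theorem freeToV_single_zero_fst (α β : k) (B : k⸨X⸩) (s : ℕ) (F : k⟦X⟧) :
    (freeToV p f α β B (Finsupp.single (0, s) F)).1 =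
      toL F * (toL (PowerSeries.C (α ^ s)) * tpow k (-((p ^ f) ^ s : ℕ))) := by
  rw [freeToV_single]
  change (F • (phiV p f α β B)^[s] (tpow k (-1), 0)).1 = _
  rw [Prod.smul_fst, phiV_iterate_fst, phiL_iterate_tpow, mul_neg_one, Algebra.smul_def]

/-- The images of `φ^s y` and, in the first coordinate, of `φ^s x` are constants times `t^(-q^s)`,
so poles of every order are reached. -/
theorem freeToV_surjective {α β : k} (hα : α ≠ 0) (hβ : β ≠ 0) (hf : 0 < f) (B : k⸨X⸩) :
    Function.Surjective (freeToV p f α β B) := by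
  have hq := two_le_q (p := p) hf
  have key : ∀ x : k⸨X⸩, ∃ (s : ℕ) (F : k⟦X⟧), x = toL F * tpow k (-((p ^ f) ^ s : ℕ)) := by
    intro x
    obtain ⟨N, hN⟩ := exists_eq_tpow_neg_mul x
    obtain ⟨F, hF⟩ := hN ((p ^ f) ^ N) (Nat.lt_pow_self (by omega)).le
    exact ⟨N, F, by rw [hF, mul_comm]⟩
  have hCC : ∀ (c : k) (n : ℕ), c ≠ 0 →
      toL (PowerSeries.C (c⁻¹ ^ n)) * toL (PowerSeries.C (c ^ n)) = (1 : k⸨X⸩) := by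
    intro c n hc
    rw [← map_mul, ← map_mul, ← mul_pow, inv_mul_cancel₀ hc, one_pow, map_one, map_one]
  have hy : ∀ y : k⸨X⸩, ∃ m, freeToV p f α β B m = (0, y) := by
    intro y
    obtain ⟨s, F, rfl⟩ := key y
    refine ⟨Finsupp.single (1, s) (F * PowerSeries.C (β⁻¹ ^ s)), ?_⟩
    rw [freeToV_single_one, map_mul]
    refine Prod.ext rfl ?_
    dsimp only
    linear_combination toL F * tpow k (-((p ^ f) ^ s : ℕ)) * hCC β s hβ
  rintro ⟨x, y⟩
  obtain ⟨s, F, rfl⟩ := key x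
  set m := Finsupp.single ((0 : Fin 2), s) (F * PowerSeries.C (α⁻¹ ^ s))
  have h1 : (freeToV p f α β B m).1 = toL F * tpow k (-((p ^ f) ^ s : ℕ)) := by
    rw [freeToV_single_zero_fst, map_mul]
    linear_combination toL F * tpow k (-((p ^ f) ^ s : ℕ)) * hCC α s hα
  obtain ⟨m', hm'⟩ := hy (y - (freeToV p f α β B m).2)
  refine ⟨m + m', ?_⟩
  rw [map_add, hm']
  refine Prod.ext ?_ ?_
  · rw [Prod.fst_add, h1, add_zero]
  · rw [Prod.snd_add, add_sub_cancel]

/-- The lattice `t ^ (n_x - 1) k⟦t⟧ e_x + t ^ (n_y - 1) k⟦t⟧ e_y`. -/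
noncomputable def latV (k : Type*) [Field k] (nx ny : ℕ) : Submodule k⟦X⟧ (k⸨X⸩ × k⸨X⸩) :=
  (lat k ((nx : ℤ) - 1)).prod (lat k ((ny : ℤ) - 1))

theorem mem_latV {nx ny : ℕ} {v : k⸨X⸩ × k⸨X⸩} :
    v ∈ latV k nx ny ↔ v.1 ∈ lat k ((nx : ℤ) - 1) ∧ v.2 ∈ lat k ((ny : ℤ) - 1) := Submodule.mem_prod

theorem phiL_mem_lat_sub_one {n : ℕ} (hn : 0 < n) (hf : 0 < f) {x : k⸨X⸩} (hx : x ∈ lat k ((n : ℤ) - 1)) :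
    phiL k p f x ∈ lat k ((n : ℤ) - 1) := by
  refine lat_anti ?_ (phiL_mem_lat (p := p) (f := f) hx)
  have hq := two_le_q (p := p) hf
  have : (1 : ℤ) ≤ (p ^ f : ℕ) := by exact_mod_cast (by omega : 1 ≤ p ^ f)
  have h2 : (0 : ℤ) ≤ (n : ℤ) - 1 := by omega
  nlinarith

/-- On the diagonal, `q(n-1) ≥ n-1` for `n ≥ 1`; the assumption on `B` deals with the remaining
entry. -/
theorem phiV_mem_latV {α β : k} {B : k⸨X⸩} {nx ny : ℕ} (hx : 0 < nx) (hy : 0 < ny) (hf : 0 < f)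
    (hB : B ∈ lat k ((ny : ℤ) - 1 - (p ^ f : ℕ) * ((nx : ℤ) - 1)))
    {v : k⸨X⸩ × k⸨X⸩} (hv : v ∈ latV k nx ny) : phiV p f α β B v ∈ latV k nx ny := by
  rw [mem_latV] at hv ⊢
  rw [phiV_apply]
  refine ⟨toL_mul_mem_lat _ (phiL_mem_lat_sub_one hx hf hv.1), Submodule.sub_mem _
    (toL_mul_mem_lat _ (phiL_mem_lat_sub_one hy hf hv.2)) ?_⟩
  rw [mul_assoc]
  exact toL_mul_mem_lat _ (mul_mem_lat' (by omega) hB (phiL_mem_lat hv.1))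

theorem phiSpan_le {S : Set (FreeM k)} {α β : k} {B : k⸨X⸩} {L : Submodule k⟦X⟧ (k⸨X⸩ × k⸨X⸩)}
    (hL : ∀ v ∈ L, phiV p f α β B v ∈ L) (hS : ∀ m ∈ S, freeToV p f α β B m ∈ L) :
    phiSpan k p f S ≤ L.comap (freeToV p f α β B) := by
  refine Submodule.span_le.2 ?_
  rintro _ ⟨n, m, hm, rfl⟩
  rw [SetLike.mem_coe, Submodule.mem_comap]
  induction n with
  | zero => exact hS m hm
  | succ n ih =>
    rw [Function.iterate_succ_apply', freeToV_phiM]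
    exact hL _ ih

end FreeModule


/-! ### `Δ` as the quotient of `k((t))²` by a lattice. -/

section DeltaModel

variable {k : Type*} [Field k] (p f : ℕ) [hp : Fact p.Prime]
  (P : Params k) (C : Scalars k p f P.ell) (A : Aux)

/-- The off-diagonal entry of `φ`. -/
noncomputable def btilde : k⸨X⸩ :=
  tpow k (1 - ((p ^ f) ^ A.N : ℕ)) * toL (seriesB p f P C A)

/-- The map from the free module to `k((t))²` attached to the parameters. -/
noncomputable abbrev toV : FreeM k →ₗ[k⟦X⟧] k⸨X⸩ × k⸨X⸩ :=
  freeToV p f (P.alpha : k) (P.beta : k) (btilde p f P C A)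

/-- The endomorphism `φ` of `k((t))²` attached to the parameters. -/
noncomputable abbrev phiVP : k⸨X⸩ × k⸨X⸩ →ₛₗ[phiR k p f] k⸨X⸩ × k⸨X⸩ :=
  phiV p f (P.alpha : k) (P.beta : k) (btilde p f P C A)

/-- The condition that `φ` preserves the lattice. -/
structure LatticeStable : Prop where
  f_pos : 0 < f
  nx_pos : 0 < A.nx
  ny_pos : 0 < A.ny
  btilde_mem : btilde p f P C A ∈ lat k ((A.ny : ℤ) - 1 - (p ^ f : ℕ) * ((A.nx : ℤ) - 1))

variable {p f P C A}

theorem toL_C_mul_toL_C (a b : k) :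
    toL (PowerSeries.C a) * toL (PowerSeries.C b) = toL (k := k) (PowerSeries.C (a * b)) := by
  simp

theorem toV_single_one (s : ℕ) (F : k⟦X⟧) :
    toV p f P C A (Finsupp.single (1, s) F) =
      (0, toL F * (toL (PowerSeries.C ((P.beta : k) ^ s)) * tpow k (-((p ^ f) ^ s : ℕ)))) :=
  freeToV_single_one _ _ _ _ _

theorem toV_single_zero (F : k⟦X⟧) :
    toV p f P C A (Finsupp.single (0, 0) F) = (toL F * tpow k (-1), 0) := by
  rw [toV, freeToV_single, Function.iterate_zero, id, genV, Matrix.cons_val_zero, Prod.smul_mk,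
    smul_zero, Algebra.smul_def]

/-- The factor `β^(1-N)` in `R` compensates the `β^N` produced by `φ^N y`, and the factor
`t^(1-q^N)` in `btilde` its pole; this is how the matrix of `φ` was chosen. -/
theorem toV_elemR (hf : 0 < f) : toV p f P C A (elemR p f P C A) = 0 := by
  have hq := two_le_q (p := p) hf
  rw [elemR, map_add, map_sub, toV_single_one, toV_single_zero]
  have h1 : toV p f P C A (Finsupp.single (0, 1) (PowerSeries.X ^ (p ^ f - 1))) =
      toL (PowerSeries.X ^ (p ^ f - 1) : k⟦X⟧) • phiVP p f P C A (tpow k (-1), 0) := by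
    rw [toV, freeToV_single]
    exact (algebraMap_smul k⸨X⸩ _ _).symm
  have e1 : tpow k ((p ^ f - 1 : ℕ) : ℤ) * tpow k ((p ^ f : ℕ) * (-1)) = tpow k (-1) := by
    rw [← tpow_add]; congr 1; push_cast [Nat.cast_sub (by omega : 1 ≤ p ^ f)]; ring
  have e2 : tpow k (1 - ((p ^ f) ^ A.N : ℕ)) * tpow k (-1) = tpow k (-((p ^ f) ^ A.N : ℕ)) := by
    rw [← tpow_add]; congr 1; ring
  have e3 : toL (PowerSeries.C ((P.alpha : k) * (P.beta : k) ^ (1 - (A.N : ℤ)))) *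
      toL (PowerSeries.C ((P.beta : k) ^ A.N)) = toL (PowerSeries.C ((P.alpha : k) * P.beta)) := by
    rw [toL_C_mul_toL_C, mul_assoc, ← zpow_natCast, ← zpow_add₀ P.beta.ne_zero, sub_add_cancel,
      zpow_one]
  rw [h1, phiV_apply, toL_X_pow]
  simp only [map_zero, mul_zero, zero_sub, phiL_tpow, Prod.smul_mk, smul_eq_mul]
  refine Prod.ext ?_ ?_
  · simp only [Prod.fst_add, Prod.fst_sub, Prod.fst_zero]
    linear_combination toL (PowerSeries.C (P.alpha : k)) * e1
  · simp only [Prod.snd_add, Prod.snd_sub, Prod.snd_zero, map_mul (toL (k := k)) (PowerSeries.C _)]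
    rw [btilde]
    linear_combination -toL (PowerSeries.C ((P.alpha : k) * P.beta)) * tpow k (1 - ((p ^ f) ^ A.N : ℕ)) *
      toL (seriesB p f P C A) * e1 + tpow k (-((p ^ f) ^ A.N : ℕ)) * toL (seriesB p f P C A) * e3 -
      toL (PowerSeries.C ((P.alpha : k) * P.beta)) * toL (seriesB p f P C A) * e2

theorem toV_nabla_y (hf : 0 < f) : toV p f P C A (Finsupp.single (1, 1) (PowerSeries.X ^ (p ^ f - 1))
      - Finsupp.single (1, 0) (PowerSeries.C (P.beta : k))) = 0 := by
  have hq := two_le_q (p := p) hf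
  rw [map_sub, toV_single_one, toV_single_one, toL_X_pow]
  have e1 : tpow k ((p ^ f - 1 : ℕ) : ℤ) * tpow k (-((p ^ f) ^ 1 : ℕ)) = tpow k (-((p ^ f) ^ 0 : ℕ)) := by
    rw [← tpow_add]; congr 1; push_cast [Nat.cast_sub (by omega : 1 ≤ p ^ f)]; ring
  refine Prod.ext (by simp) ?_
  simp only [Prod.snd_sub, Prod.snd_zero, pow_one, pow_zero, map_one, one_mul]
  rw [pow_one, pow_zero] at e1
  linear_combination toL (PowerSeries.C (P.beta : k)) * e1

theorem LatticeStable.nabla_le (h : LatticeStable p f P C A) :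
    phiSpan k p f (nablaGens p f P C A) ≤ (latV k A.nx A.ny).comap (toV p f P C A) := by
  refine phiSpan_le (fun v hv => phiV_mem_latV h.nx_pos h.ny_pos h.f_pos h.btilde_mem hv) ?_
  intro m hm
  rw [nablaGens, Set.mem_insert_iff, Set.mem_insert_iff, Set.mem_insert_iff,
    Set.mem_singleton_iff] at hm
  rcases hm with rfl | rfl | rfl | rfl
  · have := toV_single_one (p := p) (f := f) (P := P) (C := C) (A := A) 0 (PowerSeries.X ^ A.ny)
    rw [toV] at this
    rw [this, mem_latV]
    refine ⟨Submodule.zero_mem _, ?_⟩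
    dsimp only
    rw [pow_zero, pow_zero, map_one, map_one, one_mul, toL_X_pow, ← tpow_add]
    exact tpow_mem_lat (by simp [sub_eq_add_neg])
  · have := toV_nabla_y (P := P) (C := C) (A := A) (p := p) h.f_pos
    rw [toV] at this
    rw [this]
    exact Submodule.zero_mem _
  · have := toV_single_zero (p := p) (f := f) (P := P) (C := C) (A := A) (PowerSeries.X ^ A.nx)
    rw [toV] at this
    rw [this, mem_latV]
    refine ⟨?_, Submodule.zero_mem _⟩
    dsimp only
    rw [toL_X_pow, ← tpow_add]
    exact tpow_mem_lat (by simp [sub_eq_add_neg])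
  · have := toV_elemR (P := P) (C := C) (A := A) (p := p) h.f_pos
    rw [toV] at this
    rw [this]
    exact Submodule.zero_mem _

variable (p f P C A) in
/-- The class of `φ^s x` (for `i = 0`) or `φ^s y` (for `i = 1`). -/
noncomputable def genD (i : Fin 2) (s : ℕ) : Delta p f P C A :=
  deltaMk p f P C A (Finsupp.single (i, s) 1)

theorem deltaMk_add (m m' : FreeM k) : deltaMk p f P C A (m + m') =
    deltaMk p f P C A m + deltaMk p f P C A m' := rfl

theorem deltaMk_sub (m m' : FreeM k) : deltaMk p f P C A (m - m') =
    deltaMk p f P C A m - deltaMk p f P C A m' := rfl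

theorem deltaMk_smul (F : k⟦X⟧) (m : FreeM k) : deltaMk p f P C A (F • m) =
    F • deltaMk p f P C A m := rfl

theorem deltaMk_eq_zero {m : FreeM k} : deltaMk p f P C A m = 0 ↔
    m ∈ phiSpan k p f (nablaGens p f P C A) := Submodule.Quotient.mk_eq_zero _

theorem deltaMk_single (i : Fin 2) (s : ℕ) (F : k⟦X⟧) :
    deltaMk p f P C A (Finsupp.single (i, s) F) = F • genD p f P C A i s := by
  rw [genD, ← deltaMk_smul, Finsupp.smul_single, smul_eq_mul, mul_one]

theorem deltaMk_surjective : Function.Surjective (deltaMk p f P C A) :=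
  Submodule.Quotient.mk_surjective _

theorem deltaPhi_deltaMk (m : FreeM k) :
    deltaPhi p f P C A (deltaMk p f P C A m) = deltaMk p f P C A (phiM k p f m) := rfl

theorem deltaMk_iterate_eq_zero {m : FreeM k} (hm : m ∈ nablaGens p f P C A) (s : ℕ) :
    deltaMk p f P C A ((phiM k p f)^[s] m) = 0 :=
  deltaMk_eq_zero.2 (Submodule.subset_span ⟨s, m, hm, rfl⟩)

theorem genD_one_rel (s : ℕ) : genD p f P C A 1 s =
    (PowerSeries.C ((P.beta : k)⁻¹) * PowerSeries.X ^ ((p ^ f) ^ s * (p ^ f - 1))) •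
      genD p f P C A 1 (s + 1) := by
  have h := deltaMk_iterate_eq_zero (p := p) (f := f) (P := P) (C := C) (A := A)
    (m := Finsupp.single (1, 1) (PowerSeries.X ^ (p ^ f - 1))
      - Finsupp.single (1, 0) (PowerSeries.C (P.beta : k))) (by simp [nablaGens]) s
  rw [iterate_map_sub, phiM_iterate_single, phiM_iterate_single, phiR_iterate_X_pow, phiR_iterate_C,
    deltaMk_sub, deltaMk_single, deltaMk_single, sub_eq_zero, zero_add, add_comm 1] at h
  rw [mul_smul, h, smul_smul, ← map_mul, inv_mul_cancel₀ P.beta.ne_zero, map_one, one_smul]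

/-- Solving `φ^s R = 0` for `φ^s x`. The coefficient of the `y`-term is left unspecified, because
the `y`-part is controlled separately by its image in `k((t))²`. -/
theorem genD_zero_rel (s : ℕ) : ∃ G : k⟦X⟧, genD p f P C A 0 s =
    (PowerSeries.C ((P.alpha : k)⁻¹) * PowerSeries.X ^ ((p ^ f) ^ s * (p ^ f - 1))) •
      genD p f P C A 0 (s + 1) + G • genD p f P C A 1 (s + A.N) := by
  have h := deltaMk_iterate_eq_zero (p := p) (f := f) (P := P) (C := C) (A := A)
    (m := elemR p f P C A) (by simp [nablaGens]) s
  rw [elemR, iterate_map_add, iterate_map_sub, phiM_iterate_single, phiM_iterate_single,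
    phiM_iterate_single, phiR_iterate_X_pow, phiR_iterate_C, deltaMk_add, deltaMk_sub,
    deltaMk_single, deltaMk_single, deltaMk_single, zero_add, add_comm 1, add_comm A.N] at h
  generalize (phiR k p f)^[s] _ = G at h
  refine ⟨PowerSeries.C ((P.alpha : k)⁻¹) * G, ?_⟩
  rw [mul_smul, mul_smul, ← smul_add]
  rw [sub_add_eq_add_sub, sub_eq_zero] at h
  rw [h, smul_smul, ← map_mul, inv_mul_cancel₀ P.alpha.ne_zero, map_one, one_smul]

theorem sub_pow_succ_eq (q s d : ℕ) (hq : 0 < q) :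
    q ^ (s + (d + 1)) - q ^ s = (q ^ (s + d) - q ^ s) + q ^ (s + d) * (q - 1) := by
  have h1 : q ^ s ≤ q ^ (s + d) := Nat.pow_le_pow_right hq (by omega)
  have h2 : q ^ (s + (d + 1)) = q ^ (s + d) * (q - 1) + q ^ (s + d) := by
    rw [← Nat.mul_succ, Nat.succ_eq_add_one, Nat.sub_add_cancel hq, ← pow_succ, add_assoc]
  omega

theorem genD_one_eq (s d : ℕ) : genD p f P C A 1 s =
    (PowerSeries.C ((P.beta : k)⁻¹ ^ d) * PowerSeries.X ^ ((p ^ f) ^ (s + d) - (p ^ f) ^ s)) •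
      genD p f P C A 1 (s + d) := by
  induction d with
  | zero => simp
  | succ d ih =>
    rw [ih, genD_one_rel, smul_smul, sub_pow_succ_eq _ _ _ (pow_pos hp.out.pos f), pow_add, pow_succ,
      map_mul]
    congr 1; ring

theorem genD_zero_eq (s d : ℕ) : ∃ G : k⟦X⟧, genD p f P C A 0 s =
    (PowerSeries.C ((P.alpha : k)⁻¹ ^ d) * PowerSeries.X ^ ((p ^ f) ^ (s + d) - (p ^ f) ^ s)) •
      genD p f P C A 0 (s + d) + G • genD p f P C A 1 (s + d + A.N) := by
  induction d with
  | zero => exact ⟨0, by simp⟩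
  | succ d ih =>
    obtain ⟨G, hG⟩ := ih
    obtain ⟨H, hH⟩ := genD_zero_rel (p := p) (f := f) (P := P) (C := C) (A := A) (s + d)
    have h1 := genD_one_rel (p := p) (f := f) (P := P) (C := C) (A := A) (s + d + A.N)
    rw [add_right_comm (s + d)] at h1
    rw [hG, hH, h1, smul_add, smul_smul, smul_smul, smul_smul, smul_smul, add_assoc, ← add_smul]
    refine ⟨PowerSeries.C ((P.alpha : k)⁻¹ ^ d) * PowerSeries.X ^ ((p ^ f) ^ (s + d) - (p ^ f) ^ s) * H *
      (PowerSeries.C ((P.beta : k)⁻¹) * PowerSeries.X ^ ((p ^ f) ^ (s + d + A.N) * (p ^ f - 1))) +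
      G * (PowerSeries.C ((P.beta : k)⁻¹) * PowerSeries.X ^ ((p ^ f) ^ (s + d + A.N) * (p ^ f - 1))), ?_⟩
    congr 1
    rw [sub_pow_succ_eq _ _ _ (pow_pos hp.out.pos f), pow_add (PowerSeries.X : k⟦X⟧), pow_succ, map_mul]
    congr 1
    ring

/-- `Δ` is an increasing union of submodules with two generators, as the relations express every
`φ^s x`, `φ^s y` through higher ones. The offset `A.N` is the one occurring in `R`. -/
theorem exists_eq_smul_genD (z : Delta p f P C A) : ∃ S₀ : ℕ, ∀ S, S₀ ≤ S → ∃ F G : k⟦X⟧,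
    z = F • genD p f P C A 0 S + G • genD p f P C A 1 (S + A.N) := by
  obtain ⟨m, rfl⟩ := deltaMk_surjective z
  induction m using Finsupp.induction_linear with
  | zero => exact ⟨0, fun S _ => ⟨0, 0, by rw [zero_smul, zero_smul, add_zero]; rfl⟩⟩
  | add m m' h h' =>
    obtain ⟨S₁, h₁⟩ := h
    obtain ⟨S₂, h₂⟩ := h'
    refine ⟨max S₁ S₂, fun S hS => ?_⟩
    obtain ⟨F, G, e⟩ := h₁ S (le_trans (le_max_left _ _) hS)
    obtain ⟨F', G', e'⟩ := h₂ S (le_trans (le_max_right _ _) hS)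
    exact ⟨F + F', G + G', by rw [deltaMk_add, e, e', add_smul, add_smul]; abel⟩
  | single i F =>
    obtain ⟨i, s⟩ := i
    refine ⟨s, fun S hS => ?_⟩
    obtain ⟨d, rfl⟩ := Nat.exists_eq_add_of_le hS
    rw [deltaMk_single]
    fin_cases i
    · obtain ⟨G, hG⟩ := genD_zero_eq (p := p) (f := f) (P := P) (C := C) (A := A) s d
      refine ⟨F * (PowerSeries.C ((P.alpha : k)⁻¹ ^ d) *
        PowerSeries.X ^ ((p ^ f) ^ (s + d) - (p ^ f) ^ s)), F * G, ?_⟩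
      rw [mul_smul, mul_smul F G, ← smul_add, ← hG]; rfl
    · have h := genD_one_eq (p := p) (f := f) (P := P) (C := C) (A := A) s (d + A.N)
      rw [← add_assoc] at h
      exact ⟨0, F * _, by rw [zero_smul, zero_add, mul_smul]; exact congrArg (F • ·) h⟩

/-- For the converse, write the element modulo `∇` with only the generators `φ^S x` and `φ^(S+N) y`.
Membership of the first coordinate in the lattice removes the first generator, after which the
second coordinate is a single monomial multiple that can be treated in the same way. -/
theorem LatticeStable.mem_nabla_iff (h : LatticeStable p f P C A) (m : FreeM k) :
    m ∈ phiSpan k p f (nablaGens p f P C A) ↔ toV p f P C A m ∈ latV k A.nx A.ny := by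
  refine ⟨fun hm => h.nabla_le hm, fun hm => ?_⟩
  have hq0 : 0 < p ^ f := pow_pos hp.out.pos f
  obtain ⟨S, hS⟩ := exists_eq_smul_genD (deltaMk p f P C A m)
  obtain ⟨F, G, e⟩ := hS S le_rfl
  have key : ∀ m', deltaMk p f P C A m = deltaMk p f P C A m' →
      toV p f P C A m' ∈ latV k A.nx A.ny := by
    intro m' e'
    have h1 : m - m' ∈ phiSpan k p f (nablaGens p f P C A) := by
      rw [← deltaMk_eq_zero, deltaMk_sub, e', sub_self]
    have h2 := Submodule.sub_mem _ hm (h.nabla_le h1)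
    rwa [map_sub, sub_sub_cancel] at h2
  -- If `F φ^s z` lands in the lattice, then `F` is divisible by `t^n t^(q^s-1)`. The factor
  -- `t^(q^s-1)` carries `φ^s z` back down to `z`, up to a constant and to terms in `y`, and `t^n`
  -- kills `z`.
  have hzero : ∀ (c : k) (n s : ℕ), c ≠ 0 → 0 < n → ∀ F : k⟦X⟧,
      toL F * (toL (PowerSeries.C (c ^ s)) * tpow k (-((p ^ f) ^ s : ℕ))) ∈ lat k ((n : ℤ) - 1) →
      ∃ F', F = F' * PowerSeries.X ^ n *
        (PowerSeries.C (c⁻¹ ^ s) * PowerSeries.X ^ ((p ^ f) ^ s - 1)) := by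
    intro c n s hc hn F hF
    have h2 : (PowerSeries.X : k⟦X⟧) ^ (n + ((p ^ f) ^ s - 1)) ∣ F := by
      have h1 : 1 ≤ (p ^ f) ^ s := Nat.one_le_pow _ _ hq0
      refine dvd_of_toL_mem_lat ?_
      have h3 : toL F = toL (PowerSeries.C (c⁻¹ ^ s)) * (tpow k ((p ^ f) ^ s : ℕ) *
          (toL F * (toL (PowerSeries.C (c ^ s)) * tpow k (-((p ^ f) ^ s : ℕ))))) := by
        have e1 := tpow_mul_neg (k := k) ((p ^ f) ^ s : ℕ)
        have e2 : toL (PowerSeries.C (c⁻¹ ^ s)) * toL (PowerSeries.C (c ^ s)) = (1 : k⸨X⸩) := by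
          rw [toL_C_mul_toL_C, ← mul_pow, inv_mul_cancel₀ hc, one_pow, map_one, map_one]
        linear_combination -toL F * tpow k ((p ^ f) ^ s : ℕ) * tpow k (-((p ^ f) ^ s : ℕ)) * e2 -
          toL F * e1
      rw [h3]
      refine toL_mul_mem_lat _ (mul_mem_lat' ?_ (tpow_mem_lat le_rfl) hF)
      push_cast [Nat.cast_sub h1]; linarith
    obtain ⟨w, rfl⟩ := h2
    refine ⟨PowerSeries.C (c ^ s) * w, ?_⟩
    have e2 : PowerSeries.C (c⁻¹ ^ s) * PowerSeries.C (c ^ s) = (1 : k⟦X⟧) := by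
      rw [← map_mul, ← mul_pow, inv_mul_cancel₀ hc, one_pow, map_one]
    rw [pow_add]
    linear_combination -PowerSeries.X ^ n * PowerSeries.X ^ ((p ^ f) ^ s - 1) * w * e2
  have hx0 : (PowerSeries.X : k⟦X⟧) ^ A.nx • genD p f P C A 0 0 = 0 := by
    rw [← deltaMk_single]
    exact deltaMk_iterate_eq_zero (m := Finsupp.single (0, 0) (PowerSeries.X ^ A.nx)) (by simp [nablaGens]) 0
  have hy0 : (PowerSeries.X : k⟦X⟧) ^ A.ny • genD p f P C A 1 0 = 0 := by
    rw [← deltaMk_single]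
    exact deltaMk_iterate_eq_zero (m := Finsupp.single (1, 0) (PowerSeries.X ^ A.ny)) (by simp [nablaGens]) 0
  rw [← deltaMk_eq_zero]
  -- Removal of the `x`-part, at the price of an unspecified multiple of `φ^(S+N) y`.
  obtain ⟨H, hH⟩ : ∃ H : k⟦X⟧, deltaMk p f P C A m = H • genD p f P C A 1 (S + A.N) := by
    have h1 := key (Finsupp.single (0, S) F + Finsupp.single (1, S + A.N) G)
      (by rw [e, deltaMk_add, deltaMk_single, deltaMk_single])
    rw [mem_latV, map_add, toV_single_one, Prod.fst_add, toV, freeToV_single_zero_fst, add_zero] at h1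
    obtain ⟨F', rfl⟩ := hzero _ _ _ P.alpha.ne_zero h.nx_pos F h1.1
    obtain ⟨G', hG'⟩ := genD_zero_eq (p := p) (f := f) (P := P) (C := C) (A := A) 0 S
    rw [zero_add, pow_zero, ← sub_eq_iff_eq_add] at hG'
    refine ⟨G - F' * PowerSeries.X ^ A.nx * G', ?_⟩
    rw [e, mul_smul, ← hG', smul_sub, mul_smul F', hx0, smul_zero, zero_sub, sub_smul, mul_smul _ G']
    abel
  have h1 := key (Finsupp.single (1, S + A.N) H) (by rw [hH, deltaMk_single])
  rw [mem_latV, toV_single_one] at h1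
  obtain ⟨H', rfl⟩ := hzero _ _ _ P.beta.ne_zero h.ny_pos H h1.2
  have h2 := genD_one_eq (p := p) (f := f) (P := P) (C := C) (A := A) 0 (S + A.N)
  rw [zero_add, pow_zero] at h2
  rw [hH, mul_smul, ← h2, mul_smul, hy0, smul_zero]

theorem LatticeStable.exists_cl (h : LatticeStable p f P C A) :
    ∃ c : k⸨X⸩ × k⸨X⸩ →ₗ[k⟦X⟧] Delta p f P C A,
      ∀ m, c (toV p f P C A m) = deltaMk p f P C A m := by
  have hs := freeToV_surjective (p := p) P.alpha.ne_zero P.beta.ne_zero h.f_pos (btilde p f P C A)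
  have hk : LinearMap.ker (toV p f P C A) ≤ LinearMap.ker (Submodule.mkQ
      (phiSpan k p f (nablaGens p f P C A))) := by
    intro m hm
    rw [Submodule.ker_mkQ, h.mem_nabla_iff, LinearMap.mem_ker.1 hm]
    exact Submodule.zero_mem _
  refine ⟨((LinearMap.ker (toV p f P C A)).liftQ _ hk).comp
    ((toV p f P C A).quotKerEquivOfSurjective hs).symm.toLinearMap, fun m => ?_⟩
  rw [LinearMap.comp_apply, LinearEquiv.coe_coe]
  have : ((toV p f P C A).quotKerEquivOfSurjective hs).symm (toV p f P C A m) =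
      Submodule.Quotient.mk m := by
    rw [LinearEquiv.symm_apply_eq]; rfl
  rw [this]
  exact Submodule.liftQ_apply _ _ _

/-- The quotient map `k((t))² → Δ`. -/
noncomputable def LatticeStable.cl (h : LatticeStable p f P C A) :
    k⸨X⸩ × k⸨X⸩ →ₗ[k⟦X⟧] Delta p f P C A := h.exists_cl.choose

theorem LatticeStable.cl_toV (h : LatticeStable p f P C A) (m : FreeM k) :
    h.cl (toV p f P C A m) = deltaMk p f P C A m := h.exists_cl.choose_spec m

theorem LatticeStable.exists_toV (h : LatticeStable p f P C A) (v : k⸨X⸩ × k⸨X⸩) :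
    ∃ m, toV p f P C A m = v :=
  freeToV_surjective (p := p) P.alpha.ne_zero P.beta.ne_zero h.f_pos (btilde p f P C A) v

theorem LatticeStable.cl_surjective (h : LatticeStable p f P C A) : Function.Surjective h.cl := by
  intro z
  obtain ⟨m, rfl⟩ := deltaMk_surjective z
  exact ⟨_, h.cl_toV m⟩

theorem LatticeStable.cl_eq_zero (h : LatticeStable p f P C A) (v : k⸨X⸩ × k⸨X⸩) :
    h.cl v = 0 ↔ v ∈ latV k A.nx A.ny := by
  obtain ⟨m, rfl⟩ := h.exists_toV v
  rw [h.cl_toV, deltaMk_eq_zero, h.mem_nabla_iff]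

theorem LatticeStable.deltaPhi_cl (h : LatticeStable p f P C A) (v : k⸨X⸩ × k⸨X⸩) :
    deltaPhi p f P C A (h.cl v) = h.cl (phiVP p f P C A v) := by
  obtain ⟨m, rfl⟩ := h.exists_toV v
  rw [h.cl_toV, deltaPhi_deltaMk, ← h.cl_toV]
  congr 1
  exact freeToV_phiM _ _ _ m

end DeltaModel


/-! ### The residue pairing on `k((t))²`. -/

section Residue

variable {k : Type*} [Field k]

/-- The residue pairing on `k((t))²`. -/
noncomputable def resPair (h v : k⸨X⸩ × k⸨X⸩) : k := (h.1 * v.1 + h.2 * v.2).coeff (-1)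

theorem resPair_add_left (h h' v : k⸨X⸩ × k⸨X⸩) : resPair (h + h') v = resPair h v + resPair h' v := by
  rw [resPair, resPair, resPair, ← HahnSeries.coeff_add, Prod.fst_add, Prod.snd_add]
  congr 1; ring

theorem resPair_add_right (h v v' : k⸨X⸩ × k⸨X⸩) : resPair h (v + v') = resPair h v + resPair h v' := by
  rw [resPair, resPair, resPair, ← HahnSeries.coeff_add, Prod.fst_add, Prod.snd_add]
  congr 1; ring

theorem resPair_sub_left (h h' v : k⸨X⸩ × k⸨X⸩) : resPair (h - h') v = resPair h v - resPair h' v := by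
  rw [resPair, resPair, resPair, ← HahnSeries.coeff_sub, Prod.fst_sub, Prod.snd_sub]
  congr 1; ring

theorem resPair_smul_right (c : k⸨X⸩) (h v : k⸨X⸩ × k⸨X⸩) : resPair h (c • v) = resPair (c • h) v := by
  rw [resPair, resPair, Prod.smul_fst, Prod.smul_snd, Prod.smul_fst, Prod.smul_snd, smul_eq_mul,
    smul_eq_mul, smul_eq_mul, smul_eq_mul]
  congr 1; ring

theorem eq_zero_of_coeff_mul {x : k⸨X⸩} (hx : ∀ c, (c * x).coeff (-1) = 0) : x = 0 := by
  ext n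
  have := hx (tpow k (-1 - n))
  rwa [coeff_tpow_mul, show -1 - (-1 - n) = n by ring] at this

theorem eq_zero_of_resPair {h : k⸨X⸩ × k⸨X⸩} (hh : ∀ v, resPair h v = 0) : h = 0 := by
  refine Prod.ext (eq_zero_of_coeff_mul fun c => ?_) (eq_zero_of_coeff_mul fun c => ?_)
  · have := hh (c, 0)
    rwa [resPair, mul_zero, add_zero, mul_comm] at this
  · have := hh (0, c)
    rwa [resPair, mul_zero, zero_add, mul_comm] at this

/-- An additive functional, homogeneous for constants, that vanishes on a lattice and on the
monomials vanishes. -/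
theorem functional_eq_zero (l : k⸨X⸩ →+ k) (hl : ∀ (c : k) x, l (toL (PowerSeries.C c) * x) = c * l x)
    {n : ℤ} (hn : ∀ x ∈ lat k n, l x = 0) (ht : ∀ i, l (tpow k i) = 0) (x : k⸨X⸩) : l x = 0 := by
  have key : ∀ (d : ℕ) (x), x ∈ lat k (n - d) → l x = 0 := by
    intro d
    induction d with
    | zero => intro x hx; exact hn x (by simpa using hx)
    | succ d ih =>
      intro x hx
      rw [mem_lat] at hx
      obtain ⟨F, rfl⟩ := hx
      have e : F = PowerSeries.C (PowerSeries.constantCoeff F) +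
          PowerSeries.X * PowerSeries.mk fun p => PowerSeries.coeff (p + 1) F := by
        rw [add_comm]; exact PowerSeries.eq_X_mul_shift_add_const F
      rw [e, (toL (k := k)).map_add, (toL (k := k)).map_mul, mul_add, l.map_add,
        mul_comm (tpow k _) (toL (PowerSeries.C _)), hl, ht, mul_zero, zero_add, toL_X,
        ← mul_assoc, ← tpow_add]
      refine ih _ (mul_mem_lat' (m := n - d) (n := 0) (by omega) (tpow_mem_lat ?_) (toL_mem_lat _))
      push_cast; omega
  obtain ⟨N, hN⟩ := exists_eq_tpow_neg_mul x
  obtain ⟨F, rfl⟩ := hN (max N (-n).toNat + N) (by omega)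
  refine key (max N (-n).toNat + N + n.toNat) _
    (mul_mem_lat' (m := n - ((max N (-n).toNat + N + n.toNat : ℕ) : ℤ)) (n := 0) (by omega)
      (tpow_mem_lat ?_) (toL_mem_lat _))
  omega

/-- A form on `k((t))/t^n k⟦t⟧` is determined by its values on the monomials `t^i`, `i < n`, and
these values can be taken as the coefficients of a series of order at least `-n`. -/
theorem exists_functional_eq (l : k⸨X⸩ →+ k)
    (hl : ∀ (c : k) x, l (toL (PowerSeries.C c) * x) = c * l x)
    {n : ℤ} (hn : ∀ x ∈ lat k n, l x = 0) :
    ∃ h ∈ lat k (-n), ∀ x, l x = (h * x).coeff (-1) := by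
  set h : k⸨X⸩ := tpow k (-n) * toL (PowerSeries.mk fun j => l (tpow k (n - 1 - j))) with hh
  have hmem : h ∈ lat k (-n) := mem_lat.2 ⟨_, rfl⟩
  refine ⟨h, hmem, fun x => ?_⟩
  let l' : k⸨X⸩ →+ k := l - ((HahnSeries.coeff.addMonoidHom (-1)).comp (AddMonoidHom.mulLeft h))
  have hl' : ∀ x, l' x = l x - (h * x).coeff (-1) := fun x => rfl
  have := functional_eq_zero l' (n := n) (fun c x => ?_) (fun x hx => ?_) (fun i => ?_) x
  · rwa [hl', sub_eq_zero] at this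
  · rw [hl', hl', hl, mul_left_comm, coeff_toL_C_mul, mul_sub]
  · rw [hl', hn x hx, zero_sub, neg_eq_zero]
    exact (mem_lat_iff_coeff.1 (mul_mem_lat hmem hx)) _ (by omega)
  · rw [hl', mul_comm, coeff_tpow_mul, hh, coeff_tpow_mul, sub_eq_zero]
    by_cases hi : n ≤ i
    · rw [hn _ (tpow_mem_lat hi), coeff_toL_neg _ (by omega)]
    · obtain ⟨j, hj⟩ := Int.eq_ofNat_of_zero_le (by omega : 0 ≤ -1 - i - -n)
      rw [hj, coeff_toL, PowerSeries.coeff_mk]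
      congr 2; omega

end Residue

/-! ### Adjointness of `φ` and `ψ`. -/

section ResPsi

variable {k : Type*} [Field k] (p f : ℕ) [hp : Fact p.Prime]

/-- For the residue pairing, `ψ` is adjoint to `w ↦ ωφ(w)`: pull the power series part of `w` out of
both sides by the projection formula and compare a single coefficient. -/
theorem coeff_toL_mul_phiL (hf : 0 < f) (c : k⟦X⟧) (w : k⸨X⸩) :
    (toL (omegaSeries k p f) * toL c * phiL k p f w).coeff (-1) = (toL (psiR k p f c) * w).coeff (-1) := by
  have h0 : p ^ f ≠ 0 := pow_ne_zero f hp.out.ne_zero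
  obtain ⟨N, hN⟩ := exists_eq_tpow_neg_mul w
  obtain ⟨F, rfl⟩ := hN (N + 1) (by omega)
  have hq := two_le_q (p := p) hf
  have e1 : toL (omegaSeries k p f) * toL c * phiL k p f (tpow k (-((N + 1 : ℕ) : ℤ)) * toL F) =
      tpow k ((p ^ f : ℕ) * (-((N + 1 : ℕ) : ℤ))) * toL (omegaSeries k p f * (phiR k p f F * c)) := by
    rw [map_mul (phiL k p f), phiL_tpow, phiL_toL, map_mul, map_mul]; ring
  have e2 : toL (psiR k p f c) * (tpow k (-((N + 1 : ℕ) : ℤ)) * toL F) =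
      tpow k (-((N + 1 : ℕ) : ℤ)) * toL (psiR k p f (phiR k p f F * c)) := by
    rw [phiR_apply, psiR_expand_mul, map_mul]; ring
  rw [e1, e2, coeff_tpow_mul, coeff_tpow_mul, psiR_eq]
  have e3 : (-1 : ℤ) - (p ^ f : ℕ) * (-((N + 1 : ℕ) : ℤ)) = ((p ^ f * N + (p ^ f - 1) : ℕ) : ℤ) := by
    push_cast [Nat.cast_sub (by omega : 1 ≤ p ^ f)]; ring
  rw [e3, coeff_toL, show (-1 : ℤ) - (-((N + 1 : ℕ) : ℤ)) = (N : ℕ) by push_cast; ring, coeff_toL]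
  simp [psiZero]

end ResPsi

/-! ### Coordinates on `Δ* ⊗ k((t))` and the operator `φ` in them. -/

section DualCoordinates

variable {k : Type*} [Field k] {p f : ℕ} [hp : Fact p.Prime]
  {P : Params k} {C : Scalars k p f P.ell} {A : Aux}

theorem TDual.eval_add {Δ : Type*} [AddCommGroup Δ] [Module k Δ] (l : TDual k Δ) (x y : Δ) :
    l.eval (x + y) = l.eval x + l.eval y := map_add (show Δ →ₗ[k] k from l) x y

theorem TDual.eval_zero {Δ : Type*} [AddCommGroup Δ] [Module k Δ] (l : TDual k Δ) :
    l.eval 0 = 0 := map_zero (show Δ →ₗ[k] k from l)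

theorem TDual.add_eval {Δ : Type*} [AddCommGroup Δ] [Module k Δ] (l l' : TDual k Δ) (x : Δ) :
    (l + l').eval x = l.eval x + l'.eval x := rfl

theorem TDual.eval_C_smul {Δ : Type*} [AddCommGroup Δ] [Module k Δ] [Module k⟦X⟧ Δ]
    [IsScalarTower k k⟦X⟧ Δ] (l : TDual k Δ) (c : k) (x : Δ) :
    l.eval ((PowerSeries.C c : k⟦X⟧) • x) = c * l.eval x := by
  have : (PowerSeries.C c : k⟦X⟧) • x = c • x := algebraMap_smul k⟦X⟧ c x
  rw [this]
  exact map_smul (show Δ →ₗ[k] k from l) c x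

theorem TDual.ext {Δ : Type*} [AddCommGroup Δ] [Module k Δ] {l l' : TDual k Δ}
    (h : ∀ x, l.eval x = l'.eval x) : l = l' := LinearMap.ext h

/-- A linear form on a quotient given by an additive function. -/
theorem TDual.exists_mk {Δ : Type*} [AddCommGroup Δ] [Module k Δ] [Module k⟦X⟧ Δ]
    [IsScalarTower k k⟦X⟧ Δ] (g : Δ → k) (hg : ∀ x y, g (x + y) = g x + g y)
    (hc : ∀ (c : k) x, g ((PowerSeries.C c : k⟦X⟧) • x) = c * g x) :
    ∃ l : TDual k Δ, ∀ x, l.eval x = g x :=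
  ⟨(show TDual k Δ from
    { toFun := g
      map_add' := hg
      map_smul' := fun c x => by
        have : (PowerSeries.C c : k⟦X⟧) • x = c • x := algebraMap_smul k⟦X⟧ c x
        rw [← this, hc]; rfl } : TDual k Δ), fun _ => rfl⟩

theorem LatticeStable.exists_coord (h : LatticeStable p f P C A) (l : TDual k (Delta p f P C A)) :
    ∃ w : k⸨X⸩ × k⸨X⸩, (w.1 ∈ lat k (-((A.nx : ℤ) - 1)) ∧ w.2 ∈ lat k (-((A.ny : ℤ) - 1))) ∧
      ∀ v, l.eval (h.cl v) = resPair w v := by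
  have hl : ∀ (c : k) (v : k⸨X⸩ × k⸨X⸩), l.eval (h.cl ((PowerSeries.C c : k⟦X⟧) • v)) =
      c * l.eval (h.cl v) := fun c v => by rw [map_smul, TDual.eval_C_smul]
  let lf : k⸨X⸩ × k⸨X⸩ →+ k :=
    { toFun := fun v => l.eval (h.cl v)
      map_zero' := by rw [map_zero, TDual.eval_zero]
      map_add' := fun v w => by rw [map_add, TDual.eval_add] }
  have hlf : ∀ v, lf v = l.eval (h.cl v) := fun v => rfl
  have hker : ∀ v ∈ latV k A.nx A.ny, lf v = 0 := fun v hv => by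
    rw [hlf, (h.cl_eq_zero v).2 hv, TDual.eval_zero]
  obtain ⟨w1, hw1, e1⟩ := exists_functional_eq (lf.comp (AddMonoidHom.inl _ _))
    (n := (A.nx : ℤ) - 1)
    (fun c x => by
      have := hl c (x, 0)
      rw [Prod.smul_mk, smul_zero, Algebra.smul_def] at this
      exact this)
    (fun x hx => hker _ (mem_latV.2 ⟨hx, Submodule.zero_mem _⟩))
  obtain ⟨w2, hw2, e2⟩ := exists_functional_eq (lf.comp (AddMonoidHom.inr _ _))
    (n := (A.ny : ℤ) - 1)
    (fun c x => by
      have := hl c (0, x)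
      rw [Prod.smul_mk, smul_zero, Algebra.smul_def] at this
      exact this)
    (fun x hx => hker _ (mem_latV.2 ⟨Submodule.zero_mem _, hx⟩))
  refine ⟨(w1, w2), ⟨hw1, hw2⟩, fun v => ?_⟩
  rw [resPair, HahnSeries.coeff_add, ← e1, ← e2, ← hlf]
  conv_lhs => rw [show v = (v.1, 0) + (0, v.2) from Prod.ext (by simp) (by simp), map_add]
  rfl

theorem resPair_unique {w w' : k⸨X⸩ × k⸨X⸩} (h : ∀ v, resPair w v = resPair w' v) : w = w' :=
  sub_eq_zero.1 (eq_zero_of_resPair fun v => by rw [resPair_sub_left, h, sub_self])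

/-- The coordinates of a linear form on `Δ` for the residue pairing. -/
noncomputable def LatticeStable.coord (h : LatticeStable p f P C A) :
    TDual k (Delta p f P C A) →ₗ[k⟦X⟧] k⸨X⸩ × k⸨X⸩ where
  toFun l := (h.exists_coord l).choose
  map_add' l l' := resPair_unique fun v => by
    rw [resPair_add_left, ← (h.exists_coord l).choose_spec.2, ← (h.exists_coord l').choose_spec.2,
      ← (h.exists_coord (l + l')).choose_spec.2, TDual.add_eval]
  map_smul' F l := resPair_unique fun v => by
    rw [← (h.exists_coord (F • l)).choose_spec.2, RingHom.id_apply,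
      ← algebraMap_smul k⸨X⸩ F (h.exists_coord l).choose,
      ← resPair_smul_right, ← (h.exists_coord l).choose_spec.2, TDual.eval_smul, ← map_smul,
      algebraMap_smul]

theorem LatticeStable.eval_cl (h : LatticeStable p f P C A) (l : TDual k (Delta p f P C A))
    (v : k⸨X⸩ × k⸨X⸩) : l.eval (h.cl v) = resPair (h.coord l) v := (h.exists_coord l).choose_spec.2 v

theorem LatticeStable.coord_eq (h : LatticeStable p f P C A) {l : TDual k (Delta p f P C A)}
    {w : k⸨X⸩ × k⸨X⸩} (hw : ∀ v, l.eval (h.cl v) = resPair w v) : h.coord l = w :=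
  resPair_unique fun v => by rw [← h.eval_cl, hw]

theorem LatticeStable.coord_injective (h : LatticeStable p f P C A) : Function.Injective h.coord := by
  intro l l' e
  refine TDual.ext fun z => ?_
  obtain ⟨v, rfl⟩ := h.cl_surjective z
  rw [h.eval_cl, h.eval_cl, e]

theorem LatticeStable.exists_coord_eq (h : LatticeStable p f P C A) {w : k⸨X⸩ × k⸨X⸩}
    (h1 : w.1 ∈ lat k (-((A.nx : ℤ) - 1))) (h2 : w.2 ∈ lat k (-((A.ny : ℤ) - 1))) :
    ∃ l, h.coord l = w := by
  choose s hs using h.cl_surjective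
  have hw : ∀ v, resPair w (s (h.cl v)) = resPair w v := by
    intro v
    have h3 : s (h.cl v) - v ∈ latV k A.nx A.ny := by
      rw [← h.cl_eq_zero, map_sub, hs, sub_self]
    rw [mem_latV] at h3
    have h4 : resPair w (s (h.cl v) - v) = 0 := by
      have h5 := Submodule.add_mem _ (mul_mem_lat' (l := 0) (by omega) h1 h3.1)
        (mul_mem_lat' (l := 0) (by omega) h2 h3.2)
      exact mem_lat_iff_coeff.1 h5 _ (by omega)
    have h6 := resPair_add_right w (s (h.cl v) - v) v
    rwa [sub_add_cancel, h4, zero_add] at h6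
  obtain ⟨l, hl⟩ := TDual.exists_mk (fun z => resPair w (s z)) (fun x y => by
      obtain ⟨v, rfl⟩ := h.cl_surjective x
      obtain ⟨v', rfl⟩ := h.cl_surjective y
      rw [← map_add, hw, hw, hw, resPair_add_right]) (fun c x => by
      obtain ⟨v, rfl⟩ := h.cl_surjective x
      rw [← map_smul, hw, hw, ← algebraMap_smul k⸨X⸩ _ v]
      rw [resPair, resPair, ← coeff_toL_C_mul, Prod.smul_fst, Prod.smul_snd, smul_eq_mul, smul_eq_mul]
      congr 1; ring)
  exact ⟨l, h.coord_eq fun v => by rw [hl, hw]⟩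

/-- Common denominators: a single pure tensor suffices, which reduces semilinear identities on `Δ* ⊗
k((t))` to elements of `Δ*`. -/
theorem dualLaurent_exists_eq {Δ : Type*} [AddCommGroup Δ] [Module k Δ]
    [Module k⟦X⟧ Δ] [IsScalarTower k k⟦X⟧ Δ] (d : DualLaurent k Δ) :
    ∃ M₀ : ℕ, ∀ M ≥ M₀, ∃ l : TDual k Δ, d = tpow k (-(M : ℤ)) ⊗ₜ[k⟦X⟧] l := by
  induction d using TensorProduct.induction_on with
  | zero => exact ⟨0, fun M _ => ⟨0, by rw [TensorProduct.tmul_zero]⟩⟩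
  | tmul c l =>
    obtain ⟨N, hN⟩ := exists_eq_tpow_neg_mul c
    refine ⟨N, fun M hM => ?_⟩
    obtain ⟨F, rfl⟩ := hN M hM
    refine ⟨F • l, ?_⟩
    rw [TensorProduct.tmul_smul, TensorProduct.smul_tmul', Algebra.smul_def, mul_comm]
  | add d d' h h' =>
    obtain ⟨M₁, h₁⟩ := h
    obtain ⟨M₂, h₂⟩ := h'
    refine ⟨max M₁ M₂, fun M hM => ?_⟩
    obtain ⟨l, rfl⟩ := h₁ M (le_trans (le_max_left _ _) hM)
    obtain ⟨l', rfl⟩ := h₂ M (le_trans (le_max_right _ _) hM)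
    exact ⟨l + l', by rw [TensorProduct.tmul_add]⟩

/-- The coordinates on `Δ* ⊗ k((t))`. -/
noncomputable def LatticeStable.kappaHom (h : LatticeStable p f P C A) :
    DualLaurent k (Delta p f P C A) →ₗ[k⸨X⸩] k⸨X⸩ × k⸨X⸩ := h.coord.liftBaseChange k⸨X⸩

theorem LatticeStable.kappaHom_tmul (h : LatticeStable p f P C A) (c : k⸨X⸩)
    (l : TDual k (Delta p f P C A)) : h.kappaHom (c ⊗ₜ l) = c • h.coord l := by
  exact LinearMap.liftBaseChange_tmul k⸨X⸩ h.coord c l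

theorem exists_tpow_smul_mem (n : ℤ) (x : k⸨X⸩) : ∃ M₀ : ℕ, ∀ M ≥ M₀, tpow k M * x ∈ lat k n := by
  obtain ⟨N, hN⟩ := exists_eq_tpow_neg_mul x
  obtain ⟨F, rfl⟩ := hN N le_rfl
  refine ⟨N + n.toNat, fun M hM => ?_⟩
  rw [← mul_assoc, ← tpow_add]
  exact mul_mem_lat' (m := n) (n := 0) (by omega) (tpow_mem_lat (by omega)) (toL_mem_lat _)

theorem LatticeStable.exists_tpow_coord (h : LatticeStable p f P C A) (w : k⸨X⸩ × k⸨X⸩) :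
    ∃ M : ℕ, ∃ l, h.coord l = tpow k M • w := by
  obtain ⟨M₁, h₁⟩ := exists_tpow_smul_mem (-((A.nx : ℤ) - 1)) w.1
  obtain ⟨M₂, h₂⟩ := exists_tpow_smul_mem (-((A.ny : ℤ) - 1)) w.2
  exact ⟨max M₁ M₂, h.exists_coord_eq (h₁ _ (le_max_left _ _)) (h₂ _ (le_max_right _ _))⟩

theorem LatticeStable.kappaHom_bijective (h : LatticeStable p f P C A) :
    Function.Bijective h.kappaHom := by
  constructor
  · refine (injective_iff_map_eq_zero _).2 fun d hd => ?_
    obtain ⟨M, hM⟩ := dualLaurent_exists_eq d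
    obtain ⟨l, rfl⟩ := hM M le_rfl
    rw [h.kappaHom_tmul, smul_eq_zero, or_iff_right (tpow_ne_zero _)] at hd
    rw [h.coord_injective (hd.trans (map_zero _).symm), TensorProduct.tmul_zero]
  · intro w
    obtain ⟨M, l, hl⟩ := h.exists_tpow_coord w
    refine ⟨tpow k (-(M : ℤ)) ⊗ₜ l, ?_⟩
    rw [h.kappaHom_tmul, hl, smul_smul, mul_comm, tpow_mul_neg, one_smul]

/-- The coordinates on `Δ* ⊗ k((t))`, as an isomorphism. -/
noncomputable def LatticeStable.kappa (h : LatticeStable p f P C A) :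
    DualLaurent k (Delta p f P C A) ≃ₗ[k⸨X⸩] k⸨X⸩ × k⸨X⸩ :=
  LinearEquiv.ofBijective h.kappaHom h.kappaHom_bijective

theorem LatticeStable.kappa_tmul (h : LatticeStable p f P C A) (c : k⸨X⸩)
    (l : TDual k (Delta p f P C A)) : h.kappa (c ⊗ₜ l) = c • h.coord l := h.kappaHom_tmul c l

variable (p f P C A) in
/-- The operator `φ` on `Δ* ⊗ k((t))` in coordinates. -/
noncomputable def dualPhi (w : k⸨X⸩ × k⸨X⸩) : k⸨X⸩ × k⸨X⸩ :=
  (toL (omegaSeries k p f) * (toL (PowerSeries.C ((P.alpha : k)⁻¹)) * phiL k p f w.1 +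
    btilde p f P C A * phiL k p f w.2),
    toL (omegaSeries k p f) * (toL (PowerSeries.C ((P.beta : k)⁻¹)) * phiL k p f w.2))

theorem dualPhi_add (w w' : k⸨X⸩ × k⸨X⸩) :
    dualPhi p f P C A (w + w') = dualPhi p f P C A w + dualPhi p f P C A w' := by
  simp only [dualPhi, Prod.fst_add, Prod.snd_add, map_add, Prod.mk_add_mk]
  refine Prod.ext ?_ ?_ <;> dsimp only <;> ring

theorem dualPhi_smul (c : k⸨X⸩) (w : k⸨X⸩ × k⸨X⸩) :
    dualPhi p f P C A (c • w) = phiL k p f c • dualPhi p f P C A w := by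
  simp only [dualPhi, Prod.smul_fst, Prod.smul_snd, smul_eq_mul, map_mul, Prod.smul_mk]
  refine Prod.ext ?_ ?_ <;> dsimp only <;> ring

/-- The matrix in `dualPhi` is `ω` times the inverse transpose of the one in `phiV`. Hence the
pairing of `φ`-images is `ω` times `φ` of the pairing, and the adjointness of `ψ` applies. -/
theorem resPair_dualPhi (hf : 0 < f) (w v : k⸨X⸩ × k⸨X⸩) (b : k⟦X⟧) :
    resPair (dualPhi p f P C A w) (toL b • phiVP p f P C A v) = resPair w (toL (psiR k p f b) • v) := by
  have hα : toL (PowerSeries.C ((P.alpha : k)⁻¹)) * toL (PowerSeries.C (P.alpha : k)) = (1 : k⸨X⸩) := by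
    rw [toL_C_mul_toL_C, inv_mul_cancel₀ P.alpha.ne_zero, map_one, map_one]
  have hβ : toL (PowerSeries.C ((P.beta : k)⁻¹)) * toL (PowerSeries.C (P.beta : k)) = (1 : k⸨X⸩) := by
    rw [toL_C_mul_toL_C, inv_mul_cancel₀ P.beta.ne_zero, map_one, map_one]
  have h1 := coeff_toL_mul_phiL p f hf b (w.1 * v.1 + w.2 * v.2)
  rw [resPair, resPair, phiV_apply, dualPhi]
  simp only [Prod.smul_fst, Prod.smul_snd, smul_eq_mul]
  convert h1 using 2
  · rw [← toL_C_mul_toL_C, map_add, map_mul, map_mul]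
    linear_combination toL (omegaSeries k p f) * toL b * phiL k p f w.1 * phiL k p f v.1 * hα +
      toL (omegaSeries k p f) * toL b * phiL k p f w.2 * (phiL k p f v.2 - toL (PowerSeries.C (P.alpha : k))
        * btilde p f P C A * phiL k p f v.1) * hβ
  · ring

/-- The image of `φ` spans `k((t))²` over `k((t))`. This is why the condition characterizing `φ(l ⊗
1)` has at most one solution. -/
theorem eq_zero_of_resPair_phiVP {w : k⸨X⸩ × k⸨X⸩}
    (hw : ∀ (b : k⟦X⟧) v, resPair w (toL b • phiVP p f P C A v) = 0) : w = 0 := by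
  have h1 : ∀ (c : k⸨X⸩) v, resPair w (c • phiVP p f P C A v) = 0 := by
    intro c v
    obtain ⟨M, hM⟩ := exists_eq_tpow_neg_mul c
    -- A pole of order `qM` in the scalar is absorbed into the vector, because `φ(t^(-M)) =
    -- t^(-qM)`.
    have hle : M ≤ p ^ f * M := Nat.le_mul_of_pos_left _ (pow_pos hp.out.pos f)
    obtain ⟨F, rfl⟩ := hM _ hle
    have := hw F (tpow k (-(M : ℤ)) • v)
    have e : phiVP p f P C A (tpow k (-(M : ℤ)) • v) =
        tpow k (-((p ^ f * M : ℕ) : ℤ)) • phiVP p f P C A v := by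
      rw [phiV_apply, phiV_apply, Prod.smul_fst, Prod.smul_snd, smul_eq_mul, smul_eq_mul, map_mul,
        map_mul, phiL_tpow, Prod.smul_mk, smul_eq_mul, smul_eq_mul]
      push_cast
      rw [mul_neg]
      refine Prod.ext ?_ ?_ <;> dsimp only <;> ring
    rwa [e, smul_smul, mul_comm] at this
  have h2 : ∀ v, w.1 * (phiVP p f P C A v).1 + w.2 * (phiVP p f P C A v).2 = 0 := by
    intro v
    refine eq_zero_of_coeff_mul fun c => ?_
    have := h1 c v
    rw [resPair, Prod.smul_fst, Prod.smul_snd, smul_eq_mul, smul_eq_mul] at this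
    rw [← this]; congr 1; ring
  have hne : ∀ c : kˣ, (toL (PowerSeries.C (c : k)) : k⸨X⸩) ≠ 0 := fun c hc => c.ne_zero (by
    have := toL_injective (hc.trans (map_zero _).symm)
    rwa [map_eq_zero_iff _ PowerSeries.C_injective] at this)
  have h3 := h2 (0, 1)
  rw [phiV_apply] at h3
  simp only [map_zero, mul_zero, zero_add, map_one, mul_one, sub_zero] at h3
  have h4 : w.2 = 0 := (mul_eq_zero.1 h3).resolve_right (hne _)
  have h5 := h2 (1, 0)
  rw [phiV_apply, h4] at h5
  simp only [map_one, mul_one, zero_mul, add_zero] at h5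
  exact Prod.ext ((mul_eq_zero.1 h5).resolve_right (hne _)) h4

/-- `(m, μ)` computes `φ(l ⊗ 1)`. -/
def PhiSpec (l : TDual k (Delta p f P C A)) (m : ℕ) (μ : TDual k (Delta p f P C A)) : Prop :=
  ∀ (b : k⟦X⟧) (x : Delta p f P C A),
    μ.eval (b • deltaPhi p f P C A x) = l.eval (psiR k p f (PowerSeries.X ^ m * b) • x)

/-- The abstract characterization of `φ` becomes a formula in coordinates, from which existence,
uniqueness and étaleness are read off. -/
theorem LatticeStable.phiSpec_iff (h : LatticeStable p f P C A) (l : TDual k (Delta p f P C A)) (m : ℕ)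
    (μ : TDual k (Delta p f P C A)) :
    PhiSpec l m μ ↔ h.coord μ = tpow k m • dualPhi p f P C A (h.coord l) := by
  have key : ∀ b v, l.eval (psiR k p f (PowerSeries.X ^ m * b) • h.cl v) =
      resPair (tpow k m • dualPhi p f P C A (h.coord l)) (toL b • phiVP p f P C A v) := by
    intro b v
    rw [← map_smul, h.eval_cl, ← resPair_smul_right, smul_smul, ← toL_X_pow, ← map_mul,
      resPair_dualPhi h.f_pos, algebraMap_smul]
  have key2 : ∀ (b : k⟦X⟧) v, μ.eval (b • deltaPhi p f P C A (h.cl v)) =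
      resPair (h.coord μ) (toL b • phiVP p f P C A v) := by
    intro b v
    rw [h.deltaPhi_cl, ← map_smul, h.eval_cl, algebraMap_smul]
  constructor
  · intro hs
    rw [← sub_eq_zero]
    refine eq_zero_of_resPair_phiVP (p := p) (f := f) (P := P) (C := C) (A := A) fun b v => ?_
    rw [resPair_sub_left, ← key, ← key2, hs, sub_self]
  · intro e b x
    obtain ⟨v, rfl⟩ := h.cl_surjective x
    rw [key, key2, e]

theorem LatticeStable.exists_phiSpec (h : LatticeStable p f P C A) (l : TDual k (Delta p f P C A)) :
    ∃ m μ, PhiSpec l m μ := by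
  obtain ⟨m, μ, e⟩ := h.exists_tpow_coord (dualPhi p f P C A (h.coord l))
  exact ⟨m, μ, (h.phiSpec_iff _ _ _).2 e⟩

/-- The operator `φ` on `Δ* ⊗ k((t))`. -/
noncomputable def LatticeStable.phiD (h : LatticeStable p f P C A) (d : DualLaurent k (Delta p f P C A)) :
    DualLaurent k (Delta p f P C A) := h.kappa.symm (dualPhi p f P C A (h.kappa d))

theorem LatticeStable.kappa_phiD (h : LatticeStable p f P C A) (d : DualLaurent k (Delta p f P C A)) :
    h.kappa (h.phiD d) = dualPhi p f P C A (h.kappa d) := h.kappa.apply_symm_apply _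

theorem LatticeStable.phiD_add (h : LatticeStable p f P C A) (d e : DualLaurent k (Delta p f P C A)) :
    h.phiD (d + e) = h.phiD d + h.phiD e := by
  rw [phiD, map_add, dualPhi_add, map_add]; rfl

theorem LatticeStable.phiD_smul (h : LatticeStable p f P C A) (c : k⸨X⸩)
    (d : DualLaurent k (Delta p f P C A)) : h.phiD (c • d) = phiL k p f c • h.phiD d := by
  rw [phiD, map_smul, dualPhi_smul, map_smul]; rfl

theorem inv_toL_X_pow (m : ℕ) :
    ((algebraMap k⟦X⟧ k⸨X⸩ PowerSeries.X)⁻¹ ^ m : k⸨X⸩) = tpow k (-(m : ℤ)) := by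
  change (toL PowerSeries.X : k⸨X⸩)⁻¹ ^ m = _
  rw [inv_pow, ← map_pow, toL_X_pow, tpow_neg]

theorem LatticeStable.phiD_one_tmul_iff (h : LatticeStable p f P C A) (l : TDual k (Delta p f P C A))
    (m : ℕ) (μ : TDual k (Delta p f P C A)) : PhiSpec l m μ ↔
      h.phiD (1 ⊗ₜ l) = ((algebraMap k⟦X⟧ k⸨X⸩ PowerSeries.X)⁻¹ ^ m) ⊗ₜ μ := by
  rw [h.phiSpec_iff, ← h.kappa.injective.eq_iff, h.kappa_phiD, h.kappa_tmul, h.kappa_tmul, one_smul,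
    inv_toL_X_pow]
  constructor
  · intro e; rw [e, smul_smul, mul_comm, tpow_mul_neg, one_smul]
  · intro e; rw [e, smul_smul, tpow_mul_neg, one_smul]

theorem omegaSeries_ne_zero (hf : 0 < f) : toL (omegaSeries k p f) ≠ 0 := by
  intro hc
  have h1 := toL_injective (hc.trans (map_zero _).symm)
  have h2 := congrArg PowerSeries.constantCoeff h1
  have hq := two_le_q (p := p) hf
  rw [omegaSeries, map_add, map_one, map_mul, map_pow, PowerSeries.constantCoeff_X,
    zero_pow (by omega), mul_zero, add_zero, map_zero] at h2
  exact one_ne_zero h2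

theorem toL_C_ne_zero {c : k} (hc : c ≠ 0) : toL (PowerSeries.C c) ≠ 0 := fun h => hc (by
    have := toL_injective (h.trans (map_zero _).symm)
    rwa [map_eq_zero_iff _ PowerSeries.C_injective] at this)

/-- The matrix is triangular with diagonal `ω/α`, `ω/β`, and `ω` has constant term `1`. -/
theorem LatticeStable.phiD_etale (h : LatticeStable p f P C A) :
    ∃ (n : ℕ) (b b' : Module.Basis (Fin n) k⸨X⸩ (DualLaurent k (Delta p f P C A))),
      ∀ i, h.phiD (b i) = b' i := by
  have hω := omegaSeries_ne_zero (k := k) (p := p) h.f_pos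
  have hα := toL_C_ne_zero (inv_ne_zero P.alpha.ne_zero)
  have hβ := toL_C_ne_zero (inv_ne_zero P.beta.ne_zero)
  let M : k⸨X⸩ × k⸨X⸩ →ₗ[k⸨X⸩] k⸨X⸩ × k⸨X⸩ :=
    { toFun := fun w => (toL (omegaSeries k p f) * (toL (PowerSeries.C ((P.alpha : k)⁻¹)) * w.1 +
        btilde p f P C A * w.2),
        toL (omegaSeries k p f) * (toL (PowerSeries.C ((P.beta : k)⁻¹)) * w.2))
      map_add' := fun w w' => by
        simp only [Prod.fst_add, Prod.snd_add, Prod.mk_add_mk]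
        refine Prod.ext ?_ ?_ <;> dsimp only <;> ring
      map_smul' := fun c w => by
        simp only [Prod.smul_fst, Prod.smul_snd, smul_eq_mul, Prod.smul_mk, RingHom.id_apply]
        refine Prod.ext ?_ ?_ <;> dsimp only <;> ring }
  have hM : Function.Injective M := by
    refine (injective_iff_map_eq_zero _).2 fun w hw => ?_
    have h2 : toL (omegaSeries k p f) * (toL (PowerSeries.C ((P.beta : k)⁻¹)) * w.2) = 0 :=
      congrArg Prod.snd hw
    have h1 : toL (omegaSeries k p f) * (toL (PowerSeries.C ((P.alpha : k)⁻¹)) * w.1 +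
        btilde p f P C A * w.2) = 0 := congrArg Prod.fst hw
    have h3 := ((mul_eq_zero.1 ((mul_eq_zero.1 h2).resolve_left hω)).resolve_left hβ)
    rw [h3, mul_zero, add_zero] at h1
    exact Prod.ext ((mul_eq_zero.1 ((mul_eq_zero.1 h1).resolve_left hω)).resolve_left hα) h3
  let Me := LinearEquiv.ofInjectiveEndo M hM
  refine ⟨2, (Module.Basis.finTwoProd k⸨X⸩).map h.kappa.symm,
    ((Module.Basis.finTwoProd k⸨X⸩).map Me).map h.kappa.symm, fun i => ?_⟩
  rw [Module.Basis.map_apply, Module.Basis.map_apply, Module.Basis.map_apply, phiD,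
    LinearEquiv.apply_symm_apply]
  congr 1
  fin_cases i
  · change dualPhi p f P C A (Module.Basis.finTwoProd k⸨X⸩ 0) = M (Module.Basis.finTwoProd k⸨X⸩ 0)
    rw [Module.Basis.finTwoProd_zero]
    change dualPhi p f P C A (1, 0) = (toL _ * (_ * 1 + _ * 0), toL _ * (_ * 0))
    rw [dualPhi, map_one, map_zero]
  · change dualPhi p f P C A (Module.Basis.finTwoProd k⸨X⸩ 1) = M (Module.Basis.finTwoProd k⸨X⸩ 1)
    rw [Module.Basis.finTwoProd_one]
    change dualPhi p f P C A (0, 1) = (toL _ * (_ * 0 + _ * 1), toL _ * (_ * 1))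
    rw [dualPhi, map_one, map_zero]

end DualCoordinates


/-! ### The substitutions `t ↦ [γ]` as a group action commuting with `φ`. -/

section Sigma

variable {O : Type*} [CommRing O] [IsDomain O] {p f : ℕ} [hp : Fact p.Prime]
  {k : Type*} [Field k] [Algebra O k] [CharP k p]

omit [CharP k p] in
theorem IsUnramifiedBase.brk_ne_zero (hO : IsUnramifiedBase O p f) (γ : Oˣ) : brk p f k γ ≠ 0 := by
  intro h
  refine hO.brkCoeff_one_ne_zero (k := k) γ ?_
  rw [brkCoeff, h, map_zero]

variable (k) in
/-- The substitution `t ↦ [γ]` on `k⟦t⟧`. -/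
noncomputable def IsUnramifiedBase.sigmaR (hO : IsUnramifiedBase O p f) (γ : Oˣ) : k⟦X⟧ →+* k⟦X⟧ :=
  substHom (brk p f k γ) (hO.constantCoeff_brk γ)

variable (k) in
/-- The substitution `t ↦ [γ]` on `k((t))`. -/
noncomputable def IsUnramifiedBase.sigmaL (hO : IsUnramifiedBase O p f) (γ : Oˣ) : k⸨X⸩ →+* k⸨X⸩ :=
  laurentHom (brk p f k γ) (hO.constantCoeff_brk γ) (hO.brk_ne_zero γ)

omit [CharP k p] in
theorem IsUnramifiedBase.subst_brk (hO : IsUnramifiedBase O p f) (γ : Oˣ) (F : k⟦X⟧) :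
    PowerSeries.subst (brk p f k γ) F = hO.sigmaR k γ F := (substHom_apply _ F).symm

omit [CharP k p] in
theorem IsUnramifiedBase.laurentSubst_brk (hO : IsUnramifiedBase O p f) (γ : Oˣ) (c : k⸨X⸩) :
    laurentSubst (brk p f k γ) c = hO.sigmaL k γ c := laurentSubst_eq _ _ c

omit [CharP k p] in
theorem IsUnramifiedBase.sigmaL_toL (hO : IsUnramifiedBase O p f) (γ : Oˣ) (F : k⟦X⟧) :
    hO.sigmaL k γ (toL F) = toL (hO.sigmaR k γ F) := laurentHom_toL _ _ F

omit [CharP k p] in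
theorem IsUnramifiedBase.sigmaR_X (hO : IsUnramifiedBase O p f) (γ : Oˣ) :
    hO.sigmaR k γ PowerSeries.X = brk p f k γ := substHom_X _

omit [CharP k p] in
theorem IsUnramifiedBase.sigmaR_C (hO : IsUnramifiedBase O p f) (γ : Oˣ) (c : k) :
    hO.sigmaR k γ (PowerSeries.C c) = PowerSeries.C c := substHom_C _ c

omit [CharP k p] in
theorem IsUnramifiedBase.sigmaR_one (hO : IsUnramifiedBase O p f) (F : k⟦X⟧) :
    hO.sigmaR k 1 F = F := by
  rw [sigmaR, substHom_congr hO.brk_one _ PowerSeries.constantCoeff_X, substHom_X_self]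

omit [CharP k p] in
theorem IsUnramifiedBase.sigmaR_mul (hO : IsUnramifiedBase O p f) (γ γ' : Oˣ) (F : k⟦X⟧) :
    hO.sigmaR k (γ * γ') F = hO.sigmaR k γ (hO.sigmaR k γ' F) := by
  have h : PowerSeries.constantCoeff (substHom (brk p f k γ) (hO.constantCoeff_brk γ) (brk p f k γ')) = 0 := by
    rw [← hO.brk_mul, hO.constantCoeff_brk]
  rw [sigmaR, sigmaR, sigmaR, substHom_comp _ _ h]
  exact substHom_congr (hO.brk_mul γ γ') _ _ F

omit [CharP k p] in
theorem IsUnramifiedBase.sigmaR_inv (hO : IsUnramifiedBase O p f) (γ : Oˣ) (F : k⟦X⟧) :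
    hO.sigmaR k γ⁻¹ (hO.sigmaR k γ F) = F := by
  rw [← hO.sigmaR_mul, inv_mul_cancel, hO.sigmaR_one]

omit [CharP k p] in
theorem IsUnramifiedBase.sigmaL_one (hO : IsUnramifiedBase O p f) (c : k⸨X⸩) :
    hO.sigmaL k 1 c = c := by
  have : hO.sigmaL k 1 = RingHom.id k⸨X⸩ := laurentHom_ext fun F => by
    rw [hO.sigmaL_toL, hO.sigmaR_one, RingHom.id_apply]
  rw [this, RingHom.id_apply]

omit [CharP k p] in
theorem IsUnramifiedBase.sigmaL_mul (hO : IsUnramifiedBase O p f) (γ γ' : Oˣ) (c : k⸨X⸩) :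
    hO.sigmaL k (γ * γ') c = hO.sigmaL k γ (hO.sigmaL k γ' c) := by
  have : hO.sigmaL k (γ * γ') = (hO.sigmaL k γ).comp (hO.sigmaL k γ') := laurentHom_ext fun F => by
    rw [hO.sigmaL_toL, hO.sigmaR_mul, RingHom.comp_apply, hO.sigmaL_toL, hO.sigmaL_toL]
  rw [this, RingHom.comp_apply]

theorem IsUnramifiedBase.sigmaR_phiR (hO : IsUnramifiedBase O p f) (γ : Oˣ) (F : k⟦X⟧) :
    hO.sigmaR k γ (phiR k p f F) = phiR k p f (hO.sigmaR k γ F) := by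
  have h0 : p ^ f ≠ 0 := pow_ne_zero _ hp.out.ne_zero
  have h1 : PowerSeries.constantCoeff (hO.sigmaR k γ (PowerSeries.X ^ p ^ f)) = 0 := by
    rw [map_pow, hO.sigmaR_X, map_pow, hO.constantCoeff_brk, zero_pow h0]
  have h2 : PowerSeries.constantCoeff
      (substHom (PowerSeries.X ^ p ^ f) (constantCoeff_X_pow h0) (brk p f k γ)) = 0 := by
    rw [substHom_X_pow h0, hO.expand_brk, map_pow, hO.constantCoeff_brk, zero_pow h0]
  rw [phiR_apply, phiR_apply, ← substHom_X_pow h0, ← substHom_X_pow h0, sigmaR,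
    substHom_comp _ _ h1, substHom_comp _ _ h2]
  refine substHom_congr ?_ _ _ F
  rw [map_pow, substHom_X_pow h0, hO.expand_brk, substHom_X]

theorem IsUnramifiedBase.sigmaL_phiL (hO : IsUnramifiedBase O p f) (γ : Oˣ) (c : k⸨X⸩) :
    hO.sigmaL k γ (phiL k p f c) = phiL k p f (hO.sigmaL k γ c) := by
  have : (hO.sigmaL k γ).comp (phiL k p f) = (phiL k p f).comp (hO.sigmaL k γ) :=
    laurentHom_ext fun F => by
      rw [RingHom.comp_apply, RingHom.comp_apply, phiL_toL, hO.sigmaL_toL, hO.sigmaL_toL, phiL_toL,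
        hO.sigmaR_phiR]
  exact congrArg (fun τ => τ c) this

end Sigma

/-! ### The `(φ,Γ)`-module structure deduced from an action on `Δ`, and its uniqueness. -/

section Associated

variable {O : Type*} [CommRing O] [IsDomain O] {p f : ℕ} [hp : Fact p.Prime]
  {k : Type*} [Field k] [Algebra O k] [CharP k p]
  {P : Params k} {C : Scalars k p f P.ell} {A : Aux}
  {T : Oˣ → Delta p f P C A → Delta p f P C A}

omit [CharP k p] in
theorem deltaPhi_genD (i : Fin 2) (s : ℕ) :
    deltaPhi p f P C A (genD p f P C A i s) = genD p f P C A i (s + 1) := by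
  rw [genD, deltaPhi_deltaMk, phiM_single, map_one]; rfl

omit [CharP k p] [IsDomain O] in
-- The classes of `x` and `y` generate `Δ` over `k⟦t⟧[φ]`, and the action is prescribed on them.
theorem IsGammaAction.eq {T' : Oˣ → Delta p f P C A → Delta p f P C A}
    (hT : IsGammaAction p f P C A T) (hT' : IsGammaAction p f P C A T') : T = T' := by
  funext γ z
  have h1 : ∀ i s, T γ (genD p f P C A i s) = T' γ (genD p f P C A i s) := by
    intro i s
    induction s with
    | zero =>
      fin_cases i
      · exact (hT.on_x γ).trans (hT'.on_x γ).symm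
      · exact (hT.on_y γ).trans (hT'.on_y γ).symm
    | succ s ih => rw [← deltaPhi_genD, hT.phi, hT'.phi, ih]
  have h0 : T γ 0 = T' γ 0 := by
    have e1 := hT.add γ 0 0
    have e2 := hT'.add γ 0 0
    rw [add_zero] at e1 e2
    rw [left_eq_add.1 e1, left_eq_add.1 e2]
  obtain ⟨m, rfl⟩ := deltaMk_surjective z
  induction m using Finsupp.induction_linear with
  | zero => exact h0
  | add m m' h h' => rw [deltaMk_add, hT.add, hT'.add, h, h']
  | single i F => obtain ⟨i, s⟩ := i; rw [deltaMk_single, hT.smul, hT'.smul, h1]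

omit [CharP k p] in
theorem IsGammaAction.smul' (hO : IsUnramifiedBase O p f) (hT : IsGammaAction p f P C A T) (γ : Oˣ)
    (F : k⟦X⟧) (z : Delta p f P C A) : T γ (F • z) = hO.sigmaR k γ F • T γ z := by
  rw [hT.smul, hO.subst_brk]

omit [CharP k p] in
theorem IsGammaAction.exists_dual (hO : IsUnramifiedBase O p f) (hT : IsGammaAction p f P C A T) (γ : Oˣ)
    (l : TDual k (Delta p f P C A)) :
    ∃ l' : TDual k (Delta p f P C A), ∀ x, l'.eval x = l.eval (T γ⁻¹ x) :=
  TDual.exists_mk _ (fun x y => by rw [hT.add, TDual.eval_add])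
    (fun c x => by rw [hT.smul' hO, hO.sigmaR_C, TDual.eval_C_smul])

/-- The action of `γ` on `Δ*`. -/
noncomputable def IsGammaAction.dual (hO : IsUnramifiedBase O p f) (hT : IsGammaAction p f P C A T) (γ : Oˣ) :
    TDual k (Delta p f P C A) →+ TDual k (Delta p f P C A) :=
  AddMonoidHom.mk' (fun l => (hT.exists_dual hO γ l).choose) fun l l' => TDual.ext fun x => by
    rw [TDual.add_eval, (hT.exists_dual hO γ _).choose_spec, (hT.exists_dual hO γ _).choose_spec,
      (hT.exists_dual hO γ _).choose_spec, TDual.add_eval]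

omit [CharP k p] in
theorem IsGammaAction.dual_eval (hO : IsUnramifiedBase O p f) (hT : IsGammaAction p f P C A T) (γ : Oˣ)
    (l : TDual k (Delta p f P C A)) (x : Delta p f P C A) :
    (hT.dual hO γ l).eval x = l.eval (T γ⁻¹ x) := (hT.exists_dual hO γ l).choose_spec x

omit [CharP k p] in
theorem IsGammaAction.dual_smul (hO : IsUnramifiedBase O p f) (hT : IsGammaAction p f P C A T) (γ : Oˣ)
    (F : k⟦X⟧) (l : TDual k (Delta p f P C A)) :
    hT.dual hO γ (F • l) = hO.sigmaR k γ F • hT.dual hO γ l := by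
  refine TDual.ext fun x => ?_
  rw [hT.dual_eval, TDual.eval_smul, TDual.eval_smul, hT.dual_eval, hT.smul' hO, hO.sigmaR_inv]

/-- The action of `γ` on `Δ* ⊗ k((t))`. -/
noncomputable def IsGammaAction.actD (hO : IsUnramifiedBase O p f) (hT : IsGammaAction p f P C A T) (γ : Oˣ) :
    DualLaurent k (Delta p f P C A) →+ DualLaurent k (Delta p f P C A) :=
  TensorProduct.liftAddHom
    (AddMonoidHom.mk' (fun c => AddMonoidHom.mk'
      (fun l => (hO.sigmaL k γ c ⊗ₜ[k⟦X⟧] hT.dual hO γ l : DualLaurent k (Delta p f P C A)))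
      fun l l' => by rw [map_add, TensorProduct.tmul_add])
      fun c c' => by
        ext l
        change hO.sigmaL k γ (c + c') ⊗ₜ[k⟦X⟧] hT.dual hO γ l = _
        rw [map_add, TensorProduct.add_tmul]; rfl)
    fun F c l => by
      change hO.sigmaL k γ (F • c) ⊗ₜ[k⟦X⟧] hT.dual hO γ l = hO.sigmaL k γ c ⊗ₜ[k⟦X⟧] hT.dual hO γ (F • l)
      rw [hT.dual_smul, Algebra.smul_def, map_mul, hO.sigmaL_toL, TensorProduct.tmul_smul,
        TensorProduct.smul_tmul', Algebra.smul_def]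

omit [CharP k p] in
theorem IsGammaAction.actD_tmul (hO : IsUnramifiedBase O p f) (hT : IsGammaAction p f P C A T) (γ : Oˣ)
    (c : k⸨X⸩) (l : TDual k (Delta p f P C A)) :
    hT.actD hO γ (c ⊗ₜ[k⟦X⟧] l) = hO.sigmaL k γ c ⊗ₜ[k⟦X⟧] hT.dual hO γ l := rfl

/-- `[γ] = t v` with a unit `v`. -/
theorem exists_eq_X_mul_unit {g : k⟦X⟧} (h0 : PowerSeries.constantCoeff g = 0)
    (h1 : PowerSeries.coeff 1 g ≠ 0) : ∃ v : k⟦X⟧ˣ, g = PowerSeries.X * (v : k⟦X⟧) := by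
  obtain ⟨w, rfl⟩ := PowerSeries.X_dvd_iff.2 h0
  have hw : IsUnit w := by
    rw [PowerSeries.isUnit_iff_constantCoeff, isUnit_iff_ne_zero]
    rwa [show (1 : ℕ) = 0 + 1 from rfl, PowerSeries.coeff_succ_X_mul,
      PowerSeries.coeff_zero_eq_constantCoeff_apply] at h1
  exact ⟨hw.unit, rfl⟩

/-- If `φ(l ⊗ 1) = t^(-m)μ`, then applying `γ` gives `[γ]^(-m)` times the transform of `μ`, and `[γ]
= tv`; this explains the factor `v^(-m)`. The content is that `ψ` commutes with `γ⁻¹`. -/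
theorem IsGammaAction.dual_phiSpec (hO : IsUnramifiedBase O p f) (hT : IsGammaAction p f P C A T) (γ : Oˣ)
    {l : TDual k (Delta p f P C A)} {m : ℕ} {μ : TDual k (Delta p f P C A)} (hs : PhiSpec l m μ)
    {v : k⟦X⟧ˣ} (hv : brk p f k γ = PowerSeries.X * (v : k⟦X⟧)) :
    PhiSpec (hT.dual hO γ l) m (((v⁻¹ : k⟦X⟧ˣ) : k⟦X⟧) ^ m • hT.dual hO γ μ) := by
  intro b x
  have h1 : hO.sigmaR k γ⁻¹ (((v⁻¹ : k⟦X⟧ˣ) : k⟦X⟧) ^ m) * hO.sigmaR k γ⁻¹ (v : k⟦X⟧) ^ m = 1 := by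
    rw [map_pow, ← mul_pow, ← map_mul, Units.inv_mul, map_one, one_pow]
  have h2 : PowerSeries.X = brk p f k γ⁻¹ * hO.sigmaR k γ⁻¹ (v : k⟦X⟧) := by
    rw [← hO.sigmaR_X γ⁻¹, ← map_mul, ← hv, ← hO.sigmaR_X, hO.sigmaR_inv]
  have h3 : PowerSeries.X ^ m * hO.sigmaR k γ⁻¹ (((v⁻¹ : k⟦X⟧ˣ) : k⟦X⟧) ^ m) = brk p f k γ⁻¹ ^ m := by
    conv_lhs => rw [h2]
    rw [mul_pow, mul_assoc, mul_comm (_ ^ m) (hO.sigmaR k γ⁻¹ _), h1, mul_one]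
  rw [TDual.eval_smul, hT.dual_eval, hT.dual_eval, hT.smul' hO, hT.smul' hO, hT.phi, hT.smul' hO,
    ← mul_smul, hs, ← mul_assoc, h3]
  congr 2
  have h4 := hO.psiR_substHom (k := k) γ⁻¹ (PowerSeries.X ^ m * b)
  change psiR k p f (hO.sigmaR k γ⁻¹ _) = hO.sigmaR k γ⁻¹ _ at h4
  rw [← h4, map_mul, map_pow, hO.sigmaR_X]

theorem IsGammaAction.actD_phiD (hO : IsUnramifiedBase O p f) (h : LatticeStable p f P C A)
    (hT : IsGammaAction p f P C A T) (γ : Oˣ) (d : DualLaurent k (Delta p f P C A)) :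
    hT.actD hO γ (h.phiD d) = h.phiD (hT.actD hO γ d) := by
  obtain ⟨M, hM⟩ := dualLaurent_exists_eq d
  obtain ⟨l, rfl⟩ := hM M le_rfl
  have e : ∀ (c : k⸨X⸩) (l : TDual k (Delta p f P C A)), c ⊗ₜ[k⟦X⟧] l = c • ((1 : k⸨X⸩) ⊗ₜ[k⟦X⟧] l) := by
    intro c l; rw [TensorProduct.smul_tmul', smul_eq_mul, mul_one]
  obtain ⟨m, μ, hs⟩ := h.exists_phiSpec l
  obtain ⟨v, hv⟩ := exists_eq_X_mul_unit (hO.constantCoeff_brk (k := k) γ) (hO.brkCoeff_one_ne_zero γ)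
  have hs' := (h.phiD_one_tmul_iff _ _ _).1 (hT.dual_phiSpec hO γ hs hv)
  have hX : hO.sigmaL k γ ((algebraMap k⟦X⟧ k⸨X⸩ PowerSeries.X)⁻¹ ^ m) =
      (algebraMap k⟦X⟧ k⸨X⸩ PowerSeries.X)⁻¹ ^ m * toL (((v⁻¹ : k⟦X⟧ˣ) : k⟦X⟧) ^ m) := by
    have h1 : toL (v : k⟦X⟧) * toL ((v⁻¹ : k⟦X⟧ˣ) : k⟦X⟧) = (1 : k⸨X⸩) := by
      rw [← map_mul, Units.mul_inv, map_one]
    rw [map_pow, map_inv₀, hO.sigmaL_toL, hO.sigmaR_X, hv, (toL (k := k)).map_mul,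
      (toL (k := k)).map_pow, ← mul_pow, mul_inv, eq_comm, eq_inv_of_mul_eq_one_right h1]
  rw [e, h.phiD_smul, (h.phiD_one_tmul_iff _ _ _).1 hs, TensorProduct.smul_tmul', smul_eq_mul,
    hT.actD_tmul hO, map_mul, hX, ← e, hT.actD_tmul hO, e (hO.sigmaL k γ _), h.phiD_smul, hs',
    hO.sigmaL_phiL, TensorProduct.tmul_smul, TensorProduct.smul_tmul', TensorProduct.smul_tmul',
    smul_eq_mul, Algebra.smul_def]
  congr 1; ring

omit [CharP k p] in
theorem IsGammaAction.dual_one (hO : IsUnramifiedBase O p f) (hT : IsGammaAction p f P C A T)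
    (l : TDual k (Delta p f P C A)) : hT.dual hO 1 l = l :=
  TDual.ext fun x => by rw [hT.dual_eval, inv_one, hT.one]

omit [CharP k p] in
theorem IsGammaAction.dual_mul (hO : IsUnramifiedBase O p f) (hT : IsGammaAction p f P C A T) (γ γ' : Oˣ)
    (l : TDual k (Delta p f P C A)) : hT.dual hO (γ * γ') l = hT.dual hO γ (hT.dual hO γ' l) :=
  TDual.ext fun x => by rw [hT.dual_eval, hT.dual_eval, hT.dual_eval, mul_inv_rev, hT.mul]

/-- The étale `(φ,Γ)`-module attached to `Δ`. -/
noncomputable def IsGammaAction.structD (hO : IsUnramifiedBase O p f) (h : LatticeStable p f P C A)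
    (hT : IsGammaAction p f P C A T) : EtalePhiGamma O k p f (DualLaurent k (Delta p f P C A)) where
  phi := h.phiD
  act γ := hT.actD hO γ
  finite := Module.Finite.equiv h.kappa.symm
  phi_add := h.phiD_add
  phi_smul F d := by rw [h.phiD_smul, laurentSubst_phi]
  act_add γ := map_add _
  act_smul γ F d := by
    rw [hO.laurentSubst_brk]
    obtain ⟨M, hM⟩ := dualLaurent_exists_eq d
    obtain ⟨l, rfl⟩ := hM M le_rfl
    rw [TensorProduct.smul_tmul', hT.actD_tmul, hT.actD_tmul, TensorProduct.smul_tmul', smul_eq_mul,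
      map_mul, smul_eq_mul]
  act_one d := by
    obtain ⟨M, hM⟩ := dualLaurent_exists_eq d
    obtain ⟨l, rfl⟩ := hM M le_rfl
    rw [hT.actD_tmul, hT.dual_one, hO.sigmaL_one]
  act_mul γ γ' d := by
    obtain ⟨M, hM⟩ := dualLaurent_exists_eq d
    obtain ⟨l, rfl⟩ := hM M le_rfl
    rw [hT.actD_tmul, hT.actD_tmul, hT.actD_tmul, hT.dual_mul, hO.sigmaL_mul]
  act_phi γ d := hT.actD_phiD hO h γ d
  etale := h.phiD_etale

theorem IsGammaAction.structD_isAssociated (hO : IsUnramifiedBase O p f) (h : LatticeStable p f P C A)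
    (hT : IsGammaAction p f P C A T) : IsAssociated p f P C A (hT.structD hO h) := by
  refine ⟨T, hT, fun γ l => ⟨hT.dual hO γ l, hT.dual_eval hO γ l, ?_⟩, fun l => ?_⟩
  · change hT.actD hO γ _ = _
    rw [hT.actD_tmul, map_one]
  · obtain ⟨m, μ, hs⟩ := h.exists_phiSpec l
    exact ⟨m, μ, hs, (h.phiD_one_tmul_iff _ _ _).1 hs⟩

/-- Semilinearity reduces to elements `1 ⊗ l`, where the conditions in `IsAssociated` leave no
choice. The remaining fields of the structure are propositions. -/
theorem IsAssociated.eq_structD (hO : IsUnramifiedBase O p f) (h : LatticeStable p f P C A)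
    (hT : IsGammaAction p f P C A T) {S : EtalePhiGamma O k p f (DualLaurent k (Delta p f P C A))}
    (hS : IsAssociated p f P C A S) : S = hT.structD hO h := by
  obtain ⟨T', hT', hact, hphi⟩ := hS
  obtain rfl := hT'.eq hT
  have e : ∀ (c : k⸨X⸩) (l : TDual k (Delta p f P C A)), c ⊗ₜ[k⟦X⟧] l = c • ((1 : k⸨X⸩) ⊗ₜ[k⟦X⟧] l) := by
    intro c l; rw [TensorProduct.smul_tmul', smul_eq_mul, mul_one]
  have h1 : S.phi = (hT'.structD hO h).phi := by
    funext d
    obtain ⟨M, hM⟩ := dualLaurent_exists_eq d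
    obtain ⟨l, rfl⟩ := hM M le_rfl
    obtain ⟨m, μ, hs, hμ⟩ := hphi l
    rw [e, S.phi_smul, (hT'.structD hO h).phi_smul, hμ]
    congr 1
    exact ((h.phiD_one_tmul_iff _ _ _).1 hs).symm
  have h2 : S.act = (hT'.structD hO h).act := by
    funext γ d
    obtain ⟨M, hM⟩ := dualLaurent_exists_eq d
    obtain ⟨l, rfl⟩ := hM M le_rfl
    obtain ⟨l', hl', hμ⟩ := hact γ l
    have h3 : l' = hT'.dual hO γ l := TDual.ext fun x => by rw [hl', hT'.dual_eval]
    rw [e, S.act_smul, (hT'.structD hO h).act_smul, hμ, h3]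
    congr 1
    change _ = hT'.actD hO γ _
    rw [hT'.actD_tmul, map_one]
  obtain ⟨phi, act, _, _, _, _, _, _, _, _, _⟩ := S
  cases h1
  cases h2
  rfl

theorem IsGammaAction.existsUnique_isAssociated (hO : IsUnramifiedBase O p f)
    (h : LatticeStable p f P C A) (hT : IsGammaAction p f P C A T) :
    ∃! S : EtalePhiGamma O k p f (DualLaurent k (Delta p f P C A)), IsAssociated p f P C A S :=
  ⟨hT.structD hO h, hT.structD_isAssociated hO h, fun _ hS => hS.eq_structD hO h hT⟩

end Associated


/-! ### The factorization `[γ] = a t U`. -/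

section UnitPart

variable {O : Type*} [CommRing O] [IsDomain O] {p f : ℕ} [hp : Fact p.Prime]
  {k : Type*} [Field k] [Algebra O k] [CharP k p]

variable (p f k) in
/-- The one-unit `U` with `[γ] = a_{γ,1} t U`. -/
noncomputable def brkU (γ : Oˣ) : k⟦X⟧ :=
  PowerSeries.C (brkCoeff p f k γ 1)⁻¹ * PowerSeries.mk fun n => PowerSeries.coeff (n + 1) (brk p f k γ)

omit [CharP k p] in
theorem IsUnramifiedBase.brk_eq_brkU (hO : IsUnramifiedBase O p f) (γ : Oˣ) :
    brk p f k γ = PowerSeries.C (brkCoeff p f k γ 1) * PowerSeries.X * brkU p f k γ := by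
  have h1 : PowerSeries.C (brkCoeff p f k γ 1) * PowerSeries.C (brkCoeff p f k γ 1)⁻¹ = (1 : k⟦X⟧) := by
    rw [← map_mul, mul_inv_cancel₀ (hO.brkCoeff_one_ne_zero γ), map_one]
  have h2 := PowerSeries.eq_X_mul_shift_add_const (brk p f k γ)
  rw [hO.constantCoeff_brk, map_zero, add_zero] at h2
  rw [brkU]
  conv_lhs => rw [h2]
  linear_combination -(PowerSeries.X * PowerSeries.mk fun n => PowerSeries.coeff (n + 1) (brk p f k γ)) * h1

omit [CharP k p] in
theorem IsUnramifiedBase.brkU_eq_of (hO : IsUnramifiedBase O p f) (γ : Oˣ) {U : k⟦X⟧}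
    (hU : brk p f k γ = PowerSeries.C (brkCoeff p f k γ 1) * PowerSeries.X * U) :
    brkU p f k γ = U := by
  rw [hO.brk_eq_brkU] at hU
  refine mul_left_cancel₀ (mul_ne_zero ?_ PowerSeries.X_ne_zero) hU
  rw [Ne, map_eq_zero_iff _ PowerSeries.C_injective]
  exact hO.brkCoeff_one_ne_zero γ

theorem IsUnramifiedBase.brkU_expansion (hO : IsUnramifiedBase O p f) (γ : Oˣ) :
    ∃ w : k⟦X⟧, brkU p f k γ = 1 + PowerSeries.C (brkRatio p f k γ) * PowerSeries.X ^ (p ^ f - 1) -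
        PowerSeries.C (brkRatio p f k γ ^ p ^ (f - 1)) *
          PowerSeries.X ^ ((p ^ f - 1) * (1 + p ^ (f - 1))) +
        PowerSeries.X ^ ((p ^ f - 1) * (1 + 2 * p ^ (f - 1))) * w := by
  obtain ⟨U, w, h1, h2⟩ := hO.exists_brk_expansion (k := k) γ
  exact ⟨w, by rw [hO.brkU_eq_of γ h1, h2]⟩

theorem IsUnramifiedBase.constantCoeff_brkU (hO : IsUnramifiedBase O p f) (γ : Oˣ) :
    PowerSeries.constantCoeff (brkU p f k γ) = 1 := by
  obtain ⟨w, hw⟩ := hO.brkU_expansion (k := k) γ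
  have hq := two_le_q (p := p) hO.f_pos
  have h1 : (p ^ f - 1) ≠ 0 := by omega
  rw [hw]
  simp [h1]

theorem IsUnramifiedBase.phiR_brkU (hO : IsUnramifiedBase O p f) (γ : Oˣ) :
    phiR k p f (brkU p f k γ) = brkU p f k γ ^ (p ^ f) := by
  have h := hO.expand_brk (k := k) γ (pow_ne_zero f hp.out.ne_zero)
  rw [← phiR_apply, hO.brk_eq_brkU, map_mul, map_mul, mul_pow, mul_pow, ← map_pow, hO.brkCoeff_pow,
    phiR_C, ← pow_one (PowerSeries.X : k⟦X⟧), phiR_X_pow, ← pow_mul] at h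
  refine mul_left_cancel₀ (mul_ne_zero (a := PowerSeries.C (brkCoeff p f k γ 1)) ?_
    (pow_ne_zero (p ^ f * 1) PowerSeries.X_ne_zero)) ?_
  · rw [Ne, map_eq_zero_iff _ PowerSeries.C_injective]
    exact hO.brkCoeff_one_ne_zero γ
  · rw [h, mul_comm (p ^ f) 1]

theorem IsUnramifiedBase.brkCoeff_one_mul (hO : IsUnramifiedBase O p f) (γ γ' : Oˣ) :
    brkCoeff p f k (γ * γ') 1 = brkCoeff p f k γ 1 * brkCoeff p f k γ' 1 := by
  rw [hO.brkCoeff_one, hO.brkCoeff_one, hO.brkCoeff_one, Units.val_mul, map_mul]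

theorem IsUnramifiedBase.brkU_mul (hO : IsUnramifiedBase O p f) (γ γ' : Oˣ) :
    brkU p f k (γ * γ') = brkU p f k γ * hO.sigmaR k γ (brkU p f k γ') := by
  refine hO.brkU_eq_of _ ?_
  have h : brk p f k (γ * γ') = hO.sigmaR k γ (brk p f k γ') := hO.brk_mul γ γ'
  rw [h, hO.brk_eq_brkU γ', map_mul, map_mul, hO.sigmaR_C, hO.sigmaR_X, hO.brk_eq_brkU γ,
    hO.brkCoeff_one_mul, map_mul]
  ring

theorem IsUnramifiedBase.brkU_one (hO : IsUnramifiedBase O p f) : brkU p f k (1 : Oˣ) = 1 := by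
  refine hO.brkU_eq_of _ ?_
  rw [hO.brk_one, hO.brkCoeff_one, Units.val_one, map_one, map_one, one_mul, mul_one]

theorem IsUnramifiedBase.brkRatio_one (hO : IsUnramifiedBase O p f) :
    brkRatio p f k (1 : Oˣ) = 0 := by
  have := hO.brkRatio_mul (k := k) 1 1
  rwa [mul_one, left_eq_add] at this

theorem IsUnramifiedBase.tDivBrk_eq (hO : IsUnramifiedBase O p f) (γ : Oˣ) :
    PowerSeries.C (brkCoeff p f k γ 1) * tDivBrk p f k γ * brkU p f k γ = 1 := by
  have ha := hO.brkCoeff_one_ne_zero (k := k) γ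
  have h1 : PowerSeries.C (brkCoeff p f k γ 1) * PowerSeries.C (brkCoeff p f k γ 1)⁻¹ = (1 : k⟦X⟧) := by
    rw [← map_mul, mul_inv_cancel₀ ha, map_one]
  have h2 : tDivBrk p f k γ * (PowerSeries.mk fun n => PowerSeries.coeff (n + 1) (brk p f k γ)) = 1 := by
    refine PowerSeries.inv_mul_cancel _ ?_
    rw [← PowerSeries.coeff_zero_eq_constantCoeff_apply, PowerSeries.coeff_mk]
    exact ha
  rw [brkU]
  linear_combination tDivBrk p f k γ * (PowerSeries.mk fun n => PowerSeries.coeff (n + 1) (brk p f k γ)) * h1 + h2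

variable (p f k) in
/-- The image of `a_{γ,1}` in `k((t))`. -/
noncomputable def aL (γ : Oˣ) : k⸨X⸩ := toL (PowerSeries.C (brkCoeff p f k γ 1))

variable (p f k) in
/-- The image of `U` in `k((t))`. -/
noncomputable def uL (γ : Oˣ) : k⸨X⸩ := toL (brkU p f k γ)

omit [CharP k p] in
theorem IsUnramifiedBase.aL_ne_zero (hO : IsUnramifiedBase O p f) (γ : Oˣ) : aL p f k γ ≠ 0 :=
  toL_C_ne_zero (hO.brkCoeff_one_ne_zero γ)

theorem IsUnramifiedBase.uL_ne_zero (hO : IsUnramifiedBase O p f) (γ : Oˣ) : uL p f k γ ≠ 0 := by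
  intro h
  have h1 := hO.constantCoeff_brkU (k := k) γ
  rw [toL_injective (h.trans (map_zero toL).symm), map_zero] at h1
  exact zero_ne_one h1

theorem IsUnramifiedBase.toL_brk (hO : IsUnramifiedBase O p f) (γ : Oˣ) :
    toL (brk p f k γ) = aL p f k γ * tpow k 1 * uL p f k γ := by
  rw [hO.brk_eq_brkU, map_mul, map_mul, toL_X]; rfl

theorem IsUnramifiedBase.toL_tDivBrk (hO : IsUnramifiedBase O p f) (γ : Oˣ) :
    aL p f k γ * toL (tDivBrk p f k γ) = (uL p f k γ)⁻¹ := by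
  refine eq_inv_of_mul_eq_one_left ?_
  rw [aL, uL, ← map_mul, ← map_mul, hO.tDivBrk_eq, map_one]

theorem IsUnramifiedBase.sigmaL_tpow (hO : IsUnramifiedBase O p f) (γ : Oˣ) (n : ℤ) :
    hO.sigmaL k γ (tpow k n) = aL p f k γ ^ n * tpow k n * uL p f k γ ^ n := by
  rw [sigmaL, laurentHom_tpow, hO.toL_brk, mul_zpow, mul_zpow, tpow_zpow]

omit [CharP k p] in
theorem IsUnramifiedBase.sigmaL_aL (hO : IsUnramifiedBase O p f) (γ γ' : Oˣ) :
    hO.sigmaL k γ (aL p f k γ') = aL p f k γ' := by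
  rw [aL, hO.sigmaL_toL, hO.sigmaR_C]

theorem IsUnramifiedBase.aL_mul (hO : IsUnramifiedBase O p f) (γ γ' : Oˣ) :
    aL p f k (γ * γ') = aL p f k γ * aL p f k γ' := by
  rw [aL, hO.brkCoeff_one_mul, map_mul, map_mul]; rfl

theorem IsUnramifiedBase.uL_mul (hO : IsUnramifiedBase O p f) (γ γ' : Oˣ) :
    uL p f k (γ * γ') = uL p f k γ * hO.sigmaL k γ (uL p f k γ') := by
  rw [uL, hO.brkU_mul, map_mul, uL, uL, hO.sigmaL_toL]

theorem IsUnramifiedBase.phiL_uL (hO : IsUnramifiedBase O p f) (γ : Oˣ) :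
    phiL k p f (uL p f k γ) = uL p f k γ ^ (p ^ f) := by
  rw [uL, phiL_toL, hO.phiR_brkU, map_pow]

omit [IsDomain O] [CharP k p] in
theorem phiL_aL (γ : Oˣ) : phiL k p f (aL p f k γ) = aL p f k γ := phiL_toL_C _

omit [IsDomain O] in
theorem IsUnramifiedBase.aL_pow_q (hO : IsUnramifiedBase O p f) (γ : Oˣ) :
    aL p f k γ ^ (p ^ f) = aL p f k γ := by
  rw [aL, ← map_pow, ← map_pow, hO.brkCoeff_pow]

theorem IsUnramifiedBase.aL_pow_xi (hO : IsUnramifiedBase O p f) (γ : Oˣ) :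
    aL p f k γ ^ (p ^ f - 1) = 1 := by
  have hq := two_le_q (p := p) hO.f_pos
  refine mul_right_cancel₀ (hO.aL_ne_zero (k := k) γ) ?_
  rw [← pow_succ, Nat.sub_add_cancel (by omega), hO.aL_pow_q, one_mul]

/-- As `a_{γ,1}` lies in the image of `𝔽_q^×`, powers of it depend only on the exponent modulo `ξ`.
-/
theorem IsUnramifiedBase.aL_zpow_eq_one (hO : IsUnramifiedBase O p f) (γ : Oˣ) {n : ℤ}
    (hn : xi p f ∣ n) : aL p f k γ ^ n = 1 := by
  have hq := two_le_q (p := p) hO.f_pos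
  obtain ⟨m, rfl⟩ := hn
  have : xi p f = ((p ^ f - 1 : ℕ) : ℤ) := by
    rw [xi]; push_cast [Nat.cast_sub (by omega : 1 ≤ p ^ f)]; ring
  rw [this, zpow_mul, zpow_natCast, hO.aL_pow_xi, one_zpow]

theorem IsUnramifiedBase.aL_one (hO : IsUnramifiedBase O p f) : aL p f k (1 : Oˣ) = 1 := by
  rw [aL, hO.brkCoeff_one, Units.val_one, map_one, map_one, map_one]

theorem IsUnramifiedBase.uL_one (hO : IsUnramifiedBase O p f) : uL p f k (1 : Oˣ) = 1 := by
  rw [uL, hO.brkU_one, map_one]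

end UnitPart

/-! ### From semilinear maps of the free module to an action on `Δ`. -/

section Twist

variable {O : Type*} [CommRing O] [IsDomain O] {p f : ℕ} [hp : Fact p.Prime]
  {k : Type*} [Field k] [Algebra O k] [CharP k p]

/-- The semilinear endomorphism `F φ^s z ↦ F([γ]) φ^s(τ z)` of the free module. -/
noncomputable def IsUnramifiedBase.twistM (hO : IsUnramifiedBase O p f) (γ : Oˣ) (τ : Fin 2 → FreeM k) :
    FreeM k →+ FreeM k :=
  Finsupp.liftAddHom fun i : Fin 2 × ℕ => AddMonoidHom.mk'
    (fun F : k⟦X⟧ => hO.sigmaR k γ F • (phiM k p f)^[i.2] (τ i.1)) fun F G => by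
      rw [map_add, add_smul]

omit [CharP k p] in
theorem IsUnramifiedBase.twistM_single (hO : IsUnramifiedBase O p f) (γ : Oˣ) (τ : Fin 2 → FreeM k)
    (i : Fin 2) (s : ℕ) (F : k⟦X⟧) : hO.twistM γ τ (Finsupp.single (i, s) F) =
      hO.sigmaR k γ F • (phiM k p f)^[s] (τ i) :=
  Finsupp.liftAddHom_apply_single _ _ _

omit [CharP k p] in
theorem IsUnramifiedBase.twistM_smul (hO : IsUnramifiedBase O p f) (γ : Oˣ) (τ : Fin 2 → FreeM k)
    (F : k⟦X⟧) (m : FreeM k) : hO.twistM γ τ (F • m) = hO.sigmaR k γ F • hO.twistM γ τ m := by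
  induction m using Finsupp.induction_linear with
  | zero => rw [smul_zero, map_zero, smul_zero]
  | add m m' h h' => rw [smul_add, map_add, h, h', map_add, smul_add]
  | single i G =>
    obtain ⟨i, s⟩ := i
    rw [Finsupp.smul_single, hO.twistM_single, hO.twistM_single, smul_smul, smul_eq_mul, map_mul]

theorem IsUnramifiedBase.twistM_phiM (hO : IsUnramifiedBase O p f) (γ : Oˣ) (τ : Fin 2 → FreeM k)
    (m : FreeM k) : hO.twistM γ τ (phiM k p f m) = phiM k p f (hO.twistM γ τ m) := by
  induction m using Finsupp.induction_linear with
  | zero => rw [map_zero, map_zero, map_zero]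
  | add m m' h h' => rw [map_add, map_add, h, h', map_add, map_add]
  | single i G =>
    obtain ⟨i, s⟩ := i
    rw [phiM_single, hO.twistM_single, hO.twistM_single, map_smulₛₗ, hO.sigmaR_phiR,
      Function.iterate_succ_apply']

theorem IsUnramifiedBase.twistM_phiM_iterate (hO : IsUnramifiedBase O p f) (γ : Oˣ) (τ : Fin 2 → FreeM k)
    (n : ℕ) (m : FreeM k) : hO.twistM γ τ ((phiM k p f)^[n] m) = (phiM k p f)^[n] (hO.twistM γ τ m) := by
  induction n with
  | zero => rfl
  | succ n ih => rw [Function.iterate_succ_apply', hO.twistM_phiM, ih, Function.iterate_succ_apply']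

variable {P : Params k} {C : Scalars k p f P.ell} {A : Aux}

/-- A family of semilinear endomorphisms of the free module that preserves `∇` and satisfies
the group law on the generators modulo `∇` induces an action on `Δ`. -/
theorem exists_isGammaAction_of_twist (hO : IsUnramifiedBase O p f) (τ : Oˣ → Fin 2 → FreeM k)
    (hx : ∀ γ : Oˣ, τ γ 0 = (PowerSeries.C (brkCoeff p f k γ 1 ^ P.u) : k⟦X⟧) •
        (Finsupp.single (0, 0) (PowerSeries.C (brkCoeff p f k γ 1) * tDivBrk p f k γ)
          - Finsupp.single (1, A.N)
              (PowerSeries.C (C.c * (P.beta : k) ^ (1 - (A.N : ℤ))) * seriesG p f k A.N γ)))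
    (hy : ∀ γ : Oˣ, τ γ 1 = Finsupp.single (1, 0)
        (PowerSeries.C (brkCoeff p f k γ 1 ^ ((P.u : ℤ) - P.ell + 1)) * tDivBrk p f k γ))
    (hgen : ∀ γ : Oˣ, ∀ m ∈ nablaGens p f P C A, deltaMk p f P C A (hO.twistM γ (τ γ) m) = 0)
    (hone : ∀ i, deltaMk p f P C A (τ 1 i) = genD p f P C A i 0)
    (hmul : ∀ (γ γ' : Oˣ) i, deltaMk p f P C A (τ (γ * γ') i) =
      deltaMk p f P C A (hO.twistM γ (τ γ) (τ γ' i))) :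
    ∃ T : Oˣ → Delta p f P C A → Delta p f P C A, IsGammaAction p f P C A T := by
  have hpres : ∀ (γ : Oˣ) m m', deltaMk p f P C A m = deltaMk p f P C A m' →
      deltaMk p f P C A (hO.twistM γ (τ γ) m) = deltaMk p f P C A (hO.twistM γ (τ γ) m') := by
    intro γ m m' e
    rw [← sub_eq_zero, ← deltaMk_sub, deltaMk_eq_zero] at e
    rw [← sub_eq_zero, ← deltaMk_sub, ← map_sub]
    generalize m - m' = n at e
    induction e using Submodule.span_induction with
    | mem x hx =>
      obtain ⟨j, g, hg, rfl⟩ := hx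
      rw [hO.twistM_phiM_iterate]
      have h1 := hgen γ g hg
      induction j with
      | zero => exact h1
      | succ j ih =>
        rw [Function.iterate_succ_apply', ← deltaPhi_deltaMk, ih]
        exact map_zero (phiQuot k p f (nablaGens p f P C A))
    | zero => rw [map_zero]; rfl
    | add x y _ _ h h' => rw [map_add, deltaMk_add, h, h', add_zero]
    | smul F x _ h => rw [hO.twistM_smul, deltaMk_smul, h, smul_zero]
  choose s hs using deltaMk_surjective (p := p) (f := f) (P := P) (C := C) (A := A)
  set T : Oˣ → Delta p f P C A → Delta p f P C A :=
    fun γ z => deltaMk p f P C A (hO.twistM γ (τ γ) (s z)) with hT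
  have hTm : ∀ (γ : Oˣ) m, T γ (deltaMk p f P C A m) = deltaMk p f P C A (hO.twistM γ (τ γ) m) :=
    fun γ m => hpres γ _ _ (hs _)
  have hadd : ∀ (γ : Oˣ) m m', T γ (m + m') = T γ m + T γ m' := by
    intro γ z z'
    obtain ⟨m, rfl⟩ := deltaMk_surjective z
    obtain ⟨m', rfl⟩ := deltaMk_surjective z'
    rw [← deltaMk_add, hTm, hTm, hTm, map_add, deltaMk_add]
  have hsmul : ∀ (γ : Oˣ) (F : k⟦X⟧) z, T γ (F • z) = hO.sigmaR k γ F • T γ z := by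
    intro γ F z
    obtain ⟨m, rfl⟩ := deltaMk_surjective z
    rw [← deltaMk_smul, hTm, hTm, hO.twistM_smul, deltaMk_smul]
  have hphi : ∀ (γ : Oˣ) z, T γ (deltaPhi p f P C A z) = deltaPhi p f P C A (T γ z) := by
    intro γ z
    obtain ⟨m, rfl⟩ := deltaMk_surjective z
    rw [deltaPhi_deltaMk, hTm, hTm, hO.twistM_phiM, deltaPhi_deltaMk]
  have hgenD : ∀ (γ : Oˣ) i, T γ (genD p f P C A i 0) = deltaMk p f P C A (τ γ i) := by
    intro γ i
    rw [genD, hTm, hO.twistM_single, map_one, one_smul]; rfl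
  -- Two additive maps, semilinear for the same `σ` and commuting with `φ`, agree if they agree on
  -- `x` and `y`. This gives both group laws.
  have hind : ∀ (T₁ T₂ : Delta p f P C A → Delta p f P C A) (σ : k⟦X⟧ → k⟦X⟧),
      (∀ z z', T₁ (z + z') = T₁ z + T₁ z') → (∀ z z', T₂ (z + z') = T₂ z + T₂ z') →
      (∀ F z, T₁ (F • z) = σ F • T₁ z) → (∀ F z, T₂ (F • z) = σ F • T₂ z) →
      (∀ z, T₁ (deltaPhi p f P C A z) = deltaPhi p f P C A (T₁ z)) →
      (∀ z, T₂ (deltaPhi p f P C A z) = deltaPhi p f P C A (T₂ z)) →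
      (∀ i, T₁ (genD p f P C A i 0) = T₂ (genD p f P C A i 0)) → ∀ z, T₁ z = T₂ z := by
    intro T₁ T₂ σ a1 a2 s1 s2 p1 p2 g z
    have h1 : ∀ i s, T₁ (genD p f P C A i s) = T₂ (genD p f P C A i s) := by
      intro i s
      induction s with
      | zero => exact g i
      | succ s ih => rw [← deltaPhi_genD, p1, p2, ih]
    obtain ⟨m, rfl⟩ := deltaMk_surjective z
    induction m using Finsupp.induction_linear with
    | zero =>
      have e1 := a1 0 0
      have e2 := a2 0 0
      rw [add_zero] at e1 e2
      exact (left_eq_add.1 e1).trans (left_eq_add.1 e2).symm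
    | add m m' h h' => rw [deltaMk_add, a1, a2, h, h']
    | single i F => obtain ⟨i, s⟩ := i; rw [deltaMk_single, s1, s2, h1]
  refine ⟨T, hadd, fun γ F z => ?_, ?_, ?_, hphi, fun γ => ?_, fun γ => ?_⟩
  · rw [hsmul, hO.subst_brk]
  · exact hind (T 1) id id (hadd 1) (fun _ _ => rfl)
      (fun F z => by rw [hsmul, hO.sigmaR_one, id]) (fun F z => rfl) (hphi 1) (fun _ => rfl)
      (fun i => by rw [hgenD, hone, id])
  · intro γ γ'
    refine hind _ _ (fun F => hO.sigmaR k (γ * γ') F) (hadd _) ?_ (hsmul _) ?_ (hphi _) ?_ ?_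
    · intro z z'; rw [hadd, hadd]
    · intro F z; rw [hsmul, hsmul, hO.sigmaR_mul]
    · intro z; rw [hphi, hphi]
    · intro i; rw [hgenD, hgenD, hTm, hmul]
  · rw [← hx]; exact hgenD γ 0
  · rw [← hy]; exact hgenD γ 1

end Twist


/-! ### The prescribed formulae for `γ * x`, `γ * y` in the model `k((t))²`. -/

section GammaOnDelta

variable {O : Type*} [CommRing O] [IsDomain O] {p f : ℕ} [hp : Fact p.Prime]
  {k : Type*} [Field k] [Algebra O k] [CharP k p]
  {P : Params k} {C : Scalars k p f P.ell} {A : Aux}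

theorem toL_C_zpow (c : k) (n : ℤ) : toL (PowerSeries.C (c ^ n)) = toL (PowerSeries.C c) ^ n :=
  map_zpow₀ ((toL (k := k)).comp (PowerSeries.C (R := k))) c n

variable (p f) in
/-- The number `p^(f-1) (q-1)/(p-1)`. -/
def cZero : ℤ := (p : ℤ) ^ (f - 1) * (xi p f / ((p : ℤ) - 1))

theorem cast_pow_pow (N : ℕ) : (p : ℤ) ^ (f * N) = (((p ^ f) ^ N : ℕ) : ℤ) := by
  push_cast; rw [pow_mul]

theorem expR_eq (N : ℕ) : expR p f N = (((p ^ f) ^ N : ℕ) : ℤ) - 1 - cZero p f := by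
  rw [expR, cast_pow_pow, cZero]

theorem IsUnramifiedBase.uL_zpow_mem (hO : IsUnramifiedBase O p f) (γ : Oˣ) (n : ℤ) :
    uL p f k γ ^ n ∈ lat k 0 := by
  have h1 : ∀ m : ℕ, uL p f k γ ^ m ∈ lat k 0 := fun m => by rw [uL, ← map_pow]; exact toL_mem_lat _
  obtain ⟨m, rfl | rfl⟩ := n.eq_nat_or_neg
  · rw [zpow_natCast]; exact h1 m
  · rw [zpow_neg, zpow_natCast, ← inv_pow, ← hO.toL_tDivBrk, aL, ← map_mul, ← map_pow]
    exact toL_mem_lat _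

variable (p f k) in
/-- The series `U^(r+1) t^(-p^(f-1)(q-1)/(p-1))`. -/
noncomputable def gammaW (N : ℕ) (γ : Oˣ) : k⸨X⸩ :=
  uL p f k γ ^ (expR p f N + 1) * tpow k (-cZero p f)

variable (p f k) in
/-- The constant `υ^(p^(f-1))` in `k((t))`, `υ = a_{γ,q}/a_{γ,1}`. -/
noncomputable def upsL (γ : Oˣ) : k⸨X⸩ := toL (PowerSeries.C (brkRatio p f k γ ^ p ^ (f - 1)))

variable (P C A) in
/-- The congruence that makes the action of `γ` compatible with the relation `R`. -/
def GammaKey (hO : IsUnramifiedBase O p f) (γ : Oˣ) : Prop :=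
  aL p f k γ ^ (-(P.ell : ℤ)) * hO.sigmaL k γ (btilde p f P C A) - btilde p f P C A -
    toL (PowerSeries.C C.c) * upsL p f k γ *
      (phiL k p f (gammaW p f k A.N γ) - gammaW p f k A.N γ) ∈ lat k A.ny

variable (P C A) in
/-- The image of `γ * x` under the parametrization of `Δ`. -/
noncomputable def gammaX (γ : Oˣ) : k⸨X⸩ × k⸨X⸩ :=
  (aL p f k γ ^ P.u * (uL p f k γ)⁻¹ * tpow k (-1),
    -(aL p f k γ ^ P.u * (toL (PowerSeries.C C.c) * toL (PowerSeries.C (P.beta : k)) * upsL p f k γ) *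
      (uL p f k γ ^ expR p f A.N * tpow k (-1 - cZero p f))))

variable (p f P) in
/-- The image of `γ * y` under the parametrization of `Δ`. -/
noncomputable def gammaY (γ : Oˣ) : k⸨X⸩ × k⸨X⸩ :=
  (0, aL p f k γ ^ ((P.u : ℤ) - P.ell) * (uL p f k γ)⁻¹ * tpow k (-1))

variable (P C A) in
/-- Representatives of `γ * x` and `γ * y` in the free module. -/
noncomputable def gammaTau (γ : Oˣ) : Fin 2 → FreeM k :=
  ![(PowerSeries.C (brkCoeff p f k γ 1 ^ P.u) : k⟦X⟧) •
        (Finsupp.single (0, 0) (PowerSeries.C (brkCoeff p f k γ 1) * tDivBrk p f k γ)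
          - Finsupp.single (1, A.N)
              (PowerSeries.C (C.c * (P.beta : k) ^ (1 - (A.N : ℤ))) * seriesG p f k A.N γ)),
    Finsupp.single (1, 0)
        (PowerSeries.C (brkCoeff p f k γ 1 ^ ((P.u : ℤ) - P.ell + 1)) * tDivBrk p f k γ)]

theorem toV_smul_phiM_iterate (F : k⟦X⟧) (s : ℕ) (m : FreeM k) :
    toV p f P C A (F • (phiM k p f)^[s] m) = toL F • (phiVP p f P C A)^[s] (toV p f P C A m) := by
  rw [map_smul, algebraMap_smul]
  congr 1
  exact freeToV_phiM_iterate _ _ _ s m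

theorem toV_gammaTau_one (hO : IsUnramifiedBase O p f) (γ : Oˣ) :
    toV p f P C A (gammaTau P C A γ 1) = gammaY p f P γ := by
  rw [gammaTau, Matrix.cons_val_one, Matrix.cons_val_fin_one, toV_single_one, gammaY]
  refine Prod.ext rfl ?_
  dsimp only
  rw [pow_zero, pow_zero, map_one, map_one, one_mul, map_mul, toL_C_zpow, ← hO.toL_tDivBrk,
    Nat.cast_one]
  change aL p f k γ ^ _ * _ * _ = _
  rw [zpow_add_one₀ (hO.aL_ne_zero γ)]
  ring

theorem toL_seriesG (hO : IsUnramifiedBase O p f) (N : ℕ) (hr : 0 ≤ expR p f N) (γ : Oˣ) :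
    toL (seriesG p f k N γ) = upsL p f k γ * (uL p f k γ ^ expR p f N * tpow k (expR p f N)) := by
  have ha := hO.aL_ne_zero (k := k) γ
  have hac := hO.brkCoeff_one_ne_zero (k := k) γ
  have e : toL (PowerSeries.C (brkCoeff p f k γ (p ^ f) ^ (p ^ (f - 1)) *
      brkCoeff p f k γ 1 ^ (-(p : ℤ) ^ (f - 1) - expR p f N))) * aL p f k γ ^ expR p f N =
      upsL p f k γ := by
    rw [aL, ← toL_C_zpow, toL_C_mul_toL_C, mul_assoc, ← zpow_add₀ hac, sub_add_cancel, upsL, brkRatio,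
      div_pow, zpow_neg, div_eq_mul_inv]
    norm_cast
  rw [seriesG, map_mul, map_pow toL (brk p f k γ), hO.toL_brk, ← zpow_natCast _ (expR p f N).toNat,
    Int.toNat_of_nonneg hr, mul_zpow, mul_zpow,
    tpow_zpow, ← e]
  ring

theorem toL_C_beta_mul (N : ℕ) (c : k) : toL (PowerSeries.C (c * (P.beta : k) ^ (1 - (N : ℤ)))) *
    toL (PowerSeries.C ((P.beta : k) ^ N)) =
      toL (PowerSeries.C c) * toL (PowerSeries.C (P.beta : k)) := by
  rw [toL_C_mul_toL_C, toL_C_mul_toL_C, mul_assoc, ← zpow_natCast, ← zpow_add₀ P.beta.ne_zero,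
    sub_add_cancel, zpow_one]

theorem toV_gammaTau_zero (hO : IsUnramifiedBase O p f) (hr : C.c ≠ 0 → 0 ≤ expR p f A.N) (γ : Oˣ) :
    toV p f P C A (gammaTau P C A γ 0) = gammaX P C A γ := by
  rw [gammaTau, Matrix.cons_val_zero, map_smul, map_sub, toV_single_one, toV_single_zero, gammaX,
    ← algebraMap_smul k⸨X⸩]
  refine Prod.ext ?_ ?_
  · change toL _ * (_ - 0) = _
    rw [map_mul, ← aL, hO.toL_tDivBrk, map_pow, map_pow, sub_zero]
    exact (mul_assoc _ _ _).symm
  · change toL _ * (0 - toL (_ * _) * _) = _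
    rw [map_pow, map_pow, map_mul]
    change aL p f k γ ^ P.u * _ = -_
    by_cases hc : C.c = 0
    · rw [hc, zero_mul, map_zero, map_zero]; ring
    have e1 := toL_C_beta_mul (P := P) A.N C.c
    have e2 : tpow k (expR p f A.N) * tpow k (-((p ^ f) ^ A.N : ℕ)) = tpow k (-1 - cZero p f) := by
      rw [← tpow_add, expR_eq]; congr 1; ring
    rw [toL_seriesG hO _ (hr hc), ← e1, ← e2]
    ring

theorem sigmaL_btilde (hO : IsUnramifiedBase O p f) (γ : Oˣ) :
    toL (hO.sigmaR k γ (seriesB p f P C A)) * ((uL p f k γ ^ ((p ^ f) ^ A.N))⁻¹ *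
        tpow k (-((p ^ f) ^ A.N : ℕ))) =
      hO.sigmaL k γ (btilde p f P C A) * ((uL p f k γ)⁻¹ * tpow k (-1)) := by
  have hu := hO.uL_ne_zero (k := k) γ
  have h1 : aL p f k γ ^ (1 - (((p ^ f) ^ A.N : ℕ) : ℤ)) = 1 := by
    refine hO.aL_zpow_eq_one γ ?_
    rw [xi]
    push_cast
    exact (dvd_sub_comm.1 (by simpa using sub_dvd_pow_sub_pow ((p : ℤ) ^ f) 1 A.N))
  have e2 : tpow k (1 - (((p ^ f) ^ A.N : ℕ) : ℤ)) * tpow k (-1) = tpow k (-((p ^ f) ^ A.N : ℕ)) := by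
    rw [← tpow_add]; congr 1; ring
  rw [btilde, map_mul, hO.sigmaL_tpow, hO.sigmaL_toL, h1, ← e2, zpow_sub₀ hu, zpow_one, zpow_natCast]
  field_simp

theorem phiVP_iterate_gammaY (hO : IsUnramifiedBase O p f) (γ : Oˣ) (s : ℕ) :
    (phiVP p f P C A)^[s] (gammaY p f P γ) = (0, toL (PowerSeries.C ((P.beta : k) ^ s)) *
      (aL p f k γ ^ ((P.u : ℤ) - P.ell) * ((uL p f k γ ^ ((p ^ f) ^ s))⁻¹ *
        tpow k (-((p ^ f) ^ s : ℕ))))) := by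
  have e : ∀ s : ℕ, (phiL k p f)^[s] (aL p f k γ ^ ((P.u : ℤ) - P.ell) * (uL p f k γ)⁻¹ * tpow k (-1)) =
      aL p f k γ ^ ((P.u : ℤ) - P.ell) * ((uL p f k γ ^ ((p ^ f) ^ s))⁻¹ *
        tpow k (-((p ^ f) ^ s : ℕ))) := by
    intro s
    induction s with
    | zero => simp [mul_assoc]
    | succ s ih =>
      rw [Function.iterate_succ_apply', ih, map_mul, map_mul, map_inv₀, map_zpow₀, map_pow, phiL_aL,
        hO.phiL_uL, phiL_tpow, ← pow_mul, pow_succ' _ s]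
      push_cast
      rw [mul_neg]
  rw [gammaY, phiVP, phiV_iterate_snd, e]

theorem toL_brk_pow_xi (hO : IsUnramifiedBase O p f) (γ : Oˣ) :
    toL (hO.sigmaR k γ (PowerSeries.X ^ (p ^ f - 1))) =
      tpow k ((p ^ f - 1 : ℕ) : ℤ) * uL p f k γ ^ (p ^ f - 1) := by
  rw [map_pow, hO.sigmaR_X, map_pow, hO.toL_brk, mul_pow, mul_pow, hO.aL_pow_xi, one_mul, tpow_pow,
    mul_one]

theorem tpow_mul_uL_pow (hO : IsUnramifiedBase O p f) (γ : Oˣ) :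
    tpow k ((p ^ f - 1 : ℕ) : ℤ) * uL p f k γ ^ (p ^ f - 1) *
      ((uL p f k γ ^ (p ^ f))⁻¹ * tpow k (-(p ^ f : ℕ))) = (uL p f k γ)⁻¹ * tpow k (-1) := by
  have hq := two_le_q (p := p) hO.f_pos
  have hu := hO.uL_ne_zero (k := k) γ
  have e1 : tpow k ((p ^ f - 1 : ℕ) : ℤ) * tpow k (-(p ^ f : ℕ)) = tpow k (-1) := by
    rw [← tpow_add]; congr 1; push_cast [Nat.cast_sub (by omega : 1 ≤ p ^ f)]; ring
  have e2 : uL p f k γ ^ (p ^ f) = uL p f k γ ^ (p ^ f - 1) * uL p f k γ := by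
    rw [← pow_succ, Nat.sub_add_cancel (by omega)]
  rw [← e1, e2]
  field_simp

/-- The first coordinate cancels because `t^ξ U^ξ · U^(-q) t^(-q) = U⁻¹t⁻¹`. What remains in the
second one is the expression of `GammaKey` times `t⁻¹` and factors in `k⟦t⟧`, so that compatibility
with `R` is exactly a congruence modulo `t^(n_y)`. -/
theorem toV_twist_elemR (hO : IsUnramifiedBase O p f) (hr : C.c ≠ 0 → 0 ≤ expR p f A.N)
    (hαβ : C.c ≠ 0 → P.alpha = P.beta) (γ : Oˣ) :
    toV p f P C A (hO.twistM γ (gammaTau P C A γ) (elemR p f P C A)) =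
      (0, toL (PowerSeries.C (P.alpha : k)) * toL (PowerSeries.C (P.beta : k)) * aL p f k γ ^ P.u *
        (uL p f k γ)⁻¹ * tpow k (-1) *
        (aL p f k γ ^ (-(P.ell : ℤ)) * hO.sigmaL k γ (btilde p f P C A) - btilde p f P C A -
          toL (PowerSeries.C C.c) * upsL p f k γ *
            (phiL k p f (gammaW p f k A.N γ) - gammaW p f k A.N γ))) := by
  have hq := two_le_q (p := p) hO.f_pos
  have hu := hO.uL_ne_zero (k := k) γ
  have ha := hO.aL_ne_zero (k := k) γ
  -- The `c`-terms coming from `φ(γ * x)` and from `γ * x` carry different constants; they combine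
  -- only because `α = β` when `c ≠ 0`.
  have hcab : toL (PowerSeries.C C.c) * toL (PowerSeries.C (P.alpha : k)) =
      toL (PowerSeries.C C.c) * toL (PowerSeries.C (P.beta : k)) := by
    by_cases hc : C.c = 0
    · rw [hc, map_zero, map_zero, zero_mul, zero_mul]
    · rw [hαβ hc]
  have F1 := tpow_mul_uL_pow (k := k) hO γ
  have F4 := sigmaL_btilde (P := P) (C := C) (A := A) hO γ
  have hWW : gammaW p f k A.N γ = uL p f k γ ^ expR p f A.N * tpow k (-1 - cZero p f) *
      (uL p f k γ * tpow k 1) := by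
    have e : tpow k (-1 - cZero p f) * tpow k 1 = tpow k (-cZero p f) := by
      rw [← tpow_add]; congr 1; ring
    rw [gammaW, ← e, zpow_add_one₀ hu]; ring
  have t11 : tpow k 1 * tpow k (-1) = 1 := tpow_mul_neg 1
  have tqq : tpow k (p ^ f : ℕ) * tpow k (-(p ^ f : ℕ)) = 1 := tpow_mul_neg _
  rw [elemR, map_add, map_sub, hO.twistM_single, hO.twistM_single, hO.twistM_single, map_add, map_sub,
    toV_smul_phiM_iterate, toV_smul_phiM_iterate, toV_smul_phiM_iterate, toV_gammaTau_zero hO hr,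
    toV_gammaTau_one hO, phiVP_iterate_gammaY hO, Function.iterate_one, Function.iterate_zero, id,
    hO.sigmaR_C, toL_brk_pow_xi, map_mul, hO.sigmaR_C]
  have hphiX : phiL k p f (gammaX P C A γ).1 = aL p f k γ ^ P.u * ((uL p f k γ ^ (p ^ f))⁻¹ *
      tpow k (-(p ^ f : ℕ))) := by
    rw [gammaX, map_mul, map_mul, map_pow, phiL_aL, map_inv₀, hO.phiL_uL, phiL_tpow, mul_neg_one, mul_assoc]
  have hphiC : ∀ c : k, phiL k p f (toL (PowerSeries.C c)) = toL (PowerSeries.C c) := phiL_toL_C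
  set W' := uL p f k γ ^ expR p f A.N * tpow k (-1 - cZero p f) with hW'
  have hphiX2 : phiL k p f (gammaX P C A γ).2 = -(aL p f k γ ^ P.u * (toL (PowerSeries.C C.c) *
      toL (PowerSeries.C (P.beta : k)) * upsL p f k γ) * phiL k p f W') := by
    rw [gammaX]
    simp only [map_neg, map_mul, map_pow, phiL_aL, hphiC, upsL]
    rw [hW', map_mul]
  have hphiW : phiL k p f (gammaW p f k A.N γ) = phiL k p f W' * (uL p f k γ ^ (p ^ f) *
      tpow k (p ^ f : ℕ)) := by
    rw [hWW, map_mul, map_mul (phiL k p f) (uL p f k γ), hO.phiL_uL, phiL_tpow, mul_one]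
  rw [phiV_apply, hphiX, hphiX2, hphiW, hWW]
  refine Prod.ext ?_ ?_
  · simp only [Prod.fst_add, Prod.fst_sub, Prod.smul_fst, smul_eq_mul, gammaX, mul_zero, add_zero]
    linear_combination toL (PowerSeries.C (P.alpha : k)) * aL p f k γ ^ P.u * F1
  · simp only [Prod.snd_add, Prod.snd_sub, Prod.smul_snd, smul_eq_mul, gammaX]
    rw [map_mul (toL (k := k)), ← hW']
    have hCab : toL (PowerSeries.C ((P.alpha : k) * P.beta)) =
        toL (PowerSeries.C (P.alpha : k)) * toL (PowerSeries.C (P.beta : k)) := (toL_C_mul_toL_C _ _).symm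
    have e1 := toL_C_beta_mul (P := P) A.N (P.alpha : k)
    have e3 : aL p f k γ ^ ((P.u : ℤ) - P.ell) = aL p f k γ ^ P.u * aL p f k γ ^ (-(P.ell : ℤ)) := by
      rw [sub_eq_add_neg, zpow_add₀ ha, zpow_natCast]
    rw [hCab, e3]
    have hUq : (uL p f k γ ^ p ^ f)⁻¹ * uL p f k γ ^ p ^ f = 1 := inv_mul_cancel₀ (pow_ne_zero _ hu)
    have hU1 : (uL p f k γ)⁻¹ * uL p f k γ = 1 := inv_mul_cancel₀ hu
    generalize hwq : (uL p f k γ ^ p ^ f)⁻¹ = wq at *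
    generalize hwN : (uL p f k γ ^ (p ^ f) ^ A.N)⁻¹ = wN at *
    generalize hw1 : (uL p f k γ)⁻¹ = w1 at *
    generalize toL (PowerSeries.C C.c) = c at *
    generalize toL (PowerSeries.C (P.alpha : k)) = α at *
    generalize toL (PowerSeries.C (P.beta : k)) = β at *
    generalize upsL p f k γ = υ at *
    generalize uL p f k γ ^ (p ^ f - 1) = Ux at *
    generalize uL p f k γ ^ p ^ f = Uq at *
    generalize uL p f k γ = U at *
    generalize phiL k p f W' = FW at *
    generalize aL p f k γ ^ P.u = au at *
    generalize aL p f k γ ^ (-(P.ell : ℤ)) = al at *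
    generalize hO.sigmaL k γ (btilde p f P C A) = sB at *
    generalize btilde p f P C A = B at *
    generalize toL (hO.sigmaR k γ (seriesB p f P C A)) = sS at *
    generalize tpow k ((p ^ f - 1 : ℕ) : ℤ) = tx at *
    generalize tpow k (-((p ^ f) ^ A.N : ℕ)) = tN at *
    generalize tpow k (-(p ^ f : ℕ)) = tq' at *
    generalize tpow k (p ^ f : ℕ) = tq at *
    generalize tpow k (-1 - cZero p f) = tc at *
    generalize tpow k (-1) = ti at *
    generalize tpow k 1 = t at *
    generalize toL (PowerSeries.C ((P.alpha : k) * (P.beta : k) ^ (1 - (A.N : ℤ)))) = ab at *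
    generalize toL (PowerSeries.C ((P.beta : k) ^ A.N)) = bN at *
    have hF3 : tx * Ux * FW = FW * Uq * tq * (w1 * ti) := by
      have : wq * Uq * (tq * tq') = 1 := by rw [hUq, tqq, one_mul]
      linear_combination (FW * Uq * tq) * F1 - tx * Ux * FW * this
    linear_combination (-(β * au * c * β * υ)) * hF3 + β * au * υ * FW * Uq * tq * w1 * ti * hcab -
      α * β * B * au * F1 - α * β * au * c * υ * W' * (t11 * (w1 * U) + hU1) +
      sS * au * al * wN * tN * e1 + α * β * au * al * F4

theorem deltaMk_eq_iff (h : LatticeStable p f P C A) (m m' : FreeM k) :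
    deltaMk p f P C A m = deltaMk p f P C A m' ↔ toV p f P C A m - toV p f P C A m' ∈ latV k A.nx A.ny := by
  rw [← sub_eq_zero, ← deltaMk_sub, deltaMk_eq_zero, h.mem_nabla_iff, map_sub]

theorem toV_gammaTau_mul_one (hO : IsUnramifiedBase O p f) (γ γ' : Oˣ) :
    toV p f P C A (hO.twistM γ (gammaTau P C A γ) (gammaTau P C A γ' 1)) =
      toV p f P C A (gammaTau P C A (γ * γ') 1) := by
  have ha := hO.aL_ne_zero (k := k) γ
  have ha' := hO.aL_ne_zero (k := k) γ'
  have e : hO.sigmaL k γ (toL (tDivBrk p f k γ')) = (aL p f k γ')⁻¹ * (hO.sigmaL k γ (uL p f k γ'))⁻¹ := by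
    rw [← map_inv₀, ← hO.toL_tDivBrk, map_mul, hO.sigmaL_aL, inv_mul_cancel_left₀ ha']
  conv_lhs => rw [gammaTau, gammaTau, Matrix.cons_val_one, Matrix.cons_val_fin_one, hO.twistM_single,
    toV_smul_phiM_iterate]
  change toL _ • toV p f P C A (gammaTau P C A γ 1) = _
  rw [toV_gammaTau_one hO, toV_gammaTau_one hO, gammaY, gammaY, ← hO.sigmaL_toL, map_mul, toL_C_zpow]
  change hO.sigmaL k γ (aL p f k γ' ^ _ * _) • _ = _
  rw [map_mul, map_zpow₀, hO.sigmaL_aL, e, hO.aL_mul, hO.uL_mul, Prod.smul_mk, smul_zero, smul_eq_mul,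
    mul_zpow, zpow_add_one₀ ha', mul_inv]
  refine Prod.ext rfl ?_
  dsimp only
  field_simp

/-- Since `υ^(p^(f-1))` is additive in `γ`, the group law on `x` fails only by the deviation from
`1` of high powers of `U`, which the lattice absorbs under the assumptions `hW` and `hN` of
`exists_isGammaAction`. -/
theorem toV_gammaTau_mul_zero (hO : IsUnramifiedBase O p f) (hr : C.c ≠ 0 → 0 ≤ expR p f A.N)
    (hell : C.c ≠ 0 → xi p f ∣ expR p f A.N - P.ell) (γ γ' : Oˣ) :
    toV p f P C A (gammaTau P C A (γ * γ') 0) -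
      toV p f P C A (hO.twistM γ (gammaTau P C A γ) (gammaTau P C A γ' 0)) =
      (0, toL (PowerSeries.C C.c) * toL (PowerSeries.C (P.beta : k)) * aL p f k (γ * γ') ^ P.u *
        uL p f k (γ * γ') ^ expR p f A.N * tpow k (-1 - cZero p f) *
        (upsL p f k γ * (uL p f k γ ^ (expR p f A.N + 1) * (uL p f k (γ * γ') ^ (expR p f A.N + 1))⁻¹ - 1) +
          upsL p f k γ' * ((uL p f k γ ^ ((p ^ f) ^ A.N))⁻¹ - 1))) := by
  have ha := hO.aL_ne_zero (k := k) γ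
  have ha' := hO.aL_ne_zero (k := k) γ'
  have hu := hO.uL_ne_zero (k := k) γ
  have hu'' := hO.uL_ne_zero (k := k) (γ * γ')
  have e : hO.sigmaL k γ (aL p f k γ' * toL (tDivBrk p f k γ')) =
      uL p f k γ * (uL p f k (γ * γ'))⁻¹ := by
    rw [hO.toL_tDivBrk, map_inv₀, hO.uL_mul, mul_inv, mul_inv_cancel_left₀ hu]
  have hups : upsL p f k (γ * γ') = upsL p f k γ + upsL p f k γ' := by
    rw [upsL, hO.brkRatio_mul, add_pow_char_pow, map_add, map_add]; rfl
  have hupsσ : hO.sigmaL k γ (upsL p f k γ') = upsL p f k γ' := by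
    rw [upsL, hO.sigmaL_toL, hO.sigmaR_C]
  rw [toV_gammaTau_zero hO hr]
  have e2 : toV p f P C A (hO.twistM γ (gammaTau P C A γ) (gammaTau P C A γ' 0)) =
      (aL p f k γ' ^ P.u : k⸨X⸩) • ((uL p f k γ * (uL p f k (γ * γ'))⁻¹) • gammaX P C A γ -
        hO.sigmaL k γ (toL (PowerSeries.C (C.c * (P.beta : k) ^ (1 - (A.N : ℤ))) * seriesG p f k A.N γ')) •
        ((0 : k⸨X⸩), toL (PowerSeries.C ((P.beta : k) ^ A.N)) *
      (aL p f k γ ^ ((P.u : ℤ) - P.ell) * ((uL p f k γ ^ ((p ^ f) ^ A.N))⁻¹ *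
        tpow k (-((p ^ f) ^ A.N : ℕ)))))) := by
    rw [show gammaTau P C A γ' 0 = (PowerSeries.C (brkCoeff p f k γ' 1 ^ P.u) : k⟦X⟧) •
        (Finsupp.single (0, 0) (PowerSeries.C (brkCoeff p f k γ' 1) * tDivBrk p f k γ')
          - Finsupp.single (1, A.N)
              (PowerSeries.C (C.c * (P.beta : k) ^ (1 - (A.N : ℤ))) * seriesG p f k A.N γ')) from rfl,
      hO.twistM_smul, map_sub, hO.twistM_single, hO.twistM_single, map_smul, map_sub,
      toV_smul_phiM_iterate, toV_smul_phiM_iterate, toV_gammaTau_zero hO hr, toV_gammaTau_one hO,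
      phiVP_iterate_gammaY hO, ← hO.sigmaL_toL, ← algebraMap_smul k⸨X⸩, Function.iterate_zero, id, hO.sigmaR_C]
    rw [map_mul toL, ← aL, e, map_pow, map_pow, ← hO.sigmaL_toL]
    rfl
  rw [e2]
  refine Prod.ext ?_ ?_
  · simp only [gammaX, Prod.fst_sub, Prod.smul_fst, smul_eq_mul, mul_zero, sub_zero, hO.aL_mul]
    field_simp
    ring
  by_cases hc : C.c = 0
  · simp [gammaX, hc]
  have e3 : hO.sigmaL k γ (toL (PowerSeries.C (C.c * (P.beta : k) ^ (1 - (A.N : ℤ))) * seriesG p f k A.N γ')) =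
      toL (PowerSeries.C (C.c * (P.beta : k) ^ (1 - (A.N : ℤ)))) * upsL p f k γ' *
        (aL p f k γ ^ expR p f A.N * uL p f k (γ * γ') ^ expR p f A.N * tpow k (expR p f A.N)) := by
    rw [map_mul toL, map_mul, hO.sigmaL_toL, hO.sigmaR_C, toL_seriesG hO _ (hr hc),
      map_mul (hO.sigmaL k γ) (upsL p f k γ'), map_mul (hO.sigmaL k γ) (_ ^ _), hupsσ, map_zpow₀, hO.sigmaL_tpow, hO.uL_mul, mul_zpow]
    ring
  have e1 := toL_C_beta_mul (P := P) A.N C.c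
  have e4 : tpow k (expR p f A.N) * tpow k (-((p ^ f) ^ A.N : ℕ)) = tpow k (-1 - cZero p f) := by
    rw [← tpow_add, expR_eq]; congr 1; ring
  -- The congruence `r ≡ ℓ` modulo `ξ` turns `a^r a^(u-ℓ)` into `a^u`.
  have e5 : aL p f k γ ^ expR p f A.N * aL p f k γ ^ ((P.u : ℤ) - P.ell) = aL p f k γ ^ P.u := by
    have := hO.aL_zpow_eq_one (k := k) γ (hell hc)
    rw [← zpow_add₀ ha, show expR p f A.N + ((P.u : ℤ) - P.ell) = (expR p f A.N - P.ell) + P.u by ring,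
      zpow_add₀ ha, this, one_mul, zpow_natCast]
  have e6 : uL p f k γ ^ expR p f A.N * uL p f k γ * ((uL p f k (γ * γ') ^ expR p f A.N)⁻¹ *
      (uL p f k (γ * γ'))⁻¹) = uL p f k γ ^ (expR p f A.N + 1) *
        (uL p f k (γ * γ') ^ (expR p f A.N + 1))⁻¹ := by
    rw [zpow_add_one₀ hu, zpow_add_one₀ hu'', mul_inv]
  have e7 : uL p f k (γ * γ') ^ expR p f A.N * (uL p f k (γ * γ') ^ expR p f A.N)⁻¹ = 1 :=
    mul_inv_cancel₀ (zpow_ne_zero _ hu'')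
  rw [e3]
  simp only [gammaX, Prod.snd_sub, Prod.smul_snd, smul_eq_mul, hups, ← e6, hO.aL_mul, mul_pow]
  generalize (uL p f k (γ * γ') ^ expR p f A.N)⁻¹ = Vi at *
  generalize uL p f k (γ * γ') ^ expR p f A.N = V at *
  generalize (uL p f k (γ * γ'))⁻¹ = wi at *
  generalize toL (PowerSeries.C (C.c * (P.beta : k) ^ (1 - (A.N : ℤ)))) = cb at *
  generalize toL (PowerSeries.C ((P.beta : k) ^ A.N)) = bN at *
  generalize toL (PowerSeries.C C.c) = c at *
  generalize toL (PowerSeries.C (P.beta : k)) = β at *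
  generalize (uL p f k γ ^ (p ^ f) ^ A.N)⁻¹ = wN at *
  generalize aL p f k γ ^ ((P.u : ℤ) - P.ell) = aul at *
  generalize aL p f k γ ^ expR p f A.N = ar at *
  generalize aL p f k γ ^ P.u = au at *
  generalize aL p f k γ' ^ P.u = au' at *
  generalize tpow k (-((p ^ f) ^ A.N : ℕ)) = tN at *
  generalize tpow k (-1 - cZero p f) = tc at *
  generalize tpow k (expR p f A.N) = tr at *
  generalize uL p f k γ ^ expR p f A.N = Ur at *
  linear_combination (au' * upsL p f k γ' * V * wN * tr * tN * ar * aul) * e1 +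
    (c * β * au' * upsL p f k γ' * V * wN * ar * aul) * e4 +
    (c * β * au' * upsL p f k γ' * V * wN * tc) * e5 -
    (c * β * au * au' * tc * upsL p f k γ * Ur * uL p f k γ * wi) * e7

/-- Stability of `∇` needs `hkey` for the generator `R` and `hnx` for `t^(n_x)x`; the other two
generators cause no trouble. The group law on `x` needs `hell`, `hW` and `hN`, and on `y` it holds
on the nose. -/
theorem exists_isGammaAction (hO : IsUnramifiedBase O p f) (h : LatticeStable p f P C A)
    (hr : C.c ≠ 0 → 0 ≤ expR p f A.N) (hαβ : C.c ≠ 0 → P.alpha = P.beta)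
    (hell : C.c ≠ 0 → xi p f ∣ expR p f A.N - P.ell)
    (hnx : C.c ≠ 0 → (A.ny : ℤ) ≤ A.nx - cZero p f)
    (hW : C.c ≠ 0 → ∀ γ : Oˣ, uL p f k γ ^ (expR p f A.N + 1) - 1 ∈ lat k ((A.ny : ℤ) + cZero p f))
    (hN : C.c ≠ 0 → ∀ γ : Oˣ, uL p f k γ ^ ((p ^ f) ^ A.N) - 1 ∈ lat k ((A.ny : ℤ) + cZero p f))
    (hkey : ∀ γ : Oˣ, GammaKey P C A hO γ) :
    ∃ T : Oˣ → Delta p f P C A → Delta p f P C A, IsGammaAction p f P C A T := by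
  have hmemC : ∀ c : k, toL (PowerSeries.C c) ∈ lat k 0 := fun c => toL_mem_lat _
  have hmema : ∀ (γ : Oˣ) (n : ℕ), aL p f k γ ^ n ∈ lat k 0 := fun γ n => by
    rw [aL, ← map_pow]; exact toL_mem_lat _
  have hmemu : ∀ γ : Oˣ, (uL p f k γ)⁻¹ ∈ lat k 0 := fun γ => by
    rw [← zpow_neg_one]; exact hO.uL_zpow_mem γ _
  have hmemυ : ∀ γ : Oˣ, upsL p f k γ ∈ lat k 0 := fun γ => toL_mem_lat _
  have hinv : ∀ (x : k⸨X⸩) (n : ℤ), x ≠ 0 → x⁻¹ ∈ lat k 0 → x - 1 ∈ lat k n → x⁻¹ - 1 ∈ lat k n := by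
    intro x n hx h0 h1
    have e : x⁻¹ - 1 = -(x⁻¹ * (x - 1)) := by field_simp; ring
    rw [e]
    exact Submodule.neg_mem _ (mul_mem_lat' (by omega) h0 h1)
  refine exists_isGammaAction_of_twist hO (gammaTau P C A) (fun γ => rfl) (fun γ => rfl) ?_ ?_ ?_
  · intro γ m hm
    rw [deltaMk_eq_zero, h.mem_nabla_iff, mem_latV]
    rw [nablaGens, Set.mem_insert_iff, Set.mem_insert_iff, Set.mem_insert_iff,
      Set.mem_singleton_iff] at hm
    have hbrk : ∀ n : ℕ, toL (hO.sigmaR k γ (PowerSeries.X ^ n)) =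
        tpow k n * (aL p f k γ ^ n * uL p f k γ ^ n) := fun n => by
      rw [map_pow, hO.sigmaR_X, map_pow, hO.toL_brk, mul_pow, mul_pow, tpow_pow, mul_one]; ring
    have hmemun : ∀ n : ℕ, uL p f k γ ^ n ∈ lat k 0 := fun n => by
      rw [uL, ← map_pow]; exact toL_mem_lat _
    have hbrkm : ∀ n : ℕ, toL (hO.sigmaR k γ (PowerSeries.X ^ n)) ∈ lat k (n : ℤ) := fun n => by
      rw [hbrk]
      exact mul_mem_lat' (m := (n : ℤ)) (n := 0) (by omega) (tpow_mem_lat le_rfl)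
        (mul_mem_lat' (m := 0) (n := 0) (by omega) (hmema γ n) (hmemun n))
    rcases hm with rfl | rfl | rfl | rfl
    · rw [hO.twistM_single, toV_smul_phiM_iterate, toV_gammaTau_one hO, Function.iterate_zero, id, gammaY,
        Prod.smul_mk, smul_zero]
      refine ⟨Submodule.zero_mem _, ?_⟩
      have ha : aL p f k γ ^ ((P.u : ℤ) - P.ell) ∈ lat k 0 := by
        rw [aL, ← toL_C_zpow]; exact toL_mem_lat _
      exact mul_mem_lat' (m := A.ny) (n := -1) (by omega) (hbrkm _)
        (mul_mem_lat' (m := 0) (n := -1) (by omega) (mul_mem_lat' (m := 0) (n := 0) (by omega) ha (hmemu γ))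
          (tpow_mem_lat le_rfl))
    · have : toV p f P C A (hO.twistM γ (gammaTau P C A γ)
          (Finsupp.single (1, 1) (PowerSeries.X ^ (p ^ f - 1)) -
            Finsupp.single (1, 0) (PowerSeries.C (P.beta : k)))) = 0 := by
        rw [map_sub, hO.twistM_single, hO.twistM_single, map_sub, toV_smul_phiM_iterate,
          toV_smul_phiM_iterate, toV_gammaTau_one hO, phiVP_iterate_gammaY hO, toL_brk_pow_xi, hO.sigmaR_C,
          Function.iterate_zero, id, gammaY]
        refine Prod.ext (by simp) ?_
        have F1 := tpow_mul_uL_pow (k := k) hO γ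
        simp only [Prod.snd_sub, Prod.smul_snd, smul_eq_mul, Prod.snd_zero, pow_one]
        linear_combination toL (PowerSeries.C (P.beta : k)) * aL p f k γ ^ ((P.u : ℤ) - P.ell) * F1
      rw [this]
      exact ⟨Submodule.zero_mem _, Submodule.zero_mem _⟩
    · rw [hO.twistM_single, toV_smul_phiM_iterate, toV_gammaTau_zero hO hr, Function.iterate_zero, id, gammaX,
        Prod.smul_mk]
      refine ⟨?_, ?_⟩
      · exact mul_mem_lat' (m := A.nx) (n := -1) (by omega) (hbrkm _)
          (mul_mem_lat' (m := 0) (n := -1) (by omega) (mul_mem_lat' (m := 0) (n := 0) (by omega)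
            (hmema γ _) (hmemu γ)) (tpow_mem_lat le_rfl))
      · by_cases hc : C.c = 0
        · simp [hc]
        dsimp only
        rw [smul_neg]
        refine Submodule.neg_mem _ ?_
        have hx := hnx hc
        exact mul_mem_lat' (m := A.nx) (n := -1 - cZero p f) (by omega) (hbrkm _)
          (mul_mem_lat' (m := 0) (n := -1 - cZero p f) (by omega)
            (mul_mem_lat' (m := 0) (n := 0) (by omega) (hmema γ _)
              (mul_mem_lat' (m := 0) (n := 0) (by omega) (mul_mem_lat' (m := 0) (n := 0) (by omega)
                (hmemC _) (hmemC _)) (hmemυ γ)))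
            (mul_mem_lat' (m := 0) (n := -1 - cZero p f) (by omega) (hO.uL_zpow_mem γ _)
              (tpow_mem_lat le_rfl)))
    · rw [toV_twist_elemR hO hr hαβ]
      refine ⟨Submodule.zero_mem _, ?_⟩
      refine mul_mem_lat' (m := -1) (n := A.ny) (by omega) ?_ (hkey γ)
      exact mul_mem_lat' (m := 0) (n := -1) (by omega)
        (mul_mem_lat' (m := 0) (n := 0) (by omega) (mul_mem_lat' (m := 0) (n := 0) (by omega)
          (mul_mem_lat' (m := 0) (n := 0) (by omega) (hmemC _) (hmemC _)) (hmema γ _)) (hmemu γ))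
        (tpow_mem_lat le_rfl)
  · intro i
    rw [genD, deltaMk_eq_iff h]
    have : toV p f P C A (gammaTau P C A (1 : Oˣ) i) = toV p f P C A (Finsupp.single (i, 0) 1) := by
      fin_cases i
      · change toV p f P C A (gammaTau P C A (1 : Oˣ) 0) = toV p f P C A (Finsupp.single (0, 0) 1)
        rw [toV_gammaTau_zero hO hr, toV_single_zero, gammaX, hO.aL_one, hO.uL_one, upsL, hO.brkRatio_one,
          zero_pow (pow_ne_zero _ hp.out.ne_zero), map_zero, map_zero]
        simp
      · change toV p f P C A (gammaTau P C A (1 : Oˣ) 1) = toV p f P C A (Finsupp.single (1, 0) 1)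
        rw [toV_gammaTau_one hO, toV_single_one, gammaY, hO.aL_one, hO.uL_one]
        simp
    rw [this, sub_self]
    exact Submodule.zero_mem _
  · intro γ γ' i
    rw [deltaMk_eq_iff h]
    fin_cases i
    · change toV p f P C A (gammaTau P C A (γ * γ') 0) -
        toV p f P C A (hO.twistM γ (gammaTau P C A γ) (gammaTau P C A γ' 0)) ∈ _
      rw [toV_gammaTau_mul_zero hO hr hell, mem_latV]
      refine ⟨Submodule.zero_mem _, ?_⟩
      by_cases hc : C.c = 0
      · simp [hc]
      have hu := hO.uL_ne_zero (k := k) γ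
      have hu'' := hO.uL_ne_zero (k := k) (γ * γ')
      have h1 := hinv _ _ (pow_ne_zero _ hu) (by
        have := hO.uL_zpow_mem (k := k) γ (-(((p ^ f) ^ A.N : ℕ) : ℤ))
        rwa [zpow_neg, zpow_natCast] at this) (hN hc γ)
      have h2 := hinv _ _ (zpow_ne_zero _ hu'') (by
        rw [← zpow_neg]; exact hO.uL_zpow_mem (k := k) (γ * γ') _) (hW hc (γ * γ'))
      have h3 : uL p f k γ ^ (expR p f A.N + 1) * (uL p f k (γ * γ') ^ (expR p f A.N + 1))⁻¹ - 1 ∈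
          lat k ((A.ny : ℤ) + cZero p f) := by
        have e : ∀ x y : k⸨X⸩, x * y - 1 = x * (y - 1) + (x - 1) := fun x y => by ring
        rw [e]
        exact Submodule.add_mem _ (mul_mem_lat' (m := 0) (by omega) (hO.uL_zpow_mem γ _) h2) (hW hc γ)
      refine mul_mem_lat' (m := -1 - cZero p f) (n := (A.ny : ℤ) + cZero p f) (by omega) ?_
        (Submodule.add_mem _ (mul_mem_lat' (m := 0) (by omega) (hmemυ γ) h3)
          (mul_mem_lat' (m := 0) (by omega) (hmemυ γ') h1))
      exact mul_mem_lat' (m := 0) (n := -1 - cZero p f) (by omega)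
        (mul_mem_lat' (m := 0) (n := 0) (by omega) (mul_mem_lat' (m := 0) (n := 0) (by omega)
          (mul_mem_lat' (m := 0) (n := 0) (by omega) (hmemC _) (hmemC _)) (hmema _ _)) (hO.uL_zpow_mem _ _))
        (tpow_mem_lat le_rfl)
    · change toV p f P C A (gammaTau P C A (γ * γ') 1) -
        toV p f P C A (hO.twistM γ (gammaTau P C A γ) (gammaTau P C A γ' 1)) ∈ _
      rw [toV_gammaTau_mul_one, sub_self]
      exact Submodule.zero_mem _

end GammaOnDelta


/-! ### Cyclic shifts of the base `p` digits of `ℓ`. -/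

section Digits

variable (p f ell : ℕ) [hp : Fact p.Prime]

/-- `λ_i = ∑_{j < f} m_{i+j} p^j`, so that `ℓ_i = p^i λ_i`. -/
def lam (i : ℕ) : ℤ := ∑ j ∈ Finset.range f, (digit p f ell ((j : ℤ) + i) : ℤ) * (p : ℤ) ^ j

variable {p f ell}

theorem ellShift_eq (i : ℕ) : ellShift p f ell i = (p : ℤ) ^ i * lam p f ell i := by
  rw [ellShift, lam, Finset.mul_sum]
  refine Finset.sum_congr rfl fun j _ => ?_
  rw [pow_add]; ring

theorem digit_add_f (j : ℤ) : digit p f ell (j + f) = digit p f ell j := by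
  rw [digit, digit, Int.add_emod_right]

theorem digit_add_mul_f (j n : ℤ) : digit p f ell (j + f * n) = digit p f ell j := by
  rw [digit, digit, Int.add_mul_emod_self_left]

theorem digit_lt (j : ℤ) : digit p f ell j < p := Nat.mod_lt _ hp.out.pos

theorem lam_zero (hell : ell < p ^ f) : lam p f ell 0 = ell := by
  have key : ∀ n : ℕ, ∑ j ∈ Finset.range n, (ell / p ^ j % p) * p ^ j = ell % p ^ n := by
    intro n
    induction n with
    | zero => simp [Nat.mod_one]
    | succ n ih => rw [Finset.sum_range_succ, ih, Nat.mod_pow_succ, mul_comm (p ^ n)]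
  have h := key f
  rw [Nat.mod_eq_of_lt hell] at h
  conv_rhs => rw [← h]
  rw [lam, Nat.cast_sum]
  refine Finset.sum_congr rfl fun j hj => ?_
  have : (((j : ℤ) + (0 : ℕ)) % (f : ℤ)).toNat = j := by
    rw [Nat.cast_zero, add_zero, Int.emod_eq_of_lt (by omega) (by have := Finset.mem_range.1 hj; omega)]
    simp
  rw [digit, this, Nat.cast_mul, Nat.cast_pow]

/-- Passing from `λ_n` to `λ_{n+1}` moves the lowest digit `m_n` to the top, that is, replaces `m_n`
by `m_n q` and divides by `p`. -/
theorem lam_succ (n : ℕ) : (p : ℤ) * lam p f ell (n + 1) =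
    lam p f ell n + digit p f ell n * xi p f := by
  have h1 : (p : ℤ) * lam p f ell (n + 1) =
      ∑ j ∈ Finset.range f, (digit p f ell (((j + 1 : ℕ) : ℤ) + n) : ℤ) * (p : ℤ) ^ (j + 1) := by
    rw [lam, Finset.mul_sum]
    refine Finset.sum_congr rfl fun j _ => ?_
    rw [pow_succ, show (((j + 1 : ℕ) : ℤ) + n) = (j : ℤ) + ((n + 1 : ℕ) : ℤ) by push_cast; ring]; ring
  have h2 := Finset.sum_range_succ' (fun j : ℕ => (digit p f ell ((j : ℤ) + n) : ℤ) * (p : ℤ) ^ j) f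
  rw [Finset.sum_range_succ] at h2
  rw [h1, lam, xi]
  have h3 : digit p f ell ((f : ℤ) + n) = digit p f ell n := by rw [add_comm, digit_add_f]
  rw [h3] at h2
  simp only [Nat.cast_zero, zero_add, pow_zero, mul_one] at h2
  linarith

theorem lam_add_f (n : ℕ) : lam p f ell (n + f) = lam p f ell n := by
  rw [lam, lam]
  refine Finset.sum_congr rfl fun j _ => ?_
  rw [show (j : ℤ) + ((n + f : ℕ) : ℤ) = (j : ℤ) + n + f by push_cast; ring, digit_add_f]

theorem xi_pos (hf : 0 < f) : 0 < xi p f := by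
  have : (2 : ℤ) ≤ (p : ℤ) ^ f := by exact_mod_cast two_le_q (p := p) hf
  rw [xi]; omega

/-- The condition `0 < ℓ < ξ` says that the digits are neither all `0` nor all `p - 1`, hence is
invariant under cyclic shifts. -/
theorem lam_pos_lt (hf : 0 < f) (h0 : 0 < ell) (h1 : ell < p ^ f - 1) (n : ℕ) :
    0 < lam p f ell n ∧ lam p f ell n < xi p f := by
  have hp0 : (0 : ℤ) < p := by exact_mod_cast hp.out.pos
  have hq : (2 : ℤ) ≤ (p : ℤ) ^ f := by exact_mod_cast two_le_q (p := p) hf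
  induction n with
  | zero =>
    have h2 := two_le_q (p := p) hf
    rw [lam_zero (by omega), xi]
    refine ⟨by exact_mod_cast h0, ?_⟩
    have : ((ell : ℕ) : ℤ) < ((p ^ f - 1 : ℕ) : ℤ) := by exact_mod_cast h1
    rwa [Nat.cast_sub (by omega), Nat.cast_pow, Nat.cast_one] at this
  | succ n ih =>
    have h2 := lam_succ (p := p) (f := f) (ell := ell) n
    have h3 : ((digit p f ell n : ℕ) : ℤ) ≤ p - 1 := by
      have := digit_lt (p := p) (f := f) (ell := ell) n; omega
    have hξ := xi_pos (p := p) hf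
    constructor
    · have : 0 < (p : ℤ) * lam p f ell (n + 1) := by
        rw [h2]; exact add_pos_of_pos_of_nonneg ih.1 (mul_nonneg (by positivity) hξ.le)
      exact pos_of_mul_pos_right this hp0.le
    · have : (p : ℤ) * lam p f ell (n + 1) < p * xi p f := by
        rw [h2]; nlinarith [ih.2]
      exact lt_of_mul_lt_mul_left this hp0.le

theorem dvd_lam_sub_digit (hf : 0 < f) (n : ℕ) : (p : ℤ) ∣ lam p f ell n - digit p f ell n := by
  have h2 := lam_succ (p := p) (f := f) (ell := ell) n
  obtain ⟨f, rfl⟩ := Nat.exists_eq_succ_of_ne_zero hf.ne'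
  refine ⟨lam p (f + 1) ell (n + 1) - digit p (f + 1) ell n * p ^ f, ?_⟩
  rw [mul_sub, h2, xi, pow_succ]; ring

theorem xi_dvd_ellShift_sub (h1 : ell < p ^ f) (n : ℕ) :
    xi p f ∣ (p : ℤ) ^ n * lam p f ell n - ell := by
  induction n with
  | zero => rw [lam_zero h1]; simp
  | succ n ih =>
    have h2 := lam_succ (p := p) (f := f) (ell := ell) n
    have e : (p : ℤ) ^ (n + 1) * lam p f ell (n + 1) - ell = ((p : ℤ) ^ n * lam p f ell n - ell) +
        xi p f * ((p : ℤ) ^ n * digit p f ell n) := by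
      rw [pow_succ, mul_assoc, h2]; ring
    rw [e]
    exact dvd_add ih (dvd_mul_right _ _)

/-- `θ = (q-1)/(p-1)`. -/
theorem exists_theta (hf : 0 < f) : ∃ θ : ℤ, 0 < θ ∧ xi p f = ((p : ℤ) - 1) * θ ∧
    xi p f / ((p : ℤ) - 1) = θ := by
  have hp1 : (0 : ℤ) < (p : ℤ) - 1 := by have := hp.out.two_le; omega
  obtain ⟨θ, hθ⟩ : ((p : ℤ) - 1) ∣ xi p f := by rw [xi]; exact sub_one_dvd_pow_sub_one _ _
  have hξ := xi_pos (p := p) hf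
  refine ⟨θ, ?_, hθ, ?_⟩
  · rw [hθ] at hξ; exact pos_of_mul_pos_right hξ hp1.le
  · rw [hθ, Int.mul_ediv_cancel_left _ hp1.ne']

end Digits

/-! ### Congruences between one-units in `k((t))`. -/

section Congruences

variable {k : Type*} [Field k]

theorem sub_mem_lat_trans {x y z : k⸨X⸩} {n : ℤ} (h : x - y ∈ lat k n) (h' : y - z ∈ lat k n) :
    x - z ∈ lat k n := by
  have := Submodule.add_mem _ h h'
  rwa [sub_add_sub_cancel] at this

theorem pow_mem_lat {x : k⸨X⸩} {n : ℤ} (h : x ∈ lat k n) (m : ℕ) : x ^ m ∈ lat k (m * n) := by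
  induction m with
  | zero => rw [pow_zero, Nat.cast_zero, zero_mul]; exact tpow_zero (k := k) ▸ tpow_mem_lat le_rfl
  | succ m ih => rw [pow_succ]; exact mul_mem_lat' (by push_cast; linarith) ih h

theorem one_mem_lat : (1 : k⸨X⸩) ∈ lat k 0 := tpow_zero (k := k) ▸ tpow_mem_lat le_rfl

theorem intCast_mem_lat (m : ℤ) : (m : k⸨X⸩) ∈ lat k 0 := by
  rw [← map_intCast (toL (k := k)) m]; exact toL_mem_lat _

instance charP_laurent (p : ℕ) [CharP k p] : CharP k⸨X⸩ p :=
  charP_of_injective_ringHom (f := (toL (k := k)).comp (PowerSeries.C (R := k)))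
    (toL_injective.comp PowerSeries.C_injective) p

theorem pow_char_pow_sub_mem (p : ℕ) [hp : Fact p.Prime] [CharP k p] {x y : k⸨X⸩} {n : ℤ}
    (h : x - y ∈ lat k n) (i : ℕ) : x ^ p ^ i - y ^ p ^ i ∈ lat k ((p : ℤ) ^ i * n) := by
  rw [← sub_pow_char_pow]
  have := pow_mem_lat h (p ^ i)
  rwa [Nat.cast_pow] at this

/-- Units of `k⟦t⟧` congruent to `1`, seen in `k((t))`. -/
structure IsOneUnit (x : k⸨X⸩) (n : ℤ) : Prop where
  ne_zero : x ≠ 0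
  inv_mem : x⁻¹ ∈ lat k 0
  sub_one_mem : x - 1 ∈ lat k n

theorem IsOneUnit.mem {x : k⸨X⸩} {n : ℤ} (hn : 0 ≤ n) (h : IsOneUnit x n) : x ∈ lat k 0 := by
  have := Submodule.add_mem _ (lat_anti hn h.sub_one_mem) one_mem_lat
  rwa [sub_add_cancel] at this

theorem IsOneUnit.inv {x : k⸨X⸩} {n : ℤ} (hn : 0 ≤ n) (h : IsOneUnit x n) : IsOneUnit x⁻¹ n := by
  refine ⟨inv_ne_zero h.ne_zero, by rw [inv_inv]; exact h.mem hn, ?_⟩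
  have hx := h.ne_zero
  have e : x⁻¹ - 1 = -(x⁻¹ * (x - 1)) := by field_simp; ring
  rw [e]
  exact Submodule.neg_mem _ (mul_mem_lat' (by omega) h.inv_mem h.sub_one_mem)

theorem IsOneUnit.pow {x : k⸨X⸩} {n : ℤ} (hn : 0 ≤ n) (h : IsOneUnit x n) (m : ℕ) :
    IsOneUnit (x ^ m) n := by
  refine ⟨pow_ne_zero _ h.ne_zero, ?_, ?_⟩
  · rw [← inv_pow]
    have := pow_mem_lat h.inv_mem m
    rwa [mul_zero] at this
  · induction m with
    | zero => rw [pow_zero, sub_self]; exact Submodule.zero_mem _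
    | succ m ih =>
      have e : x ^ (m + 1) - 1 = x * (x ^ m - 1) + (x - 1) := by ring
      rw [e]
      exact Submodule.add_mem _ (mul_mem_lat' (m := 0) (by omega) (h.mem hn) ih) h.sub_one_mem

theorem IsOneUnit.zpow {x : k⸨X⸩} {n : ℤ} (hn : 0 ≤ n) (h : IsOneUnit x n) (m : ℤ) :
    IsOneUnit (x ^ m) n := by
  obtain ⟨m, rfl | rfl⟩ := m.eq_nat_or_neg
  · rw [zpow_natCast]; exact h.pow hn m
  · rw [zpow_neg, zpow_natCast]; exact (h.pow hn m).inv hn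

theorem IsOneUnit.char_pow (p : ℕ) [hp : Fact p.Prime] [CharP k p] {x : k⸨X⸩} {n : ℤ} (hn : 0 ≤ n)
    (h : IsOneUnit x n) (i : ℕ) : IsOneUnit (x ^ p ^ i) ((p : ℤ) ^ i * n) := by
  refine ⟨pow_ne_zero _ h.ne_zero, (h.pow hn _).inv_mem, ?_⟩
  have := pow_char_pow_sub_mem p h.sub_one_mem i
  rwa [one_pow] at this

/-- First order binomial expansion; negative exponents are reduced to positive ones by replacing `x`
with `x⁻¹`, whose linear term is the opposite up to second order. -/
theorem IsOneUnit.zpow_linear {x : k⸨X⸩} {n : ℤ} (hn : 0 ≤ n) (h : IsOneUnit x n) (m : ℤ) :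
    x ^ m - 1 - m * (x - 1) ∈ lat k (2 * n) := by
  have hnat : ∀ {y : k⸨X⸩}, IsOneUnit y n → ∀ m : ℕ, y ^ m - 1 - m * (y - 1) ∈ lat k (2 * n) := by
    intro y hy m
    induction m with
    | zero => simp
    | succ m ih =>
      have e : y ^ (m + 1) - 1 - ((m + 1 : ℕ) : k⸨X⸩) * (y - 1) =
          (y ^ m - 1 - m * (y - 1)) + (y ^ m - 1) * (y - 1) := by push_cast; ring
      rw [e]
      exact Submodule.add_mem _ ih (mul_mem_lat' (by omega) (hy.pow hn m).sub_one_mem hy.sub_one_mem)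
  obtain ⟨m, rfl | rfl⟩ := m.eq_nat_or_neg
  · rw [zpow_natCast, Int.cast_natCast]; exact hnat h m
  · have h1 := hnat (h.inv hn) m
    have hx := h.ne_zero
    have e : x ^ (-(m : ℤ)) - 1 - ((-(m : ℤ) : ℤ) : k⸨X⸩) * (x - 1) =
        (x⁻¹ ^ m - 1 - m * (x⁻¹ - 1)) + m * (x⁻¹ * ((x - 1) * (x - 1))) := by
      rw [zpow_neg, zpow_natCast, inv_pow]; push_cast; field_simp; ring
    rw [e]
    refine Submodule.add_mem _ h1 (mul_mem_lat' (m := 0) (n := 2 * n) (by omega) ?_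
      (mul_mem_lat' (m := 0) (n := 2 * n) (by omega) h.inv_mem
        (mul_mem_lat' (by omega) h.sub_one_mem h.sub_one_mem)))
    exact_mod_cast intCast_mem_lat (k := k) m

end Congruences

/-! ### Congruences for powers of `U`. -/

section UnitPartCongruences

variable {O : Type*} [CommRing O] [IsDomain O] {p f : ℕ} [hp : Fact p.Prime]
  {k : Type*} [Field k] [Algebra O k] [CharP k p]

variable (p f k) in
/-- The constant `υ = a_{γ,q}/a_{γ,1}` in `k((t))`. -/
noncomputable def upsilonL (γ : Oˣ) : k⸨X⸩ := toL (PowerSeries.C (brkRatio p f k γ))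

theorem upsilonL_mem (γ : Oˣ) (n : ℕ) : upsilonL p f k γ ^ n ∈ lat k 0 := by
  rw [upsilonL, ← map_pow]; exact toL_mem_lat _

theorem IsUnramifiedBase.upsilonL_pow (hO : IsUnramifiedBase O p f) (γ : Oˣ) :
    upsilonL p f k γ ^ p ^ f = upsilonL p f k γ := by
  rw [upsilonL, ← map_pow, ← map_pow, hO.brkRatio_pow]

theorem upsL_eq (γ : Oˣ) : upsL p f k γ = upsilonL p f k γ ^ p ^ (f - 1) := by
  rw [upsL, upsilonL, ← map_pow, ← map_pow]

theorem xi_eq_cast (hf : 0 < f) : xi p f = ((p ^ f - 1 : ℕ) : ℤ) := by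
  have hq := two_le_q (p := p) hf
  rw [xi]; push_cast [Nat.cast_sub (by omega : 1 ≤ p ^ f)]; ring

theorem IsUnramifiedBase.uL_sub_mem (hO : IsUnramifiedBase O p f) (γ : Oˣ) :
    uL p f k γ - (1 + upsilonL p f k γ * tpow k (xi p f) -
      upsilonL p f k γ ^ p ^ (f - 1) * tpow k (xi p f * (1 + (p : ℤ) ^ (f - 1)))) ∈
      lat k (xi p f * (1 + 2 * (p : ℤ) ^ (f - 1))) := by
  obtain ⟨w, hw⟩ := hO.brkU_expansion (k := k) γ
  have e : uL p f k γ - (1 + upsilonL p f k γ * tpow k (xi p f) -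
      upsilonL p f k γ ^ p ^ (f - 1) * tpow k (xi p f * (1 + (p : ℤ) ^ (f - 1)))) =
      tpow k (xi p f * (1 + 2 * (p : ℤ) ^ (f - 1))) * toL w := by
    rw [uL, hw, map_add, map_sub, map_add, map_one, map_mul, map_mul, map_mul, toL_X_pow, toL_X_pow,
      toL_X_pow, upsilonL, xi_eq_cast hO.f_pos, ← map_pow, ← map_pow]
    push_cast
    ring
  rw [e]
  exact mul_mem_lat' (n := 0) (by omega) (tpow_mem_lat le_rfl) (toL_mem_lat _)

theorem IsUnramifiedBase.isOneUnit_uL (hO : IsUnramifiedBase O p f) (γ : Oˣ) :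
    IsOneUnit (uL p f k γ) (xi p f) := by
  refine ⟨hO.uL_ne_zero γ, ?_, ?_⟩
  · rw [← zpow_neg_one]; exact hO.uL_zpow_mem γ _
  · have hξ := xi_pos (p := p) hO.f_pos
    have hP : (1 : ℤ) ≤ (p : ℤ) ^ (f - 1) := one_le_pow₀ (by exact_mod_cast hp.out.one_le)
    have h1 := lat_anti (k := k) (m := xi p f) (by nlinarith) (hO.uL_sub_mem γ)
    have h2 : upsilonL p f k γ * tpow k (xi p f) -
        upsilonL p f k γ ^ p ^ (f - 1) * tpow k (xi p f * (1 + (p : ℤ) ^ (f - 1))) ∈ lat k (xi p f) := by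
      refine Submodule.sub_mem _ (mul_mem_lat' (m := 0) (n := xi p f) (by omega) ?_ (tpow_mem_lat le_rfl))
        (mul_mem_lat' (m := 0) (n := xi p f) (by omega) (upsilonL_mem γ _) (tpow_mem_lat (by nlinarith)))
      simpa using upsilonL_mem (p := p) (f := f) (k := k) γ 1
    have := Submodule.add_mem _ h1 h2
    convert this using 1
    ring

theorem IsUnramifiedBase.isOneUnit_zpow (hO : IsUnramifiedBase O p f) (γ : Oˣ) (i : ℕ) (m : ℤ) :
    IsOneUnit (uL p f k γ ^ ((p : ℤ) ^ i * m)) ((p : ℤ) ^ i * xi p f) := by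
  have hξ := (xi_pos (p := p) hO.f_pos).le
  have := ((hO.isOneUnit_uL (k := k) γ).zpow hξ m).char_pow p hξ i
  rwa [← zpow_natCast, ← zpow_mul, Nat.cast_pow, mul_comm] at this

/-- `U^(p^v e)` for `e ≡ 1 mod q`. -/
theorem IsUnramifiedBase.uL_zpow_sub_mem (hO : IsUnramifiedBase O p f) (γ : Oˣ) (v : ℕ) (d : ℤ)
    (n : ℤ) (hn : n ≤ 1 + 2 * (p : ℤ) ^ (f - 1)) (hn' : n ≤ (p : ℤ) ^ f) :
    uL p f k γ ^ ((p : ℤ) ^ v * (1 + (p : ℤ) ^ f * d)) -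
      (1 + upsilonL p f k γ ^ p ^ v * tpow k ((p : ℤ) ^ v * xi p f) -
        upsilonL p f k γ ^ p ^ (f - 1 + v) *
          tpow k ((p : ℤ) ^ v * (xi p f * (1 + (p : ℤ) ^ (f - 1))))) ∈
      lat k ((p : ℤ) ^ v * (xi p f * n)) := by
  have hξ := (xi_pos (p := p) hO.f_pos)
  have hu := hO.uL_ne_zero (k := k) γ
  -- `U^(qd)` is `1` modulo `t^(qξ)`, so the extra factor is harmless as long as `n ≤ q`; the bound
  -- `n ≤ 1 + 2p^(f-1)` is the precision of the expansion of `U`.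
  have h1 : uL p f k γ ^ (1 + (p : ℤ) ^ f * d) - (1 + upsilonL p f k γ * tpow k (xi p f) -
      upsilonL p f k γ ^ p ^ (f - 1) * tpow k (xi p f * (1 + (p : ℤ) ^ (f - 1)))) ∈
      lat k (xi p f * n) := by
    refine sub_mem_lat_trans (y := uL p f k γ) ?_ (lat_anti (by nlinarith) (hO.uL_sub_mem γ))
    have e : uL p f k γ ^ (1 + (p : ℤ) ^ f * d) - uL p f k γ =
        uL p f k γ * (uL p f k γ ^ ((p : ℤ) ^ f * d) - 1) := by
      rw [zpow_add₀ hu, zpow_one]; ring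
    rw [e]
    exact mul_mem_lat' (m := 0) (by nlinarith) ((hO.isOneUnit_uL γ).mem hξ.le)
      (hO.isOneUnit_zpow γ f d).sub_one_mem
  have h2 := pow_char_pow_sub_mem p h1 v
  rw [sub_pow_char_pow, add_pow_char_pow, one_pow, mul_pow, mul_pow, tpow_pow, tpow_pow, ← pow_mul,
    ← zpow_natCast, ← zpow_mul, ← pow_add] at h2
  convert h2 using 3
  · rw [Nat.cast_pow, mul_comm]
  · rw [Nat.cast_pow]
  · rw [Nat.cast_pow]

end UnitPartCongruences


/-! ### Closed form of `B` and stability of the lattice. -/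

section Series

variable {k : Type*} [Field k] (p f : ℕ) [hp : Fact p.Prime] (P : Params k) (C : Scalars k p f P.ell)

/-- The number `θ = (q-1)/(p-1)`. -/
def thetaN : ℤ := xi p f / ((p : ℤ) - 1)

/-- The exponent attached to `b_i`. -/
def expD (ell i : ℕ) : ℤ := (p : ℤ) ^ i * (lam p f ell i - xi p f)

/-- The exponents attached to the extra scalar. -/
def expC (i : ℕ) : ℤ := (p : ℤ) ^ i * -(xi p f + (p : ℤ) ^ f * thetaN p f)

/-- The leading exponent attached to `c_i`. -/
def expE (ell i : ℕ) : ℤ := (p : ℤ) ^ i * ((p : ℤ) ^ (2 * f) * (lam p f ell i - 2 * xi p f))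

/-- The factor `H(m, i)` in `k((t))`. -/
noncomputable def polyHL (k : Type*) [Field k] (m i : ℕ) : k⸨X⸩ :=
  1 - ((m + 2 : ℕ) : k⸨X⸩) * ∑ j ∈ Finset.Icc 1 f, tpow k ((p : ℤ) ^ i * gNum p f j)

/-- The off-diagonal entry of `φ` in closed form. It does not depend on the auxiliary integers. -/
noncomputable def bseries : k⸨X⸩ :=
  (∑ i : setD p f P.ell, toL (PowerSeries.C (C.b i)) * tpow k (expD p f P.ell i)) +
    toL (PowerSeries.C C.c) * (∑ i ∈ Finset.range f, tpow k (expC p f i)) +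
    ∑ i : setE p f P.ell, toL (PowerSeries.C (C.cE i)) *
      (tpow k (expE p f P.ell i) * polyHL p f k (digit p f P.ell i) i)

variable {p f P C}

theorem gNum_ge (hf : 0 < f) {j : ℕ} (hj : 1 ≤ j) :
    xi p f * ((p : ℤ) ^ (2 * f) - (p : ℤ) ^ f) ≤ gNum p f j := by
  have hξ := xi_pos (p := p) hf
  have hp0 : (0 : ℤ) < p := by exact_mod_cast hp.out.pos
  have hp1 : (1 : ℤ) ≤ p := by exact_mod_cast hp.out.one_le
  rw [gNum]
  refine mul_le_mul_of_nonneg_left ?_ hξ.le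
  have h1 : (p : ℤ) ^ (2 * f) ≤ ∑ s ∈ Finset.range j, (p : ℤ) ^ (2 * f + s + 1 - j) := by
    refine le_trans (le_of_eq ?_) (Finset.single_le_sum (f := fun s => (p : ℤ) ^ (2 * f + s + 1 - j))
      (fun s _ => by positivity) (Finset.mem_range.2 (show j - 1 < j by omega)))
    congr 1; omega
  have h2 : (p : ℤ) ^ (f + 1 - j) ≤ (p : ℤ) ^ f := pow_le_pow_right₀ hp1 (by omega)
  linarith

theorem gNum_nonneg (hf : 0 < f) {j : ℕ} (hj : 1 ≤ j) : 0 ≤ gNum p f j := by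
  have hp1 : (1 : ℤ) ≤ p := by exact_mod_cast hp.out.one_le
  have h2 : (p : ℤ) ^ f ≤ (p : ℤ) ^ (2 * f) := pow_le_pow_right₀ hp1 (by omega)
  exact le_trans (mul_nonneg (xi_pos (p := p) hf).le (by linarith)) (gNum_ge hf hj)

theorem toL_polyH (hf : 0 < f) (m i : ℕ) : toL (polyH p f k m i) = polyHL p f k m i := by
  rw [polyH, polyHL, map_sub, map_one, map_mul, map_sum, map_natCast, map_natCast]
  congr 2
  refine Finset.sum_congr rfl fun j hj => ?_
  rw [toL_X_pow, Int.toNat_of_nonneg]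
  exact mul_nonneg (by positivity) (gNum_nonneg hf (Finset.mem_Icc.1 hj).1)

variable {A : Aux}

theorem tpow_mul_toL_X_pow {n m : ℤ} (N : ℕ) (hn : 0 ≤ n) (e : 1 - (N : ℤ) + n = m) :
    tpow k (1 - (N : ℤ)) * toL (PowerSeries.X ^ n.toNat) = tpow k m := by
  rw [toL_X_pow, Int.toNat_of_nonneg hn, ← tpow_add, e]

/-- Multiplication by `t^(1-q^N)` removes the summand `q^N - 1` from every exponent, so `N` drops
out. Non-negativity of the exponents ensures that `toNat` does not truncate. -/
theorem btilde_eq (hf : 0 < f) (hA : A.Admissible C) : btilde p f P C A = bseries p f P C := by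
  rw [btilde, seriesB, bseries, map_add, map_add, mul_add, mul_add, map_sum, map_sum, map_mul, map_sum]
  congr 1
  · congr 1
    · rw [Finset.mul_sum]
      refine Finset.sum_congr rfl fun i _ => ?_
      rw [map_mul, mul_left_comm, tpow_mul_toL_X_pow _ (hA.expRi_nonneg i i.2)]
      rw [expRi, cast_pow_pow, ellShift_eq, expD]; ring
    · rw [mul_left_comm, Finset.mul_sum]
      congr 1
      refine Finset.sum_congr rfl fun i hi => ?_
      rw [tpow_mul_toL_X_pow _ (hA.expO_nonneg i (Finset.mem_range.1 hi))]
      rw [expO, cast_pow_pow, expC, thetaN]; ring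
  · rw [Finset.mul_sum]
    refine Finset.sum_congr rfl fun i _ => ?_
    rw [map_mul, map_mul, toL_polyH hf, mul_left_comm, ← mul_assoc (tpow k _),
      tpow_mul_toL_X_pow _ (hA.expN_nonneg i i.2)]
    rw [expN, cast_pow_pow, ellShift_eq, expE, pow_add]; ring

theorem polyHL_mem (hf : 0 < f) (m i : ℕ) : polyHL p f k m i ∈ lat k 0 := by
  rw [← toL_polyH hf]; exact toL_mem_lat _

/-- The conditions `d2`, `e2` and `c4` say that the exponents in `B` are at least `n_y - 1 - q(n_x -
1)`; for `c_i` the leading exponent suffices, as `H_i` is a power series. -/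
theorem Aux.Admissible.latticeStable (hf : 0 < f) (hA : A.Admissible C) : LatticeStable p f P C A := by
  refine ⟨hf, hA.nx_pos, hA.ny_pos, ?_⟩
  have hp1 : (1 : ℤ) ≤ p := by exact_mod_cast hp.out.one_le
  have hξ : xi p f = (p : ℤ) ^ f - 1 := rfl
  rw [btilde_eq hf hA, bseries, Nat.cast_pow]
  refine Submodule.add_mem _ (Submodule.add_mem _ ?_ ?_) ?_
  · refine Submodule.sum_mem _ fun i _ => toL_mul_mem_lat _ (tpow_mem_lat ?_)
    have := hA.d2 i i.2
    rw [ellShift_eq, hξ] at this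
    rw [expD, hξ]
    linarith
  · by_cases hc : C.c = 0
    · rw [hc, map_zero, map_zero, zero_mul]; exact Submodule.zero_mem _
    refine toL_mul_mem_lat _ (Submodule.sum_mem _ fun i hi => tpow_mem_lat ?_)
    have h4 := hA.c4 hc
    have hi' := Finset.mem_range.1 hi
    obtain ⟨θ, hθ, _, hθ'⟩ := exists_theta (p := p) hf
    -- Among the exponents attached to `c`, the most negative one is that of `i = f - 1`, for which
    -- `c4` is stated.
    have h2 : (p : ℤ) ^ i ≤ (p : ℤ) ^ (f - 1) := pow_le_pow_right₀ hp1 (by omega)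
    have h3 : (p : ℤ) ^ (2 * f - 1) = (p : ℤ) ^ (f - 1) * (p : ℤ) ^ f := by
      rw [← pow_add]; congr 1; omega
    have h5 : (0 : ℤ) ≤ xi p f + (p : ℤ) ^ f * θ := by
      have := (xi_pos (p := p) hf).le; positivity
    rw [expC, thetaN, hθ']
    rw [hθ', h3] at h4
    have h6 := mul_le_mul_of_nonneg_right h2 h5
    rw [hξ] at *
    linarith
  · refine Submodule.sum_mem _ fun i _ => toL_mul_mem_lat _
      (mul_mem_lat' (n := 0) (m := expE p f P.ell i) ?_ (tpow_mem_lat le_rfl) (polyHL_mem hf _ _))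
    have := hA.e2 i i.2
    rw [ellShift_eq, hξ, pow_add (p : ℤ) (2 * f)] at this
    rw [expE, hξ]
    linarith

end Series

/-! ### The key congruence for the terms in `b_i` and in `c`. -/

section KeyCongruence

variable {O : Type*} [CommRing O] [IsDomain O] {p f : ℕ} [hp : Fact p.Prime]
  {k : Type*} [Field k] [Algebra O k] [CharP k p]
  {P : Params k} {C : Scalars k p f P.ell} {A : Aux}

theorem sum_tele_sub {M : Type*} [AddCommGroup M] (g : ℕ → M) (n a : ℕ) :
    ∑ i ∈ Finset.range n, (g (i + a + 1) - g (i + a)) = g (n + a) - g a := by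
  have := Finset.sum_range_sub (fun i => g (i + a)) n
  rw [zero_add] at this
  rw [← this]
  refine Finset.sum_congr rfl fun i _ => ?_
  rw [add_right_comm]

/-- Contribution of a scalar `b_i`. -/
theorem twist_expD_sub_mem (hO : IsUnramifiedBase O p f) (γ : Oˣ) (ell i : ℕ) :
    tpow k (expD p f ell i) * uL p f k γ ^ expD p f ell i - tpow k (expD p f ell i) ∈
      lat k (ellShift p f ell i) := by
  have e : ∀ x y : k⸨X⸩, x * y - x = x * (y - 1) := fun x y => by ring
  rw [e]
  refine mul_mem_lat' (m := expD p f ell i) (n := (p : ℤ) ^ i * xi p f) ?_ (tpow_mem_lat le_rfl)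
    (hO.isOneUnit_zpow γ i _).sub_one_mem
  rw [ellShift_eq, expD]; linarith

/-- The inequality behind the error terms attached to the extra scalar. -/
theorem le_error_of_c {θ : ℤ} (hp3 : 3 ≤ p) (hf : 0 < f) (hθ : 0 < θ) (hξ : xi p f = ((p : ℤ) - 1) * θ)
    {n : ℤ} (h1 : n ≤ xi p f) (h2 : f = 1 → n ≤ (p : ℤ) - 2) :
    n ≤ (p : ℤ) ^ (f - 1) * θ * ((p : ℤ) - 2) := by
  have hp3' : (3 : ℤ) ≤ p := by exact_mod_cast hp3
  by_cases hf1 : f = 1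
  · subst hf1
    -- For `f = 1` one has `ξ = p - 1`; only here is the stronger condition `n ≤ p - 2` required.
    have : θ = 1 := by
      rw [xi, pow_one] at hξ
      have h3 : ((p : ℤ) - 1) * (θ - 1) = 0 := by linarith
      rcases mul_eq_zero.1 h3 with h | h <;> omega
    rw [this]
    simpa using h2 rfl
  · have hP : (p : ℤ) ≤ (p : ℤ) ^ (f - 1) := by
      conv_lhs => rw [← pow_one (p : ℤ)]
      exact pow_le_pow_right₀ (by omega) (by omega)
    have h3 : (p : ℤ) - 1 ≤ (p : ℤ) ^ (f - 1) * ((p : ℤ) - 2) := by nlinarith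
    calc n ≤ ((p : ℤ) - 1) * θ := by rw [← hξ]; exact h1
      _ ≤ (p : ℤ) ^ (f - 1) * ((p : ℤ) - 2) * θ := mul_le_mul_of_nonneg_right h3 hθ.le
      _ = _ := by ring

theorem p_pow_pred_mul (hf : 0 < f) : (p : ℤ) ^ (f - 1) * p = (p : ℤ) ^ f := by
  rw [← pow_succ, Nat.sub_add_cancel hf]

/-- Contribution of the extra scalar. -/
theorem twist_expC_sub_mem (hO : IsUnramifiedBase O p f) (γ : Oˣ) (hp3 : 3 ≤ p) {n : ℤ}
    (h1 : n ≤ xi p f) (h2 : f = 1 → n ≤ (p : ℤ) - 2) {N : ℕ}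
    (hW : uL p f k γ ^ (expR p f N + 1) - 1 ∈ lat k (n + cZero p f)) (hn : 0 ≤ n) :
    (∑ i ∈ Finset.range f, (tpow k (expC p f i) * uL p f k γ ^ expC p f i - tpow k (expC p f i))) -
      upsL p f k γ * (phiL k p f (gammaW p f k N γ) - gammaW p f k N γ) ∈ lat k n := by
  have hf := hO.f_pos
  obtain ⟨θ, hθ, hξ, hθ'⟩ := exists_theta (p := p) hf
  have herr := le_error_of_c hp3 hf hθ hξ h1 h2
  have hp3' : (3 : ℤ) ≤ p := by exact_mod_cast hp3
  have hP1 : (1 : ℤ) ≤ (p : ℤ) ^ (f - 1) := one_le_pow₀ (by omega)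
  have hq : (p : ℤ) ^ (f - 1) * p = (p : ℤ) ^ f := p_pow_pred_mul hf
  have hξq : xi p f = (p : ℤ) ^ f - 1 := rfl
  have hc0 : cZero p f = (p : ℤ) ^ (f - 1) * θ := by rw [cZero, hθ']
  -- The terms of the telescope: the `i`-th summand will be `a(i+f) - a(i+f-1)` modulo `t^n`, its
  -- two parts coming from the two nontrivial terms of `U`.
  let a : ℕ → k⸨X⸩ := fun n => upsilonL p f k γ ^ p ^ n * tpow k (-((p : ℤ) ^ n * θ))
  have ha : ∀ n, a n = upsilonL p f k γ ^ p ^ n * tpow k (-((p : ℤ) ^ n * θ)) := fun n => rfl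
  have hυf : ∀ n, upsilonL p f k γ ^ p ^ (n + f) = upsilonL p f k γ ^ p ^ n := by
    intro n
    rw [pow_add, mul_comm, pow_mul, hO.upsilonL_pow]
  have step : ∀ i ∈ Finset.range f, (tpow k (expC p f i) * uL p f k γ ^ expC p f i - tpow k (expC p f i)) -
      (a (i + (f - 1) + 1) - a (i + (f - 1))) ∈ lat k n := by
    intro i _
    -- Since `-(ξ + qθ) = 1 - q(1 + θ)`, the exponent is `p^i` times an integer congruent to `1`
    -- modulo `q`.
    have e0 : expC p f i = (p : ℤ) ^ i * (1 + (p : ℤ) ^ f * (-(1 + θ))) := by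
      rw [expC, thetaN, hθ', hξq]; ring
    have h3 := hO.uL_zpow_sub_mem (k := k) γ i (-(1 + θ)) (1 + 2 * (p : ℤ) ^ (f - 1)) le_rfl
      (by rw [← hq]; nlinarith)
    rw [← e0] at h3
    have h4 := mul_mem_lat' (l := n) (m := expC p f i) ?_ (tpow_mem_lat (k := k) le_rfl) h3
    · convert h4 using 1
      have e1 : tpow k (expC p f i) * tpow k ((p : ℤ) ^ i * xi p f) =
          tpow k (-((p : ℤ) ^ (i + (f - 1) + 1) * θ)) := by
        rw [← tpow_add, expC, thetaN, hθ']
        congr 1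
        rw [show i + (f - 1) + 1 = i + f by omega, pow_add]; ring
      have e2 : tpow k (expC p f i) * tpow k ((p : ℤ) ^ i * (xi p f * (1 + (p : ℤ) ^ (f - 1)))) =
          tpow k (-((p : ℤ) ^ (i + (f - 1)) * θ)) := by
        rw [← tpow_add, expC, thetaN, hθ']
        congr 1
        rw [pow_add]
        linear_combination (p : ℤ) ^ i * (p : ℤ) ^ (f - 1) * hξ + (p : ℤ) ^ i * θ * hq
      have e3 : upsilonL p f k γ ^ p ^ (i + (f - 1) + 1) = upsilonL p f k γ ^ p ^ i := by
        rw [show i + (f - 1) + 1 = i + f by omega, hυf]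
      rw [ha, ha, e3, ← e1, ← e2, add_comm (f - 1) i]
      ring
    · have hi : (1 : ℤ) ≤ (p : ℤ) ^ i := one_le_pow₀ (by omega)
      -- The error starts at `p^i p^(f-1) θ(p-2)`, which is at least `n` by `le_error_of_c`.
      have e5 : expC p f i + (p : ℤ) ^ i * (xi p f * (1 + 2 * (p : ℤ) ^ (f - 1))) =
          (p : ℤ) ^ i * ((p : ℤ) ^ (f - 1) * θ * ((p : ℤ) - 2)) := by
        rw [expC, thetaN, hθ']
        linear_combination 2 * (p : ℤ) ^ i * (p : ℤ) ^ (f - 1) * hξ + (p : ℤ) ^ i * θ * hq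
      rw [e5]
      nlinarith
  have h5 := Submodule.sum_mem _ step
  rw [Finset.sum_sub_distrib, sum_tele_sub] at h5
  have hυ : upsL p f k γ ∈ lat k 0 := toL_mem_lat _
  have hWe : gammaW p f k N γ - tpow k (-cZero p f) ∈ lat k n := by
    have e : gammaW p f k N γ - tpow k (-cZero p f) =
        (uL p f k γ ^ (expR p f N + 1) - 1) * tpow k (-cZero p f) := by rw [gammaW]; ring
    rw [e]
    exact mul_mem_lat' (by omega) hW (tpow_mem_lat le_rfl)
  have hWφ : phiL k p f (gammaW p f k N γ) - tpow k ((p ^ f : ℕ) * (-cZero p f)) ∈ lat k n := by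
    rw [← phiL_tpow, ← map_sub]
    refine lat_anti ?_ (phiL_mem_lat hWe)
    have hq1 : (1 : ℤ) ≤ ((p ^ f : ℕ) : ℤ) := by exact_mod_cast Nat.one_le_pow _ _ hp.out.pos
    nlinarith
  have h6 := mul_mem_lat' (m := 0) (l := n) (by omega) hυ (Submodule.sub_mem _ hWφ hWe)
  -- The ends of the telescope are `υ^(p^(f-1))` times `φ(t^(-c₀))` and `t^(-c₀)`, with `c₀ =
  -- p^(f-1)θ`. Replacing `t^(-c₀)` by `W` costs only a term in the lattice.
  have e7 : upsL p f k γ * (phiL k p f (gammaW p f k N γ) - gammaW p f k N γ) -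
      (a (f + (f - 1)) - a (f - 1)) =
      upsL p f k γ * (phiL k p f (gammaW p f k N γ) - tpow k ((p ^ f : ℕ) * (-cZero p f)) -
        (gammaW p f k N γ - tpow k (-cZero p f))) := by
    have e8 : a (f + (f - 1)) = upsL p f k γ * tpow k ((p ^ f : ℕ) * (-cZero p f)) := by
      rw [ha, upsL_eq, add_comm, hυf, hc0, pow_add]
      congr 2; push_cast; ring
    have e9 : a (f - 1) = upsL p f k γ * tpow k (-cZero p f) := by rw [ha, upsL_eq, hc0]
    rw [e8, e9]; ring
  rw [← e7] at h6
  have := Submodule.sub_mem _ h5 h6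
  rwa [sub_sub_sub_cancel_right] at this

end KeyCongruence


/-! ### The key congruence for the terms in `c_i` and the polynomials `H_i`. -/

section KeyCongruence

variable {O : Type*} [CommRing O] [IsDomain O] {p f : ℕ} [hp : Fact p.Prime]
  {k : Type*} [Field k] [Algebra O k] [CharP k p]
  {P : Params k} {C : Scalars k p f P.ell} {A : Aux}

/-- The exponents `ξ (p^(2f) + … + p^(2f+1-j))`. -/
def kapN (p f j : ℕ) : ℤ := xi p f * ∑ s ∈ Finset.range j, (p : ℤ) ^ (2 * f + s + 1 - j)

theorem gNum_eq (j : ℕ) : gNum p f j = kapN p f j - (p : ℤ) ^ (f + 1 - j) * xi p f := by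
  rw [gNum, kapN]; ring

theorem kapN_succ {j : ℕ} (hj : j ≤ f) : kapN p f (j + 1) = kapN p f j + xi p f * (p : ℤ) ^ (2 * f - j) := by
  rw [kapN, kapN, Finset.sum_range_succ', mul_add]
  congr 2
  · refine Finset.sum_congr rfl fun s _ => ?_
    congr 1; omega
  · congr 1; omega

theorem kapN_one : kapN p f 1 = xi p f * (p : ℤ) ^ (2 * f) := by
  rw [kapN, Finset.sum_range_one]; rfl

/-- `g^(j) = p^(f+1-j) (1 + q d)`. -/
theorem exists_gNum_eq {j : ℕ} (hj : 1 ≤ j) (hj' : j ≤ f) :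
    ∃ d : ℤ, gNum p f j = (p : ℤ) ^ (f + 1 - j) * (1 + (p : ℤ) ^ f * d) := by
  refine ⟨xi p f * (∑ s ∈ Finset.range j, (p : ℤ) ^ s) - 1, ?_⟩
  have h : ∑ s ∈ Finset.range j, (p : ℤ) ^ (2 * f + s + 1 - j) =
      (p : ℤ) ^ (f + 1 - j) * ((p : ℤ) ^ f * ∑ s ∈ Finset.range j, (p : ℤ) ^ s) := by
    rw [Finset.mul_sum, Finset.mul_sum]
    refine Finset.sum_congr rfl fun s _ => ?_
    rw [← pow_add, ← pow_add]
    congr 1; omega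
  rw [gNum, h, xi]; ring

/-- The right-hand side is where the error of the `j`-th step of the telescope begins. It lies
beyond the final exponent `κ_{f+1}` because the increments `ξp^(2f-j)` of `κ` decrease by a factor
`p ≥ 2`, so that the remaining ones add up to less than twice the first. -/
theorem kapN_last_sub_le (hf : 0 < f) {j : ℕ} (hj : 1 ≤ j) (hj' : j ≤ f) :
    kapN p f (f + 1) ≤ gNum p f j + (p : ℤ) ^ (f + 1 - j) * (xi p f * (2 * (p : ℤ) ^ (f - 1))) := by
  have hp2 : (2 : ℤ) ≤ p := by exact_mod_cast hp.out.two_le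
  have hξ := xi_pos (p := p) hf
  have key : ∀ d, d ≤ f - 1 → ∀ j, j + d = f →
      kapN p f (f + 1) ≤ kapN p f j + xi p f * (2 * (p : ℤ) ^ (2 * f - j) - (p : ℤ) ^ f) := by
    intro d
    induction d with
    | zero =>
      intro _ j hj
      rw [add_zero] at hj
      subst hj
      rw [kapN_succ le_rfl, show 2 * j - j = j by omega]
      linarith
    | succ d ih =>
      intro hd j hj
      have h1 := ih (by omega) (j + 1) (by omega)
      rw [kapN_succ (j := j) (by omega)] at h1
      have h2 : (p : ℤ) ^ (2 * f - j) = (p : ℤ) ^ (2 * f - (j + 1)) * p := by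
        rw [← pow_succ]; congr 1; omega
      have h3 : (0 : ℤ) < (p : ℤ) ^ (2 * f - (j + 1)) := by positivity
      have h4 : 2 * (p : ℤ) ^ (2 * f - (j + 1)) ≤ (p : ℤ) ^ (2 * f - j) := by rw [h2]; nlinarith
      nlinarith
  have h1 := key (f - j) (by omega) j (by omega)
  have h2 : (p : ℤ) ^ (f + 1 - j) * (p : ℤ) ^ (f - 1) = (p : ℤ) ^ (2 * f - j) := by
    rw [← pow_add]; congr 1; omega
  have h3 : (p : ℤ) ^ (f + 1 - j) ≤ (p : ℤ) ^ f := pow_le_pow_right₀ (by omega) (by omega)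
  have h4 : (p : ℤ) ^ (f + 1 - j) * (xi p f * (2 * (p : ℤ) ^ (f - 1))) =
      xi p f * (2 * (p : ℤ) ^ (2 * f - j)) := by rw [← h2]; ring
  rw [gNum_eq, h4]
  nlinarith

/-- It makes negligible both the terms of order `2q²ξ` and the products of order `g^{(j)} + q²ξ`. -/
theorem kapN_last_le (hf : 0 < f) :
    kapN p f (f + 1) ≤ xi p f * (2 * (p : ℤ) ^ (2 * f) - (p : ℤ) ^ f) := by
  have h1 := kapN_last_sub_le (p := p) hf (j := 1) le_rfl hf
  have h2 : (p : ℤ) ^ (f - 1 + 1) = (p : ℤ) ^ f := by rw [Nat.sub_add_cancel hf]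
  have hp2 : (2 : ℤ) ≤ p := by exact_mod_cast hp.out.two_le
  have hξ := xi_pos (p := p) hf
  have h4 : 2 * (p : ℤ) ^ (f - 1) ≤ (p : ℤ) ^ f := by
    rw [← h2, pow_succ]
    have : (0 : ℤ) < (p : ℤ) ^ (f - 1) := by positivity
    nlinarith
  rw [gNum_eq, kapN_one, Nat.add_sub_cancel] at h1
  have h5 : (p : ℤ) ^ (2 * f) = (p : ℤ) ^ f * (p : ℤ) ^ f := by rw [two_mul, pow_add]
  have h6 : (0 : ℤ) < (p : ℤ) ^ f := by positivity
  have h7 : (p : ℤ) ^ f * (xi p f * (2 * (p : ℤ) ^ (f - 1))) ≤ (p : ℤ) ^ f * (xi p f * (p : ℤ) ^ f) :=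
    mul_le_mul_of_nonneg_left (mul_le_mul_of_nonneg_left h4 hξ.le) h6.le
  rw [h5] at h1 ⊢
  linarith

/-- The telescoping sum over the correction terms `t^(g^(j))`. -/
theorem sum_twist_gNum_sub_mem (hO : IsUnramifiedBase O p f) (γ : Oˣ) :
    ∑ j ∈ Finset.Icc 1 f, tpow k (gNum p f j) * (uL p f k γ ^ gNum p f j - 1) -
      upsilonL p f k γ * tpow k (xi p f * (p : ℤ) ^ (2 * f)) ∈ lat k (kapN p f (f + 1)) := by
  have hf := hO.f_pos
  -- The `j`-th summand will be `K j - K (j+1)`, from the second and third terms of `U`. The power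
  -- of `υ` drops from `p^(f+1-j)` to `p^(f-j)` because `υ^q = υ`.
  let K : ℕ → k⸨X⸩ := fun j => upsilonL p f k γ ^ p ^ (f + 1 - j) * tpow k (kapN p f j)
  have hK : ∀ j, K j = upsilonL p f k γ ^ p ^ (f + 1 - j) * tpow k (kapN p f j) := fun j => rfl
  have hp2 : (2 : ℤ) ≤ p := by exact_mod_cast hp.out.two_le
  have hPq : 2 * (p : ℤ) ^ (f - 1) ≤ (p : ℤ) ^ f := by
    rw [← p_pow_pred_mul hf]
    have : (0 : ℤ) < (p : ℤ) ^ (f - 1) := by positivity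
    nlinarith
  have step : ∀ i ∈ Finset.range f, tpow k (gNum p f (1 + i)) * (uL p f k γ ^ gNum p f (1 + i) - 1) -
      (K (1 + i) - K (1 + i + 1)) ∈ lat k (kapN p f (f + 1)) := by
    intro i hi
    have hi' := Finset.mem_range.1 hi
    obtain ⟨j, hj⟩ : ∃ j, j = 1 + i := ⟨_, rfl⟩
    rw [← hj]
    obtain ⟨d, hd⟩ := exists_gNum_eq (p := p) (f := f) (j := j) (by omega) (by omega)
    -- The precision `2p^(f-1)`, one less than what the expansion of `U` allows, is used because it
    -- must not exceed `q`, with equality for `p = 2`.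
    have h3 := hO.uL_zpow_sub_mem (k := k) γ (f + 1 - j) d (2 * (p : ℤ) ^ (f - 1)) (by linarith) hPq
    rw [← hd] at h3
    have h4 := mul_mem_lat' (kapN_last_sub_le (p := p) hf (j := j) (by omega) (by omega))
      (tpow_mem_lat (k := k) le_rfl) h3
    convert h4 using 1
    have e1 : tpow k (gNum p f j) * tpow k ((p : ℤ) ^ (f + 1 - j) * xi p f) = tpow k (kapN p f j) := by
      rw [← tpow_add, gNum_eq]; congr 1; ring
    have e2 : tpow k (gNum p f j) * tpow k ((p : ℤ) ^ (f + 1 - j) * (xi p f * (1 + (p : ℤ) ^ (f - 1)))) =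
        tpow k (kapN p f (j + 1)) := by
      rw [← tpow_add, gNum_eq, kapN_succ (by omega)]
      have h2 : (p : ℤ) ^ (f + 1 - j) * (p : ℤ) ^ (f - 1) = (p : ℤ) ^ (2 * f - j) := by
        rw [← pow_add]; congr 1; omega
      rw [← h2]; congr 1; ring
    have e3 : upsilonL p f k γ ^ p ^ (f - 1 + (f + 1 - j)) = upsilonL p f k γ ^ p ^ (f + 1 - (j + 1)) := by
      rw [show f - 1 + (f + 1 - j) = f + (f + 1 - (j + 1)) by omega, pow_add, pow_mul, hO.upsilonL_pow]
    rw [hK, hK, ← e1, ← e2, e3]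
    ring
  have h5 := Submodule.sum_mem _ step
  have h6 : ∑ j ∈ Finset.Icc 1 f, tpow k (gNum p f j) * (uL p f k γ ^ gNum p f j - 1) =
      ∑ i ∈ Finset.range f, tpow k (gNum p f (1 + i)) * (uL p f k γ ^ gNum p f (1 + i) - 1) := by
    have : Finset.Icc 1 f = Finset.Ico 1 (f + 1) := by ext; simp
    rw [this, Finset.sum_Ico_eq_sum_range, Nat.add_sub_cancel]
  have h7 : ∑ i ∈ Finset.range f, (K (1 + i) - K (1 + i + 1)) = K 1 - K (f + 1) := by
    have := sum_tele_sub K f 1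
    have e : ∀ i, K (1 + i) - K (1 + i + 1) = -(K (i + 1 + 1) - K (i + 1)) := fun i => by
      rw [neg_sub, add_comm 1 i]
    simp only [e, Finset.sum_neg_distrib]
    rw [this, neg_sub]
  rw [Finset.sum_sub_distrib, h7, ← h6] at h5
  have h8 : K 1 = upsilonL p f k γ * tpow k (xi p f * (p : ℤ) ^ (2 * f)) := by
    rw [hK, kapN_one, Nat.add_sub_cancel, hO.upsilonL_pow]
  -- The last term of the telescope is exactly of the order of the modulus and is discarded.
  have h9 : K (f + 1) ∈ lat k (kapN p f (f + 1)) :=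
    mul_mem_lat' (m := 0) (by omega) (upsilonL_mem γ _) (tpow_mem_lat le_rfl)
  rw [← h8]
  have := Submodule.sub_mem _ h5 h9
  convert this using 1
  ring

/-- The congruence behind the polynomials `H(m, i)`. -/
theorem twist_polyH_sub_mem (hO : IsUnramifiedBase O p f) (γ : Oˣ) (ν : ℤ) (m : ℕ)
    (hν : (p : ℤ) ∣ ν - ((m + 2 : ℕ) : ℤ)) :
    uL p f k γ ^ ((p : ℤ) ^ (2 * f) * ν) * (1 - ((m + 2 : ℕ) : k⸨X⸩) *
        ∑ j ∈ Finset.Icc 1 f, tpow k (gNum p f j) * uL p f k γ ^ gNum p f j) -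
      (1 - ((m + 2 : ℕ) : k⸨X⸩) * ∑ j ∈ Finset.Icc 1 f, tpow k (gNum p f j)) ∈
      lat k (kapN p f (f + 1)) := by
  have hf := hO.f_pos
  have hξ := xi_pos (p := p) hf
  have hq1 : (1 : ℤ) ≤ (p : ℤ) ^ f := one_le_pow₀ (by exact_mod_cast hp.out.one_le)
  have hqq : (p : ℤ) ^ (2 * f) = (p : ℤ) ^ f * (p : ℤ) ^ f := by rw [two_mul, pow_add]
  have hP1 : (1 : ℤ) ≤ (p : ℤ) ^ (f - 1) := one_le_pow₀ (by exact_mod_cast hp.out.one_le)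
  have hlast := kapN_last_le (p := p) hf
  have hu := hO.isOneUnit_uL (k := k) γ
  set x := uL p f k γ ^ ((p : ℤ) ^ (2 * f) * ν) with hx
  have hx1 : x - 1 ∈ lat k ((p : ℤ) ^ (2 * f) * xi p f) := (hO.isOneUnit_zpow γ _ _).sub_one_mem
  have hmu : ((ν : ℤ) : k⸨X⸩) = ((m + 2 : ℕ) : k⸨X⸩) := by
    have := (CharP.intCast_eq_zero_iff k⸨X⸩ p _).2 hν
    rw [Int.cast_sub, sub_eq_zero, Int.cast_natCast] at this
    exact this
  -- To first order `U^(q²)` is `1 + υ^(q²)t^(q²ξ)` with `υ^(q²) = υ`, and raising to the power `ν`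
  -- multiplies the linear term by `ν ≡ m + 2` modulo `p`.
  have hxlin : x - 1 - ((m + 2 : ℕ) : k⸨X⸩) * (upsilonL p f k γ * tpow k (xi p f * (p : ℤ) ^ (2 * f))) ∈
      lat k (kapN p f (f + 1)) := by
    have hy := hu.char_pow p hξ.le (2 * f)
    have hn : (0 : ℤ) ≤ (p : ℤ) ^ (2 * f) * xi p f := by positivity
    have h1 := hy.zpow_linear hn ν
    rw [← zpow_natCast (uL p f k γ), ← zpow_mul, Nat.cast_pow, ← hx, hmu] at h1
    have h2 := hO.uL_sub_mem (k := k) γ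
    have h3 : uL p f k γ - (1 + upsilonL p f k γ * tpow k (xi p f)) ∈ lat k (xi p f * 2) := by
      have h4 : upsilonL p f k γ ^ p ^ (f - 1) * tpow k (xi p f * (1 + (p : ℤ) ^ (f - 1))) ∈
          lat k (xi p f * 2) :=
        mul_mem_lat' (m := 0) (n := xi p f * 2) (by omega) (upsilonL_mem γ _)
          (tpow_mem_lat (mul_le_mul_of_nonneg_left (by omega) hξ.le))
      have h5 := Submodule.sub_mem _ (lat_anti (m := xi p f * 2)
        (mul_le_mul_of_nonneg_left (by omega) hξ.le) h2) h4
      convert h5 using 1; ring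
    have h6 := pow_char_pow_sub_mem p h3 (2 * f)
    rw [add_pow_char_pow, one_pow, mul_pow, tpow_pow, two_mul f, pow_add p f f, pow_mul (upsilonL p f k γ),
      hO.upsilonL_pow, hO.upsilonL_pow] at h6
    have h7 : (uL p f k γ ^ (((p : ℤ) ^ (2 * f)))) - 1 -
        upsilonL p f k γ * tpow k (xi p f * (p : ℤ) ^ (2 * f)) ∈ lat k (kapN p f (f + 1)) := by
      refine lat_anti ?_ (n := (p : ℤ) ^ (f + f) * (xi p f * 2)) ?_
      · rw [pow_add]; nlinarith
      · convert h6 using 1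
        rw [← zpow_natCast, show ((p ^ f * p ^ f : ℕ) : ℤ) = (p : ℤ) ^ (2 * f) by
          rw [hqq]; push_cast; ring]
        rw [mul_comm (xi p f)]; ring
    have h8 := mul_mem_lat' (m := 0) (l := kapN p f (f + 1)) (by omega)
      (intCast_mem_lat (k := k) ((m + 2 : ℕ) : ℤ)) h7
    have h9 := Submodule.add_mem _ (lat_anti (m := kapN p f (f + 1)) (by nlinarith) h1) h8
    rw [Int.cast_natCast] at h9
    convert h9 using 1; ring
  -- The cross terms between `U^(q²ν) - 1` and the correction terms vanish modulo the final
  -- exponent, as `g^{(j)} ≥ ξ(q² - q)`.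
  have hgm : ∀ j ∈ Finset.Icc 1 f, tpow k (gNum p f j) * uL p f k γ ^ gNum p f j * (x - 1) ∈
      lat k (kapN p f (f + 1)) := by
    intro j hj
    have hj' := Finset.mem_Icc.1 hj
    have hg := gNum_ge (p := p) hf hj'.1
    refine mul_mem_lat' (m := gNum p f j) ?_ (mul_mem_lat' (m := gNum p f j) (n := 0) (by omega)
      (tpow_mem_lat le_rfl) (hO.uL_zpow_mem γ _)) hx1
    linarith
  have hsum := sum_twist_gNum_sub_mem (k := k) hO γ
  have hμ := intCast_mem_lat (k := k) ((m + 2 : ℕ) : ℤ)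
  rw [Int.cast_natCast] at hμ
  -- The linear term `(m+2)υt^(q²ξ)` of `x` cancels against `m + 2` times the telescoping sum: this
  -- is the purpose of `H`.
  have h1 := Submodule.sub_mem _ (Submodule.sub_mem _ hxlin
    (mul_mem_lat' (m := 0) (l := kapN p f (f + 1)) (by omega) hμ (Submodule.sum_mem _ hgm)))
    (mul_mem_lat' (m := 0) (l := kapN p f (f + 1)) (by omega) hμ hsum)
  convert h1 using 1
  rw [← Finset.sum_mul]
  simp only [mul_sub, mul_one, Finset.sum_sub_distrib]
  ring

/-- Contribution of a scalar `c_i`. -/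
theorem twist_expE_sub_mem (hO : IsUnramifiedBase O p f) (γ : Oˣ) (ell i : ℕ) :
    tpow k (expE p f ell i) * uL p f k γ ^ expE p f ell i * (1 - ((digit p f ell i + 2 : ℕ) : k⸨X⸩) *
        ∑ j ∈ Finset.Icc 1 f, tpow k ((p : ℤ) ^ i * gNum p f j) *
          uL p f k γ ^ ((p : ℤ) ^ i * gNum p f j)) -
      tpow k (expE p f ell i) * polyHL p f k (digit p f ell i) i ∈
      lat k ((p : ℤ) ^ (2 * f) * ellShift p f ell i
      - (p : ℤ) ^ (i + f) * xi p f * ((p : ℤ) ^ f - ∑ s ∈ Finset.range f, (p : ℤ) ^ s)) := by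
  have hf := hO.f_pos
  -- `λ_i ≡ m_i` and `ξ ≡ -1` modulo `p`, whence the constant `m_i + 2` in `H_i`.
  have hν : (p : ℤ) ∣ (lam p f ell i - 2 * xi p f) - ((digit p f ell i + 2 : ℕ) : ℤ) := by
    have h1 := dvd_lam_sub_digit (p := p) (ell := ell) hf i
    have h2 : (p : ℤ) ∣ (p : ℤ) ^ f := dvd_pow_self _ hf.ne'
    have e : (lam p f ell i - 2 * xi p f) - ((digit p f ell i + 2 : ℕ) : ℤ) =
        (lam p f ell i - digit p f ell i) - 2 * (p : ℤ) ^ f := by rw [xi]; push_cast; ring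
    rw [e]
    exact dvd_sub h1 (Dvd.dvd.mul_left h2 _)
  -- The case of index `i` is the `p^i`-th power of the basic congruence, since integers are fixed
  -- by Frobenius.
  have h := pow_char_pow_sub_mem p (twist_polyH_sub_mem (k := k) hO γ _ _ hν) i
  have hcast : ∀ n : ℕ, (n : k⸨X⸩) ^ p ^ i = n := fun n => by
    rw [← iterateFrobenius_def, map_natCast]
  have hz : ∀ n : ℤ, (uL p f k γ ^ n) ^ p ^ i = uL p f k γ ^ ((p : ℤ) ^ i * n) := fun n => by
    rw [← zpow_natCast, ← zpow_mul, Nat.cast_pow, mul_comm]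
  have ht : ∀ n : ℤ, tpow k n ^ p ^ i = tpow k ((p : ℤ) ^ i * n) := fun n => by
    rw [tpow_pow, Nat.cast_pow]
  rw [mul_pow, sub_pow_char_pow, sub_pow_char_pow, one_pow, mul_pow, mul_pow, hcast, sum_pow_char_pow,
    sum_pow_char_pow, hz] at h
  simp only [mul_pow, hz, ht] at h
  have h1 := mul_mem_lat' (l := (p : ℤ) ^ (2 * f) * ellShift p f ell i
      - (p : ℤ) ^ (i + f) * xi p f * ((p : ℤ) ^ f - ∑ s ∈ Finset.range f, (p : ℤ) ^ s)) ?_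
    (tpow_mem_lat (k := k) (le_refl (expE p f ell i))) h
  · convert h1 using 1
    change _ = tpow k (expE p f ell i) * (uL p f k γ ^ expE p f ell i * _ - _)
    rw [polyHL]; ring
  · have e1 : kapN p f (f + 1) = xi p f * ((p : ℤ) ^ (2 * f) + (p : ℤ) ^ f *
        ∑ s ∈ Finset.range f, (p : ℤ) ^ s) := by
      rw [kapN, Finset.sum_range_succ, Finset.mul_sum, add_comm ((p : ℤ) ^ (2 * f))]
      congr 2
      · refine Finset.sum_congr rfl fun s _ => ?_
        rw [← pow_add]; congr 1; omega
      · congr 1; omega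
    have e2 : (p : ℤ) ^ (2 * f) = (p : ℤ) ^ f * (p : ℤ) ^ f := by rw [two_mul, pow_add]
    rw [e1, ellShift_eq, expE, pow_add, e2]
    linarith

end KeyCongruence


/-! ### Existence of the action of `Γ` on `Δ`. -/

section ActionExists

variable {O : Type*} [CommRing O] [IsDomain O] {p f : ℕ} [hp : Fact p.Prime]
  {k : Type*} [Field k] [Algebra O k] [CharP k p]
  {P : Params k} {C : Scalars k p f P.ell} {A : Aux}

/-- The powers of `a_{γ,1}` cancel for exponents congruent to `ℓ` modulo `ξ`; the divisibility
lemmas below check this for `B` and for `r`. -/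
theorem twist_tpow (hO : IsUnramifiedBase O p f) (γ : Oˣ) {n ell : ℤ} (h : xi p f ∣ n - ell) :
    aL p f k γ ^ (-ell) * hO.sigmaL k γ (tpow k n) = tpow k n * uL p f k γ ^ n := by
  have h1 : aL p f k γ ^ (-ell) * aL p f k γ ^ n = 1 := by
    rw [← zpow_add₀ (hO.aL_ne_zero γ), neg_add_eq_sub, hO.aL_zpow_eq_one γ h]
  rw [hO.sigmaL_tpow, ← mul_assoc, ← mul_assoc, h1, one_mul]

theorem sigmaL_tpow_of_dvd (hO : IsUnramifiedBase O p f) (γ : Oˣ) {n : ℤ} (h : xi p f ∣ n) :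
    hO.sigmaL k γ (tpow k n) = tpow k n * uL p f k γ ^ n := by
  rw [hO.sigmaL_tpow, hO.aL_zpow_eq_one γ h, one_mul]

omit [CharP k p] in
theorem sigmaL_toL_C (hO : IsUnramifiedBase O p f) (γ : Oˣ) (c : k) :
    hO.sigmaL k γ (toL (PowerSeries.C c)) = toL (PowerSeries.C c) := by
  rw [hO.sigmaL_toL, hO.sigmaR_C]

theorem sigmaL_polyHL (hO : IsUnramifiedBase O p f) (γ : Oˣ) (m i : ℕ) :
    hO.sigmaL k γ (polyHL p f k m i) = 1 - ((m + 2 : ℕ) : k⸨X⸩) *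
        ∑ j ∈ Finset.Icc 1 f, tpow k ((p : ℤ) ^ i * gNum p f j) *
          uL p f k γ ^ ((p : ℤ) ^ i * gNum p f j) := by
  rw [polyHL, map_sub, map_one, map_mul, map_natCast, map_sum]
  congr 2
  refine Finset.sum_congr rfl fun j _ => sigmaL_tpow_of_dvd hO γ ?_
  exact Dvd.dvd.mul_left (Dvd.intro _ rfl) _

theorem xi_dvd_expD_sub {ell : ℕ} (h1 : ell < p ^ f) (i : ℕ) : xi p f ∣ expD p f ell i - ell := by
  have := xi_dvd_ellShift_sub (p := p) (f := f) h1 i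
  rw [expD, show (p : ℤ) ^ i * (lam p f ell i - xi p f) - ell =
    ((p : ℤ) ^ i * lam p f ell i - ell) - xi p f * (p : ℤ) ^ i by ring]
  exact dvd_sub this (Dvd.intro _ rfl)

theorem xi_dvd_expE_sub {ell : ℕ} (h1 : ell < p ^ f) (i : ℕ) : xi p f ∣ expE p f ell i - ell := by
  have := xi_dvd_ellShift_sub (p := p) (f := f) h1 i
  have hq : (p : ℤ) ^ (2 * f) = (xi p f + 1) ^ 2 := by rw [xi, mul_comm, pow_mul]; ring
  rw [expE, hq, show (p : ℤ) ^ i * ((xi p f + 1) ^ 2 * (lam p f ell i - 2 * xi p f)) - ell =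
    ((p : ℤ) ^ i * lam p f ell i - ell) + xi p f * ((p : ℤ) ^ i * ((xi p f + 2) * lam p f ell i -
      2 * (xi p f + 1) ^ 2)) by ring]
  exact dvd_add this (Dvd.intro _ rfl)

omit [CharP k p] in
/-- The numerical consequence of `c ≠ 0`. -/
theorem Scalars.Allowed.ell_eq (hf : 0 < f) (hC : C.Allowed P) (hc : C.c ≠ 0) :
    (P.ell : ℤ) = ((p : ℤ) - 2) * thetaN p f := by
  have hp1 : (0 : ℤ) < (p : ℤ) - 1 := by have := hp.out.two_le; omega
  obtain ⟨θ, _, hξ, hθ⟩ := exists_theta (p := p) hf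
  have h := (hC hc).1
  rw [thetaN, hθ]
  rw [hξ] at h
  refine mul_right_cancel₀ hp1.ne' ?_
  rw [h]; ring

theorem sub_one_dvd_pow_add (n : ℕ) : (p : ℤ) - 1 ∣ (p : ℤ) ^ n + (p - 2) := by
  have := sub_one_dvd_pow_sub_one (p : ℤ) n
  rw [show (p : ℤ) ^ n + (p - 2) = (p ^ n - 1) + (p - 1) by ring]
  exact dvd_add this dvd_rfl

theorem xi_dvd_expC_sub (hf : 0 < f) (hC : C.Allowed P) (hc : C.c ≠ 0) (i : ℕ) :
    xi p f ∣ expC p f i - P.ell := by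
  obtain ⟨θ, _, hξ, hθ⟩ := exists_theta (p := p) hf
  obtain ⟨m, hm⟩ := sub_one_dvd_pow_add (p := p) (i + f)
  rw [hC.ell_eq hf hc, expC, thetaN, hθ]
  refine ⟨-((p : ℤ) ^ i + m), ?_⟩
  rw [pow_add] at hm
  linear_combination -θ * hm + m * hξ

theorem xi_dvd_expR_sub (hf : 0 < f) (hC : C.Allowed P) (hc : C.c ≠ 0) (N : ℕ) :
    xi p f ∣ expR p f N - P.ell := by
  obtain ⟨θ, _, hξ, hθ⟩ := exists_theta (p := p) hf
  obtain ⟨m, hm⟩ := sub_one_dvd_pow_add (p := p) (f - 1)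
  obtain ⟨n, hn⟩ : xi p f ∣ (p : ℤ) ^ (f * N) - 1 := by
    rw [pow_mul]; exact sub_one_dvd_pow_sub_one _ _
  rw [hC.ell_eq hf hc, expR, thetaN, hθ]
  refine ⟨n - m, ?_⟩
  linear_combination hn - θ * hm + m * hξ

/-- For `p = 2` the condition on `ℓ` attached to `c ≠ 0` would force `ℓ = 0`. -/
theorem three_le_of_c (hell : 0 < P.ell) (hC : C.Allowed P) (hc : C.c ≠ 0) : 3 ≤ p := by
  have h := (hC hc).1
  have h2 := hp.out.two_le
  rcases Nat.lt_or_ge p 3 with h3 | h3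
  · have : p = 2 := by omega
    subst this
    norm_num at h
    omega
  · exact h3

/-- For `N = 0` the exponent `r` is `-p^(f-1)θ`, which is negative. -/
theorem Aux.Admissible.N_pos (hf : 0 < f) (hA : A.Admissible C) : 0 < A.N := by
  rcases Nat.eq_zero_or_pos A.N with h | h
  · have h1 := hA.expR_nonneg
    obtain ⟨θ, h0, _, hθ⟩ := exists_theta (p := p) hf
    rw [expR, h, hθ, mul_zero, pow_zero] at h1
    have : 0 < (p : ℤ) ^ (f - 1) * θ := mul_pos (pow_pos (by exact_mod_cast hp.out.pos) _) h0
    omega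
  · exact h

/-- The power is `1` modulo `t^(p^(f-1)ξ)`, and `p^(f-1)ξ = p^(f-1)θ(p-2) + c₀`, where the first
summand is at least `n_y`. -/
theorem Aux.Admissible.uL_zpow_sub_one_mem (hO : IsUnramifiedBase O p f) (hell : 0 < P.ell)
    (hC : C.Allowed P) (hc : C.c ≠ 0) (hA : A.Admissible C) (γ : Oˣ) (m : ℤ) :
    uL p f k γ ^ ((p : ℤ) ^ (f - 1) * m) - 1 ∈ lat k ((A.ny : ℤ) + cZero p f) := by
  have hf := hO.f_pos
  obtain ⟨θ, h0, hξ, hθ⟩ := exists_theta (p := p) hf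
  refine lat_anti ?_ (hO.isOneUnit_zpow γ (f - 1) m).sub_one_mem
  have h1 := le_error_of_c (three_le_of_c hell hC hc) hf h0 hξ (hA.c1 hc) (hA.c2 hc)
  rw [cZero, hθ, hξ]
  linarith

theorem Aux.Admissible.gammaKey (hO : IsUnramifiedBase O p f) (hell : 0 < P.ell)
    (hell' : P.ell < p ^ f) (hC : C.Allowed P) (hA : A.Admissible C) (γ : Oˣ) :
    GammaKey P C A hO γ := by
  have hf := hO.f_pos
  have hC0 : ∀ c : k, toL (PowerSeries.C c) ∈ lat k 0 := fun c => toL_mem_lat _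
  have e1 : ∀ c : k, ∀ x y : k⸨X⸩, x * hO.sigmaL k γ (toL (PowerSeries.C c) * y) =
      toL (PowerSeries.C c) * (x * hO.sigmaL k γ y) := fun c x y => by
    rw [map_mul, sigmaL_toL_C, mul_left_comm]
  rw [GammaKey, btilde_eq hf hA, bseries, map_add, map_add, map_sum, map_sum, mul_add, mul_add,
    Finset.mul_sum (Finset.univ : Finset (setD p f P.ell)),
    Finset.mul_sum (Finset.univ : Finset (setE p f P.ell))]
  simp only [e1]
  have hD : ∑ i : setD p f P.ell, toL (PowerSeries.C (C.b i)) *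
      (aL p f k γ ^ (-(P.ell : ℤ)) * hO.sigmaL k γ (tpow k (expD p f P.ell i))) -
      ∑ i : setD p f P.ell, toL (PowerSeries.C (C.b i)) * tpow k (expD p f P.ell i) ∈ lat k A.ny := by
    rw [← Finset.sum_sub_distrib]
    refine Submodule.sum_mem _ fun i _ => ?_
    rw [← mul_sub, twist_tpow hO γ (xi_dvd_expD_sub hell' i)]
    exact mul_mem_lat' (m := 0) (n := A.ny) (by omega) (hC0 _)
      (lat_anti (hA.d1 i i.2) (twist_expD_sub_mem hO γ _ _))
  have hE : ∑ i : setE p f P.ell, toL (PowerSeries.C (C.cE i)) *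
      (aL p f k γ ^ (-(P.ell : ℤ)) * hO.sigmaL k γ
        (tpow k (expE p f P.ell i) * polyHL p f k (digit p f P.ell i) i)) -
      ∑ i : setE p f P.ell, toL (PowerSeries.C (C.cE i)) *
        (tpow k (expE p f P.ell i) * polyHL p f k (digit p f P.ell i) i) ∈ lat k A.ny := by
    rw [← Finset.sum_sub_distrib]
    refine Submodule.sum_mem _ fun i _ => ?_
    rw [← mul_sub, map_mul, sigmaL_polyHL, ← mul_assoc (aL p f k γ ^ _),
      twist_tpow hO γ (xi_dvd_expE_sub hell' i)]
    exact mul_mem_lat' (m := 0) (n := A.ny) (by omega) (hC0 _)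
      (lat_anti (hA.e1 i i.2) (twist_expE_sub_mem hO γ _ _))
  have hc : toL (PowerSeries.C C.c) * (aL p f k γ ^ (-(P.ell : ℤ)) *
        hO.sigmaL k γ (∑ i ∈ Finset.range f, tpow k (expC p f i))) -
      toL (PowerSeries.C C.c) * (∑ i ∈ Finset.range f, tpow k (expC p f i)) -
      toL (PowerSeries.C C.c) * upsL p f k γ *
      (phiL k p f (gammaW p f k A.N γ) - gammaW p f k A.N γ) ∈ lat k A.ny := by
    by_cases hc : C.c = 0
    · rw [hc, map_zero, map_zero]; simp
    have h1 : aL p f k γ ^ (-(P.ell : ℤ)) *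
        hO.sigmaL k γ (∑ i ∈ Finset.range f, tpow k (expC p f i)) =
        ∑ i ∈ Finset.range f, tpow k (expC p f i) * uL p f k γ ^ expC p f i := by
      rw [map_sum, Finset.mul_sum]
      exact Finset.sum_congr rfl fun i _ => twist_tpow hO γ (xi_dvd_expC_sub hf hC hc i)
    have hW : uL p f k γ ^ (expR p f A.N + 1) - 1 ∈ lat k ((A.ny : ℤ) + cZero p f) := by
      obtain ⟨N, hN⟩ := Nat.exists_eq_succ_of_ne_zero (hA.N_pos hf).ne'
      -- For `N ≥ 1` the exponent `r + 1 = q^N - p^(f-1)θ` is divisible by `p^(f-1)`.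
      have : expR p f A.N + 1 = (p : ℤ) ^ (f - 1) * (p * (p : ℤ) ^ (f * N) - thetaN p f) := by
        rw [expR, hN, thetaN, Nat.mul_succ, pow_add, ← p_pow_pred_mul (p := p) hf]; ring
      rw [this]
      exact hA.uL_zpow_sub_one_mem hO hell hC hc γ _
    have h2 := twist_expC_sub_mem hO γ (three_le_of_c hell hC hc) (hA.c1 hc) (hA.c2 hc) hW
      (Int.natCast_nonneg _)
    rw [h1, ← mul_sub, mul_assoc, ← mul_sub, ← Finset.sum_sub_distrib]
    exact mul_mem_lat' (m := 0) (n := A.ny) (by omega) (hC0 _) h2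
  have := Submodule.add_mem _ (Submodule.add_mem _ hD hE) hc
  convert this using 1
  ring

theorem Aux.Admissible.exists_isGammaAction (hO : IsUnramifiedBase O p f) (hell : 0 < P.ell)
    (hell' : P.ell < p ^ f) (hC : C.Allowed P) (hA : A.Admissible C) :
    ∃ T : Oˣ → Delta p f P C A → Delta p f P C A, IsGammaAction p f P C A T := by
  have hf := hO.f_pos
  obtain ⟨N, hN⟩ := Nat.exists_eq_succ_of_ne_zero (hA.N_pos hf).ne'
  refine LTPhiGamma.exists_isGammaAction hO (hA.latticeStable hf) (fun _ => hA.expR_nonneg)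
    (fun hc => (hC hc).2) (fun hc => xi_dvd_expR_sub hf hC hc _) (fun hc => hA.c3 hc)
    (fun hc γ => ?_) (fun hc γ => ?_) (fun γ => hA.gammaKey hO hell hell' hC γ)
  · have : expR p f A.N + 1 = (p : ℤ) ^ (f - 1) * (p * (p : ℤ) ^ (f * N) - thetaN p f) := by
      rw [expR, hN, thetaN, Nat.mul_succ, pow_add, ← p_pow_pred_mul (p := p) hf]; ring
    rw [this]
    exact hA.uL_zpow_sub_one_mem hO hell hC hc γ _
  · have h := hA.uL_zpow_sub_one_mem hO hell hC hc γ (p * (p : ℤ) ^ (f * N))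
    have e : (p : ℤ) ^ (f - 1) * (p * (p : ℤ) ^ (f * N)) = (((p ^ f) ^ A.N : ℕ) : ℤ) := by
      rw [← cast_pow_pow, hN, Nat.mul_succ, pow_add, ← p_pow_pred_mul (p := p) hf]; ring
    rwa [e, zpow_natCast] at h

end ActionExists


/-! ### Eigenvectors of `φ` on `k((t))`, and functionals killing coboundaries. -/

section FrobeniusEquations

variable {k : Type*} [Field k] {p f : ℕ} [hp : Fact p.Prime]

/-- The equation ties the coefficient at `n` to the one at `n/q`, or makes it zero if `q ∤ n`; a
nonzero `n` can be divided by `q` only finitely often. -/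
theorem phiL_eigenvector_coeff (hf : 0 < f) {x : k⸨X⸩} {μ : k} (hμ : μ ≠ 0)
    (hx : phiL k p f x = toL (PowerSeries.C μ) * x) {n : ℤ} (hn : n ≠ 0) : x.coeff n = 0 := by
  have hq : (2 : ℤ) ≤ ((p ^ f : ℕ) : ℤ) := by exact_mod_cast two_le_q (p := p) hf
  suffices ∀ (N : ℕ) (n : ℤ), n.natAbs ≤ N → n ≠ 0 → x.coeff n = 0 from this _ n le_rfl hn
  intro N
  induction N with
  | zero => intro n h1 h2; omega
  | succ N ih =>
    intro n h1 h2
    have h3 : μ * x.coeff n = 0 := by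
      rw [← coeff_toL_C_mul, ← hx]
      by_cases hd : ((p ^ f : ℕ) : ℤ) ∣ n
      · obtain ⟨m, rfl⟩ := hd
        rw [coeff_phiL_mul]
        have hm : m ≠ 0 := by rintro rfl; simp at h2
        refine ih m ?_ hm
        rw [Int.natAbs_mul, Int.natAbs_natCast] at h1
        have := two_le_q (p := p) hf
        have h4 : 0 < m.natAbs := Int.natAbs_pos.2 hm
        nlinarith
      · exact coeff_phiL_of_not_dvd x hd
    exact (mul_eq_zero.1 h3).resolve_left hμ

theorem phiL_eigenvector_eq (hf : 0 < f) {x : k⸨X⸩} {μ : k} (hμ : μ ≠ 0)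
    (hx : phiL k p f x = toL (PowerSeries.C μ) * x) : x = toL (PowerSeries.C (x.coeff 0)) := by
  ext n
  rw [toL_C, HahnSeries.coeff_single]
  split_ifs with h
  · rw [h]
  · exact phiL_eigenvector_coeff hf hμ hx h

/-- A functional that vanishes on the coboundary `W` and detects the orbit of the exponent `e₀`
under multiplication by `q`. -/
theorem exists_orbit_functional (hf : 0 < f) {α β : k} (hα : α ≠ 0) (hβ : β ≠ 0) {W h : k⸨X⸩}
    (hW : W = toL (PowerSeries.C α⁻¹) * phiL k p f h - toL (PowerSeries.C β⁻¹) * h)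
    {e₀ : ℤ} (he : e₀ < 0) :
    ∃ Λ : k⸨X⸩ →+ k, (∀ c x, Λ (toL (PowerSeries.C c) * x) = c * Λ x) ∧ Λ W = 0 ∧
      Λ (tpow k e₀) ≠ 0 ∧
      ∀ e : ℤ, (∀ a b : ℕ, e * ((p : ℤ) ^ f) ^ a ≠ e₀ * ((p : ℤ) ^ f) ^ b) → Λ (tpow k e) = 0 := by
  have hqN := two_le_q (p := p) hf
  have hq : (2 : ℤ) ≤ (p : ℤ) ^ f := by exact_mod_cast hqN
  have hcast : ((p ^ f : ℕ) : ℤ) = (p : ℤ) ^ f := by push_cast; rfl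
  -- The integer `n` is the start of the orbit of `e₀`: `e₀ = n q^(j₀)` with `q ∤ n`.
  obtain ⟨n, hn, hnd⟩ := (Int.finiteMultiplicity_iff (a := (p : ℤ) ^ f) (b := e₀).2
    ⟨by omega, he.ne⟩).exists_eq_pow_mul_and_not_dvd
  set j₀ := multiplicity ((p : ℤ) ^ f) e₀
  obtain ⟨M, hM⟩ := exists_eq_tpow_neg_mul h
  obtain ⟨F, hF⟩ := hM M le_rfl
  have hcoeff : ∀ m < -(M : ℤ), h.coeff m = 0 :=
    mem_lat_iff_coeff.1 (mem_lat.2 ⟨F, hF⟩)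
  have hq0 : ∀ j : ℕ, 0 < ((p : ℤ) ^ f) ^ j := fun j => pow_pos (by omega) j
  have hn0 : n < 0 := by
    by_contra h0
    have := mul_nonneg (hq0 j₀).le (not_lt.1 h0)
    omega
  have hinj : ∀ i j : ℕ, n * ((p : ℤ) ^ f) ^ i = n * ((p : ℤ) ^ f) ^ j → i = j := by
    intro i j hij
    exact Int.pow_right_injective (by rw [Int.natAbs_pow, Int.natAbs_natCast]; omega)
      (mul_left_cancel₀ hn0.ne hij)
  -- With the weights `(α/β)^j` the coboundary telescopes along the orbit. There is no contribution
  -- at the lower end, since `φ(h)` has no coefficient at `n`.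
  have htel : ∀ J : ℕ, ∑ j ∈ Finset.range (J + 1), (α / β) ^ j * W.coeff (n * ((p : ℤ) ^ f) ^ j) =
      -(β⁻¹ * (α / β) ^ J * h.coeff (n * ((p : ℤ) ^ f) ^ J)) := by
    intro J
    induction J with
    | zero =>
      rw [zero_add, Finset.sum_range_one, pow_zero, pow_zero, mul_one, hW, HahnSeries.coeff_sub,
        coeff_toL_C_mul, coeff_toL_C_mul, coeff_phiL_of_not_dvd _ (by rwa [hcast])]
      ring
    | succ J ih =>
      rw [Finset.sum_range_succ, ih, hW, HahnSeries.coeff_sub, coeff_toL_C_mul, coeff_toL_C_mul,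
        show n * ((p : ℤ) ^ f) ^ (J + 1) = ((p ^ f : ℕ) : ℤ) * (n * ((p : ℤ) ^ f) ^ J) by
          rw [hcast]; ring, coeff_phiL_mul, pow_succ]
      field_simp
      ring
  -- The sum is long enough to contain `j₀` and to end at an exponent below the pole order `M` of
  -- `h`, where the boundary term vanishes.
  refine ⟨AddMonoidHom.mk' (fun x => ∑ j ∈ Finset.range (M + j₀ + 1),
    (α / β) ^ j * x.coeff (n * ((p : ℤ) ^ f) ^ j)) fun x y => ?_, fun c x => ?_, ?_, ?_, fun e hne => ?_⟩
  · simp only [HahnSeries.coeff_add, mul_add, Finset.sum_add_distrib]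
  · simp only [AddMonoidHom.mk'_apply, coeff_toL_C_mul, Finset.mul_sum]
    exact Finset.sum_congr rfl fun j _ => by ring
  · rw [AddMonoidHom.mk'_apply, htel, hcoeff, mul_zero, neg_zero]
    have h1 : (M + j₀ : ℕ) < 2 ^ (M + j₀) := Nat.lt_two_pow_self
    have h2 : (2 : ℤ) ^ (M + j₀) ≤ ((p : ℤ) ^ f) ^ (M + j₀) := pow_le_pow_left₀ (by norm_num) hq _
    have h3 : ((M + j₀ : ℕ) : ℤ) < 2 ^ (M + j₀) := by exact_mod_cast h1
    push_cast at h3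
    nlinarith
  · rw [AddMonoidHom.mk'_apply, Finset.sum_eq_single j₀]
    · rw [coeff_tpow, if_pos (by rw [mul_comm, ← hn]), mul_one]
      exact pow_ne_zero _ (div_ne_zero hα hβ)
    · intro j _ hj
      rw [coeff_tpow, if_neg, mul_zero]
      intro h1
      refine hj (hinj _ _ (h1.trans ?_))
      rw [mul_comm, ← hn]
    · intro h1
      exact absurd (Finset.mem_range.2 (by omega)) h1
  · rw [AddMonoidHom.mk'_apply]
    refine Finset.sum_eq_zero fun j _ => ?_
    rw [coeff_tpow, if_neg, mul_zero]
    rintro rfl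
    refine hne j₀ j ?_
    rw [hn]; ring

end FrobeniusEquations


/-! ### Coincidences among the exponents `D_n`, `E_n`. -/

section Exponents

variable {p f ell : ℕ} [hp : Fact p.Prime]

/-- The exponents `D_n = p^n (ξ - λ_n)`. -/
def ordD (p f ell n : ℕ) : ℤ := (p : ℤ) ^ n * (xi p f - lam p f ell n)

/-- The exponents `E_n = p^n (2ξ - λ_n)`. -/
def ordE (p f ell n : ℕ) : ℤ := (p : ℤ) ^ n * (2 * xi p f - lam p f ell n)

theorem pow_dvd_ordD (n : ℕ) : (p : ℤ) ^ n ∣ ordD p f ell n := Dvd.intro _ rfl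

theorem pow_dvd_ordE (n : ℕ) : (p : ℤ) ^ n ∣ ordE p f ell n := Dvd.intro _ rfl

theorem ordE_eq (n : ℕ) : ordE p f ell n = ordD p f ell n + (p : ℤ) ^ n * xi p f := by
  rw [ordD, ordE]; ring

theorem ordD_succ (n : ℕ) :
    ordD p f ell (n + 1) = ordD p f ell n + (p : ℤ) ^ n * xi p f * ((p : ℤ) - 1 - digit p f ell n) := by
  have h := lam_succ (p := p) (f := f) (ell := ell) n
  rw [ordD, ordD]
  linear_combination -(p : ℤ) ^ n * h

theorem ordE_eq_ordD_succ (n : ℕ) (h : (digit p f ell n : ℤ) = p - 2) :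
    ordE p f ell n = ordD p f ell (n + 1) := by
  rw [ordD_succ, h, ordE_eq]; ring

theorem lam_add_mul_f (n s : ℕ) : lam p f ell (n + s * f) = lam p f ell n := by
  induction s with
  | zero => simp
  | succ s ih => rw [Nat.succ_mul, ← add_assoc, lam_add_f, ih]

theorem ordD_shift (n s : ℕ) : ordD p f ell (n + s * f) = ((p : ℤ) ^ f) ^ s * ordD p f ell n := by
  rw [ordD, ordD, lam_add_mul_f, pow_add, mul_comm s, pow_mul]; ring

theorem ordE_shift (n s : ℕ) : ordE p f ell (n + s * f) = ((p : ℤ) ^ f) ^ s * ordE p f ell n := by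
  rw [ordE, ordE, lam_add_mul_f, pow_add, mul_comm s, pow_mul]; ring

theorem ordD_le (hf : 0 < f) {a b : ℕ} (h : a ≤ b) : ordD p f ell a ≤ ordD p f ell b := by
  refine monotone_nat_of_le_succ (fun n => ?_) h
  rw [ordD_succ]
  have h1 := digit_lt (p := p) (f := f) (ell := ell) n
  have := (xi_pos (p := p) hf).le
  have h2 : (0 : ℤ) ≤ (p : ℤ) - 1 - digit p f ell n := by omega
  have : 0 ≤ (p : ℤ) ^ n * xi p f * ((p : ℤ) - 1 - digit p f ell n) := by positivity
  linarith

theorem ordD_lt_ordE (hf : 0 < f) (n : ℕ) : ordD p f ell n < ordE p f ell n := by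
  have h1 := xi_pos (p := p) hf
  have h2 : (0 : ℤ) < (p : ℤ) ^ n := pow_pos (by exact_mod_cast hp.out.pos) n
  rw [ordE_eq]
  have := mul_pos h2 h1
  linarith

theorem digit_eq_of_dvd_sub {n : ℕ} (hf : 0 < f) (c : ℤ) (h : (p : ℤ) ∣ c - lam p f ell n) :
    (p : ℤ) ∣ c - digit p f ell n := by
  have := dvd_add h (dvd_lam_sub_digit (p := p) (ell := ell) hf n)
  rwa [sub_add_sub_cancel] at this

theorem dvd_of_pow_dvd {b a : ℕ} {z : ℤ} (h : a < b) (hd : (p : ℤ) ^ b ∣ (p : ℤ) ^ a * z) : (p : ℤ) ∣ z := by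
  have h1 : (p : ℤ) ^ a * p ∣ (p : ℤ) ^ a * z := (pow_succ (p : ℤ) a) ▸ (pow_dvd_pow _ h).trans hd
  exact Int.dvd_of_mul_dvd_mul_left (pow_ne_zero a (by exact_mod_cast hp.out.ne_zero)) h1

theorem p_dvd_q (hf : 0 < f) : (p : ℤ) ∣ (p : ℤ) ^ f := dvd_pow_self _ hf.ne'

/-- A divisible `D_a` stays constant, with digits `p - 1`. -/
theorem ordD_eq_of_dvd (hf : 0 < f) {a b : ℕ} (hab : a ≤ b) (hd : (p : ℤ) ^ b ∣ ordD p f ell a) :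
    ordD p f ell a = ordD p f ell b ∧ (a < b → (digit p f ell ((b : ℤ) - 1) : ℤ) = p - 1) := by
  induction b, hab using Nat.le_induction with
  | base => exact ⟨rfl, fun h => absurd h (lt_irrefl _)⟩
  | succ b hab ih =>
    have h1 := (ih ((pow_dvd_pow _ b.le_succ).trans hd)).1
    rw [h1, ordD] at hd
    have h2 := digit_eq_of_dvd_sub hf _ (dvd_of_pow_dvd b.lt_succ_self hd)
    -- As `ξ ≡ -1`, the prime `p` divides `m_b + 1`, and `0 ≤ m_b < p`. A digit `p - 1` makes `D`
    -- stationary.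
    have h3 : (digit p f ell b : ℤ) = p - 1 := by
      have h4 := digit_lt (p := p) (f := f) (ell := ell) b
      rw [xi] at h2
      have h5 : (p : ℤ) ∣ digit p f ell b + 1 := by
        have := dvd_sub (p_dvd_q (p := p) hf) h2
        rwa [show (p : ℤ) ^ f - (p ^ f - 1 - digit p f ell b) = digit p f ell b + 1 by ring] at this
      have := Int.le_of_dvd (by omega) h5
      omega
    refine ⟨?_, fun _ => ?_⟩
    · rw [h1, ordD_succ, h3]; ring
    · rw [Nat.cast_succ, add_sub_cancel_right]; exact h3

/-- Divisibility of `2ξ - λ_a` by `p` forces `m_a = p - 2`. Then `E_a = D_{a+1}`, and the analysis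
of the `D_n` takes over. -/
theorem ordE_eq_of_dvd (hf : 0 < f) {a b : ℕ} (hab : a < b) (hd : (p : ℤ) ^ b ∣ ordE p f ell a) :
    ordE p f ell a = ordD p f ell b ∧ digit p f ell a = p - 2 ∧
      (a + 1 < b → (digit p f ell ((b : ℤ) - 1) : ℤ) = p - 1) := by
  have h1 := hd
  rw [ordE] at h1
  have h2 := digit_eq_of_dvd_sub hf _ (dvd_of_pow_dvd hab h1)
  have hp2 := hp.out.two_le
  have h3 : (digit p f ell a : ℤ) = p - 2 := by
    have h4 := digit_lt (p := p) (f := f) (ell := ell) a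
    rw [xi] at h2
    have h5 : (p : ℤ) ∣ digit p f ell a + 2 - p := by
      have := dvd_sub (dvd_sub ((p_dvd_q (p := p) hf).mul_left 2) h2) (dvd_refl (p : ℤ))
      rwa [show 2 * (p : ℤ) ^ f - (2 * (p ^ f - 1) - digit p f ell a) - p =
        digit p f ell a + 2 - p by ring] at this
    obtain ⟨c, hc⟩ := h5
    have hc1 : c < 1 := by by_contra h; nlinarith
    have hc2 : -1 < c := by by_contra h; nlinarith
    have : c = 0 := by omega
    rw [this, mul_zero] at hc
    omega
  rw [ordE_eq_ordD_succ a h3] at hd ⊢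
  obtain ⟨h4, h5⟩ := ordD_eq_of_dvd hf hab hd
  exact ⟨h4, by omega, h5⟩

/-- The condition defining `setE`, for arbitrary indices. -/
def IsE (p f ell : ℕ) (i : ℤ) : Prop := ∃ r : ℤ, r < i ∧ digit p f ell r = p - 1 ∧
    ∀ s : ℤ, r < s → s < i → digit p f ell s = p - 2

theorem IsE.add {i : ℤ} (h : IsE p f ell i) (n : ℤ) : IsE p f ell (i + f * n) := by
  obtain ⟨r, h1, h2, h3⟩ := h
  refine ⟨r + f * n, by omega, by rwa [digit_add_mul_f], fun s hs hs' => ?_⟩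
  have := h3 (s - f * n) (by omega) (by omega)
  rwa [← digit_add_mul_f _ n, sub_add_cancel] at this

theorem mem_setE {i : ℕ} : i ∈ setE p f ell ↔ i < f ∧ IsE p f ell i := by
  classical
  rw [setE, Finset.mem_filter, Finset.mem_range, IsE]

theorem mem_setD {i : ℕ} : i ∈ setD p f ell ↔ i < f ∧ ¬ IsE p f ell i := by
  rw [setD, Finset.mem_sdiff, Finset.mem_range, mem_setE]; tauto

theorem isE_shift_iff (i s : ℕ) : IsE p f ell ((i + s * f : ℕ) : ℤ) ↔ IsE p f ell i := by
  push_cast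
  constructor
  · intro h; have := h.add (-s); rwa [show (i : ℤ) + s * f + f * -s = i by ring] at this
  · intro h; have := h.add s; rwa [mul_comm] at this

theorem isE_of_pred {b : ℕ} (h : (digit p f ell ((b : ℤ) - 1) : ℤ) = p - 1) : IsE p f ell b :=
  ⟨b - 1, by omega, by have := hp.out.two_le; omega, fun s h1 h2 => by omega⟩

/-- If `D_a = D_b` with `a < b`, then `p^b` divides `D_a`, so `m_{b-1} = p - 1`, which puts `b`
among the indices of type `ℰ`. -/
theorem ordD_eq_ordD_imp (hf : 0 < f) {a b : ℕ} (ha : ¬ IsE p f ell a) (hb : ¬ IsE p f ell b)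
    (h : ordD p f ell a = ordD p f ell b) : a = b := by
  wlog hab : a ≤ b generalizing a b
  · exact (this hb ha h.symm (by omega)).symm
  by_contra hne
  have h1 := ordD_eq_of_dvd (ell := ell) hf hab (h.symm ▸ pow_dvd_ordD b)
  exact hb (isE_of_pred (h1.2 (by omega)))

/-- A coincidence with `a < b` would give `E_a = D_b < E_b`. -/
theorem ordE_eq_ordE_imp (hf : 0 < f) {a b : ℕ} (h : ordE p f ell a = ordE p f ell b) : a = b := by
  wlog hab : a ≤ b generalizing a b
  · exact (this h.symm (by omega)).symm
  by_contra hne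
  have h1 := ordE_eq_of_dvd (ell := ell) hf (show a < b by omega) (h.symm ▸ pow_dvd_ordE b)
  have := ordD_lt_ordE (p := p) (ell := ell) hf b
  omega

/-- The equality `E_a = D_b` needs `a < b`, and either `m_{b-1} = p - 1`, or `b = a + 1` and `m_a =
p - 2`. In the second case the run of digits witnessing that `a` is of type `ℰ` extends to `b`. So
`b` would be of type `ℰ` each time; this explains the shape of the definition of `ℰ(ℓ)`. -/
theorem ordD_ne_ordE (hf : 0 < f) {a b : ℕ} (ha : IsE p f ell a) (hb : ¬ IsE p f ell b) :
    ordD p f ell b ≠ ordE p f ell a := by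
  intro h
  rcases Nat.lt_or_ge a b with hab | hab
  · obtain ⟨_, h2, h3⟩ := ordE_eq_of_dvd (ell := ell) hf hab (h ▸ pow_dvd_ordD b)
    rcases Nat.lt_or_ge (a + 1) b with h4 | h4
    · exact hb (isE_of_pred (h3 h4))
    · have : b = a + 1 := by omega
      subst this
      obtain ⟨r, h5, h6, h7⟩ := ha
      refine hb ⟨r, by push_cast; omega, h6, fun s h8 h9 => ?_⟩
      push_cast at h9
      rcases lt_or_ge s (a : ℤ) with h10 | h10
      · exact h7 s h8 h10
      · rw [show s = a by omega]; exact h2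
  · have h1 := ordD_le (p := p) (ell := ell) hf hab
    have h2 := ordD_lt_ordE (p := p) (ell := ell) hf a
    omega

/-- An integer `p^a (ξ + qY)` is not of the form `D_b`. -/
theorem ne_ordD (hf : 0 < f) (h0 : 0 < ell) (h1 : ell < p ^ f - 1) (a b : ℕ) (Y : ℤ) :
    (p : ℤ) ^ a * (xi p f + (p : ℤ) ^ f * Y) ≠ ordD p f ell b := by
  intro h
  have hp0 : (p : ℤ) ≠ 0 := by exact_mod_cast hp.out.ne_zero
  have hξ : xi p f = (p : ℤ) ^ f - 1 := rfl
  rcases Nat.lt_or_ge a b with hab | hab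
  -- Here `p` would divide `ξ + qY ≡ -1`.
  · have h2 := dvd_of_pow_dvd hab (h.symm ▸ pow_dvd_ordD b)
    rw [hξ, show (p : ℤ) ^ f - 1 + p ^ f * Y = p ^ f * (1 + Y) - 1 by ring] at h2
    have h3 := dvd_sub ((p_dvd_q (p := p) hf).mul_right (1 + Y)) h2
    rw [sub_sub_cancel] at h3
    exact hp.out.one_lt.not_ge (by exact_mod_cast Int.le_of_dvd one_pos h3)
  -- Now `D_b = D_a`, and cancelling `p^a` leaves `q ∣ λ_a`, impossible for `0 < λ_a < ξ`.
  · rw [(ordD_eq_of_dvd hf hab (h ▸ Dvd.intro _ rfl)).1, ordD] at h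
    have h2 := mul_left_cancel₀ (pow_ne_zero a hp0) h
    obtain ⟨h3, h4⟩ := lam_pos_lt (p := p) hf h0 h1 a
    have h5 : (p : ℤ) ^ f ∣ lam p f ell a := ⟨-Y, by linarith⟩
    have := Int.le_of_dvd h3 h5
    omega

/-- An integer `p^a (ξ + qY)` is not of the form `E_b`. -/
theorem ne_ordE (hf : 0 < f) (h0 : 0 < ell) (h1 : ell < p ^ f - 1) (a b : ℕ) (Y : ℤ) :
    (p : ℤ) ^ a * (xi p f + (p : ℤ) ^ f * Y) ≠ ordE p f ell b := by
  intro h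
  have hp0 : (p : ℤ) ≠ 0 := by exact_mod_cast hp.out.ne_zero
  have hξ : xi p f = (p : ℤ) ^ f - 1 := rfl
  rcases lt_trichotomy a b with hab | hab | hab
  · have h2 := dvd_of_pow_dvd hab (h.symm ▸ pow_dvd_ordE b)
    rw [hξ, show (p : ℤ) ^ f - 1 + p ^ f * Y = p ^ f * (1 + Y) - 1 by ring] at h2
    have h3 := dvd_sub ((p_dvd_q (p := p) hf).mul_right (1 + Y)) h2
    rw [sub_sub_cancel] at h3
    exact hp.out.one_lt.not_ge (by exact_mod_cast Int.le_of_dvd one_pos h3)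
  · subst hab
    rw [ordE] at h
    have h2 := mul_left_cancel₀ (pow_ne_zero a hp0) h
    obtain ⟨h3, h4⟩ := lam_pos_lt (p := p) hf h0 h1 a
    have h5 : (p : ℤ) ^ f ∣ xi p f - lam p f ell a := ⟨Y, by linarith⟩
    have := Int.le_of_dvd (by omega) h5
    omega
  -- For `a > b` one has `E_b = D_a`, which reduces to the previous case.
  · rw [(ordE_eq_of_dvd hf hab (h ▸ Dvd.intro _ rfl)).1] at h
    exact ne_ordD hf h0 h1 _ _ _ h

end Exponents


/-! ### A series `B` that is a coboundary has zero scalars. -/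

section Vanishing

variable {p f : ℕ} [hp : Fact p.Prime] {k : Type*} [Field k] {P : Params k} {C : Scalars k p f P.ell}

theorem expD_eq (ell i : ℕ) : expD p f ell i = -ordD p f ell i := by rw [expD, ordD]; ring

theorem expE_eq (ell i : ℕ) : expE p f ell i = -ordE p f ell (i + 2 * f) := by
  rw [ordE_shift, expE, ordE, mul_comm 2 f, pow_mul]; ring

/-- This form excludes the exponents of the correction terms in `H_i` from the `q`-orbits of all
`D_n` and `E_n`, by `ne_ordD` and `ne_ordE`; so the corrections are invisible to the functionals
used. -/
theorem expE_add_gNum (ell : ℕ) {i j : ℕ} (hj : j ∈ Finset.Icc 1 f) :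
    ∃ Y : ℤ, expE p f ell i + (p : ℤ) ^ i * gNum p f j =
      -((p : ℤ) ^ (i + f + 1 - j) * (xi p f + (p : ℤ) ^ f * Y)) := by
  obtain ⟨h1, h2⟩ := Finset.mem_Icc.1 hj
  refine ⟨(p : ℤ) ^ (j - 1) * (2 * xi p f - lam p f ell i) - xi p f * ∑ s ∈ Finset.range j, (p : ℤ) ^ s, ?_⟩
  have e1 : ∑ s ∈ Finset.range j, (p : ℤ) ^ (2 * f + s + 1 - j) =
      (p : ℤ) ^ (2 * f + 1 - j) * ∑ s ∈ Finset.range j, (p : ℤ) ^ s := by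
    rw [Finset.mul_sum]
    refine Finset.sum_congr rfl fun s _ => ?_
    rw [← pow_add]; congr 1; omega
  have e2 : (p : ℤ) ^ (i + f + 1 - j) = (p : ℤ) ^ i * (p : ℤ) ^ (f + 1 - j) := by
    rw [← pow_add]; congr 1; omega
  have e3 : (p : ℤ) ^ (2 * f + 1 - j) = (p : ℤ) ^ (f + 1 - j) * (p : ℤ) ^ f := by
    rw [← pow_add]; congr 1; omega
  have e4 : (p : ℤ) ^ (2 * f) = (p : ℤ) ^ (f + 1 - j) * (p : ℤ) ^ f * (p : ℤ) ^ (j - 1) := by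
    rw [← pow_add, ← pow_add]; congr 1; omega
  rw [expE, gNum, e1, e2, e3, e4]
  ring

theorem eq_of_shift_eq {i j a b : ℕ} (hi : i < f) (hj : j < f) (h : i + a * f = j + b * f) : i = j := by
  have := congrArg (· % f) h
  simpa [Nat.add_mul_mod_self_right, Nat.mod_eq_of_lt hi, Nat.mod_eq_of_lt hj] using this

theorem map_bseries (Λ : k⸨X⸩ →+ k) (hΛ : ∀ c x, Λ (toL (PowerSeries.C c) * x) = c * Λ x) :
    Λ (bseries p f P C) = ∑ i : setD p f P.ell, C.b i * Λ (tpow k (expD p f P.ell i)) +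
      C.c * ∑ i ∈ Finset.range f, Λ (tpow k (expC p f i)) +
      ∑ i : setE p f P.ell, C.cE i * (Λ (tpow k (expE p f P.ell i)) -
        ((digit p f P.ell i + 2 : ℕ) : k) *
        ∑ j ∈ Finset.Icc 1 f, Λ (tpow k (expE p f P.ell i + (p : ℤ) ^ (i : ℕ) * gNum p f j))) := by
  rw [bseries, map_add, map_add, map_sum, map_sum, hΛ, map_sum]
  simp only [hΛ]
  congr 1
  refine Finset.sum_congr rfl fun i _ => ?_
  rw [polyHL, mul_sub, mul_one, map_sub, mul_left_comm,
    show ((digit p f P.ell i + 2 : ℕ) : k⸨X⸩) = toL (PowerSeries.C ((digit p f P.ell i + 2 : ℕ) : k)) by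
      rw [map_natCast, map_natCast], hΛ, Finset.mul_sum, map_sum]
  simp only [tpow_add]

/-- If `ℓ = (p-2)θ` then all the digits of `ℓ` are `p - 2`. -/
theorem lam_digit_of_eq (hf : 0 < f) {ell : ℕ} (h1 : ell < p ^ f)
    (h : (ell : ℤ) = ((p : ℤ) - 2) * thetaN p f) (n : ℕ) :
    lam p f ell n = ((p : ℤ) - 2) * thetaN p f ∧ (digit p f ell n : ℤ) = p - 2 := by
  obtain ⟨θ, h0, hξ, hθ⟩ := exists_theta (p := p) hf
  have hp2 := hp.out.two_le
  have hθ' : thetaN p f = θ := hθ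
  rw [hθ'] at h ⊢
  have hθp : (p : ℤ) ∣ θ - 1 := by
    have e : θ - 1 = p * θ - (p : ℤ) ^ f := by
      have : xi p f = (p : ℤ) ^ f - 1 := rfl
      linarith
    rw [e]
    exact dvd_sub (Dvd.intro _ rfl) (p_dvd_q hf)
  have step : ∀ n : ℕ, lam p f ell n = ((p : ℤ) - 2) * θ → (digit p f ell n : ℤ) = p - 2   := fun n hl => by
    have h2 := digit_eq_of_dvd_sub (ell := ell) (n := n) hf ((p - 2) * θ) (by rw [hl]; simp)
    have h3 : (p : ℤ) ∣ digit p f ell n + 2 - p := by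
      have := dvd_sub (hθp.mul_left ((p : ℤ) - 2)) h2
      rw [show ((p : ℤ) - 2) * (θ - 1) - ((p - 2) * θ - digit p f ell n) =
        digit p f ell n + 2 - p by ring] at this
      exact this
    have h4 := digit_lt (p := p) (f := f) (ell := ell) n
    obtain ⟨c, hc⟩ := h3
    have hc1 : c < 1 := by by_contra h; nlinarith
    have hc2 : -1 < c := by by_contra h; nlinarith
    have : c = 0 := by omega
    rw [this, mul_zero] at hc
    omega
  induction n with
  | zero =>
    have := lam_zero (p := p) (f := f) h1
    exact ⟨this.trans h, step _ (this.trans h)⟩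
  | succ n ih =>
    have h5 : lam p f ell (n + 1) = ((p : ℤ) - 2) * θ := by
      refine mul_left_cancel₀ (show (p : ℤ) ≠ 0 by omega) ?_
      rw [lam_succ, ih.1, ih.2, hξ]; ring
    exact ⟨h5, step _ h5⟩

theorem setE_eq_empty_of_eq (hf : 0 < f) {ell : ℕ} (h1 : ell < p ^ f)
    (h : (ell : ℤ) = ((p : ℤ) - 2) * thetaN p f) : setE p f ell = ∅ := by
  refine Finset.eq_empty_of_forall_notMem fun i hi => ?_
  obtain ⟨_, r, _, h2, _⟩ := mem_setE.1 hi
  have h3 := (lam_digit_of_eq hf h1 h (r + f * r.natAbs).toNat).2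
  have h4 : 0 ≤ r + f * r.natAbs := by
    have : (r.natAbs : ℤ) ≤ f * r.natAbs := le_mul_of_one_le_left (by omega) (by omega)
    omega
  rw [Int.toNat_of_nonneg h4, digit_add_mul_f] at h3
  have := hp.out.two_le
  omega

/-- The exponents `O_n = p^n (ξ + qθ)`. -/
theorem expC_eq (hf : 0 < f) (i : ℕ) :
    expC p f i = -((p : ℤ) ^ i * (thetaN p f * ((p : ℤ) ^ f + p - 1))) := by
  obtain ⟨θ, h0, hξ, hθ⟩ := exists_theta (p := p) hf
  rw [expC, thetaN, hθ, hξ]; ring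

/-- When `c ≠ 0`, all digits of `ℓ` are `p - 2`, so `ℰ(ℓ)` is empty and the exponents of the `b_i`
are `-p^iθ`. Those of `c` are `-p^iθ(q+p-1)`, and only `i = 0` meets the orbit of the first one. -/
theorem c_eq_zero_of_coboundary (hf : 0 < f) (hell : P.ell < p ^ f) (hC : C.Allowed P) {h : k⸨X⸩}
    (hW : bseries p f P C = toL (PowerSeries.C (P.alpha : k)⁻¹) * phiL k p f h -
      toL (PowerSeries.C (P.beta : k)⁻¹) * h) : C.c = 0 := by
  by_contra hc
  have he := hC.ell_eq hf hc
  have hθ : 0 < thetaN p f := by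
    obtain ⟨θ, h0, hξ, hθ⟩ := exists_theta (p := p) hf
    rw [thetaN, hθ]; exact h0
  have hp2 : (2 : ℤ) ≤ p := by exact_mod_cast hp.out.two_le
  have hp0 : (p : ℤ) ≠ 0 := by omega
  have hq : (2 : ℤ) ≤ (p : ℤ) ^ f := by exact_mod_cast two_le_q (p := p) hf
  have hz : (0 : ℤ) < thetaN p f * ((p : ℤ) ^ f + p - 1) := mul_pos hθ (by omega)
  obtain ⟨Λ, h1, h2, h3, h4⟩ := exists_orbit_functional (e₀ := expC p f 0) hf P.alpha.ne_zero
    P.beta.ne_zero hW (by rw [expC_eq hf, pow_zero, one_mul]; omega)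
  rw [map_bseries Λ h1] at h2
  have hE : ∀ i : setE p f P.ell, False := fun i =>
    Finset.notMem_empty _ ((Finset.ext_iff.1 (setE_eq_empty_of_eq hf hell he) _).1 i.2)
  have hinj : ∀ a b : ℕ, (p : ℤ) ^ a = (p : ℤ) ^ b → a = b := fun a b hab =>
    Int.pow_right_injective (by rw [Int.natAbs_natCast]; exact hp.out.two_le) hab
  rw [Finset.sum_eq_zero (s := (Finset.univ : Finset (setE p f P.ell))) fun i _ => (hE i).elim,
    Finset.sum_eq_zero, Finset.sum_eq_single 0] at h2
  · rw [zero_add, add_zero] at h2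
    exact (mul_ne_zero hc h3) h2
  · intro i hi hi0
    refine h4 _ fun a b hab => hi0 ?_
    rw [expC_eq hf, expC_eq hf, neg_mul, neg_mul, neg_inj, pow_zero, one_mul,
      mul_right_comm, mul_comm _ (((p : ℤ) ^ f) ^ b), ← pow_mul, ← pow_mul, ← pow_add] at hab
    have h5 := hinj _ _ (mul_right_cancel₀ hz.ne' hab)
    exact eq_of_shift_eq (a := a) (b := b) (Finset.mem_range.1 hi) hf (by rw [mul_comm a, mul_comm b]; omega)
  · intro h5; exact absurd (Finset.mem_range.2 hf) h5
  · intro i _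
    rw [h4, mul_zero]
    intro a b hab
    rw [expD_eq, expC_eq hf, neg_mul, neg_mul, neg_inj, mul_comm, ← ordD_shift, ordD,
      (lam_digit_of_eq hf hell he _).1, pow_zero, one_mul, mul_comm _ (((p : ℤ) ^ f) ^ b), ← pow_mul,
      show xi p f = ((p : ℤ) - 1) * thetaN p f by
        obtain ⟨θ, h0, hξ, hθ⟩ := exists_theta (p := p) hf
        rw [thetaN, hθ]; exact hξ,
      show ((p : ℤ) - 1) * thetaN p f - ((p : ℤ) - 2) * thetaN p f = thetaN p f by ring,
      mul_left_comm, mul_comm] at hab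
    have h5 := mul_left_cancel₀ hθ.ne' hab
    have h6 : (p : ℤ) ^ f + p - 1 ∣ (p : ℤ) ^ ((i : ℕ) + a * f) := Dvd.intro_left _ h5.symm
    -- `q + p - 1 ≡ -1` modulo `p`, so this integer is prime to `p`; being larger than `1`, it
    -- cannot divide a power of `p`.
    have h7 : IsCoprime ((p : ℤ) ^ f + p - 1) ((p : ℤ) ^ ((i : ℕ) + a * f)) := by
      refine IsCoprime.pow_right ?_
      obtain ⟨c, hc⟩ := p_dvd_q (p := p) hf
      exact ⟨-1, c + 1, by rw [hc]; ring⟩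
    have h8 := h7.isUnit_of_dvd' dvd_rfl h6
    have := Int.isUnit_iff.1 h8
    omega

/-- The functional of the orbit of `D_i` annihilates every other monomial of `B`, so its value on
the coboundary is `b_i` times a nonzero constant. -/
theorem b_eq_zero_of_coboundary (hf : 0 < f) (h0 : 0 < P.ell) (hell : P.ell < p ^ f - 1) (hc : C.c = 0)
    {h : k⸨X⸩} (hW : bseries p f P C = toL (PowerSeries.C (P.alpha : k)⁻¹) * phiL k p f h -
      toL (PowerSeries.C (P.beta : k)⁻¹) * h) (i : setD p f P.ell) : C.b i = 0 := by
  have hp0 : (0 : ℤ) < p := by exact_mod_cast hp.out.pos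
  obtain ⟨Λ, h1, h2, h3, h4⟩ := exists_orbit_functional (e₀ := expD p f P.ell i) hf P.alpha.ne_zero
    P.beta.ne_zero hW (by
      rw [expD_eq, ordD]
      have := mul_pos (pow_pos hp0 i) (sub_pos.2 (lam_pos_lt (p := p) hf h0 hell i).2)
      omega)
  have hi := mem_setD.1 i.2
  rw [map_bseries Λ h1, hc, zero_mul, add_zero, Finset.sum_eq_single i,
    Finset.sum_eq_zero (s := (Finset.univ : Finset (setE p f P.ell))), add_zero] at h2
  · exact (mul_eq_zero.1 h2).resolve_right h3
  · intro j _
    rw [h4, zero_sub, Finset.sum_eq_zero, mul_zero, neg_zero, mul_zero]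
    · intro s hs
      obtain ⟨Y, hY⟩ := expE_add_gNum (p := p) P.ell (i := j) hs
      refine h4 _ fun a b hab => ?_
      rw [hY, expD_eq, neg_mul, neg_mul, neg_inj, mul_right_comm, mul_comm (ordD _ _ _ _),
        ← pow_mul, ← pow_add, ← ordD_shift] at hab
      exact ne_ordD hf h0 hell _ _ _ hab
    · intro a b hab
      rw [expE_eq, expD_eq, neg_mul, neg_mul, neg_inj, mul_comm, mul_comm (ordD _ _ _ _),
        ← ordD_shift, ← ordE_shift] at hab
      refine ordD_ne_ordE hf ?_ ?_ hab.symm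
      · rw [isE_shift_iff, isE_shift_iff]; exact (mem_setE.1 j.2).2
      · rw [isE_shift_iff]; exact hi.2
  · intro j _ hji
    rw [h4, mul_zero]
    intro a b hab
    rw [expD_eq, expD_eq, neg_mul, neg_mul, neg_inj, mul_comm, mul_comm (ordD _ _ _ _),
        ← ordD_shift, ← ordD_shift] at hab
    have hj := mem_setD.1 j.2
    exact hji (Subtype.ext (eq_of_shift_eq hj.1 hi.1 (ordD_eq_ordD_imp hf
      (by rw [isE_shift_iff]; exact hj.2) (by rw [isE_shift_iff]; exact hi.2) hab)))
  · intro hh; exact absurd (Finset.mem_univ _) hh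

theorem cE_eq_zero_of_coboundary (hf : 0 < f) (h0 : 0 < P.ell) (hell : P.ell < p ^ f - 1) (hc : C.c = 0)
    {h : k⸨X⸩} (hW : bseries p f P C = toL (PowerSeries.C (P.alpha : k)⁻¹) * phiL k p f h -
      toL (PowerSeries.C (P.beta : k)⁻¹) * h) (i : setE p f P.ell) : C.cE i = 0 := by
  have hp0 : (0 : ℤ) < p := by exact_mod_cast hp.out.pos
  obtain ⟨Λ, h1, h2, h3, h4⟩ := exists_orbit_functional (e₀ := expE p f P.ell i) hf P.alpha.ne_zero
    P.beta.ne_zero hW (by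
      rw [expE_eq, ordE]
      have h5 := lam_pos_lt (p := p) hf h0 hell (i + 2 * f)
      have := mul_pos (pow_pos hp0 (i + 2 * f))
        (show 0 < 2 * xi p f - lam p f P.ell (i + 2 * f) by omega)
      omega)
  have hi := mem_setE.1 i.2
  have hX : ∀ (j : setE p f P.ell), ∀ s ∈ Finset.Icc 1 f,
      Λ (tpow k (expE p f P.ell j + (p : ℤ) ^ (j : ℕ) * gNum p f s)) = 0 := by
    intro j s hs
    obtain ⟨Y, hY⟩ := expE_add_gNum (p := p) P.ell (i := j) hs
    refine h4 _ fun a b hab => ?_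
    rw [hY, expE_eq, neg_mul, neg_mul, neg_inj, mul_right_comm, mul_comm (ordE _ _ _ _),
      ← pow_mul, ← pow_add, ← ordE_shift] at hab
    exact ne_ordE hf h0 hell _ _ _ hab
  rw [map_bseries Λ h1, hc, zero_mul, add_zero, Finset.sum_eq_zero, zero_add, Finset.sum_eq_single i] at h2
  · rw [Finset.sum_eq_zero (hX i), mul_zero, sub_zero] at h2
    exact (mul_eq_zero.1 h2).resolve_right h3
  · intro j _ hji
    rw [Finset.sum_eq_zero (hX j), mul_zero, sub_zero, h4, mul_zero]
    intro a b hab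
    rw [expE_eq, expE_eq, neg_mul, neg_mul, neg_inj, mul_comm, mul_comm (ordE _ _ _ _),
        ← ordE_shift, ← ordE_shift] at hab
    have hj := mem_setE.1 j.2
    have := ordE_eq_ordE_imp hf hab
    exact hji (Subtype.ext (eq_of_shift_eq (a := a) (b := b) hj.1 hi.1 (by omega)))
  · intro hh; exact absurd (Finset.mem_univ _) hh
  · intro j _
    rw [h4, mul_zero]
    intro a b hab
    rw [expE_eq, expD_eq, neg_mul, neg_mul, neg_inj, mul_comm, mul_comm (ordE _ _ _ _),
        ← ordD_shift, ← ordE_shift] at hab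
    refine ordD_ne_ordE hf ?_ ?_ hab
    · rw [isE_shift_iff, isE_shift_iff]; exact hi.2
    · rw [isE_shift_iff]; exact (mem_setD.1 j.2).2

end Vanishing


/-! ### Isomorphic modules have proportional scalars. -/

section Classification

variable {p f : ℕ} [hp : Fact p.Prime] {k : Type*} [Field k] {P : Params k} {C C' : Scalars k p f P.ell}
  {A A' : Aux}

/-- The scalars `a C - d C'`. -/
def Scalars.comb (a d : k) (C C' : Scalars k p f P.ell) : Scalars k p f P.ell where
  b i := a * C.b i - d * C'.b i
  cE i := a * C.cE i - d * C'.cE i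
  c := a * C.c - d * C'.c

theorem bseries_comb (a d : k) : bseries p f P (Scalars.comb a d C C') =
    toL (PowerSeries.C a) * bseries p f P C - toL (PowerSeries.C d) * bseries p f P C' := by
  simp only [bseries, Scalars.comb, map_sub, map_mul, sub_mul, mul_add, Finset.mul_sum,
    Finset.sum_sub_distrib, mul_assoc]
  ring

theorem Scalars.Allowed.comb (hC : C.Allowed P) (hC' : C'.Allowed P) (a d : k) :
    (Scalars.comb a d C C').Allowed P := by
  intro hc
  by_cases h : C.c = 0
  · refine hC' fun h' => hc ?_
    change a * C.c - d * C'.c = 0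
    rw [h, h', mul_zero, mul_zero, sub_zero]
  · exact hC h

/-- Scalars whose off-diagonal entry is a coboundary vanish. -/
theorem scalars_eq_of_coboundary (hf : 0 < f) (h0 : 0 < P.ell) (hell : P.ell < p ^ f - 1)
    (hC : C.Allowed P) (hC' : C'.Allowed P) {a d : k} {h : k⸨X⸩}
    (hW : toL (PowerSeries.C a) * bseries p f P C - toL (PowerSeries.C d) * bseries p f P C' =
      toL (PowerSeries.C (P.alpha : k)⁻¹) * phiL k p f h - toL (PowerSeries.C (P.beta : k)⁻¹) * h) :
    (∀ i, a * C.b i = d * C'.b i) ∧ (∀ i, a * C.cE i = d * C'.cE i) ∧ a * C.c = d * C'.c := by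
  rw [← bseries_comb] at hW
  have hc := c_eq_zero_of_coboundary hf (by omega) (hC.comb hC' a d) hW
  exact ⟨fun i => sub_eq_zero.1 (b_eq_zero_of_coboundary hf h0 hell hc hW i),
    fun i => sub_eq_zero.1 (cE_eq_zero_of_coboundary hf h0 hell hc hW i), sub_eq_zero.1 hc⟩

/-- Write `M` as the matrix `(a, b; c, d)` and compare entries after dividing by `ω`. The entry `c`
is constant. If `c = 0`, then `a` and `d` are constants and `b` exhibits `aB - dB'` as a coboundary.
If `c ≠ 0`, then `d` and `a` exhibit `cB` and `-cB'` as coboundaries. Compatibility with `Γ` plays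
no role. -/
theorem scalars_eq_of_linearEquiv (hf : 0 < f) (h0 : 0 < P.ell) (hell : P.ell < p ^ f - 1)
    (hC : C.Allowed P) (hC' : C'.Allowed P) (hB : btilde p f P C A = bseries p f P C)
    (hB' : btilde p f P C' A' = bseries p f P C')
    (M : (k⸨X⸩ × k⸨X⸩) ≃ₗ[k⸨X⸩] (k⸨X⸩ × k⸨X⸩))
    (hM : ∀ w, M (dualPhi p f P C A w) = dualPhi p f P C' A' (M w)) :
    ∃ ε : kˣ, (∀ i, C.b i = (ε : k) * C'.b i) ∧ (∀ i, C.cE i = (ε : k) * C'.cE i) ∧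
      C.c = (ε : k) * C'.c := by
  have hω := omegaSeries_ne_zero (k := k) (p := p) hf
  have hα := toL_C_ne_zero (inv_ne_zero P.alpha.ne_zero)
  have hβ := toL_C_ne_zero (inv_ne_zero P.beta.ne_zero)
  have hα1 : toL (PowerSeries.C (P.alpha : k)⁻¹) * toL (PowerSeries.C (P.alpha : k)) = (1 : k⸨X⸩) := by
    rw [toL_C_mul_toL_C, inv_mul_cancel₀ P.alpha.ne_zero, map_one, map_one]
  have hβ1 : toL (PowerSeries.C (P.beta : k)⁻¹) * toL (PowerSeries.C (P.beta : k)) = (1 : k⸨X⸩) := by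
    rw [toL_C_mul_toL_C, inv_mul_cancel₀ P.beta.ne_zero, map_one, map_one]
  obtain ⟨a, c, hac⟩ : ∃ a c, M (1, 0) = (a, c) := ⟨_, _, rfl⟩
  obtain ⟨b, d, hbd⟩ : ∃ b d, M (0, 1) = (b, d) := ⟨_, _, rfl⟩
  have hMw : ∀ x y : k⸨X⸩, M (x, y) = (x * a + y * b, x * c + y * d) := fun x y => by
    have : (x, y) = x • ((1 : k⸨X⸩), (0 : k⸨X⸩)) + y • ((0 : k⸨X⸩), (1 : k⸨X⸩)) := by simp
    rw [this, map_add, map_smul, map_smul, hac, hbd]; simp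
  have e1 := hM (1, 0)
  have e2 := hM (0, 1)
  rw [hac] at e1
  rw [hbd] at e2
  simp only [dualPhi, map_one, map_zero, mul_one, mul_zero, add_zero, zero_add, hMw, hB, hB',
    Prod.mk.injEq, zero_mul] at e1 e2
  obtain ⟨e11, e12⟩ := e1
  obtain ⟨e21, e22⟩ := e2
  have q11 := mul_left_cancel₀ hω ((mul_assoc _ _ _).symm.trans e11)
  have q12 := mul_left_cancel₀ hω ((mul_assoc _ _ _).symm.trans e12)
  have q21 : bseries p f P C * a + toL (PowerSeries.C (P.beta : k)⁻¹) * b =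
      toL (PowerSeries.C (P.alpha : k)⁻¹) * phiL k p f b + bseries p f P C' * phiL k p f d :=
    mul_left_cancel₀ hω (by rw [← e21]; ring)
  have q22 : bseries p f P C * c + toL (PowerSeries.C (P.beta : k)⁻¹) * d =
      toL (PowerSeries.C (P.beta : k)⁻¹) * phiL k p f d :=
    mul_left_cancel₀ hω (by rw [← e22]; ring)
  -- The lower left entry satisfies `φ(c) = (β/α)c`, hence is constant.
  have hc := phiL_eigenvector_eq (p := p) hf (x := c) (μ := (P.beta : k) * (P.alpha : k)⁻¹)
    (mul_ne_zero P.beta.ne_zero (inv_ne_zero P.alpha.ne_zero)) (by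
      refine mul_left_cancel₀ hβ ?_
      rw [← q12, ← toL_C_mul_toL_C]
      linear_combination -toL (PowerSeries.C (P.alpha : k)⁻¹) * c * hβ1)
  set c₀ := c.coeff 0 with hc₀
  by_cases hcz : c₀ = 0
  · rw [hcz, map_zero, map_zero] at hc
    subst hc
    rw [map_zero, mul_zero, add_zero] at q11
    rw [mul_zero, zero_add] at q22
    have ha := phiL_eigenvector_eq (p := p) hf (x := a) (μ := 1) one_ne_zero
      (by rw [map_one, map_one, one_mul]; exact (mul_left_cancel₀ hα q11).symm)
    have hd := phiL_eigenvector_eq (p := p) hf (x := d) (μ := 1) one_ne_zero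
      (by rw [map_one, map_one, one_mul]; exact (mul_left_cancel₀ hβ q22).symm)
    have ha0 : a.coeff 0 ≠ 0 := fun h => by
      rw [h, map_zero, map_zero] at ha
      have := M.injective (hac.trans (by rw [ha, map_zero]; rfl))
      exact one_ne_zero (congrArg Prod.fst this)
    have hd0 : d.coeff 0 ≠ 0 := fun h => by
      rw [h, map_zero, map_zero] at hd
      obtain ⟨⟨x, y⟩, hxy⟩ := M.surjective (0, 1)
      rw [hMw, hd, mul_zero, mul_zero, add_zero] at hxy
      exact zero_ne_one (congrArg Prod.snd hxy)
    rw [← mul_left_cancel₀ hβ q22] at q21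
    obtain ⟨h1, h2, h3⟩ := scalars_eq_of_coboundary (C := C) (C' := C') (a := a.coeff 0) (d := d.coeff 0)
      (h := b) hf h0 hell hC hC' (by rw [← ha, ← hd]; linear_combination q21)
    have key : ∀ x y : k, a.coeff 0 * x = d.coeff 0 * y →
        x = ((Units.mk0 _ (div_ne_zero hd0 ha0) : kˣ) : k) * y := fun x y hxy => by
      rw [Units.val_mk0, div_mul_eq_mul_div, eq_div_iff ha0, ← hxy, mul_comm]
    exact ⟨_, fun i => key _ _ (h1 i), fun i => key _ _ (h2 i), key _ _ h3⟩
  -- A nonzero constant eigenvector has eigenvalue `1`. In this case both families of scalars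
  -- vanish, and `ε = 1` works.
  · have hαβ : (P.alpha : k) = P.beta := by
      rw [hc, phiL_toL_C, toL_C_mul_toL_C, toL_C_mul_toL_C] at q12
      have h1 := mul_right_cancel₀ hcz (PowerSeries.C_injective (toL_injective q12))
      exact inv_injective h1
    rw [hc] at q22
    obtain ⟨h1, h2, h3⟩ := scalars_eq_of_coboundary (C := C) (C' := C) (a := c₀) (d := 0) (h := d)
      hf h0 hell hC hC (by rw [hαβ, map_zero, map_zero]; linear_combination q22)
    rw [hc, phiL_toL_C] at q11
    obtain ⟨h1', h2', h3'⟩ := scalars_eq_of_coboundary (C := C') (C' := C') (a := -c₀) (d := 0) (h := a)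
      hf h0 hell hC' hC' (by
        rw [← hαβ, map_zero, map_zero, map_neg, map_neg]; linear_combination q11)
    have key : ∀ (s x : k), s ≠ 0 → s * x = 0 * x → x = 0 := fun s x hs hx => by
      rw [zero_mul] at hx; exact (mul_eq_zero.1 hx).resolve_left hs
    have hn := neg_ne_zero.2 hcz
    refine ⟨1, fun i => ?_, fun i => ?_, ?_⟩
    · rw [key _ _ hcz (h1 i), key _ _ hn (h1' i), mul_zero]
    · rw [key _ _ hcz (h2 i), key _ _ hn (h2' i), mul_zero]
    · rw [key _ _ hcz h3, key _ _ hn h3', mul_zero]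

end Classification


/-! ### Maps between the modules `Δ` for nested lattices. -/

section Comparison

variable {O : Type*} [CommRing O] [IsDomain O] {p f : ℕ} [hp : Fact p.Prime]
  {k : Type*} [Field k] [Algebra O k] [CharP k p]
  {P : Params k} {C C' : Scalars k p f P.ell} {A A' : Aux}

/-- `(v₁, v₂) ↦ (v₁, δ v₂)`. -/
noncomputable def scaleSnd (δ : k) (v : k⸨X⸩ × k⸨X⸩) : k⸨X⸩ × k⸨X⸩ := (v.1, toL (PowerSeries.C δ) * v.2)

theorem scaleSnd_add (δ : k) (v w : k⸨X⸩ × k⸨X⸩) : scaleSnd δ (v + w) = scaleSnd δ v + scaleSnd δ w :=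
  Prod.ext rfl (mul_add _ _ _)

theorem scaleSnd_smul (δ : k) (F : k⟦X⟧) (v : k⸨X⸩ × k⸨X⸩) : scaleSnd δ (F • v) = F • scaleSnd δ v :=
  Prod.ext rfl (mul_smul_comm _ _ _)

theorem scaleSnd_mem {δ : k} {v : k⸨X⸩ × k⸨X⸩} (hx : A'.nx ≤ A.nx) (hy : A'.ny ≤ A.ny)
    (hv : v ∈ latV k A.nx A.ny) : scaleSnd δ v ∈ latV k A'.nx A'.ny := by
  rw [mem_latV] at *
  exact ⟨lat_anti (by omega) hv.1, toL_mul_mem_lat _ (lat_anti (by omega) hv.2)⟩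

/-- A comparison map between two modules `Δ`. -/
structure IsComparison (h : LatticeStable p f P C A) (h' : LatticeStable p f P C' A') (δ : k)
    (s : Delta p f P C A → Delta p f P C' A') : Prop where
  apply_cl : ∀ v, s (h.cl v) = h'.cl (scaleSnd δ v)

variable {h : LatticeStable p f P C A} {h' : LatticeStable p f P C' A'} {δ : k}
  {s : Delta p f P C A → Delta p f P C' A'}

theorem exists_isComparison (h : LatticeStable p f P C A) (h' : LatticeStable p f P C' A') (δ : k)
    (hx : A'.nx ≤ A.nx) (hy : A'.ny ≤ A.ny) : ∃ s, IsComparison h h' δ s := by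
  refine ⟨fun z => h'.cl (scaleSnd δ (Function.surjInv h.cl_surjective z)), ⟨fun v => ?_⟩⟩
  have h1 : h.cl (Function.surjInv h.cl_surjective (h.cl v) - v) = 0 := by
    rw [map_sub, Function.surjInv_eq h.cl_surjective, sub_self]
  have h2 := (h'.cl_eq_zero _).2 (scaleSnd_mem (δ := δ) hx hy ((h.cl_eq_zero _).1 h1))
  rw [← sub_eq_zero, ← map_sub, ← h2]
  congr 1
  exact Prod.ext rfl (mul_sub _ _ _).symm

theorem IsComparison.add (hs : IsComparison h h' δ s) (x y : Delta p f P C A) : s (x + y) = s x + s y := by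
  obtain ⟨v, rfl⟩ := h.cl_surjective x
  obtain ⟨w, rfl⟩ := h.cl_surjective y
  rw [← map_add, hs.apply_cl, hs.apply_cl, hs.apply_cl, scaleSnd_add, map_add]

theorem IsComparison.smul (hs : IsComparison h h' δ s) (F : k⟦X⟧) (x : Delta p f P C A) :
    s (F • x) = F • s x := by
  obtain ⟨v, rfl⟩ := h.cl_surjective x
  rw [← map_smul, hs.apply_cl, hs.apply_cl, scaleSnd_smul, map_smul]

theorem IsComparison.deltaPhi (hs : IsComparison h h' δ s)
    (hB : toL (PowerSeries.C δ) * btilde p f P C A = btilde p f P C' A') (x : Delta p f P C A) :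
    s (LTPhiGamma.deltaPhi p f P C A x) = LTPhiGamma.deltaPhi p f P C' A' (s x) := by
  obtain ⟨v, rfl⟩ := h.cl_surjective x
  rw [h.deltaPhi_cl, hs.apply_cl, hs.apply_cl, h'.deltaPhi_cl]
  congr 1
  rw [phiV_apply, phiV_apply, ← hB]
  refine Prod.ext rfl ?_
  simp only [scaleSnd, map_mul, phiL_toL_C]
  ring

theorem LatticeStable.genD_zero (h : LatticeStable p f P C A) (i : Fin 2) :
    genD p f P C A i 0 = h.cl (genV k i) := by
  rw [genD, ← h.cl_toV]
  congr 1
  exact (freeToV_single _ _ _ _ _ _).trans (by simp)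

/-- It suffices to compare on `x` and `y`. On `y` the formulae agree exactly. On `x` they differ
only through the exponent `r` of `U`, which depends on `N`; the difference lies in the target
lattice by `hu`. -/
theorem IsComparison.gammaAction (hO : IsUnramifiedBase O p f) (hs : IsComparison h h' δ s)
    (hB : toL (PowerSeries.C δ) * btilde p f P C A = btilde p f P C' A') (hc : δ * C.c = C'.c)
    (hr : C.c ≠ 0 → 0 ≤ expR p f A.N) (hr' : C'.c ≠ 0 → 0 ≤ expR p f A'.N)
    (hu : C'.c ≠ 0 → ∀ γ : Oˣ, uL p f k γ ^ expR p f A.N - uL p f k γ ^ expR p f A'.N ∈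
      lat k ((A'.ny : ℤ) + cZero p f))
    {T : Oˣ → Delta p f P C A → Delta p f P C A} {T' : Oˣ → Delta p f P C' A' → Delta p f P C' A'}
    (hT : IsGammaAction p f P C A T) (hT' : IsGammaAction p f P C' A' T') (γ : Oˣ)
    (x : Delta p f P C A) : s (T γ x) = T' γ (s x) := by
  have hx : s (T γ (genD p f P C A 0 0)) = T' γ (s (genD p f P C A 0 0)) := by
    have e1 : T γ (genD p f P C A 0 0) = h.cl (gammaX P C A γ) := by
      rw [← toV_gammaTau_zero hO hr, h.cl_toV]; exact hT.on_x γ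
    have e2 : T' γ (genD p f P C' A' 0 0) = h'.cl (gammaX P C' A' γ) := by
      rw [← toV_gammaTau_zero hO hr', h'.cl_toV]; exact hT'.on_x γ
    have e3 : s (genD p f P C A 0 0) = genD p f P C' A' 0 0 := by
      rw [h.genD_zero, hs.apply_cl, h'.genD_zero]
      congr 1
      exact Prod.ext rfl (mul_zero _)
    rw [e1, hs.apply_cl, e3, e2, ← sub_eq_zero, ← map_sub, h'.cl_eq_zero, mem_latV]
    refine ⟨by rw [Prod.fst_sub, scaleSnd, gammaX, gammaX, sub_self]; exact Submodule.zero_mem _, ?_⟩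
    rw [Prod.snd_sub, scaleSnd, gammaX, gammaX, ← hc, ← toL_C_mul_toL_C]
    dsimp only
    by_cases h0 : C'.c = 0
    · rw [toL_C_mul_toL_C δ, hc, h0]
      have : toL (PowerSeries.C δ) * toL (PowerSeries.C C.c) = (0 : k⸨X⸩) := by
        rw [toL_C_mul_toL_C δ, hc, h0, map_zero, map_zero]
      convert Submodule.zero_mem (lat k ((A'.ny : ℤ) - 1)) using 1
      rw [map_zero, map_zero]
      linear_combination -(aL p f k γ ^ P.u * (toL (PowerSeries.C (P.beta : k)) * upsL p f k γ) *
        (uL p f k γ ^ expR p f A.N * tpow k (-1 - cZero p f))) * this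
    · have h1 := mul_mem_lat' (l := (A'.ny : ℤ) - 1) (by omega) (hu h0 γ)
        (tpow_mem_lat (k := k) (le_refl (-1 - cZero p f)))
      have h2 : aL p f k γ ^ P.u ∈ lat k 0 := by rw [aL, ← map_pow]; exact toL_mem_lat _
      have h3 := mul_mem_lat' (m := 0) (l := (A'.ny : ℤ) - 1) (by omega) (mul_mem_lat' (l := 0) (m := 0)
        (n := 0) (by omega) h2 (toL_mem_lat (PowerSeries.C δ * PowerSeries.C C.c * PowerSeries.C (P.beta : k) *
          PowerSeries.C (brkRatio p f k γ ^ p ^ (f - 1))))) h1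
      refine (Submodule.neg_mem_iff _).1 ?_
      convert h3 using 1
      rw [map_mul, map_mul, map_mul, ← upsL]
      ring
  have hy : s (T γ (genD p f P C A 1 0)) = T' γ (s (genD p f P C A 1 0)) := by
    have e1 : T γ (genD p f P C A 1 0) = h.cl (gammaY p f P γ) := by
      rw [← toV_gammaTau_one hO, h.cl_toV]; exact hT.on_y γ
    have e2 : T' γ (genD p f P C' A' 1 0) = h'.cl (gammaY p f P γ) := by
      rw [← toV_gammaTau_one hO, h'.cl_toV]; exact hT'.on_y γ
    have e4 : ∀ v : k⸨X⸩ × k⸨X⸩, v.1 = 0 → scaleSnd δ v = (PowerSeries.C δ : k⟦X⟧) • v := fun v hv =>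
      Prod.ext (by change v.1 = _ • v.1; rw [hv, smul_zero]) (Algebra.smul_def _ _).symm
    rw [e1, hs.apply_cl, h.genD_zero, hs.apply_cl, e4 _ rfl, e4 _ rfl, map_smul, map_smul, hT'.smul' hO,
      hO.sigmaR_C, ← h'.genD_zero, e2]
  have h1 : ∀ i n, s (T γ (genD p f P C A i n)) = T' γ (s (genD p f P C A i n)) := by
    intro i n
    induction n with
    | zero => fin_cases i <;> assumption
    | succ n ih => rw [← deltaPhi_genD, hT.phi, hs.deltaPhi hB, ih, hs.deltaPhi hB, hT'.phi]
  obtain ⟨m, rfl⟩ := deltaMk_surjective x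
  induction m using Finsupp.induction_linear with
  | zero =>
    change s (T γ 0) = T' γ (s 0)
    have e0 : s 0 = 0 := by have := hs.add 0 0; rwa [add_zero, left_eq_add] at this
    have e1 : T γ 0 = 0 := by have := hT.add γ 0 0; rwa [add_zero, left_eq_add] at this
    have e2 : T' γ 0 = 0 := by have := hT'.add γ 0 0; rwa [add_zero, left_eq_add] at this
    rw [e1, e0, e2]
  | add m m' h h' => rw [deltaMk_add, hT.add, hs.add, hs.add, hT'.add, h, h']
  | single i F => obtain ⟨i, n⟩ := i; rw [deltaMk_single, hT.smul, hs.smul, hs.smul, hT'.smul, h1]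

/-- `(w₁, w₂) ↦ (w₁, δ w₂)` as a linear automorphism. -/
noncomputable def scaleSndEquiv (δ : k) (hδ : δ ≠ 0) : (k⸨X⸩ × k⸨X⸩) ≃ₗ[k⸨X⸩] (k⸨X⸩ × k⸨X⸩) :=
  (LinearEquiv.refl _ _).prodCongr (LinearEquiv.smulOfNeZero k⸨X⸩ k⸨X⸩ _ (toL_C_ne_zero hδ))

/-- The isomorphism is the transpose of `s`. In coordinates it is again `(w₁, w₂) ↦ (w₁, δw₂)`,
hence bijective over `k((t))`, although `s` itself need not be injective. -/
theorem IsComparison.isomorphic (hO : IsUnramifiedBase O p f) (hs : IsComparison h h' δ s) (hδ : δ ≠ 0)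
    (hB : toL (PowerSeries.C δ) * btilde p f P C A = btilde p f P C' A')
    {T : Oˣ → Delta p f P C A → Delta p f P C A} {T' : Oˣ → Delta p f P C' A' → Delta p f P C' A'}
    (hT : IsGammaAction p f P C A T) (hT' : IsGammaAction p f P C' A' T')
    (hsT : ∀ γ x, s (T γ x) = T' γ (s x)) :
    (hT'.structD hO h').Isomorphic (hT.structD hO h) := by
  set e := h'.kappa.trans ((scaleSndEquiv δ hδ).trans h.kappa.symm) with he
  have hk : ∀ d, h.kappa (e d) = scaleSnd δ (h'.kappa d) := fun d => h.kappa.apply_symm_apply _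
  have hpull : ∀ l' : TDual k (Delta p f P C' A'), ∃ l : TDual k (Delta p f P C A),
      (∀ x, l.eval x = l'.eval (s x)) ∧ ∀ c : k⸨X⸩, e (c ⊗ₜ[k⟦X⟧] l') = c ⊗ₜ[k⟦X⟧] l := by
    intro l'
    obtain ⟨l, hl⟩ := TDual.exists_mk (k := k) (fun x : Delta p f P C A => l'.eval (s x))
      (fun x y => by rw [hs.add, TDual.eval_add]) (fun c x => by rw [hs.smul, TDual.eval_C_smul])
    refine ⟨l, hl, fun c => h.kappa.injective ?_⟩
    have h1 : h.coord l = scaleSnd δ (h'.coord l') := h.coord_eq fun v => by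
      rw [hl, hs.apply_cl, h'.eval_cl, resPair, resPair, scaleSnd, scaleSnd]
      congr 1; ring
    rw [hk, h'.kappa_tmul, h.kappa_tmul, h1]
    exact Prod.ext rfl (mul_left_comm _ _ _)
  refine ⟨e, fun d => h.kappa.injective ?_, fun γ d => ?_⟩
  · change h.kappa (e (h'.phiD d)) = h.kappa (h.phiD (e d))
    rw [hk, h'.kappa_phiD, h.kappa_phiD, hk, dualPhi, dualPhi, scaleSnd, scaleSnd, ← hB]
    refine Prod.ext ?_ ?_
    · dsimp only
      rw [map_mul, phiL_toL_C]; ring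
    · dsimp only
      rw [map_mul, phiL_toL_C]; ring
  · obtain ⟨M, hM⟩ := dualLaurent_exists_eq d
    obtain ⟨l', rfl⟩ := hM M le_rfl
    change e (hT'.actD hO γ _) = hT.actD hO γ (e _)
    obtain ⟨l, hl, hel⟩ := hpull l'
    obtain ⟨l₁, hl₁, hel₁⟩ := hpull (hT'.dual hO γ l')
    rw [hT'.actD_tmul, hel, hel₁, hT.actD_tmul]
    congr 1
    refine TDual.ext fun x => ?_
    rw [hl₁, hT'.dual_eval, hT.dual_eval, hl, hsT]

end Comparison


/-! ### Independence of the auxiliary integers and the classification over an abstract base. -/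

section Isomorphism

variable {O : Type*} [CommRing O] {p f : ℕ} [hp : Fact p.Prime] {k : Type*} [Field k] [Algebra O k]

theorem EtalePhiGamma.Isomorphic.symm {D D' : Type*} [AddCommGroup D] [Module k⸨X⸩ D] [AddCommGroup D']
    [Module k⸨X⸩ D'] {S : EtalePhiGamma O k p f D} {S' : EtalePhiGamma O k p f D'}
    (h : S.Isomorphic S') : S'.Isomorphic S := by
  obtain ⟨e, h1, h2⟩ := h
  refine ⟨e.symm, fun d => ?_, fun γ d => ?_⟩
  · rw [LinearEquiv.symm_apply_eq, h1, e.apply_symm_apply]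
  · rw [LinearEquiv.symm_apply_eq, h2, e.apply_symm_apply]

theorem EtalePhiGamma.Isomorphic.trans {D D' D'' : Type*} [AddCommGroup D] [Module k⸨X⸩ D]
    [AddCommGroup D'] [Module k⸨X⸩ D'] [AddCommGroup D''] [Module k⸨X⸩ D''] {S : EtalePhiGamma O k p f D}
    {S' : EtalePhiGamma O k p f D'} {S'' : EtalePhiGamma O k p f D''}
    (h : S.Isomorphic S') (h' : S'.Isomorphic S'') : S.Isomorphic S'' := by
  obtain ⟨e, h1, h2⟩ := h
  obtain ⟨e', h1', h2'⟩ := h'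
  exact ⟨e.trans e', fun d => by rw [LinearEquiv.trans_apply, h1, h1', LinearEquiv.trans_apply],
    fun γ d => by rw [LinearEquiv.trans_apply, h2, h2', LinearEquiv.trans_apply]⟩

variable [IsDomain O] [CharP k p] {P : Params k} {C C' : Scalars k p f P.ell} {A A' : Aux}

omit [CharP k p] in
theorem Aux.Admissible.mono (hA : A.Admissible C) {nx ny : ℕ} (hx : A.nx ≤ nx) (hy : ny ≤ A.ny)
    (h0 : 0 < ny) : Aux.Admissible ⟨A.N, nx, ny⟩ C := by
  have hx' : (A.nx : ℤ) ≤ nx := by exact_mod_cast hx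
  have hy' : (ny : ℤ) ≤ A.ny := by exact_mod_cast hy
  have hq : (p : ℤ) ^ f * A.nx ≤ (p : ℤ) ^ f * nx := mul_le_mul_of_nonneg_left hx' (by positivity)
  exact
    { nx_pos := hA.nx_pos.trans_le hx
      ny_pos := h0
      expR_nonneg := hA.expR_nonneg
      expO_nonneg := hA.expO_nonneg
      expRi_nonneg := hA.expRi_nonneg
      expN_nonneg := hA.expN_nonneg
      expNj_nonneg := hA.expNj_nonneg
      d1 := fun i hi => hy'.trans (hA.d1 i hi)
      d2 := fun i hi => hy'.trans ((hA.d2 i hi).trans (by dsimp only; linarith))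
      e1 := fun i hi => hy'.trans (hA.e1 i hi)
      e2 := fun i hi => hy'.trans ((hA.e2 i hi).trans (by dsimp only; linarith))
      c1 := fun hc => hy'.trans (hA.c1 hc)
      c2 := fun hc h1 => hy'.trans (hA.c2 hc h1)
      c3 := fun hc => hy'.trans ((hA.c3 hc).trans (by dsimp only; linarith))
      c4 := fun hc => hy'.trans ((hA.c4 hc).trans (by dsimp only; linarith)) }

theorem expR_sub (hf : 0 < f) {N N' : ℕ} (h : 0 < N) (h' : 0 < N') :
    ∃ m : ℤ, expR p f N - expR p f N' = (p : ℤ) ^ (f - 1) * m := by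
  obtain ⟨n, rfl⟩ := Nat.exists_eq_succ_of_ne_zero h.ne'
  obtain ⟨n', rfl⟩ := Nat.exists_eq_succ_of_ne_zero h'.ne'
  refine ⟨p * ((p : ℤ) ^ (f * n) - (p : ℤ) ^ (f * n')), ?_⟩
  rw [expR, expR, Nat.mul_succ, Nat.mul_succ, pow_add, pow_add, ← p_pow_pred_mul (p := p) hf]
  ring

/-- For positive `N`, `N'` the two exponents `r` differ by a multiple of `p^(f-1)`, and such powers
of `U` are `1` to sufficient precision. -/
theorem Aux.Admissible.uL_zpow_expR_sub_mem (hO : IsUnramifiedBase O p f) (hell : 0 < P.ell)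
    (hC : C.Allowed P) (hc : C.c ≠ 0) (hA : A.Admissible C) {N : ℕ} (hN : 0 < N) (γ : Oˣ) :
    uL p f k γ ^ expR p f N - uL p f k γ ^ expR p f A.N ∈ lat k ((A.ny : ℤ) + cZero p f) := by
  obtain ⟨m, hm⟩ := expR_sub (p := p) hO.f_pos hN (hA.N_pos hO.f_pos)
  have h1 := hA.uL_zpow_sub_one_mem hO hell hC hc γ m
  have h2 := mul_mem_lat' (m := 0) (l := (A.ny : ℤ) + cZero p f) (by omega)
    (hO.uL_zpow_mem (k := k) γ (expR p f A.N)) h1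
  convert h2 using 1
  rw [mul_sub, mul_one, ← zpow_add₀ (hO.uL_ne_zero γ), ← hm, add_sub_cancel]

/-- Enlarging `n_x`, decreasing `n_y` and rescaling the scalars do not change the isomorphism class. -/
theorem isomorphic_of_le (hO : IsUnramifiedBase O p f) (hell : 0 < P.ell)
    (hC' : C'.Allowed P) (hA : A.Admissible C) (hA' : A'.Admissible C')
    (hx : A'.nx ≤ A.nx) (hy : A'.ny ≤ A.ny) {δ : k} (hδ : δ ≠ 0)
    (hb : ∀ i, δ * C.b i = C'.b i) (hcE : ∀ i, δ * C.cE i = C'.cE i) (hc : δ * C.c = C'.c)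
    {T : Oˣ → Delta p f P C A → Delta p f P C A} {T' : Oˣ → Delta p f P C' A' → Delta p f P C' A'}
    (hT : IsGammaAction p f P C A T) (hT' : IsGammaAction p f P C' A' T') :
    (hT'.structD hO (hA'.latticeStable hO.f_pos)).Isomorphic
      (hT.structD hO (hA.latticeStable hO.f_pos)) := by
  have hf := hO.f_pos
  obtain ⟨s, hs⟩ := exists_isComparison (hA.latticeStable hf) (hA'.latticeStable hf) δ hx hy
  have hB : toL (PowerSeries.C δ) * btilde p f P C A = btilde p f P C' A' := by
    have h1 := bseries_comb (p := p) (f := f) (P := P) (C := C) (C' := C) δ 0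
    rw [map_zero, map_zero, zero_mul, sub_zero] at h1
    rw [btilde_eq hf hA, btilde_eq hf hA', ← h1]
    congr 1
    obtain ⟨b', cE', c'⟩ := C'
    rw [Scalars.comb, Scalars.mk.injEq]
    exact ⟨funext fun i => by rw [zero_mul, sub_zero]; exact hb i,
      funext fun i => by rw [zero_mul, sub_zero]; exact hcE i, by rw [zero_mul, sub_zero]; exact hc⟩
  exact hs.isomorphic hO hδ hB hT hT' (hs.gammaAction hO hB hc (fun _ => hA.expR_nonneg)
    (fun _ => hA'.expR_nonneg) (fun h0 γ => hA'.uL_zpow_expR_sub_mem hO hell hC' h0 (hA.N_pos hf) γ) hT hT')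

/-- Admissibility allows `n_x` to grow and `n_y` to shrink, but not the reverse, so no single module
need map to or from all the others. The chain enlarges `n_x` to the maximum for each side and joins
the two results through a module with the minimal `n_y`; the rescaling by `ε⁻¹` takes place in one
of the middle steps. -/
theorem isomorphic_of_scalars_eq (hO : IsUnramifiedBase O p f) (hell : 0 < P.ell) (hell' : P.ell < p ^ f)
    (hC : C.Allowed P) (hC' : C'.Allowed P) (hA : A.Admissible C) (hA' : A'.Admissible C') {ε : kˣ}
    (hb : ∀ i, C.b i = (ε : k) * C'.b i) (hcE : ∀ i, C.cE i = (ε : k) * C'.cE i) (hc : C.c = (ε : k) * C'.c)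
    {T : Oˣ → Delta p f P C A → Delta p f P C A} {T' : Oˣ → Delta p f P C' A' → Delta p f P C' A'}
    (hT : IsGammaAction p f P C A T) (hT' : IsGammaAction p f P C' A' T') :
    (hT.structD hO (hA.latticeStable hO.f_pos)).Isomorphic
      (hT'.structD hO (hA'.latticeStable hO.f_pos)) := by
  have h1 := hA.mono (le_max_left A.nx A'.nx) le_rfl hA.ny_pos
  have h1' := hA'.mono (le_max_right A.nx A'.nx) le_rfl hA'.ny_pos
  have h2 := hA'.mono (le_max_right A.nx A'.nx) (min_le_right A.ny A'.ny) (lt_min hA.ny_pos hA'.ny_pos)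
  obtain ⟨T1, hT1⟩ := h1.exists_isGammaAction hO hell hell' hC
  obtain ⟨T1', hT1'⟩ := h1'.exists_isGammaAction hO hell hell' hC'
  obtain ⟨T2, hT2⟩ := h2.exists_isGammaAction hO hell hell' hC'
  have key : ∀ x y : k, x = (ε : k) * y → ((ε⁻¹ : kˣ) : k) * x = y := fun x y hxy => by
    rw [hxy, Units.inv_mul_cancel_left]
  have i1 := isomorphic_of_le hO hell hC h1 hA (le_max_left _ _) le_rfl one_ne_zero
    (fun i => one_mul _) (fun i => one_mul _) (one_mul _) hT1 hT
  have i2 := isomorphic_of_le hO hell hC' h1 h2 le_rfl (min_le_left _ _) (ε⁻¹).ne_zero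
    (fun i => key _ _ (hb i)) (fun i => key _ _ (hcE i)) (key _ _ hc) hT1 hT2
  have i3 := isomorphic_of_le hO hell hC' h1' h2 le_rfl (min_le_right _ _) one_ne_zero
    (fun i => one_mul _) (fun i => one_mul _) (one_mul _) hT1' hT2
  have i4 := isomorphic_of_le hO hell hC' h1' hA' (le_max_right _ _) le_rfl one_ne_zero
    (fun i => one_mul _) (fun i => one_mul _) (one_mul _) hT1' hT'
  exact ((i1.trans i2.symm).trans i3).trans i4.symm

theorem scalars_eq_of_isomorphic (hO : IsUnramifiedBase O p f) (hell : 0 < P.ell) (hell' : P.ell < p ^ f - 1)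
    (hC : C.Allowed P) (hC' : C'.Allowed P) (hA : A.Admissible C) (hA' : A'.Admissible C')
    {T : Oˣ → Delta p f P C A → Delta p f P C A} {T' : Oˣ → Delta p f P C' A' → Delta p f P C' A'}
    (hT : IsGammaAction p f P C A T) (hT' : IsGammaAction p f P C' A' T')
    (hiso : (hT.structD hO (hA.latticeStable hO.f_pos)).Isomorphic
      (hT'.structD hO (hA'.latticeStable hO.f_pos))) :
    ∃ ε : kˣ, (∀ i, C.b i = (ε : k) * C'.b i) ∧ (∀ i, C.cE i = (ε : k) * C'.cE i) ∧
      C.c = (ε : k) * C'.c := by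
  have hf := hO.f_pos
  obtain ⟨e, he, _⟩ := hiso
  refine scalars_eq_of_linearEquiv hf hell hell' hC hC' (btilde_eq hf hA) (btilde_eq hf hA')
    ((hA.latticeStable hf).kappa.symm.trans (e.trans (hA'.latticeStable hf).kappa)) fun w => ?_
  obtain ⟨d, rfl⟩ := (hA.latticeStable hf).kappa.surjective w
  have h1 := he d
  change e ((hA.latticeStable hf).phiD d) = (hA'.latticeStable hf).phiD (e d) at h1
  rw [← (hA.latticeStable hf).kappa_phiD]
  simp only [LinearEquiv.trans_apply, LinearEquiv.symm_apply_apply]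
  rw [h1, (hA'.latticeStable hf).kappa_phiD]

/-- The classification over an abstract base ring. -/
theorem classification (hO : IsUnramifiedBase O p f) (hell : 0 < P.ell) (hell' : P.ell < p ^ f - 1)
    (hC : C.Allowed P) (hC' : C'.Allowed P) (hA : A.Admissible C) (hA' : A'.Admissible C') :
    (∃! S : EtalePhiGamma O k p f (DualLaurent k (Delta p f P C A)), IsAssociated p f P C A S) ∧
    (∃! S' : EtalePhiGamma O k p f (DualLaurent k (Delta p f P C' A')), IsAssociated p f P C' A' S') ∧
    ∀ (S : EtalePhiGamma O k p f (DualLaurent k (Delta p f P C A)))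
      (S' : EtalePhiGamma O k p f (DualLaurent k (Delta p f P C' A'))),
      IsAssociated p f P C A S → IsAssociated p f P C' A' S' →
        (S.Isomorphic S' ↔
          ∃ ε : kˣ, (∀ i, C.b i = (ε : k) * C'.b i) ∧ (∀ i, C.cE i = (ε : k) * C'.cE i) ∧
            C.c = (ε : k) * C'.c) := by
  have hf := hO.f_pos
  have hell'' : P.ell < p ^ f := by omega
  obtain ⟨T, hT⟩ := hA.exists_isGammaAction hO hell hell'' hC
  obtain ⟨T', hT'⟩ := hA'.exists_isGammaAction hO hell hell'' hC'
  refine ⟨hT.existsUnique_isAssociated hO (hA.latticeStable hf),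
    hT'.existsUnique_isAssociated hO (hA'.latticeStable hf), fun S S' hS hS' => ?_⟩
  rw [hS.eq_structD hO (hA.latticeStable hf) hT, hS'.eq_structD hO (hA'.latticeStable hf) hT']
  refine ⟨fun h => scalars_eq_of_isomorphic hO hell hell' hC hC' hA hA' hT hT' h, ?_⟩
  rintro ⟨ε, h1, h2, h3⟩
  exact isomorphic_of_scalars_eq hO hell hell'' hC hC' hA hA' h1 h2 h3 hT hT'

end Isomorphism


/-! ### The ring of integers of an unramified extension of `ℚ_p`. -/

section IntegralClosure

theorem natCard_quotient_map (R S : Type*) [CommRing R] [CommRing S] [Algebra R S] [IsLocalRing R]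
    [Module.Finite R S] [Module.Free R S] :
    Nat.card (S ⧸ Ideal.map (algebraMap R S) (IsLocalRing.maximalIdeal R)) =
      Nat.card (R ⧸ IsLocalRing.maximalIdeal R) ^ Module.finrank R S := by
  let _ := Ideal.Quotient.field (IsLocalRing.maximalIdeal R)
  have : Module.Finite (R ⧸ IsLocalRing.maximalIdeal R)
    (S ⧸ Ideal.map (algebraMap R S) (IsLocalRing.maximalIdeal R)) :=
    Module.Finite.of_restrictScalars_finite R _ _
  rw [Module.natCard_eq_pow_finrank (K := R ⧸ IsLocalRing.maximalIdeal R),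
    IsLocalRing.finrank_quotient_map]

variable {p : ℕ} [Fact p.Prime] {F : Type*} [Field F] [Algebra ℚ_[p] F] [Algebra ℤ_[p] F]
  [IsScalarTower ℤ_[p] ℚ_[p] F] [FiniteDimensional ℚ_[p] F]

/-- The integral closure is free of rank `f` over `ℤ_p`, whose residue field has `p` elements. No
assumption on ramification enters; it is only needed to know that the quotient is a field. -/
theorem natCard_quotient_p {f : ℕ} (hf : Module.finrank ℚ_[p] F = f) :
    Nat.card (integralClosure ℤ_[p] F ⧸ Ideal.span {(p : integralClosure ℤ_[p] F)}) = p ^ f := by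
  have : Module.IsTorsionFree ℤ_[p] F := Module.IsTorsionFree.trans_faithfulSMul ℤ_[p] ℚ_[p] F
  have : Module.Finite ℤ_[p] (integralClosure ℤ_[p] F) :=
    IsIntegralClosure.finite ℤ_[p] ℚ_[p] F (integralClosure ℤ_[p] F)
  have : Module.Free ℤ_[p] (integralClosure ℤ_[p] F) :=
    IsIntegralClosure.module_free ℤ_[p] ℚ_[p] F (integralClosure ℤ_[p] F)
  have hm : Ideal.map (algebraMap ℤ_[p] (integralClosure ℤ_[p] F)) (IsLocalRing.maximalIdeal ℤ_[p]) =
      Ideal.span {(p : integralClosure ℤ_[p] F)} := by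
    rw [PadicInt.maximalIdeal_eq_span_p, Ideal.map_span, Set.image_singleton, map_natCast]
  rw [← hm]
  have h3 := IsIntegralClosure.rank ℤ_[p] ℚ_[p] F (integralClosure ℤ_[p] F)
  have h4 : Nat.card (IsLocalRing.ResidueField ℤ_[p]) = p := by
    rw [Nat.card_congr PadicInt.residueField.toEquiv, Nat.card_zmod]
  rw [natCard_quotient_map, h3, hf]
  exact congrArg (· ^ f) h4

theorem isUnramifiedBase_integralClosure
    (hunr : (Ideal.span {(p : integralClosure ℤ_[p] F)}).IsMaximal)
    {f : ℕ} (hf : Module.finrank ℚ_[p] F = f) : IsUnramifiedBase (integralClosure ℤ_[p] F) p f where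
  f_pos := hf ▸ Module.finrank_pos
  p_ne h := by
    have h1 : algebraMap ℚ_[p] F (p : ℚ_[p]) = 0 := by
      rw [map_natCast, ← map_natCast (algebraMap (integralClosure ℤ_[p] F) F), h, map_zero]
    rw [map_eq_zero] at h1
    exact (Fact.out : p.Prime).ne_zero (by exact_mod_cast h1)
  -- In the field `O/pO` with `q` elements, `x^q = x`.
  dvd_pow_sub x := by
    let _ := Ideal.Quotient.field (Ideal.span {(p : integralClosure ℤ_[p] F)})
    have hcard := natCard_quotient_p (p := p) (F := F) hf
    have : Finite (integralClosure ℤ_[p] F ⧸ Ideal.span {(p : integralClosure ℤ_[p] F)}) :=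
      Nat.finite_of_card_ne_zero (hcard ▸ pow_ne_zero _ (Fact.out : p.Prime).ne_zero)
    let _ := Fintype.ofFinite (integralClosure ℤ_[p] F ⧸ Ideal.span {(p : integralClosure ℤ_[p] F)})
    rw [← Ideal.mem_span_singleton, ← Ideal.Quotient.eq, map_pow, ← hcard, Nat.card_eq_fintype_card]
    exact FiniteField.pow_card _
  isUnit_one_sub n hn := by
    have h1 : IsUnit (1 - (p : ℤ_[p]) ^ n) := by
      refine (IsLocalRing.isUnit_or_isUnit_one_sub_self ((p : ℤ_[p]) ^ n)).resolve_left fun h => ?_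
      exact PadicInt.prime_p.not_isUnit ((isUnit_pow_iff hn.ne').1 h)
    have := h1.map (algebraMap ℤ_[p] (integralClosure ℤ_[p] F))
    rwa [map_sub, map_one, map_pow, map_natCast] at this

/-- Every prime other than `p` is a unit in `ℤ_p`, so it cannot vanish in `k`. -/
theorem charP_of_finite_algebra {R : Type*} [CommRing R] [Algebra ℤ_[p] R] {k : Type*} [Field k] [Finite k]
    [Algebra R k] : CharP k p := by
  obtain ⟨r, hr⟩ := CharP.exists k
  have hrp : r.Prime := (CharP.char_is_prime_or_zero k r).resolve_right (CharP.char_ne_zero_of_finite k r)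
  suffices r = p from this ▸ hr
  by_contra hne
  have h1 : IsUnit ((r : ℕ) : ℤ_[p]) := by
    rw [PadicInt.isUnit_iff, PadicInt.norm_natCast_eq_one_iff]
    exact (Nat.coprime_primes (Fact.out : p.Prime) hrp).2 (Ne.symm hne)
  have h2 := (h1.map (algebraMap ℤ_[p] R)).map (algebraMap R k)
  rw [map_natCast, map_natCast, CharP.cast_eq_zero] at h2
  exact not_isUnit_zero h2

end IntegralClosure

end LTPhiGamma

theorem mainTheorem4 {p : ℕ} [Fact p.Prime]
    {F : Type*} [Field F] [Algebra ℚ_[p] F] [Algebra ℤ_[p] F] [IsScalarTower ℤ_[p] ℚ_[p] F]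
    [FiniteDimensional ℚ_[p] F]
    (hunr : (Ideal.span {(p : integralClosure ℤ_[p] F)}).IsMaximal)
    {f : ℕ} (hf : Module.finrank ℚ_[p] F = f)
    {k : Type*} [Field k] [Finite k] [Algebra (integralClosure ℤ_[p] F) k]
    (P : LTPhiGamma.Params k)
    (hell : 0 < P.ell) (hell' : P.ell < p ^ f - 1) (hu : P.u < p ^ f - 1)
    (C C' : LTPhiGamma.Scalars k p f P.ell) (hC : C.Allowed P) (hC' : C'.Allowed P)
    (A A' : LTPhiGamma.Aux) (hA : A.Admissible C) (hA' : A'.Admissible C') :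
    (∃! S : LTPhiGamma.EtalePhiGamma (integralClosure ℤ_[p] F) k p f
        (LTPhiGamma.DualLaurent k (LTPhiGamma.Delta p f P C A)),
      LTPhiGamma.IsAssociated p f P C A S) ∧
    (∃! S' : LTPhiGamma.EtalePhiGamma (integralClosure ℤ_[p] F) k p f
        (LTPhiGamma.DualLaurent k (LTPhiGamma.Delta p f P C' A')),
      LTPhiGamma.IsAssociated p f P C' A' S') ∧
    ∀ (S : LTPhiGamma.EtalePhiGamma (integralClosure ℤ_[p] F) k p f
        (LTPhiGamma.DualLaurent k (LTPhiGamma.Delta p f P C A)))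
      (S' : LTPhiGamma.EtalePhiGamma (integralClosure ℤ_[p] F) k p f
        (LTPhiGamma.DualLaurent k (LTPhiGamma.Delta p f P C' A'))),
      LTPhiGamma.IsAssociated p f P C A S → LTPhiGamma.IsAssociated p f P C' A' S' →
        (S.Isomorphic S' ↔
          ∃ ε : kˣ, (∀ i, C.b i = (ε : k) * C'.b i) ∧ (∀ i, C.cE i = (ε : k) * C'.cE i) ∧
            C.c = (ε : k) * C'.c) := by
  have hO := LTPhiGamma.isUnramifiedBase_integralClosure hunr hf
  have : CharP k p := LTPhiGamma.charP_of_finite_algebra (R := integralClosure ℤ_[p] F)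
  exact LTPhiGamma.classification hO hell hell' hC hC' hA hA'
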